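/- Let $F$ be a nonarchimedean local field of characteristic zero with ring of integers $\mathfrak o$, maximal ideal $\mathfrak p=\varpi\mathfrak o$, residue field of order $q$ and absolute value normalized by $|\varpi|=q^{-1}$. Let $\psi$ be an additive character of $F$ which is trivial on $\mathfrak o$ but not on $\mathfrak p^{-1}$. For $i=1,2,3$ let $\pi_i$ be either an irreducible principal series representation $I(\mu_i,\nu_i)$ of $\mathrm{GL}_2(F)$ (normalized induction) with unramified quasi-characters $\mu_i,\nu_i$ of $F^\times$, or $\mathrm{St}\otimes\sigma_i$, the twist of the Steinberg representation by an unramified quasi-character $\sigma_i$. Assume that not all $\pi_i$ are principal series. Let $\omega_i$ be the central character of $\pi_i$ and $\hat\omega=\omega_1\omega_2\omega_3$. Let $W_i$ be the following element of the $\psi$-Whittaker model of $\pi_i$: if $\pi_i$ is a principal series, $W_i$ is right $\mathrm{GL}_2(\mathfrak o)$-invariant and equal to $1$ on $\mathrm{GL}_2(\mathfrak o)$; if $\pi_i=\mathrm{St}\otimes\sigma_i$, then $W_i(\mathrm{diag}(a,1))=\sigma_i(a)|a|\,\mathbb I_{\mathfrak o}(a)$ for $a\in F^\times$. Put $\breve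 W_i(g)=W_i(g)\,\omega_i(\det g)^{-1}$. Let $J_3=\begin{pmatrix}0&-\mathbf 1_3\\ \mathbf 1_3&0\end{pmatrix}$ and $\mathrm{GSp}_6(F)=\{g\in \mathrm{GL}_6(F)\mid gJ_3g^{\rm t}=\nu_3(g)J_3,\ \nu_3(g)\in F^\times\}$. For quasi-characters $\omega,\chi$ of $F^\times$ let $h^0_{\omega}(\chi)$ be the function on $\mathrm{GSp}_6(F)$ which satisfies $$f\left(\begin{pmatrix}A&0\\0&\lambda (A^{\rm t})^{-1}\end{pmatrix}\begin{pmatrix}\mathbf 1_3&z\\0&\mathbf 1_3\end{pmatrix}g\right)=\omega(\lambda^{-2}\det A)\,\chi(\lambda^{-3}(\det A)^2)\,|\lambda^{-3}(\det A)^2|\,f(g)$$ for $A\in\mathrm{GL}_3(F)$, $\lambda\in F^\times$, $z\in\mathrm{Sym}_3(F)$, which is zero on matrices whose lower left $3\times 3$ block is singular, and for which $f\left(J_3\begin{pmatrix}\mathbf 1_3&z\\0&\mathbf 1_3\end{pmatrix}\right)$ is the characteristic function of $\mathrm{Sym}_3(\mathfrak o)$ in $z\in \mathrm{Sym}_3(F)$.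 Let $H=\{(g_1,g_2,g_3)\in\mathrm{GL}_2(F)^3\mid\det g_1=\det g_2=\det g_3\}$, let $Z\cong F^\times$ be the group of triples $(z\mathbf 1_2,z\mathbf 1_2,z\mathbf 1_2)$, and let $U^0$ be the group of triples of matrices $\begin{pmatrix}1&x_i\\0&1\end{pmatrix}$ with $x_1+x_2+x_3=0$. Let $\iota:H\hookrightarrow\mathrm{GSp}_6(F)$ be the embedding which sends $\left(\begin{pmatrix}a_i&b_i\\c_i&d_i\end{pmatrix}\right)_i$ to the matrix with diagonal blocks $\mathrm{diag}(a_i)$, $\mathrm{diag}(b_i)$, $\mathrm{diag}(c_i)$, $\mathrm{diag}(d_i)$, and put $$\boldsymbol\eta=\begin{pmatrix}0&0&0&-1&0&0\\0&1&0&0&0&0\\0&0&1&0&0&0\\1&1&1&0&0&0\\0&0&0&-1&1&0\\0&0&0&-1&0&1\end{pmatrix}.$$ Define $$Z(W_1,W_2,W_3,f)=\int_{U^0Z\backslash H}W_1(g_1)W_2(g_2)W_3(g_3)f(\boldsymbol\eta\,\iota(g_1,g_2,g_3))\,dg,$$ where $dg$ is the right $H$-invariant measure on $U^0Z\backslash H$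 for which the image of $H\cap\mathrm{GL}_2(\mathfrak o)^3$ has volume $1$. Let $L(s,\pi_1\times\pi_2\times\pi_3\otimes\chi)$ and $\varepsilon(s,\pi_1\times\pi_2\times\pi_3\otimes\chi,\psi)$ be the factors of the tensor product of the Weil--Deligne representations attached to $\pi_1,\pi_2,\pi_3$ and $\chi$: if $\Phi$ is the geometric Frobenius and $N$ the monodromy operator on its $8$-dimensional space $V$, then $L(s)=\det(1-q^{-s}\Phi\mid\ker N)^{-1}$ and $\varepsilon(s)=\det(-q^{-s}\Phi\mid V/\ker N)$. Then for every unramified quasi-character $\chi$ of $F^\times$ the integrals $Z(W_1,W_2,W_3,h^0_{\hat\omega}(\chi|\cdot|^s))$ and $Z(\breve W_1,\breve W_2,\breve W_3,h^0_{\hat\omega^{-1}}(\chi\hat\omega|\cdot|^s))$ converge absolutely if $\Re s$ is sufficiently large, they are equal there, and they have a common meromorphic continuation to $s\in\mathbf C$. The continuation is holomorphic wherever $L(\frac12,\pi_1\times\pi_2\times\pi_3\otimes\chi|\cdot|^s)$ has no pole, and its value there is $$-(\hat\omega^2(\chi|\cdot|^s)^4)(\varpi)\,q(1+q)^{-3}\,\frac{L\left(\frac12,\pi_1\times\pi_2\times\pi_3\otimes\chi|\cdot|^s\right)}{\varepsilon\left(\frac12,\pi_1\times\pi_2\times\pi_3\otimes\chi|\cdot|^s,\psi\right)}.$$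 In particular, at $s=0$, provided $L\left(\frac12,\pi_1\times\pi_2\times\pi_3\otimes\chi\right)$ is finite, $$Z(W_1,W_2,W_3,h^0_{\hat\omega}(\chi))=Z(\breve W_1,\breve W_2,\breve W_3,h^0_{\hat\omega^{-1}}(\chi\hat\omega))=-(\hat\omega^2\chi^4)(\varpi)\,q(1+q)^{-3}\,\frac{L\left(\frac12,\pi_1\times\pi_2\times\pi_3\otimes\chi\right)}{\varepsilon\left(\frac12,\pi_1\times\pi_2\times\pi_3\otimes\chi,\psi\right)}.$$ -/

import Mathlib

open MeasureTheory Matrix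
open scoped MatrixGroups TensorProduct

noncomputable section

namespace TripleZeta

/-! ### The local field -/

section LocalField

variable {F : Type*} [NontriviallyNormedField F]

/-- The order `q` of the residue field `𝔬/𝔭`. -/
def residueCard (F : Type*) [NontriviallyNormedField F] [IsUltrametricDist F] : ℕ :=
  Nat.card (IsLocalRing.ResidueField (NormedField.valuation (K := F)).valuationSubring)

/-- `ϖ` generates the maximal ideal `𝔭 = {x | ‖x‖ < 1}` of `𝔬 = {x | ‖x‖ ≤ 1}`. -/
def IsUniformizer (ϖ : Fˣ) : Prop := ∀ x : F, ‖x‖ < 1 ↔ ‖x‖ ≤ ‖(ϖ : F)‖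

/-- A quasi-character of `Fˣ` is unramified if it is trivial on `𝔬ˣ`. -/
def IsUnramified (χ : Fˣ →* ℂˣ) : Prop := ∀ u : Fˣ, ‖(u : F)‖ = 1 → χ u = 1

/-- The quasi-character `a ↦ |a|^s`. -/
def absChar (F : Type*) [NontriviallyNormedField F] (s : ℂ) : Fˣ →* ℂˣ where
  toFun a := Units.mk0 ((‖(a : F)‖ : ℂ) ^ s) (by simp [Complex.cpow_eq_zero_iff])
  map_one' := by ext; simp
  map_mul' a b := by
    ext
    simp [Complex.mul_cpow_ofReal_nonneg (norm_nonneg (a : F)) (norm_nonneg (b : F))]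

end LocalField

/-! ### Representations of `GL₂(F)` and their Whittaker models -/

section GL2

variable {F : Type*} [NontriviallyNormedField F]

/-- The matrix `𝐧(x)`. -/
def nUp (x : F) : GL (Fin 2) F := GeneralLinearGroup.mkOfDetNeZero !![1, x; 0, 1] (by simp)

/-- The matrix `𝐧⁻(u)`. -/
def nLow (u : F) : GL (Fin 2) F := GeneralLinearGroup.mkOfDetNeZero !![1, 0; u, 1] (by simp)

/-- The matrix `diag(a, d)`. -/
def diagGL (a d : Fˣ) : GL (Fin 2) F :=
  GeneralLinearGroup.mkOfDetNeZero !![(a : F), 0; 0, (d : F)] (by simp)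

/-- The maximal compact subgroup `GL₂(𝔬)`, as a set. -/
def maxCompact (F : Type*) [NontriviallyNormedField F] : Set (GL (Fin 2) F) :=
  {k | (∀ i j, ‖k i j‖ ≤ 1) ∧ ‖(k.det : F)‖ = 1}

/-- The space of the (normalised) principal series `I(μ, ν)`: the smooth functions `f` on `GL₂(F)`
with `f([a b; 0 d] g) = μ(a) ν(d) |a/d|^{1/2} f(g)`. -/
def principalSeriesSpace (μ ν : Fˣ →* ℂˣ) : Submodule ℂ (GL (Fin 2) F → ℂ) where
  carrier := {f |
    (∃ U : Subgroup (GL (Fin 2) F), IsOpen (U : Set (GL (Fin 2) F)) ∧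
      ∀ u ∈ U, ∀ g, f (g * u) = f g) ∧
    ∀ (a d : Fˣ) (b : F) (g : GL (Fin 2) F),
      f (nUp b * diagGL a d * g) =
        (μ a : ℂ) * (ν d : ℂ) * (absChar F (1 / 2) (a / d) : ℂ) * f g}
  zero_mem' := ⟨⟨⊤, isOpen_univ, by simp⟩, by simp⟩
  add_mem' := by
    rintro f f' ⟨⟨U, hU, hf⟩, hf'⟩ ⟨⟨V, hV, hg⟩, hg'⟩
    refine ⟨⟨U ⊓ V, hU.inter hV, fun u hu g => ?_⟩, fun a d b g => ?_⟩
    · simp [hf u hu.1, hg u hu.2]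
    · simp only [Pi.add_apply, hf', hg', mul_add]
  smul_mem' := by
    rintro c f ⟨⟨U, hU, hf⟩, hf'⟩
    refine ⟨⟨U, hU, fun u hu g => ?_⟩, fun a d b g => ?_⟩
    · simp [hf u hu]
    · simp only [Pi.smul_apply, hf', smul_eq_mul]
      ring

/-- `I(μ, ν)` as a representation of `GL₂(F)`, acting by right translation. -/
def principalSeries (μ ν : Fˣ →* ℂˣ) :
    Representation ℂ (GL (Fin 2) F) (principalSeriesSpace μ ν) where
  toFun h :=
    { toFun := fun f => ⟨fun g => f.1 (g * h), by
        obtain ⟨⟨U, hU, hf⟩, hf'⟩ := f.2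
        refine ⟨⟨U.comap (MulAut.conj h⁻¹).toMonoidHom, ?_, fun u hu g => ?_⟩,
          fun a d b g => ?_⟩
        · have hc : Continuous fun u : GL (Fin 2) F => h⁻¹ * u * h := by fun_prop
          have := hU.preimage hc
          convert this using 1
          ext u
          simp
        · have h1 := hf (h⁻¹ * u * h) (by simpa using hu) (g * h)
          change f.1 (g * u * h) = f.1 (g * h)
          rw [← h1]
          group
        · have := hf' a d b (g * h)
          rwa [← mul_assoc] at this⟩
      map_add' := fun _ _ => rfl
      map_smul' := fun _ _ => rfl }
  map_one' := by ext; simp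
  map_mul' h h' := by ext f g; simp [mul_assoc]

/-- The subspace of `I(μ, ν)` spanned by `σ ∘ det` when that function lies in `I(μ, ν)`. -/
def detLine (μ ν σ : Fˣ →* ℂˣ) : Submodule ℂ (principalSeriesSpace μ ν) where
  carrier := {f | ∃ c : ℂ, ∀ g, f.1 g = c * (σ g.det : ℂ)}
  zero_mem' := ⟨0, by simp⟩
  add_mem' := by
    rintro f f' ⟨c, hc⟩ ⟨c', hc'⟩
    exact ⟨c + c', fun g => by simp [hc, hc', add_mul]⟩
  smul_mem' := by
    rintro d f ⟨c, hc⟩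
    exact ⟨d * c, fun g => by simp [hc, mul_assoc]⟩

/-- The twisted Steinberg representation `St ⊗ σ`: the quotient of
`I(σ|·|^{-1/2}, σ|·|^{1/2})` by the line spanned by `σ ∘ det`. -/
def steinberg (σ : Fˣ →* ℂˣ) :
    Representation ℂ (GL (Fin 2) F)
      (principalSeriesSpace (σ * absChar F (-1 / 2)) (σ * absChar F (1 / 2)) ⧸
        detLine (σ * absChar F (-1 / 2)) (σ * absChar F (1 / 2)) σ) :=
  (principalSeries (σ * absChar F (-1 / 2)) (σ * absChar F (1 / 2))).quotient
    (detLine _ _ σ) (by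
      rintro h f ⟨c, hc⟩
      refine ⟨c * (σ h.det : ℂ), fun g => ?_⟩
      change f.1 (g * h) = _
      rw [hc, map_mul, map_mul, Units.val_mul]
      ring)

/-- The Whittaker model of `π` with respect to `ψ`: all functions `g ↦ ℓ(π(g) v)`, where `ℓ` is a
`ψ`-Whittaker functional on `π` and `v` a vector. -/
def whittakerModel (ψ : AddChar F Circle) {V : Type*} [AddCommGroup V] [Module ℂ V]
    (π : Representation ℂ (GL (Fin 2) F) V) : Set (GL (Fin 2) F → ℂ) :=
  {W | ∃ ℓ : V →ₗ[ℂ] ℂ, (∀ (x : F) (v : V), ℓ (π (nUp x) v) = (ψ x : ℂ) * ℓ v) ∧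
    ∃ v : V, ∀ g, W g = ℓ (π g v)}

/-- The twist `W ⊗ σ`. -/
def twistFun (W : GL (Fin 2) F → ℂ) (σ : Fˣ →* ℂˣ) : GL (Fin 2) F → ℂ :=
  fun g => W g * (σ g.det : ℂ)

end GL2

/-! ### Weil--Deligne representations, `L`- and `ε`-factors -/

/-- An unramified Weil--Deligne representation on `V`: a geometric Frobenius `Φ` and a nilpotent
monodromy operator `N` with `Φ N Φ⁻¹ = c N`, where `c = |ϖ| = q⁻¹`. -/
structure WDRep (c : ℂ) (V : Type*) [AddCommGroup V] [Module ℂ V] where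
  frob : V ≃ₗ[ℂ] V
  mono : V →ₗ[ℂ] V
  nilpotent : IsNilpotent mono
  comm : ∀ v, frob (mono v) = c • mono (frob v)

namespace WDRep

variable {c : ℂ} {V W : Type*} [AddCommGroup V] [Module ℂ V] [AddCommGroup W] [Module ℂ W]

/-- The tensor product: `Φ ⊗ Φ'` and `N ⊗ 1 + 1 ⊗ N'`. -/
def tensor (ρ : WDRep c V) (ρ' : WDRep c W) : WDRep c (V ⊗[ℂ] W) where
  frob := TensorProduct.congr ρ.frob ρ'.frob
  mono := ρ.mono.rTensor W + ρ'.mono.lTensor V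
  nilpotent := by
    refine Commute.isNilpotent_add ?_ ?_ ?_
    · change _ ∘ₗ _ = _ ∘ₗ _
      rw [LinearMap.rTensor_comp_lTensor, LinearMap.lTensor_comp_rTensor]
    · obtain ⟨n, hn⟩ := ρ.nilpotent
      exact ⟨n, by rw [LinearMap.rTensor_pow, hn, LinearMap.rTensor_zero]⟩
    · obtain ⟨n, hn⟩ := ρ'.nilpotent
      exact ⟨n, by rw [LinearMap.lTensor_pow, hn, LinearMap.lTensor_zero]⟩
  comm v := by
    induction v using TensorProduct.induction_on with
    | zero => simp
    | tmul x y =>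
      simp [ρ.comm, ρ'.comm, TensorProduct.smul_tmul', TensorProduct.tmul_smul]
    | add x y hx hy => rw [map_add, map_add, hx, hy, map_add, map_add, smul_add]

/-- The twist by the unramified character with value `t` at `ϖ`. -/
def twist (ρ : WDRep c V) (t : ℂˣ) : WDRep c V where
  frob := ρ.frob.trans (LinearEquiv.smulOfUnit t)
  mono := ρ.mono
  nilpotent := ρ.nilpotent
  comm v := by
    change t • ρ.frob (ρ.mono v) = c • ρ.mono (t • ρ.frob v)
    rw [ρ.comm, LinearMap.map_smul_of_tower, smul_comm]

/-- `c^s Φ`, with `c^s = q^{-s}`. -/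
def frobS (ρ : WDRep c V) (s : ℂ) : V →ₗ[ℂ] V := (c ^ s) • (ρ.frob : V →ₗ[ℂ] V)

theorem frobS_mem_ker (ρ : WDRep c V) (s : ℂ) {v : V} (hv : v ∈ LinearMap.ker ρ.mono) :
    ρ.frobS s v ∈ LinearMap.ker ρ.mono := by
  rw [LinearMap.mem_ker] at hv ⊢
  by_cases hc : c = 0
  · have h0 : ∀ w, ρ.mono w = 0 := fun w => by
      have h1 : ρ.frob (ρ.mono w) = 0 := by
        rw [ρ.comm w]
        simp [hc]
      simpa using h1
    exact h0 _
  · have h := ρ.comm v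
    rw [hv, map_zero] at h
    have h1 : ρ.mono (ρ.frob v) = 0 := (smul_eq_zero.mp h.symm).resolve_left hc
    simp [frobS, h1]

/-- `det(1 - q^{-s} Φ | ker N)`, the inverse of the `L`-factor. -/
def lFactorInv (ρ : WDRep c V) (s : ℂ) : ℂ :=
  LinearMap.det ((LinearMap.id - ρ.frobS s).restrict (p := LinearMap.ker ρ.mono)
    (q := LinearMap.ker ρ.mono) fun _ hv => Submodule.sub_mem _ hv (ρ.frobS_mem_ker s hv))

/-- The `L`-factor `L(s, ρ) = det(1 - q^{-s} Φ | ker N)⁻¹`. -/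
def lFactor (ρ : WDRep c V) (s : ℂ) : ℂ := (ρ.lFactorInv s)⁻¹

/-- The `ε`-factor `ε(s, ρ, ψ) = det(-q^{-s} Φ | V / ker N)` for an additive character `ψ` which is
trivial on `𝔬` but not on `𝔭⁻¹` (and the self-dual measure). -/
def epsFactor (ρ : WDRep c V) (s : ℂ) : ℂ :=
  LinearMap.det ((LinearMap.ker ρ.mono).mapQ (LinearMap.ker ρ.mono) (-ρ.frobS s)
    fun _ hv => Submodule.neg_mem _ (ρ.frobS_mem_ker s hv))

/-- The representation on `ℂ²` with `Φ = diag(α, β)` and `N = 0`. -/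
def ofPrincipal (c : ℂ) (α β : ℂˣ) : WDRep c (ℂ × ℂ) where
  frob := (LinearEquiv.smulOfUnit α).prodCongr (LinearEquiv.smulOfUnit β)
  mono := 0
  nilpotent := IsNilpotent.zero
  comm v := by simp

/-- The representation on `ℂ²` with `Φ = diag(α, β)`, `α = cβ`, and `N = [0 1; 0 0]`. -/
def ofSteinberg (c : ℂ) (α β : ℂˣ) (h : (α : ℂ) = c * β) : WDRep c (ℂ × ℂ) where
  frob := (LinearEquiv.smulOfUnit α).prodCongr (LinearEquiv.smulOfUnit β)
  mono := LinearMap.inl ℂ ℂ ℂ ∘ₗ LinearMap.snd ℂ ℂ ℂ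
  nilpotent := ⟨2, by ext <;> simp [pow_two]⟩
  comm v := by
    change ((α : ℂ) * v.2, (β : ℂ) * (0 : ℂ)) = (c * ((β : ℂ) * v.2), c * (0 : ℂ))
    rw [h]
    ring_nf

end WDRep

/-! ### The representations `π_i` -/

/-- A principal series `I(μ, ν)` or a twisted Steinberg representation `St ⊗ σ`. -/
inductive RepType (F : Type*) [NontriviallyNormedField F] : Type _
  | principal (μ ν : Fˣ →* ℂˣ) : RepType F
  | steinberg (σ : Fˣ →* ℂˣ) : RepType F

namespace RepType

variable {F : Type*} [NontriviallyNormedField F]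

/-- `π` is an irreducible unramified principal series, or a twist of the Steinberg representation
by an unramified character. -/
def IsAdmissible : RepType F → Prop
  | principal μ ν => IsUnramified μ ∧ IsUnramified ν ∧ (principalSeries μ ν).IsIrreducible
  | steinberg σ => IsUnramified σ

/-- `π` is a twist of the Steinberg representation. -/
def IsSteinberg : RepType F → Prop
  | principal _ _ => False
  | steinberg _ => True

/-- The Whittaker model `𝒲(π)`. -/
def whittaker (ψ : AddChar F Circle) : RepType F → Set (GL (Fin 2) F → ℂ)
  | principal μ ν => whittakerModel ψ (principalSeries μ ν)
  | steinberg σ => whittakerModel ψ (TripleZeta.steinberg σ)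

/-- The central character. -/
def centralChar : RepType F → (Fˣ →* ℂˣ)
  | principal μ ν => μ * ν
  | steinberg σ => σ ^ 2

/-- The distinguished element of `𝒲(π)`: for a principal series the Whittaker function fixed by
`GL₂(𝔬)` and equal to `1` there; for `St ⊗ σ` the Whittaker function with
`W(diag(a, 1)) = σ(a) |a| 𝟙_𝔬(a)`. -/
def IsDistinguished (ψ : AddChar F Circle) (π : RepType F) (W : GL (Fin 2) F → ℂ) : Prop :=
  W ∈ π.whittaker ψ ∧
    match π with
    | principal _ _ => (∀ g, ∀ k ∈ maxCompact F, W (g * k) = W g) ∧ ∀ k ∈ maxCompact F, W k = 1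
    | steinberg σ => ∀ a : Fˣ,
        W (diagGL a 1) = if ‖(a : F)‖ ≤ 1 then (σ a : ℂ) * (‖(a : F)‖ : ℂ) else 0

theorem absChar_half_relation (ϖ : Fˣ) (σ : Fˣ →* ℂˣ) :
    (((σ * absChar F (1 / 2)) ϖ : ℂˣ) : ℂ) =
      (‖(ϖ : F)‖ : ℂ) * (((σ * absChar F (-1 / 2)) ϖ : ℂˣ) : ℂ) := by
  have h : (‖(ϖ : F)‖ : ℂ) ≠ 0 := by simp
  have h2 : (‖(ϖ : F)‖ : ℂ) ^ (1 / 2 : ℂ) = ‖(ϖ : F)‖ * (‖(ϖ : F)‖ : ℂ) ^ (-1 / 2 : ℂ) := by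
    have h3 := Complex.cpow_add (1 : ℂ) (-1 / 2) h
    rw [Complex.cpow_one] at h3
    rw [← h3]
    norm_num
  simp only [MonoidHom.mul_apply, Units.val_mul, absChar, MonoidHom.coe_mk, OneHom.coe_mk,
    Units.val_mk0, h2]
  ring

/-- The Weil--Deligne representation attached to `π` by the local Langlands correspondence. -/
def wd (ϖ : Fˣ) : RepType F → WDRep (‖(ϖ : F)‖ : ℂ) (ℂ × ℂ)
  | principal μ ν => WDRep.ofPrincipal _ (μ ϖ) (ν ϖ)
  | steinberg σ => WDRep.ofSteinberg _ ((σ * absChar F (1 / 2)) ϖ)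
      ((σ * absChar F (-1 / 2)) ϖ) (absChar_half_relation ϖ σ)

end RepType

/-- The eight-dimensional Weil--Deligne representation attached to `π₁ × π₂ × π₃ ⊗ χ`. -/
def tripleWD {F : Type*} [NontriviallyNormedField F] (ϖ : Fˣ) (π : Fin 3 → RepType F)
    (χ : Fˣ →* ℂˣ) : WDRep (‖(ϖ : F)‖ : ℂ) (((ℂ × ℂ) ⊗[ℂ] (ℂ × ℂ)) ⊗[ℂ] (ℂ × ℂ)) :=
  ((((π 0).wd ϖ).tensor ((π 1).wd ϖ)).tensor ((π 2).wd ϖ)).twist (χ ϖ)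

/-! ### The symplectic similitude group of degree three -/

section GSp

variable {F : Type*} [Field F]

/-- `GSp₆(F)`, the group of `g` with `g J₃ gᵗ = ν₃(g) J₃` for a scalar `ν₃(g)`, where
`J₃ = [0 -1; 1 0]`. -/
def GSp6 (F : Type*) [Field F] : Subgroup (GL (Fin 3 ⊕ Fin 3) F) where
  carrier := {g | ∃ ν : Fˣ, g.1 * J (Fin 3) F * g.1ᵀ = (ν : F) • J (Fin 3) F}
  one_mem' := ⟨1, by simp⟩
  mul_mem' := by
    rintro g h ⟨ν, hg⟩ ⟨ξ, hh⟩
    refine ⟨ξ * ν, ?_⟩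
    calc (g * h).1 * J (Fin 3) F * (g * h).1ᵀ
        = g.1 * (h.1 * J (Fin 3) F * h.1ᵀ) * g.1ᵀ := by
          simp [Matrix.transpose_mul, Matrix.mul_assoc]
      _ = _ := by rw [hh, Matrix.mul_smul, Matrix.smul_mul, hg, smul_smul, Units.val_mul]
  inv_mem' := by
    rintro g ⟨ν, hg⟩
    refine ⟨ν⁻¹, ?_⟩
    have h1 : (g⁻¹).1 * g.1 = 1 := by rw [← Units.val_mul, inv_mul_cancel, Units.val_one]
    have h2 : g.1ᵀ * (g⁻¹).1ᵀ = 1 := by rw [← Matrix.transpose_mul, h1, Matrix.transpose_one]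
    have h3 : J (Fin 3) F = (ν : F) • ((g⁻¹).1 * J (Fin 3) F * (g⁻¹).1ᵀ) := by
      calc J (Fin 3) F = ((g⁻¹).1 * g.1) * J (Fin 3) F * (g.1ᵀ * (g⁻¹).1ᵀ) := by
            rw [h1, h2, Matrix.one_mul, Matrix.mul_one]
        _ = (g⁻¹).1 * (g.1 * J (Fin 3) F * g.1ᵀ) * (g⁻¹).1ᵀ := by simp only [Matrix.mul_assoc]
        _ = _ := by rw [hg, Matrix.mul_smul, Matrix.smul_mul]
    conv_rhs => rw [h3, smul_smul, ← Units.val_mul, inv_mul_cancel, Units.val_one, one_smul]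

/-- The similitude `ν₃(g)`. -/
def similitude (g : GSp6 F) : Fˣ := g.2.choose

theorem similitude_spec (g : GSp6 F) :
    g.1.1 * J (Fin 3) F * g.1.1ᵀ = (similitude g : F) • J (Fin 3) F := g.2.choose_spec

theorem similitude_eq {g : GSp6 F} {ν : Fˣ}
    (h : g.1.1 * J (Fin 3) F * g.1.1ᵀ = (ν : F) • J (Fin 3) F) : similitude g = ν := by
  have h1 := (similitude_spec g).symm.trans h
  have h2 := congrFun (congrFun h1 (Sum.inr 0)) (Sum.inl 0)
  ext
  simpa [J] using h2

theorem similitude_mul (g h : GSp6 F) : similitude (g * h) = similitude g * similitude h := by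
  apply similitude_eq
  calc (g * h).1.1 * J (Fin 3) F * (g * h).1.1ᵀ
      = g.1.1 * (h.1.1 * J (Fin 3) F * h.1.1ᵀ) * g.1.1ᵀ := by
        simp [Matrix.transpose_mul, Matrix.mul_assoc]
    _ = _ := by
      rw [similitude_spec h, Matrix.mul_smul, Matrix.smul_mul, similitude_spec g, smul_smul,
        Units.val_mul, mul_comm]

/-- The element of `GSp₆(F)` given by a matrix `g` with `g J₃ gᵗ = ν J₃`. -/
def GSp6.mk' (g : Matrix (Fin 3 ⊕ Fin 3) (Fin 3 ⊕ Fin 3) F) (ν : Fˣ)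
    (h : g * J (Fin 3) F * gᵀ = (ν : F) • J (Fin 3) F) : GSp6 F :=
  ⟨⟨g, -((ν⁻¹ : Fˣ) : F) • (J (Fin 3) F * gᵀ * J (Fin 3) F), by
      have : g * (J (Fin 3) F * gᵀ * J (Fin 3) F) = -((ν : F) • 1) := by
        rw [← Matrix.mul_assoc, ← Matrix.mul_assoc, h, Matrix.smul_mul, J_squared, smul_neg]
      rw [Matrix.mul_smul, this]
      simp [smul_smul], by
      apply mul_eq_one_comm.mp
      have : g * (J (Fin 3) F * gᵀ * J (Fin 3) F) = -((ν : F) • 1) := by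
        rw [← Matrix.mul_assoc, ← Matrix.mul_assoc, h, Matrix.smul_mul, J_squared, smul_neg]
      rw [Matrix.mul_smul, this]
      simp [smul_smul]⟩, ν, h⟩

theorem similitude_mk' (g : Matrix (Fin 3 ⊕ Fin 3) (Fin 3 ⊕ Fin 3) F) (ν : Fˣ)
    (h : g * J (Fin 3) F * gᵀ = (ν : F) • J (Fin 3) F) : similitude (GSp6.mk' g ν h) = ν :=
  similitude_eq h

/-- The element `J₃`. -/
def J3 (F : Type*) [Field F] : GSp6 F :=
  GSp6.mk' (J (Fin 3) F) 1 (by simp [J_transpose, J_squared])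

/-- The element `𝐦(A, λ) = [A 0; 0 λ (Aᵗ)⁻¹]`. -/
def mSieg (A : GL (Fin 3) F) (l : Fˣ) : GSp6 F :=
  GSp6.mk' (fromBlocks A.1 0 0 ((l : F) • (A⁻¹).1ᵀ)) l (by
    have h1 : A.1 * (A⁻¹).1 = 1 := by rw [← Units.val_mul, mul_inv_cancel, Units.val_one]
    have h2 : (A⁻¹).1ᵀ * A.1ᵀ = 1 := by rw [← Matrix.transpose_mul, h1, Matrix.transpose_one]
    rw [J, fromBlocks_transpose, fromBlocks_multiply, fromBlocks_multiply, fromBlocks_smul]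
    simp only [Matrix.transpose_smul, Matrix.transpose_transpose, Matrix.mul_zero,
      Matrix.zero_mul, add_zero, zero_add, Matrix.mul_one, Matrix.mul_neg, Matrix.neg_mul,
      Matrix.mul_smul, Matrix.smul_mul, h1, h2, Matrix.transpose_zero, smul_zero, smul_neg,
      neg_zero])

/-- The element `𝐧(z) = [1 z; 0 1]`, for a symmetric matrix `z`. -/
def nSieg (z : Matrix (Fin 3) (Fin 3) F) (hz : z.IsSymm) : GSp6 F :=
  GSp6.mk' (fromBlocks 1 z 0 1) 1 (by
    rw [J, fromBlocks_transpose, fromBlocks_multiply, fromBlocks_multiply]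
    simp [hz.eq])

/-- The element `𝛈` representing the open orbit. -/
def eta (F : Type*) [Field F] : GSp6 F :=
  GSp6.mk' (fromBlocks !![0, 0, 0; 0, 1, 0; 0, 0, 1] !![-1, 0, 0; 0, 0, 0; 0, 0, 0]
      !![1, 1, 1; 0, 0, 0; 0, 0, 0] !![0, 0, 0; -1, 1, 0; -1, 0, 1]) 1 (by
    rw [J, fromBlocks_transpose, fromBlocks_multiply, fromBlocks_multiply, Units.val_one, one_smul]
    congr 1 <;> ext i j <;> fin_cases i <;> fin_cases j <;>
      simp [Matrix.vecMul_transpose])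

/-- The group `H = {(g₁, g₂, g₃) ∈ GL₂(F)³ | det g₁ = det g₂ = det g₃}`. -/
def H (F : Type*) [Field F] : Subgroup (GL (Fin 2) F × GL (Fin 2) F × GL (Fin 2) F) where
  carrier := {g | g.1.det = g.2.1.det ∧ g.1.det = g.2.2.det}
  one_mem' := by simp
  mul_mem' := by
    rintro g h ⟨h1, h2⟩ ⟨h3, h4⟩
    exact ⟨by simp [h1, h3], by simp [← h2, ← h4]⟩
  inv_mem' := by
    rintro g ⟨h1, h2⟩
    exact ⟨by simp [h1], by simp [← h2]⟩

/-- The embedding `ι : H → GSp₆`, with diagonal blocks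
`[diag(a₁,a₂,a₃) diag(b₁,b₂,b₃); diag(c₁,c₂,c₃) diag(d₁,d₂,d₃)]`. -/
def iota (h : H F) : GSp6 F :=
  let g : Fin 3 → Matrix (Fin 2) (Fin 2) F := ![h.1.1.1, h.1.2.1.1, h.1.2.2.1]
  GSp6.mk' (fromBlocks (diagonal fun i => g i 0 0) (diagonal fun i => g i 0 1)
      (diagonal fun i => g i 1 0) (diagonal fun i => g i 1 1)) h.1.1.det (by
    have hg : ∀ i, g i 0 0 * g i 1 1 - g i 0 1 * g i 1 0 = (h.1.1.det : F) := by
      have e1 : (h.1.1.det : F) = h.1.2.1.det := congrArg Units.val h.2.1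
      have e2 : (h.1.1.det : F) = h.1.2.2.det := congrArg Units.val h.2.2
      intro i
      match i with
      | 0 => exact (det_fin_two h.1.1.1).symm
      | 1 => exact (det_fin_two h.1.2.1.1).symm.trans e1.symm
      | 2 => exact (det_fin_two h.1.2.2.1).symm.trans e2.symm
    clear_value g
    rw [J, fromBlocks_transpose, fromBlocks_multiply, fromBlocks_multiply, fromBlocks_smul]
    simp only [diagonal_transpose, Matrix.mul_zero, Matrix.mul_one, Matrix.mul_neg, zero_add,
      add_zero, Matrix.neg_mul, diagonal_mul_diagonal, smul_zero, smul_neg]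
    congr 1 <;> ext i j <;> by_cases hij : i = j
    all_goals
      first
        | subst hij
          simp only [Matrix.add_apply, Matrix.neg_apply, Matrix.smul_apply, diagonal_apply_eq,
            Matrix.zero_apply, Matrix.one_apply_eq, smul_eq_mul, ← hg i]
          ring
        | simp only [Matrix.add_apply, Matrix.neg_apply, Matrix.smul_apply,
            diagonal_apply_ne _ hij, Matrix.zero_apply, Matrix.one_apply_ne hij, smul_eq_mul]
          ring)

end GSp

/-! ### The section `h⁰(χ)` -/

section Section

variable {F : Type*} [NontriviallyNormedField F]

/-- The section `f_Φ(χ)` of the degenerate principal series `I₃(ω, χ)`: the function on `GSp₆(F)`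
which is supported on the big cell `𝒫₃ J₃ N₃`, satisfies
`f(𝐦(A,λ) 𝐧(z) g) = ω(λ⁻² det A) χ(λ⁻³ (det A)²) |λ⁻³ (det A)²| f(g)` and has
`f(J₃ 𝐧(z)) = Φ(z)`. On `g = [* *; C D]` the big cell is `det C ≠ 0`, and there
`g ∈ 𝐦(A, ν) N₃ J₃ 𝐧(C⁻¹ D)` with `ν = ν₃(g)` and `A = ν (Cᵗ)⁻¹`. -/
def siegelSection (ω χ : Fˣ →* ℂˣ) (Φ : Matrix (Fin 3) (Fin 3) F → ℂ) (g : GSp6 F) : ℂ :=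
  open Classical in
  if h : IsUnit (g.1.1.toBlocks₂₁).det then
    (ω (similitude g / h.unit) : ℂ) * (χ (similitude g ^ 3 / h.unit ^ 2) : ℂ) *
      (‖((similitude g ^ 3 / h.unit ^ 2 : Fˣ) : F)‖ : ℂ) *
      Φ ((g.1.1.toBlocks₂₁)⁻¹ * g.1.1.toBlocks₂₂)
  else 0

/-- The characteristic function of the matrices with entries in `𝔬`. -/
def integralIndicator (z : Matrix (Fin 3) (Fin 3) F) : ℂ :=
  open Classical in if ∀ i j, ‖z i j‖ ≤ 1 then 1 else 0

/-- The section `h⁰(χ) = f_Φ(χ)` of `I₃(ω, χ)` with `Φ` the characteristic function of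
`Sym₃(𝔬)`. -/
def hZero (ω χ : Fˣ →* ℂˣ) : GSp6 F → ℂ := siegelSection ω χ integralIndicator

theorem siegelSection_of_det (ω χ : Fˣ →* ℂˣ) (Φ : Matrix (Fin 3) (Fin 3) F → ℂ) (g : GSp6 F)
    (δ : Fˣ) (h : (g.1.1.toBlocks₂₁).det = δ) :
    siegelSection ω χ Φ g = (ω (similitude g / δ) : ℂ) * (χ (similitude g ^ 3 / δ ^ 2) : ℂ) *
      (‖((similitude g ^ 3 / δ ^ 2 : Fˣ) : F)‖ : ℂ) *
      Φ ((g.1.1.toBlocks₂₁)⁻¹ * g.1.1.toBlocks₂₂) := by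
  have hu : IsUnit (g.1.1.toBlocks₂₁).det := ⟨δ, h.symm⟩
  have he : hu.unit = δ := by ext; exact h
  rw [siegelSection, dif_pos hu, he]

theorem siegelSection_J3_mul_nSieg (ω χ : Fˣ →* ℂˣ) (Φ : Matrix (Fin 3) (Fin 3) F → ℂ)
    (z : Matrix (Fin 3) (Fin 3) F) (hz : z.IsSymm) :
    siegelSection ω χ Φ (J3 F * nSieg z hz) = Φ z := by
  have hm : (J3 F * nSieg z hz).1.1 = fromBlocks 0 (-1) 1 z := by
    change J (Fin 3) F * fromBlocks 1 z 0 1 = _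
    rw [J, fromBlocks_multiply]
    simp
  have hs : similitude (J3 F * nSieg z hz) = 1 := by
    rw [similitude_mul, J3, nSieg, similitude_mk', similitude_mk', one_mul]
  rw [siegelSection_of_det ω χ Φ _ 1 (by rw [hm]; simp), hm, hs]
  simp

theorem siegelSection_equivariant (ω χ : Fˣ →* ℂˣ) (Φ : Matrix (Fin 3) (Fin 3) F → ℂ)
    (A : GL (Fin 3) F) (l : Fˣ) (z : Matrix (Fin 3) (Fin 3) F) (hz : z.IsSymm) (g : GSp6 F) :
    siegelSection ω χ Φ (mSieg A l * nSieg z hz * g) =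
      (ω ((l ^ 2)⁻¹ * A.det) : ℂ) * (χ ((l ^ 3)⁻¹ * A.det ^ 2) : ℂ) *
        (‖(((l ^ 3)⁻¹ * A.det ^ 2 : Fˣ) : F)‖ : ℂ) * siegelSection ω χ Φ g := by
  obtain ⟨a, b, c, d, hg⟩ : ∃ a b c d, g.1.1 = fromBlocks a b c d :=
    ⟨_, _, _, _, (fromBlocks_toBlocks g.1.1).symm⟩
  set B : Matrix (Fin 3) (Fin 3) F := (l : F) • (A⁻¹).1ᵀ with hB
  have hBdet : B.det = ((l ^ 3 * A.det⁻¹ : Fˣ) : F) := by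
    rw [hB, det_smul, det_transpose]
    simp [← GeneralLinearGroup.val_det_apply]
  have hm : ∃ a' b', (mSieg A l * nSieg z hz * g).1.1 = fromBlocks a' b' (B * c) (B * d) := by
    refine ⟨A.1 * a + A.1 * z * c, A.1 * b + A.1 * z * d, ?_⟩
    · change fromBlocks A.1 0 0 B * fromBlocks 1 z 0 1 * g.1.1 = _
      rw [hg, fromBlocks_multiply, fromBlocks_multiply]
      simp only [Matrix.zero_mul, Matrix.mul_one, Matrix.mul_zero, zero_add, add_zero]
  obtain ⟨a', b', hm⟩ := hm
  have hs : similitude (mSieg A l * nSieg z hz * g) = l * similitude g := by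
    rw [similitude_mul, similitude_mul, mSieg, nSieg, similitude_mk', similitude_mk', mul_one]
  by_cases hc : IsUnit c.det
  · obtain ⟨δ, hδ⟩ := hc
    rw [siegelSection_of_det ω χ Φ _ (l ^ 3 * A.det⁻¹ * δ)
        (by rw [hm, toBlocks_fromBlocks₂₁, det_mul, hBdet, ← hδ, ← Units.val_mul]),
      siegelSection_of_det ω χ Φ g δ (by rw [hg, toBlocks_fromBlocks₂₁, hδ]), hm, hg, hs]
    have e1 : l * similitude g / (l ^ 3 * A.det⁻¹ * δ) =
        ((l ^ 2)⁻¹ * A.det) * (similitude g / δ) := by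
      ext
      simp only [Units.val_mul, Units.val_div_eq_div_val, Units.val_pow_eq_pow_val,
        Units.val_inv_eq_inv_val]
      field_simp
    have e2 : (l * similitude g) ^ 3 / (l ^ 3 * A.det⁻¹ * δ) ^ 2 =
        ((l ^ 3)⁻¹ * A.det ^ 2) * (similitude g ^ 3 / δ ^ 2) := by
      ext
      simp only [Units.val_mul, Units.val_div_eq_div_val, Units.val_pow_eq_pow_val,
        Units.val_inv_eq_inv_val]
      field_simp
    have e3 : (B * c)⁻¹ * (B * d) = c⁻¹ * d := by
      have hBu : IsUnit B.det := by rw [hBdet]; exact Units.isUnit _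
      rw [Matrix.mul_inv_rev, Matrix.mul_assoc, Matrix.nonsing_inv_mul_cancel_left _ _ hBu]
    simp only [toBlocks_fromBlocks₂₁, toBlocks_fromBlocks₂₂, e1, e2, e3, map_mul, Units.val_mul,
      norm_mul, Complex.ofReal_mul]
    ring
  · have h1 : ¬ IsUnit ((mSieg A l * nSieg z hz * g).1.1.toBlocks₂₁).det := by
      rw [hm, toBlocks_fromBlocks₂₁, det_mul, hBdet]
      rw [isUnit_iff_ne_zero, not_not] at hc
      simp [hc]
    have h2 : ¬ IsUnit (g.1.1.toBlocks₂₁).det := by rwa [hg, toBlocks_fromBlocks₂₁]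
    rw [siegelSection, siegelSection, dif_neg h1, dif_neg h2, mul_zero]

end Section

/-! ### The local zeta integral -/

section Zeta

variable {F : Type*} [NontriviallyNormedField F]

/-- The element
`(𝐧(x), 1, 1) · (diag(a,1), diag(a,1) 𝐦(b), diag(a,1) 𝐦(c)) · (𝐧⁻(u₁), 𝐧⁻(u₂), 𝐧⁻(u₃))` of `H`,
where `𝐦(b) = diag(b, b⁻¹)`. These elements represent, each exactly once, the points of an open
dense subset of `U⁰Z \ H` with complement of measure zero. -/
def cell (p : F × (Fˣ × Fˣ × Fˣ) × (F × F × F)) : H F :=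
  ⟨(nUp p.1 * diagGL p.2.1.1 1 * nLow p.2.2.1,
    diagGL (p.2.1.1 * p.2.1.2.1) p.2.1.2.1⁻¹ * nLow p.2.2.2.1,
    diagGL (p.2.1.1 * p.2.1.2.2) p.2.1.2.2⁻¹ * nLow p.2.2.2.2), by
    constructor <;> ext <;>
      simp [nUp, nLow, diagGL, GeneralLinearGroup.val_det_apply, det_fin_two]⟩

/-- The density `(ζ(2)/ζ(1))³ |a|⁻³ |b|⁻² |c|⁻²`, with `ζ(2)/ζ(1) = (1 + q⁻¹)⁻¹`, of the right
`H`-invariant measure on `U⁰Z \ H` with respect to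
`dx d^×a d^×b d^×c du₁ du₂ du₃` in the coordinates `cell`. Here `|a|³|b|²|c|²` is the modulus of
`(diag(a,1), diag(a,1) 𝐦(b), diag(a,1) 𝐦(c))` acting on `U`, and `ζ(2)/ζ(1)` is the constant in
`∫_{SL₂(F)} h(g) dg = (ζ(2)/ζ(1)) ∫ h(𝐦(a) 𝐧⁻(u) 𝐧(x)) d^×a du dx`, so that the measure of the image
of `H ∩ GL₂(𝔬)³` is one. -/
def cellWeight [IsUltrametricDist F] (p : F × (Fˣ × Fˣ × Fˣ) × (F × F × F)) : ℝ :=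
  ((1 + (residueCard F : ℝ)⁻¹) ^ 3)⁻¹ *
    (‖(p.2.1.1 : F)‖ ^ 3 * ‖(p.2.1.2.1 : F)‖ ^ 2 * ‖(p.2.1.2.2 : F)‖ ^ 2)⁻¹

/-- The integrand `W₁(g₁) W₂(g₂) W₃(g₃) f(𝛈 ι(g₁, g₂, g₃))`, a function on `U⁰Z \ H`. -/
def zetaIntegrand (W : Fin 3 → GL (Fin 2) F → ℂ) (f : GSp6 F → ℂ) (h : H F) : ℂ :=
  W 0 h.1.1 * W 1 h.1.2.1 * W 2 h.1.2.2 * f (eta F * iota h)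

variable [MeasurableSpace F] [IsUltrametricDist F]

/-- The product measure `dx d^×a d^×b d^×c du₁ du₂ du₃`. -/
def cellMeasure (dx : Measure F) (dt : Measure Fˣ) :
    Measure (F × (Fˣ × Fˣ × Fˣ) × (F × F × F)) :=
  dx.prod ((dt.prod (dt.prod dt)).prod (dx.prod (dx.prod dx)))

/-- Absolute convergence of the integral defining `Z(W₁, W₂, W₃, f)`. -/
def ZetaConverges (dx : Measure F) (dt : Measure Fˣ) (W : Fin 3 → GL (Fin 2) F → ℂ)
    (f : GSp6 F → ℂ) : Prop :=
  Integrable (fun p => (cellWeight p : ℂ) * zetaIntegrand W f (cell p)) (cellMeasure dx dt)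

/-- The local zeta integral
`Z(W₁, W₂, W₃, f) = ∫_{U⁰Z\H} W₁(g₁) W₂(g₂) W₃(g₃) f(𝛈 ι(g₁, g₂, g₃)) dg`. -/
def localZeta (dx : Measure F) (dt : Measure Fˣ) (W : Fin 3 → GL (Fin 2) F → ℂ)
    (f : GSp6 F → ℂ) : ℂ :=
  ∫ p, (cellWeight p : ℂ) * zetaIntegrand W f (cell p) ∂(cellMeasure dx dt)

end Zeta

end TripleZeta

end

noncomputable section

namespace TripleZeta

/-! ### Valuations -/

section Valuation

variable {F : Type*} [NontriviallyNormedField F] {ϖ : Fˣ}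

/-! Write r = |ϖ| = q⁻¹ and C = χ(ϖ)|ϖ|^s. The zeta integral is computed outright, as a power series
in C that sums to a rational function, and this function is compared with L/ε.

On N T N⁻ a distinguished Whittaker function is a value of ψ times a function of the orders of the
coordinates (`IsLocalData`). For a principal series the given vector must be spherical, by
irreducibility, and the Hecke operator yields a recurrence (`spherical_isLocalData`). For St ⊗ σ the
prescribed Kirillov function determines the vector by Fourier inversion on the big cell: it is a
multiple of the Iwahori-fixed vector (`smul_eq_iwahoriVector`, `steinberg_isLocalData`).

The section, too, depends only on orders once x is translated by `cellShear`, and the same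
translation collects all values of ψ into ψ(x) (`zetaIntegrand_cell`). The integral thus becomes a
sum over seven orders (`integrable_of_cellShell_shear`). Right translation by n⁻(u) with |u| < 1
changes nothing, so a small uᵢ counts as 0; if two of them are small, the lower left block is
singular and the section vanishes. Four orbits remain: all uᵢ large, or exactly one small.
Invariance under the centre removes the orders of the uᵢ from the summand, and their sums give 1 for
a large and r for a small uᵢ (`cellCoeff_eq_orbits`, `hasSum_orbits`). What is left is one series
over the order of x, whose terms are products of the sums ∑ₖ P(m + 2k) vᵏ (`cellCoeff_isTotal`).

For St ⊗ σ these step sums are geometric, and for a principal series they satisfy a recurrence of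
order two. After multiplication by the characteristic polynomial of the recurrence the series
telescopes, which gives a closed formula for each number of Steinberg factors (the three theorems
`IsTotal.steinberg_...`).

On the Galois side, coordinates are chosen in which Frobenius is diagonal and ker N is a coordinate
subspace, so that L⁻¹ is a product of linear factors and ε is a monomial (`WDRep.HasCoords`). In
every case the normalized integral times L⁻¹ ε is the same monomial
(`IsTotal.mul_lFactorInv_mul_epsFactor`). The right-hand side of the formula is therefore the
continuation. The second integral needs no computation, since its integrand is pointwise equal to
the first (`zetaIntegrand_twist`). -/

theorem norm_unit_pos (a : Fˣ) : 0 < ‖(a : F)‖ := norm_pos_iff.2 a.ne_zero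

theorem IsUniformizer.norm_lt_one (hϖ : IsUniformizer ϖ) : ‖(ϖ : F)‖ < 1 := (hϖ ϖ).2 le_rfl

/-- A power of ϖ scales the norm of x into the interval (|ϖ|, 1], and `IsUniformizer` leaves only
the value 1 there. -/
theorem IsUniformizer.exists_zpow (hϖ : IsUniformizer ϖ) {x : F} (hx : x ≠ 0) :
    ∃ k : ℤ, ‖x‖ = ‖(ϖ : F)‖ ^ k := by
  have h0 := norm_unit_pos ϖ
  obtain ⟨n, hn1, hn2⟩ := exists_mem_Ioc_zpow (norm_pos_iff.2 hx)
    ((one_lt_inv₀ h0).2 hϖ.norm_lt_one)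
  refine ⟨-(n + 1), ?_⟩
  have hy : ‖x * (ϖ : F) ^ (n + 1)‖ = ‖x‖ * ‖(ϖ : F)‖ ^ (n + 1) := by rw [norm_mul, norm_zpow]
  have hpos : 0 < ‖(ϖ : F)‖ ^ (n + 1) := zpow_pos h0 _
  have h1 : ‖x * (ϖ : F) ^ (n + 1)‖ ≤ 1 := by
    rw [hy, ← mul_inv_cancel₀ hpos.ne', mul_comm]
    rw [_root_.inv_zpow] at hn2
    gcongr
  have h2 : ¬ ‖x * (ϖ : F) ^ (n + 1)‖ < 1 := by
    rw [hϖ, hy, not_le, zpow_add_one₀ h0.ne', ← mul_assoc]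
    rw [_root_.inv_zpow, inv_lt_iff_one_lt_mul₀ (zpow_pos h0 _)] at hn1
    exact lt_mul_of_one_lt_left h0 hn1
  have h3 := le_antisymm h1 (not_lt.1 h2)
  rw [hy] at h3
  rw [_root_.zpow_neg]
  exact eq_inv_of_mul_eq_one_left h3

/-- The normalised valuation attached to `ϖ` (with an arbitrary value at `0`). -/
def ord (ϖ : Fˣ) (x : F) : ℤ := Classical.epsilon fun k : ℤ => ‖x‖ = ‖(ϖ : F)‖ ^ k

theorem IsUniformizer.norm_eq (hϖ : IsUniformizer ϖ) {x : F} (hx : x ≠ 0) :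
    ‖x‖ = ‖(ϖ : F)‖ ^ ord ϖ x := Classical.epsilon_spec (hϖ.exists_zpow hx)

theorem IsUniformizer.zpow_inj (hϖ : IsUniformizer ϖ) {m n : ℤ}
    (h : ‖(ϖ : F)‖ ^ m = ‖(ϖ : F)‖ ^ n) : m = n :=
  zpow_right_injective₀ (norm_unit_pos ϖ) hϖ.norm_lt_one.ne h

theorem IsUniformizer.zpow_le_zpow_iff (hϖ : IsUniformizer ϖ) {m n : ℤ} :
    ‖(ϖ : F)‖ ^ m ≤ ‖(ϖ : F)‖ ^ n ↔ n ≤ m :=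
  (zpow_right_strictAnti₀ (norm_unit_pos ϖ) hϖ.norm_lt_one).le_iff_ge

theorem IsUniformizer.ord_eq (hϖ : IsUniformizer ϖ) {x : F} {k : ℤ}
    (h : ‖x‖ = ‖(ϖ : F)‖ ^ k) : ord ϖ x = k := by
  have hx : x ≠ 0 := norm_pos_iff.1 (h ▸ zpow_pos (norm_unit_pos ϖ) k)
  exact hϖ.zpow_inj ((hϖ.norm_eq hx).symm.trans h)

theorem IsUniformizer.ord_mul (hϖ : IsUniformizer ϖ) {x y : F} (hx : x ≠ 0) (hy : y ≠ 0) :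
    ord ϖ (x * y) = ord ϖ x + ord ϖ y :=
  hϖ.ord_eq (by rw [norm_mul, hϖ.norm_eq hx, hϖ.norm_eq hy,
    zpow_add₀ (norm_unit_pos ϖ).ne'])

theorem IsUniformizer.ord_inv (hϖ : IsUniformizer ϖ) {x : F} (hx : x ≠ 0) :
    ord ϖ x⁻¹ = -ord ϖ x :=
  hϖ.ord_eq (by rw [norm_inv, hϖ.norm_eq hx, _root_.zpow_neg])

theorem IsUniformizer.ord_div (hϖ : IsUniformizer ϖ) {x y : F} (hx : x ≠ 0) (hy : y ≠ 0) :
    ord ϖ (x / y) = ord ϖ x - ord ϖ y := by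
  rw [div_eq_mul_inv, hϖ.ord_mul hx (inv_ne_zero hy), hϖ.ord_inv hy, sub_eq_add_neg]

theorem IsUniformizer.ord_pow (hϖ : IsUniformizer ϖ) {x : F} (hx : x ≠ 0) (n : ℕ) :
    ord ϖ (x ^ n) = n * ord ϖ x :=
  hϖ.ord_eq (by rw [norm_pow, hϖ.norm_eq hx, mul_comm, _root_.zpow_mul, zpow_natCast])

theorem IsUniformizer.ord_one (hϖ : IsUniformizer ϖ) : ord ϖ (1 : F) = 0 :=
  hϖ.ord_eq (by simp)

theorem IsUniformizer.norm_le_iff (hϖ : IsUniformizer ϖ) {x : F} (hx : x ≠ 0) (k : ℤ) :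
    ‖x‖ ≤ ‖(ϖ : F)‖ ^ k ↔ k ≤ ord ϖ x := by
  rw [hϖ.norm_eq hx, hϖ.zpow_le_zpow_iff]

theorem IsUniformizer.norm_le_one_iff (hϖ : IsUniformizer ϖ) {x : F} (hx : x ≠ 0) :
    ‖x‖ ≤ 1 ↔ 0 ≤ ord ϖ x := by
  rw [← hϖ.norm_le_iff hx, zpow_zero]

theorem IsUniformizer.norm_lt_one_iff (hϖ : IsUniformizer ϖ) {x : F} (hx : x ≠ 0) :
    ‖x‖ < 1 ↔ 1 ≤ ord ϖ x := by
  rw [hϖ, ← hϖ.norm_le_iff hx, zpow_one]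

/-- An unramified quasi-character is determined by its value at `ϖ`. -/
theorem IsUnramified.apply_eq {χ : Fˣ →* ℂˣ} (hχ : IsUnramified χ) (hϖ : IsUniformizer ϖ)
    (a : Fˣ) : χ a = χ ϖ ^ ord ϖ (a : F) := by
  have h : χ (a / ϖ ^ ord ϖ (a : F)) = 1 := hχ _ (by
    rw [Units.val_div_eq_div_val, Units.val_zpow_eq_zpow_val, norm_div, norm_zpow,
      ← hϖ.norm_eq a.ne_zero, div_self (norm_unit_pos a).ne'])
  rwa [map_div, map_zpow, div_eq_one] at h

theorem IsUnramified.coe_apply {χ : Fˣ →* ℂˣ} (hχ : IsUnramified χ) (hϖ : IsUniformizer ϖ)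
    (a : Fˣ) : (χ a : ℂ) = (χ ϖ : ℂ) ^ ord ϖ (a : F) := by
  rw [hχ.apply_eq hϖ, Units.val_zpow_eq_zpow_val]

theorem IsUnramified.mul {χ η : Fˣ →* ℂˣ} (hχ : IsUnramified χ) (hη : IsUnramified η) :
    IsUnramified (χ * η) := fun u hu => by simp [hχ u hu, hη u hu]

theorem isUnramified_absChar (s : ℂ) : IsUnramified (absChar F s) := fun u hu => by
  ext; simp [absChar, hu]

theorem IsUnramified.pow {χ : Fˣ →* ℂˣ} (hχ : IsUnramified χ) (n : ℕ) :
    IsUnramified (χ ^ n) := fun u hu => by simp [hχ u hu]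

theorem shell_eq_diff (hϖ : IsUniformizer ϖ) (k : ℤ) :
    {x : F | ‖x‖ = ‖(ϖ : F)‖ ^ k} =
      {x : F | ‖x‖ ≤ ‖(ϖ : F)‖ ^ k} \ {x : F | ‖x‖ ≤ ‖(ϖ : F)‖ ^ (k + 1)} := by
  ext x
  simp only [Set.mem_ofPred_eq, Set.mem_sdiff]
  by_cases hx : x = 0
  · have h1 := zpow_pos (norm_unit_pos ϖ) k
    have h2 := zpow_pos (norm_unit_pos ϖ) (k + 1)
    simp only [hx, norm_zero]
    exact ⟨fun h => absurd h h1.ne, fun h => absurd h2.le h.2⟩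
  · rw [hϖ.norm_le_iff hx, hϖ.norm_le_iff hx]
    constructor
    · intro h
      rw [hϖ.ord_eq h]
      lia
    · intro h
      rw [hϖ.norm_eq hx, show ord ϖ x = k by lia]

theorem ball_succ_subset (hϖ : IsUniformizer ϖ) (k : ℤ) :
    {x : F | ‖x‖ ≤ ‖(ϖ : F)‖ ^ (k + 1)} ⊆ {x : F | ‖x‖ ≤ ‖(ϖ : F)‖ ^ k} := fun _ hx =>
  le_trans hx (hϖ.zpow_le_zpow_iff.2 (by lia))

/-- Continuity of ψ is not a hypothesis of its own: being trivial on 𝔬, ψ is constant on closed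
balls of radius one. -/
theorem continuous_of_trivial {ψ : AddChar F Circle} (hψ : ∀ x : F, ‖x‖ ≤ 1 → ψ x = 1) :
    Continuous fun x => (ψ x : ℂ) := by
  rw [continuous_iff_continuousAt]
  intro x
  refine (continuousAt_const (y := (ψ x : ℂ))).congr ?_
  filter_upwards [Metric.closedBall_mem_nhds x one_pos] with y hy
  have h := hψ (y - x) (by simpa [dist_eq_norm] using hy)
  rw [← sub_add_cancel y x, AddChar.map_add_eq_mul, h, one_mul]

end Valuation

/-! ### Measures of balls and spheres -/

section Measurable

variable {F : Type*} [NontriviallyNormedField F] [MeasurableSpace F] [BorelSpace F]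

theorem measurableSet_ball_le (R : ℝ) : MeasurableSet {x : F | ‖x‖ ≤ R} :=
  measurableSet_le measurable_norm measurable_const

theorem measurableSet_shell (R : ℝ) : MeasurableSet {x : F | ‖x‖ = R} :=
  measurableSet_eq_fun measurable_norm measurable_const

end Measurable

section Reps

variable {F : Type*} [NontriviallyNormedField F] [IsUltrametricDist F]

theorem ultra_add_le {x y : F} {R : ℝ} (hx : ‖x‖ ≤ R) (hy : ‖y‖ ≤ R) : ‖x + y‖ ≤ R :=
  (IsUltrametricDist.norm_add_le_max x y).trans (max_le hx hy)

theorem ultra_sub_le {x y : F} {R : ℝ} (hx : ‖x‖ ≤ R) (hy : ‖y‖ ≤ R) : ‖x - y‖ ≤ R := by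
  rw [sub_eq_add_neg]; exact ultra_add_le hx (by rwa [norm_neg])

theorem ultra_add_lt {x y : F} {R : ℝ} (hx : ‖x‖ < R) (hy : ‖y‖ < R) : ‖x + y‖ < R :=
  (IsUltrametricDist.norm_add_le_max x y).trans_lt (max_lt hx hy)

/-- A finite set of representatives of the ball of radius `R` modulo the ball of radius `ε`. -/
theorem exists_ball_reps [LocallyCompactSpace F] {ε R : ℝ} (hε : 0 < ε) (hR : ε ≤ R) :
    ∃ T : Finset F, (∀ y ∈ T, ‖y‖ ≤ R) ∧ ∀ x : F, ‖x‖ ≤ R → ∃! y, y ∈ T ∧ ‖x - y‖ ≤ ε := by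
  classical
  have : ProperSpace F := ProperSpace.of_locallyCompactSpace F
  let P : AddSubgroup F :=
    { carrier := {x | ‖x‖ ≤ ε}
      zero_mem' := by simp [hε.le]
      add_mem' := fun hx hy => ultra_add_le hx hy
      neg_mem' := fun {x} hx => by simpa using hx }
  let rep : F → F := fun x => Quotient.out (x : F ⧸ P)
  have hrep : ∀ x, ‖x - rep x‖ ≤ ε := fun x => by
    have h : ((rep x : F) : F ⧸ P) = (x : F ⧸ P) := Quotient.out_eq _
    have h2 : -rep x + x ∈ P := QuotientAddGroup.eq.1 h
    rwa [neg_add_eq_sub] at h2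
  have hrep2 : ∀ x y, ‖x - y‖ ≤ ε → rep x = rep y := fun x y h => by
    have : (x : F ⧸ P) = (y : F ⧸ P) := QuotientAddGroup.eq.2 (by
      change ‖-x + y‖ ≤ ε
      rwa [neg_add_eq_sub, norm_sub_rev])
    change Quotient.out (x : F ⧸ P) = Quotient.out (y : F ⧸ P)
    rw [this]
  obtain ⟨t, htR, htf, hcov⟩ := (isCompact_closedBall (0 : F) R).finite_cover_balls hε
  -- The centres of a finite cover of the compact ball may repeat classes modulo the smaller ball;
  -- passing to one representative per class restores uniqueness.
  refine ⟨htf.toFinset.image rep, ?_, fun x hx => ?_⟩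
  · simp only [Finset.mem_image, Set.Finite.mem_toFinset]
    rintro _ ⟨x, hx, rfl⟩
    have h1 : ‖x‖ ≤ R := by simpa using htR hx
    have h2 := ultra_sub_le h1 ((hrep x).trans hR)
    simpa using h2
  · have hx' : x ∈ Metric.closedBall (0 : F) R := by simpa using hx
    obtain ⟨y, hy, hxy⟩ := Set.mem_iUnion₂.1 (hcov hx')
    rw [Metric.mem_ball, dist_eq_norm] at hxy
    refine ⟨rep y, ⟨Finset.mem_image_of_mem _ (by simpa using hy), ?_⟩, ?_⟩
    · rw [← hrep2 x y hxy.le]; exact hrep x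
    · rintro z ⟨hz, hxz⟩
      obtain ⟨w, -, rfl⟩ := Finset.mem_image.1 hz
      have : rep (rep w) = rep w := (hrep2 w (rep w) (hrep w)).symm
      rw [← this, ← hrep2 x _ hxz, hrep2 x y hxy.le]

/-- Representatives of `𝔬/𝔭`: there are `q` of them. -/
theorem exists_residue_reps [LocallyCompactSpace F] {ϖ : Fˣ} (hϖ : IsUniformizer ϖ) :
    ∃ T : Finset F, (∀ y ∈ T, ‖y‖ ≤ 1) ∧
      (∀ x : F, ‖x‖ ≤ 1 → ∃! y, y ∈ T ∧ ‖x - y‖ ≤ ‖(ϖ : F)‖) ∧ T.card = residueCard F := by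
  obtain ⟨T, hT1, hT2⟩ := exists_ball_reps (F := F) (norm_unit_pos ϖ) hϖ.norm_lt_one.le
  refine ⟨T, hT1, hT2, ?_⟩
  have hmem : ∀ x : F, x ∈ (NormedField.valuation (K := F)).valuationSubring ↔ ‖x‖ ≤ 1 :=
    fun x => by
      rw [Valuation.mem_valuationSubring_iff, NormedField.valuation_apply, ← NNReal.coe_le_coe]
      simp
  have hmax : ∀ x : (NormedField.valuation (K := F)).valuationSubring,
      x ∈ IsLocalRing.maximalIdeal _ ↔ ‖(x : F)‖ ≤ ‖(ϖ : F)‖ := fun x => by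
    have h1 := (hmem x).1 x.2
    have h2 : IsUnit x ↔ NormedField.valuation (x : F) = 1 :=
      (Valuation.integer.integers (NormedField.valuation (K := F))).isUnit_iff_valuation_eq_one
    rw [IsLocalRing.mem_maximalIdeal, mem_nonunits_iff, h2, ← hϖ, NormedField.valuation_apply, ← NNReal.coe_inj]
    simp only [coe_nnnorm, NNReal.coe_one]
    exact ⟨fun h => lt_of_le_of_ne h1 h, fun h => h.ne⟩
  let f : T → IsLocalRing.ResidueField (NormedField.valuation (K := F)).valuationSubring :=
    fun y => IsLocalRing.residue _ ⟨y.1, (hmem _).2 (hT1 _ y.2)⟩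
  have hf : ∀ x y : (NormedField.valuation (K := F)).valuationSubring,
      IsLocalRing.residue _ x = IsLocalRing.residue _ y ↔ ‖(x : F) - y‖ ≤ ‖(ϖ : F)‖ := by
    intro x y
    rw [← sub_eq_zero, ← map_sub, IsLocalRing.residue_eq_zero_iff, hmax]
    rfl
  have hbij : Function.Bijective f := by
    constructor
    · intro y z hyz
      have h := (hf _ _).1 hyz
      ext
      exact (hT2 y (hT1 _ y.2)).unique ⟨y.2, by simp⟩ ⟨z.2, h⟩
    · intro c
      obtain ⟨x, rfl⟩ := IsLocalRing.residue_surjective c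
      obtain ⟨y, ⟨hy, hxy⟩, -⟩ := hT2 x ((hmem _).1 x.2)
      exact ⟨⟨y, hy⟩, ((hf _ _).2 hxy).symm⟩
  rw [residueCard, ← Nat.card_congr (Equiv.ofBijective f hbij)]
  simp

variable [MeasurableSpace F] [BorelSpace F] {ϖ : Fˣ}

/-- The ball of radius `R` is a disjoint union of translates of the ball of radius `ε`. -/
theorem measure_ball_eq_card_mul (dx : Measure F) [dx.IsAddHaarMeasure] {ε R : ℝ} (hR : ε ≤ R)
    {T : Finset F} (hT1 : ∀ y ∈ T, ‖y‖ ≤ R)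
    (hT2 : ∀ x : F, ‖x‖ ≤ R → ∃! y, y ∈ T ∧ ‖x - y‖ ≤ ε) :
    dx {x | ‖x‖ ≤ R} = T.card * dx {x | ‖x‖ ≤ ε} := by
  have h : {x : F | ‖x‖ ≤ R} = ⋃ y ∈ T, (fun x => -y + x) ⁻¹' {x | ‖x‖ ≤ ε} := by
    ext x
    simp only [Set.mem_ofPred_eq, Set.mem_iUnion, Set.mem_preimage, neg_add_eq_sub, exists_prop]
    constructor
    · intro hx
      exact (hT2 x hx).exists
    · rintro ⟨y, hy, hxy⟩
      simpa using ultra_add_le (hxy.trans hR) (hT1 y hy)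
  rw [h, measure_biUnion_finset]
  · rw [Finset.sum_congr rfl fun y _ => measure_preimage_add dx (-y) _]
    simp
  · intro y hy z hz hyz
    refine Set.disjoint_left.2 fun x hxy hxz => hyz ?_
    simp only [Set.mem_preimage, Set.mem_ofPred_eq, neg_add_eq_sub] at hxy hxz
    have hx : ‖x‖ ≤ R := by simpa using ultra_add_le (hxy.trans hR) (hT1 y hy)
    exact (hT2 x hx).unique ⟨hy, hxy⟩ ⟨hz, hxz⟩
  · intro y _
    exact (measurable_const_add (-y)) (measurableSet_ball_le ε)

/-- The volume of `𝔭^k` is `|ϖ|^k`. -/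
theorem measure_ball [LocallyCompactSpace F] (hϖ : IsUniformizer ϖ)
    (hnorm : ‖(ϖ : F)‖ = (residueCard F : ℝ)⁻¹) (dx : Measure F) [dx.IsAddHaarMeasure]
    (hdx : dx {x | ‖x‖ ≤ 1} = 1) (k : ℤ) :
    dx {x | ‖x‖ ≤ ‖(ϖ : F)‖ ^ k} = ENNReal.ofReal (‖(ϖ : F)‖ ^ k) := by
  have h0 := norm_unit_pos ϖ
  obtain ⟨T, hT1, hT2, hT3⟩ := exists_residue_reps hϖ
  have hq : (residueCard F : ENNReal) = ENNReal.ofReal ‖(ϖ : F)‖⁻¹ := by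
    rw [hnorm, inv_inv, ENNReal.ofReal_natCast]
  -- 𝔭^k is the union of the q translates of 𝔭^(k+1) by ϖ^k y, with y running over representatives
  -- of 𝔬/𝔭. Read in both directions, this carries the volume from k = 0 to all integers.
  have hstep : ∀ k : ℤ, dx {x | ‖x‖ ≤ ‖(ϖ : F)‖ ^ k} =
      ENNReal.ofReal ‖(ϖ : F)‖⁻¹ * dx {x | ‖x‖ ≤ ‖(ϖ : F)‖ ^ (k + 1)} := by
    intro k
    have hk : ((ϖ : F)) ^ k ≠ 0 := zpow_ne_zero _ ϖ.ne_zero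
    have hpk : 0 < ‖(ϖ : F)‖ ^ k := zpow_pos h0 k
    have hinj : Function.Injective fun y : F => (ϖ : F) ^ k * y := mul_right_injective₀ hk
    rw [measure_ball_eq_card_mul dx (T := T.map ⟨_, hinj⟩) (ε := ‖(ϖ : F)‖ ^ (k + 1)) ?_ ?_ ?_,
      Finset.card_map, hT3, hq]
    · exact hϖ.zpow_le_zpow_iff.2 (by lia)
    · simp only [Finset.mem_map, Function.Embedding.coeFn_mk]
      rintro _ ⟨y, hy, rfl⟩
      rw [norm_mul, norm_zpow]
      exact mul_le_of_le_one_right hpk.le (hT1 y hy)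
    · intro x hx
      have key : ∀ y : F, ‖x - (ϖ : F) ^ k * y‖ ≤ ‖(ϖ : F)‖ ^ (k + 1) ↔
          ‖((ϖ : F) ^ k)⁻¹ * x - y‖ ≤ ‖(ϖ : F)‖ := fun y => by
        have : x - (ϖ : F) ^ k * y = (ϖ : F) ^ k * (((ϖ : F) ^ k)⁻¹ * x - y) := by
          rw [mul_sub, mul_inv_cancel_left₀ hk]
        rw [this, norm_mul, norm_zpow, zpow_add_one₀ h0.ne', mul_le_mul_iff_right₀ hpk]
      obtain ⟨y, ⟨hy, hxy⟩, hu⟩ := hT2 (((ϖ : F) ^ k)⁻¹ * x) (by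
        rw [norm_mul, norm_inv, norm_zpow, inv_mul_le_iff₀ hpk, mul_one]
        exact hx)
      refine ⟨(ϖ : F) ^ k * y, ⟨Finset.mem_map_of_mem ⟨_, hinj⟩ hy, (key y).2 hxy⟩, ?_⟩
      rintro z ⟨hz, hxz⟩
      obtain ⟨w, hw, rfl⟩ := Finset.mem_map.1 hz
      exact congrArg _ (hu w ⟨hw, (key w).1 hxz⟩)
  have hr : ENNReal.ofReal ‖(ϖ : F)‖⁻¹ * ENNReal.ofReal ‖(ϖ : F)‖ = 1 := by
    rw [← ENNReal.ofReal_mul (inv_nonneg.2 h0.le), inv_mul_cancel₀ h0.ne', ENNReal.ofReal_one]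
  induction k using Int.induction_on with
  | zero => simpa using hdx
  | succ i ih =>
    rw [hstep] at ih
    rw [zpow_add_one₀ h0.ne' i, mul_comm, ENNReal.ofReal_mul h0.le, ← ih, ← mul_assoc,
      mul_comm (ENNReal.ofReal ‖(ϖ : F)‖), hr, one_mul, mul_comm, zpow_add_one₀ h0.ne']
  | pred i ih =>
    rw [hstep, sub_add_cancel, ih, ← ENNReal.ofReal_mul (inv_nonneg.2 h0.le), mul_comm,
      zpow_sub_one₀ h0.ne']

variable [LocallyCompactSpace F]

theorem measureReal_shell (hϖ : IsUniformizer ϖ)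
    (hnorm : ‖(ϖ : F)‖ = (residueCard F : ℝ)⁻¹) (dx : Measure F) [dx.IsAddHaarMeasure]
    (hdx : dx {x | ‖x‖ ≤ 1} = 1) (k : ℤ) :
    dx.real {x | ‖x‖ = ‖(ϖ : F)‖ ^ k} = ‖(ϖ : F)‖ ^ k * (1 - ‖(ϖ : F)‖) := by
  have hb := measure_ball hϖ hnorm dx hdx
  have hb' : ∀ k : ℤ, dx.real {x | ‖x‖ ≤ ‖(ϖ : F)‖ ^ k} = ‖(ϖ : F)‖ ^ k := fun k => by
    rw [Measure.real, hb, ENNReal.toReal_ofReal (zpow_nonneg (norm_nonneg _) k)]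
  rw [shell_eq_diff hϖ, measureReal_sdiff (ball_succ_subset hϖ k) (measurableSet_ball_le _)
    (by rw [hb]; exact ENNReal.ofReal_ne_top), hb', hb', zpow_add_one₀ (norm_unit_pos ϖ).ne']
  ring

theorem measure_shell_lt_top (hϖ : IsUniformizer ϖ)
    (hnorm : ‖(ϖ : F)‖ = (residueCard F : ℝ)⁻¹) (dx : Measure F) [dx.IsAddHaarMeasure]
    (hdx : dx {x | ‖x‖ ≤ 1} = 1) (k : ℤ) :
    dx {x | ‖x‖ = ‖(ϖ : F)‖ ^ k} < ⊤ := by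
  refine (measure_mono fun x (hx : ‖x‖ = _) => hx.le).trans_lt
    (b := dx {x | ‖x‖ ≤ ‖(ϖ : F)‖ ^ k}) ?_
  rw [measure_ball hϖ hnorm dx hdx]
  exact ENNReal.ofReal_lt_top

/-! ### The additive character -/

section Character

theorem integrableOn_char (hϖ : IsUniformizer ϖ)
    (hnorm : ‖(ϖ : F)‖ = (residueCard F : ℝ)⁻¹) (dx : Measure F) [dx.IsAddHaarMeasure]
    (hdx : dx {x | ‖x‖ ≤ 1} = 1) {ψ : AddChar F Circle} (hψ : ∀ x : F, ‖x‖ ≤ 1 → ψ x = 1)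
    (k : ℤ) : IntegrableOn (fun x => (ψ x : ℂ)) {x | ‖x‖ ≤ ‖(ϖ : F)‖ ^ k} dx := by
  refine Measure.integrableOn_of_bounded (M := 1) ?_
    (continuous_of_trivial hψ).aestronglyMeasurable
    (Filter.Eventually.of_forall fun x => (Circle.norm_coe (ψ x)).le)
  rw [measure_ball hϖ hnorm dx hdx]
  exact ENNReal.ofReal_ne_top

theorem setIntegral_ball_of_trivial (hϖ : IsUniformizer ϖ)
    (hnorm : ‖(ϖ : F)‖ = (residueCard F : ℝ)⁻¹) (dx : Measure F) [dx.IsAddHaarMeasure]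
    (hdx : dx {x | ‖x‖ ≤ 1} = 1) {ψ : AddChar F Circle} {k : ℤ}
    (hψ : ∀ x : F, ‖x‖ ≤ ‖(ϖ : F)‖ ^ k → ψ x = 1) :
    ∫ x in {x | ‖x‖ ≤ ‖(ϖ : F)‖ ^ k}, (ψ x : ℂ) ∂dx = (‖(ϖ : F)‖ : ℂ) ^ k := by
  have h1 : ∀ x ∈ {x : F | ‖x‖ ≤ ‖(ϖ : F)‖ ^ k}, (ψ x : ℂ) = 1 := fun x hx => by
    simp [hψ x hx]
  rw [setIntegral_congr_fun (measurableSet_ball_le _) h1, setIntegral_const, Measure.real,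
    measure_ball hϖ hnorm dx hdx, ENNReal.toReal_ofReal (zpow_nonneg (norm_nonneg _) k)]
  simp

/-- Translation by y preserves the ball and multiplies the integral by ψ(y) ≠ 1. -/
theorem setIntegral_ball_of_nontrivial (dx : Measure F) [dx.IsAddHaarMeasure]
    {ψ : AddChar F Circle} {R : ℝ} {y : F} (hy : ‖y‖ ≤ R) (hy1 : ψ y ≠ 1) :
    ∫ x in {x | ‖x‖ ≤ R}, (ψ x : ℂ) ∂dx = 0 := by
  have h := integral_add_left_eq_self (μ := dx)
    ({x : F | ‖x‖ ≤ R}.indicator fun x => (ψ x : ℂ)) y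
  have h2 : (fun x => {x : F | ‖x‖ ≤ R}.indicator (fun x => (ψ x : ℂ)) (y + x)) =
      fun x => (ψ y : ℂ) * {x : F | ‖x‖ ≤ R}.indicator (fun x => (ψ x : ℂ)) x := by
    ext x
    by_cases hx : ‖x‖ ≤ R
    · rw [Set.indicator_of_mem (show x ∈ {x : F | ‖x‖ ≤ R} from hx),
        Set.indicator_of_mem (show y + x ∈ {x : F | ‖x‖ ≤ R} from
          ultra_add_le hy hx), AddChar.map_add_eq_mul, Circle.coe_mul]
    · rw [Set.indicator_of_notMem (show x ∉ {x : F | ‖x‖ ≤ R} from hx),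
        Set.indicator_of_notMem (show y + x ∉ {x : F | ‖x‖ ≤ R} from fun h' => hx
          (by simpa using ultra_sub_le h' hy)), mul_zero]
  rw [h2, integral_const_mul, integral_indicator (measurableSet_ball_le _)] at h
  have h3 : ((ψ y : ℂ) - 1) * ∫ x in {x | ‖x‖ ≤ R}, (ψ x : ℂ) ∂dx = 0 := by
    rw [sub_mul, one_mul, h, sub_self]
  refine (mul_eq_zero.1 h3).resolve_left fun h4 => hy1 ?_
  rw [sub_eq_zero] at h4
  ext
  simpa using h4

theorem setIntegral_ball_char (hϖ : IsUniformizer ϖ)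
    (hnorm : ‖(ϖ : F)‖ = (residueCard F : ℝ)⁻¹) (dx : Measure F) [dx.IsAddHaarMeasure]
    (hdx : dx {x | ‖x‖ ≤ 1} = 1) {ψ : AddChar F Circle} (hψ : ∀ x : F, ‖x‖ ≤ 1 → ψ x = 1)
    (hψ' : ∃ x : F, ‖x‖ ≤ ‖(ϖ : F)‖⁻¹ ∧ ψ x ≠ 1) (k : ℤ) :
    ∫ x in {x | ‖x‖ ≤ ‖(ϖ : F)‖ ^ k}, (ψ x : ℂ) ∂dx =
      if 0 ≤ k then (‖(ϖ : F)‖ : ℂ) ^ k else 0 := by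
  split_ifs with hk
  · refine setIntegral_ball_of_trivial hϖ hnorm dx hdx fun x hx => hψ x (le_trans hx ?_)
    rw [← zpow_zero ‖(ϖ : F)‖]
    exact hϖ.zpow_le_zpow_iff.2 hk
  · obtain ⟨y, hy, hy1⟩ := hψ'
    refine setIntegral_ball_of_nontrivial dx (hy.trans ?_) hy1
    rw [← _root_.zpow_neg_one]
    exact hϖ.zpow_le_zpow_iff.2 (by lia)

/-- Orthogonality: the Fourier transform of the characteristic function of a ball. -/
theorem setIntegral_ball_char_mul (hϖ : IsUniformizer ϖ)
    (hnorm : ‖(ϖ : F)‖ = (residueCard F : ℝ)⁻¹) (dx : Measure F) [dx.IsAddHaarMeasure]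
    (hdx : dx {x | ‖x‖ ≤ 1} = 1) {ψ : AddChar F Circle} (hψ : ∀ x : F, ‖x‖ ≤ 1 → ψ x = 1)
    (hψ' : ∃ x : F, ‖x‖ ≤ ‖(ϖ : F)‖⁻¹ ∧ ψ x ≠ 1) (k : ℤ) (h : F) :
    ∫ x in {x | ‖x‖ ≤ ‖(ϖ : F)‖ ^ k}, (ψ (h * x) : ℂ) ∂dx =
      if ‖h‖ ≤ ‖(ϖ : F)‖ ^ (-k) then (‖(ϖ : F)‖ : ℂ) ^ k else 0 := by
  have h0 := norm_unit_pos ϖ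
  change ∫ x in {x | ‖x‖ ≤ ‖(ϖ : F)‖ ^ k}, (AddChar.mulShift ψ h x : ℂ) ∂dx = _
  split_ifs with hh
  · refine setIntegral_ball_of_trivial hϖ hnorm dx hdx fun x hx => ?_
    rw [AddChar.mulShift_apply]
    refine hψ _ ?_
    rw [norm_mul]
    refine (mul_le_mul hh hx (norm_nonneg _) (zpow_nonneg h0.le _)).trans ?_
    rw [← zpow_add₀ h0.ne', neg_add_cancel, zpow_zero]
  · obtain ⟨y, hy, hy1⟩ := hψ'
    have hne : h ≠ 0 := by
      rintro rfl
      exact hh (by simpa using zpow_nonneg h0.le (-k))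
    -- Here ord h ≤ -k - 1 and ord y ≥ -1, so y / h has order at least k.
    refine setIntegral_ball_of_nontrivial dx (y := h⁻¹ * y) ?_ ?_
    · have hy0 : y ≠ 0 := by
        rintro rfl
        exact hy1 (by simp)
      rw [hϖ.norm_le_iff hne] at hh
      rw [hϖ.norm_le_iff (mul_ne_zero (inv_ne_zero hne) hy0),
        hϖ.ord_mul (inv_ne_zero hne) hy0, hϖ.ord_inv hne]
      rw [← _root_.zpow_neg_one, hϖ.norm_le_iff hy0] at hy
      lia
    · rwa [AddChar.mulShift_apply, mul_inv_cancel_left₀ hne]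

/-- The integral of `ψ` over the sphere of valuation `k`. -/
def shellChar (r : ℝ) (k : ℤ) : ℂ :=
  if 0 ≤ k then (r : ℂ) ^ k * (1 - r) else if k = -1 then -1 else 0

theorem setIntegral_shell_char (hϖ : IsUniformizer ϖ)
    (hnorm : ‖(ϖ : F)‖ = (residueCard F : ℝ)⁻¹) (dx : Measure F) [dx.IsAddHaarMeasure]
    (hdx : dx {x | ‖x‖ ≤ 1} = 1) {ψ : AddChar F Circle} (hψ : ∀ x : F, ‖x‖ ≤ 1 → ψ x = 1)
    (hψ' : ∃ x : F, ‖x‖ ≤ ‖(ϖ : F)‖⁻¹ ∧ ψ x ≠ 1) (k : ℤ) :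
    ∫ x in {x | ‖x‖ = ‖(ϖ : F)‖ ^ k}, (ψ x : ℂ) ∂dx = shellChar ‖(ϖ : F)‖ k := by
  have h0 : (‖(ϖ : F)‖ : ℂ) ≠ 0 := by simp
  rw [shell_eq_diff hϖ, setIntegral_sdiff (measurableSet_ball_le _)
    (integrableOn_char hϖ hnorm dx hdx hψ k) (ball_succ_subset hϖ k),
    setIntegral_ball_char hϖ hnorm dx hdx hψ hψ', setIntegral_ball_char hϖ hnorm dx hdx hψ hψ',
    shellChar]
  rcases lt_trichotomy k (-1) with h | h | h
  · rw [if_neg (by lia), if_neg (by lia), if_neg (by lia), if_neg (by lia), sub_zero]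
  -- At order -1 the larger ball contributes 0, and the smaller one, which is 𝔬, contributes -1.
  · subst h
    simp
  · rw [if_pos (by lia), if_pos (by lia), if_pos (by lia), zpow_add_one₀ h0]
    ring

end Character

end Reps

/-! ### Haar measure on the multiplicative group -/

section Units

variable {F : Type*} [NontriviallyNormedField F] [MeasurableSpace F] [BorelSpace F] {ϖ : Fˣ}

theorem measurable_units_val : Measurable fun a : Fˣ => (a : F) := comap_measurable _

theorem measurableSet_unitShell (R : ℝ) : MeasurableSet {a : Fˣ | ‖(a : F)‖ = R} :=
  measurable_units_val (measurableSet_shell R)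

theorem measure_unitShell (dt : Measure Fˣ) [dt.IsHaarMeasure]
    (hdt : dt {t | ‖(t : F)‖ = 1} = 1) (k : ℤ) : dt {t | ‖(t : F)‖ = ‖(ϖ : F)‖ ^ k} = 1 := by
  have : MeasurableMul Fˣ :=
    { measurable_const_mul := fun c => by
        rw [measurable_comap_iff]
        exact measurable_units_val.const_mul (c : F)
      measurable_mul_const := fun c => by
        rw [measurable_comap_iff]
        exact measurable_units_val.mul_const (c : F) }
  rw [← hdt, ← measure_preimage_mul dt (ϖ ^ (-k)) {t | ‖(t : F)‖ = 1}]
  congr 1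
  ext t
  have hpos := zpow_pos (norm_unit_pos ϖ) k
  simp only [Set.mem_ofPred_eq, Set.mem_preimage, Units.val_mul, _root_.zpow_neg,
    norm_mul, Units.val_inv_eq_inv_val, Units.val_zpow_eq_zpow_val, norm_inv, norm_zpow]
  rw [inv_mul_eq_one₀ hpos.ne', eq_comm]

/-- Finitely many shells at a time, each of volume one, exhaust Fˣ. σ-finiteness is what the product
measure in the cell coordinates requires. -/
theorem sigmaFinite_units (hϖ : IsUniformizer ϖ) (dt : Measure Fˣ) [dt.IsHaarMeasure]
    (hdt : dt {t | ‖(t : F)‖ = 1} = 1) : SigmaFinite dt := by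
  refine ⟨⟨⟨fun n => ⋃ k ∈ Finset.Icc (-(n : ℤ)) n, {t | ‖(t : F)‖ = ‖(ϖ : F)‖ ^ k}, fun _ => trivial,
    fun n => ?_, ?_⟩⟩⟩
  · refine (measure_biUnion_finset_le _ _).trans_lt ?_
    simp [measure_unitShell dt hdt, ENNReal.natCast_lt_top]
  · refine Set.eq_univ_of_forall fun t => ?_
    refine Set.mem_iUnion.2 ⟨(ord ϖ (t : F)).natAbs, Set.mem_iUnion₂.2
      ⟨ord ϖ (t : F), ?_, hϖ.norm_eq t.ne_zero⟩⟩
    rw [Finset.mem_Icc]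
    lia

end Units


/-! ### Matrices in `GL₂(F)` -/

section Matrices

variable {F : Type*} [NontriviallyNormedField F] {ϖ : Fˣ}

/-- The Weyl element `[0 -1; 1 0]`. -/
def weyl (F : Type*) [NontriviallyNormedField F] : GL (Fin 2) F :=
  GeneralLinearGroup.mkOfDetNeZero !![0, -1; 1, 0] (by simp)

@[simp] theorem coe_nUp (x : F) : (nUp x : Matrix (Fin 2) (Fin 2) F) = !![1, x; 0, 1] := rfl
@[simp] theorem coe_nLow (x : F) : (nLow x : Matrix (Fin 2) (Fin 2) F) = !![1, 0; x, 1] := rfl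
@[simp] theorem coe_diagGL (a d : Fˣ) :
    (diagGL a d : Matrix (Fin 2) (Fin 2) F) = !![(a : F), 0; 0, (d : F)] := rfl
@[simp] theorem coe_weyl : (weyl F : Matrix (Fin 2) (Fin 2) F) = !![0, -1; 1, 0] := rfl

theorem nUp_mul_nUp (x y : F) : nUp x * nUp y = nUp (x + y) := by
  ext i j
  fin_cases i <;> fin_cases j <;> simp [add_comm]

theorem nUp_zero : nUp (0 : F) = 1 := by
  ext i j
  fin_cases i <;> fin_cases j <;> simp

theorem diagGL_mul (a d a' d' : Fˣ) :
    diagGL a d * diagGL a' d' = diagGL (a * a') (d * d') := by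
  ext i j
  fin_cases i <;> fin_cases j <;> simp

theorem diagGL_mul_nUp (a d : Fˣ) (x : F) :
    diagGL a d * nUp x = nUp (a * x / d) * diagGL a d := by
  ext i j
  fin_cases i <;> fin_cases j <;> simp

theorem nLow_zero : nLow (0 : F) = 1 := by
  ext i j
  fin_cases i <;> fin_cases j <;> simp

theorem diagGL_central_comm (z : Fˣ) (g : GL (Fin 2) F) : diagGL z z * g = g * diagGL z z := by
  ext i j
  fin_cases i <;> fin_cases j <;> simp [Matrix.mul_apply, Fin.sum_univ_two, mul_comm]

theorem continuous_nUp : Continuous (nUp : F → GL (Fin 2) F) := by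
  rw [Units.continuous_iff]
  have h : ∀ x : F, ((nUp x)⁻¹ : GL (Fin 2) F) = nUp (-x) := fun x => by
    rw [inv_eq_iff_mul_eq_one, nUp_mul_nUp, add_neg_cancel, nUp_zero]
  constructor
  · refine continuous_matrix fun i j => ?_
    fin_cases i <;> fin_cases j <;> simp <;> fun_prop
  · simp only [h]
    refine continuous_matrix fun i j => ?_
    fin_cases i <;> fin_cases j <;> simp <;> fun_prop

theorem continuous_nLow : Continuous (nLow : F → GL (Fin 2) F) := by
  rw [Units.continuous_iff]
  have h : ∀ x : F, ((nLow x)⁻¹ : GL (Fin 2) F) = nLow (-x) := fun x => by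
    rw [inv_eq_iff_mul_eq_one]
    ext i j
    fin_cases i <;> fin_cases j <;> simp
  constructor
  · refine continuous_matrix fun i j => ?_
    fin_cases i <;> fin_cases j <;> simp <;> fun_prop
  · simp only [h]
    refine continuous_matrix fun i j => ?_
    fin_cases i <;> fin_cases j <;> simp <;> fun_prop

/-- The values of `W` on the cell `N T N⁻`, in terms of the functions `A` and `B` on the value
group which describe `W` on `diag(a, 1)` and on `diag(a, 1)` times the Weyl element. -/
structure IsLocalData (ϖ : Fˣ) (ψ : AddChar F Circle) (W : GL (Fin 2) F → ℂ) (A B : ℤ → ℂ)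
    (w : ℂ) : Prop where
  low : ∀ (a d : Fˣ) (x u : F), ‖u‖ < 1 → W (nUp x * diagGL a d * nLow (u : F)) =
    (ψ x : ℂ) * w ^ ord ϖ (d : F) * A (ord ϖ (a : F) - ord ϖ (d : F))
  big : ∀ (a d : Fˣ) (x : F) (u : Fˣ), 1 ≤ ‖(u : F)‖ → W (nUp x * diagGL a d * nLow (u : F)) =
    (ψ (x + (a : F) / (d * u)) : ℂ) * w ^ (ord ϖ (d : F) + ord ϖ (u : F)) *
      B (ord ϖ (a : F) - ord ϖ (d : F) - 2 * ord ϖ (u : F))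

/-- For |u| ≥ 1 one has n⁻(u) = n(u⁻¹) diag(u⁻¹, u) w n(u⁻¹). The last factor is absorbed by the
invariance, and the first, moved past the torus, produces ψ(a / (du)). So only the two functions on
diag(a, 1) and on diag(a, 1) w matter. -/
theorem IsLocalData.of_iwahori (hϖ : IsUniformizer ϖ) {ψ : AddChar F Circle}
    {W : GL (Fin 2) F → ℂ} {A B : ℤ → ℂ} {w : ℂ}
    (hW : ∀ x g, W (nUp x * g) = (ψ x : ℂ) * W g)
    (hz : ∀ z g, W (g * diagGL z z) = w ^ ord ϖ (z : F) * W g)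
    (hlow : ∀ u g, ‖u‖ < 1 → W (g * nLow u) = W g)
    (hup : ∀ x g, ‖x‖ ≤ 1 → W (g * nUp x) = W g)
    (hA : ∀ a : Fˣ, W (diagGL a 1) = A (ord ϖ (a : F)))
    (hB : ∀ a : Fˣ, W (diagGL a 1 * weyl F) = B (ord ϖ (a : F))) :
    IsLocalData ϖ ψ W A B w where
  low a d x u hu := by
    have h : diagGL a d = diagGL (a / d) 1 * diagGL d d := by rw [diagGL_mul]; simp
    rw [hlow _ _ hu, hW, h, hz, hA, Units.val_div_eq_div_val, hϖ.ord_div a.ne_zero d.ne_zero]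
    ring
  big a d x u hu := by
    have h : nUp x * diagGL a d * nLow (u : F) =
        nUp (x + a / (d * u)) * (diagGL (a / (d * u ^ 2)) 1 * weyl F * diagGL (d * u) (d * u)) *
          nUp ((u : F)⁻¹) := by
      ext i j
      fin_cases i <;> fin_cases j <;> simp [Matrix.mul_apply, Fin.sum_univ_two] <;> field_simp <;>
        ring
    have h2 : ord ϖ (((a / (d * u ^ 2) : Fˣ)) : F) =
        ord ϖ (a : F) - ord ϖ (d : F) - 2 * ord ϖ (u : F) := by
      rw [Units.val_div_eq_div_val, hϖ.ord_div a.ne_zero (Units.ne_zero _), Units.val_mul,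
        hϖ.ord_mul d.ne_zero (Units.ne_zero _), Units.val_pow_eq_pow_val, hϖ.ord_pow u.ne_zero]
      push_cast
      ring
    rw [h, hup _ _ (by rw [norm_inv]; exact inv_le_one_of_one_le₀ hu), hW, hz, hB, h2,
      Units.val_mul, hϖ.ord_mul d.ne_zero u.ne_zero]
    ring

end Matrices

/-! ### Principal series -/

section Principal

variable {F : Type*} [NontriviallyNormedField F] {ϖ : Fˣ} {μ ν : Fˣ →* ℂˣ}

@[simp] theorem principalSeries_apply (h g : GL (Fin 2) F) (f : principalSeriesSpace μ ν) :
    (principalSeries μ ν h f).1 g = f.1 (g * h) := rfl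

theorem principalSeries_central (f : principalSeriesSpace μ ν) (z : Fˣ) :
    principalSeries μ ν (diagGL z z) f = ((μ z : ℂ) * ν z) • f := by
  ext g
  have h := f.2.2 z z 0 g
  rw [nUp_zero, one_mul, diagGL_central_comm] at h
  rw [principalSeries_apply, h, div_self', map_one]
  simp

theorem absChar_half_apply (hϖ : IsUniformizer ϖ) (a : Fˣ) :
    (absChar F (1 / 2) a : ℂ) = (absChar F (1 / 2) ϖ : ℂ) ^ ord ϖ (a : F) :=
  (isUnramified_absChar _).coe_apply hϖ a

theorem absChar_half_sq : (absChar F (1 / 2) ϖ : ℂ) ^ 2 = (‖(ϖ : F)‖ : ℂ) := by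
  change ((‖(ϖ : F)‖ : ℂ) ^ (1 / 2 : ℂ)) ^ 2 = _
  rw [← Complex.cpow_nat_mul]
  norm_num

/-- The values of a `GL₂(𝔬)`-invariant function in the principal series. -/
theorem spherical_eval [IsUltrametricDist F] (hϖ : IsUniformizer ϖ) (hμ : IsUnramified μ)
    (hν : IsUnramified ν)
    (f : principalSeriesSpace μ ν) (hf : ∀ k ∈ maxCompact F, ∀ g, f.1 (g * k) = f.1 g)
    (g : GL (Fin 2) F) (k : ℤ) (hc : ‖g 1 0‖ ≤ ‖(ϖ : F)‖ ^ k) (hd : ‖g 1 1‖ ≤ ‖(ϖ : F)‖ ^ k)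
    (hcd : ‖g 1 0‖ = ‖(ϖ : F)‖ ^ k ∨ ‖g 1 1‖ = ‖(ϖ : F)‖ ^ k) :
    f.1 g = ((μ ϖ : ℂ) * absChar F (1 / 2) ϖ) ^ (ord ϖ (g.det : F) - k) *
      ((ν ϖ : ℂ) / absChar F (1 / 2) ϖ) ^ k * f.1 1 := by
  have h0 := norm_unit_pos ϖ
  have hρ : (absChar F (1 / 2) ϖ : ℂ) ≠ 0 := Units.ne_zero _
  have key : ∀ (z : Fˣ) (b : F) (k' : GL (Fin 2) F), k' ∈ maxCompact F → ‖(z : F)‖ = ‖(ϖ : F)‖ ^ k →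
      g = nUp b * diagGL (g.det / z) z * k' →
      f.1 g = ((μ ϖ : ℂ) * absChar F (1 / 2) ϖ) ^ (ord ϖ (g.det : F) - k) *
        ((ν ϖ : ℂ) / absChar F (1 / 2) ϖ) ^ k * f.1 1 := by
    intro z b k' hk' hz hg
    have hz' : ord ϖ (z : F) = k := hϖ.ord_eq hz
    have e1 : f.1 g = f.1 (nUp b * diagGL (g.det / z) z * 1) := by
      conv_lhs => rw [hg]
      rw [hf k' hk', mul_one]
    rw [e1, f.2.2, hμ.coe_apply hϖ, hν.coe_apply hϖ, absChar_half_apply hϖ,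
      Units.val_div_eq_div_val (_ / z) z, Units.val_div_eq_div_val,
      hϖ.ord_div (div_ne_zero (Units.ne_zero _) z.ne_zero) z.ne_zero,
      hϖ.ord_div (Units.ne_zero _) z.ne_zero, hz', mul_zpow, div_zpow,
      zpow_sub₀ hρ (ord ϖ (g.det : F) - k) k]
    ring
  have hdet : (g.det : F) = g 0 0 * g 1 1 - g 0 1 * g 1 0 := by
    rw [GeneralLinearGroup.val_det_apply, det_fin_two]
  have hpos := zpow_pos h0 k
  -- An explicit Iwasawa decomposition: with bottom row (c, d), z is an entry of maximal norm, and
  -- k' is n⁻(c/d) or w n(d/c) accordingly.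
  by_cases h : ‖g 1 1‖ = ‖(ϖ : F)‖ ^ k
  · have hne : g 1 1 ≠ 0 := norm_pos_iff.1 (h ▸ hpos)
    refine key (Units.mk0 _ hne) (g 0 1 / g 1 1) (nLow (g 1 0 / g 1 1)) ⟨?_, ?_⟩ h ?_
    · have : ‖g 1 0‖ / ‖g 1 1‖ ≤ 1 := by
        rw [h]
        exact div_le_one_of_le₀ hc hpos.le
      intro i j
      fin_cases i <;> fin_cases j <;> simp [this]
    · simp [GeneralLinearGroup.val_det_apply]
    · ext i j
      fin_cases i <;> fin_cases j <;>
        simp [Matrix.mul_apply, Fin.sum_univ_two, hdet] <;> field_simp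
      ring
  · replace h := hcd.resolve_right h
    have hne : g 1 0 ≠ 0 := norm_pos_iff.1 (h ▸ hpos)
    refine key (Units.mk0 _ hne) (g 0 0 / g 1 0) (weyl F * nUp (g 1 1 / g 1 0)) ⟨?_, ?_⟩ h ?_
    · have : ‖g 1 1‖ / ‖g 1 0‖ ≤ 1 := by
        rw [h]
        exact div_le_one_of_le₀ hd hpos.le
      intro i j
      fin_cases i <;> fin_cases j <;> simp [this]
    · simp [GeneralLinearGroup.val_det_apply]
    · ext i j
      fin_cases i <;> fin_cases j <;>
        simp [Matrix.mul_apply, Fin.sum_univ_two, hdet] <;> field_simp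
      ring

end Principal


/-! ### Spherical Whittaker functions -/

/-- The complete homogeneous symmetric polynomials of two variables, in terms of the elementary
symmetric polynomials `s` and `e`. -/
def homSum (s e : ℂ) : ℕ → ℂ
  | 0 => 1
  | 1 => s
  | n + 2 => s * homSum s e (n + 1) - e * homSum s e n

/-- `homSum`, extended by zero to negative integers. -/
def sphData (s e : ℂ) (m : ℤ) : ℂ := if 0 ≤ m then homSum s e m.toNat else 0

section Spherical

variable {F : Type*} [NontriviallyNormedField F] [IsUltrametricDist F] {ϖ : Fˣ} {μ ν : Fˣ →* ℂˣ}

/-- The Hecke operator of `GL₂(𝔬) diag(ϖ, 1) GL₂(𝔬)` acts on the spherical vector by the scalar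
`q^{1/2} (μ(ϖ) + ν(ϖ))`. -/
theorem hecke_spherical (hϖ : IsUniformizer ϖ)
    (hnorm : ‖(ϖ : F)‖ = (residueCard F : ℝ)⁻¹) (hμ : IsUnramified μ) (hν : IsUnramified ν)
    (f : principalSeriesSpace μ ν) (hf : ∀ k ∈ maxCompact F, ∀ g, f.1 (g * k) = f.1 g)
    {T : Finset F} (hT1 : ∀ y ∈ T, ‖y‖ ≤ 1)
    (hT2 : ∀ x : F, ‖x‖ ≤ 1 → ∃! y, y ∈ T ∧ ‖x - y‖ ≤ ‖(ϖ : F)‖) (hT3 : T.card = residueCard F) :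
    ∑ x ∈ T, principalSeries μ ν (nUp x * diagGL ϖ 1) f + principalSeries μ ν (diagGL 1 ϖ) f =
      (((μ ϖ : ℂ) + ν ϖ) / absChar F (1 / 2) ϖ) • f := by
  classical
  have h0 := norm_unit_pos ϖ
  have h0' : (‖(ϖ : F)‖ : ℂ) ≠ 0 := by simp
  have hρ : (absChar F (1 / 2) ϖ : ℂ) ≠ 0 := Units.ne_zero _
  have hρ2 : (absChar F (1 / 2) ϖ : ℂ) ^ 2 = (‖(ϖ : F)‖ : ℂ) := absChar_half_sq
  have hq : (residueCard F : ℂ) * (absChar F (1 / 2) ϖ : ℂ) ^ 2 = 1 := by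
    rw [hρ2, hnorm]
    push_cast
    refine mul_inv_cancel₀ fun h => ?_
    rw [hnorm] at h0
    have : residueCard F = 0 := by exact_mod_cast h
    simp [this] at h0
  have hM : (μ ϖ : ℂ) * absChar F (1 / 2) ϖ ≠ 0 := mul_ne_zero (Units.ne_zero _) hρ
  have hN : (ν ϖ : ℂ) / absChar F (1 / 2) ϖ ≠ 0 := div_ne_zero (Units.ne_zero _) hρ
  ext g
  have hsum : (∑ x ∈ T, principalSeries μ ν (nUp x * diagGL ϖ 1) f +
      principalSeries μ ν (diagGL 1 ϖ) f).1 g =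
      ∑ x ∈ T, f.1 (g * (nUp x * diagGL ϖ 1)) + f.1 (g * diagGL 1 ϖ) := by
    simp [mul_assoc]
  rw [hsum]
  change _ = (((μ ϖ : ℂ) + ν ϖ) / absChar F (1 / 2) ϖ) * f.1 g
  have ev := spherical_eval hϖ hμ hν f hf
  have r10 : ∀ x, (g * (nUp x * diagGL ϖ 1)).1 1 0 = g 1 0 * ϖ := fun x => by
    simp [Matrix.mul_apply, Fin.sum_univ_two]
  have r11 : ∀ x, (g * (nUp x * diagGL ϖ 1)).1 1 1 = g 1 0 * x + g 1 1 := fun x => by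
    simp [Matrix.mul_apply, Fin.sum_univ_two]
  have s10 : (g * diagGL 1 ϖ).1 1 0 = g 1 0 := by
    simp [Matrix.mul_apply, Fin.sum_univ_two]
  have s11 : (g * diagGL 1 ϖ).1 1 1 = g 1 1 * ϖ := by
    simp [Matrix.mul_apply, Fin.sum_univ_two]
  have hord1 : ord ϖ (ϖ : F) = 1 := hϖ.ord_eq (by simp)
  have d1 : ∀ x, ord ϖ ((g * (nUp x * diagGL ϖ 1)).det : F) = ord ϖ (g.det : F) + 1 := fun x => by
    rw [map_mul, Units.val_mul, hϖ.ord_mul (Units.ne_zero _) (Units.ne_zero _)]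
    congr 1
    rw [← hord1]
    congr 1
    simp [GeneralLinearGroup.val_det_apply]
  have d2 : ord ϖ ((g * diagGL 1 ϖ).det : F) = ord ϖ (g.det : F) + 1 := by
    rw [map_mul, Units.val_mul, hϖ.ord_mul (Units.ne_zero _) (Units.ne_zero _)]
    congr 1
    rw [← hord1]
    congr 1
    simp [GeneralLinearGroup.val_det_apply]
  have hdet : (g.det : F) = g 0 0 * g 1 1 - g 0 1 * g 1 0 := by
    rw [GeneralLinearGroup.val_det_apply, det_fin_two]
  have hz1 : ∀ k : ℤ, ‖(ϖ : F)‖ ^ (k + 1) = ‖(ϖ : F)‖ ^ k * ‖(ϖ : F)‖ :=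
    fun k => zpow_add_one₀ h0.ne' k
  have hlt : ∀ k : ℤ, ‖(ϖ : F)‖ ^ (k + 1) ≤ ‖(ϖ : F)‖ ^ k := fun k =>
    hϖ.zpow_le_zpow_iff.2 (by lia)
  -- For each g, exactly one of the q + 1 cosets raises the order of the bottom row (c, d) from k to
  -- k + 1. It is the coset of the representative of -d/c if |d| ≤ |c|, and the coset of diag(1, ϖ)
  -- otherwise.
  by_cases hcd : ‖g 1 1‖ ≤ ‖g 1 0‖
  · have hc0 : g 1 0 ≠ 0 := by
      intro h
      have h1 : g 1 1 = 0 := by simpa [h] using hcd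
      exact g.det.ne_zero (by rw [hdet, h, h1]; ring)
    set k := ord ϖ (g 1 0) with hk
    have hc : ‖g 1 0‖ = ‖(ϖ : F)‖ ^ k := hϖ.norm_eq hc0
    obtain ⟨x₀, ⟨hx₀, hxx⟩, hu⟩ := hT2 (-(g 1 1 / g 1 0)) (by
      rw [norm_neg, norm_div]; exact div_le_one_of_le₀ hcd (norm_nonneg _))
    have hfac : ∀ x, g 1 0 * x + g 1 1 = -(g 1 0 * (-(g 1 1 / g 1 0) - x)) := fun x => by
      field_simp
      ring
    have hval : ∀ x ∈ T, f.1 (g * (nUp x * diagGL ϖ 1)) = if x = x₀ then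
        ((μ ϖ : ℂ) * absChar F (1 / 2) ϖ) ^ (ord ϖ (g.det : F) - k) *
          ((ν ϖ : ℂ) / absChar F (1 / 2) ϖ) ^ (k + 1) * f.1 1 else
        ((μ ϖ : ℂ) * absChar F (1 / 2) ϖ) ^ (ord ϖ (g.det : F) - k + 1) *
          ((ν ϖ : ℂ) / absChar F (1 / 2) ϖ) ^ k * f.1 1 := by
      intro x hx
      split_ifs with h
      · rw [ev _ (k + 1) (by rw [r10, norm_mul, hc, hz1]) (by
          rw [r11, hfac, norm_neg, norm_mul, hc, hz1, h]; gcongr)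
          (Or.inl (by rw [r10, norm_mul, hc, hz1])), d1]
        congr 3
        ring
      · have h1 : ‖-(g 1 1 / g 1 0) - x‖ = 1 := by
          refine le_antisymm (ultra_sub_le ?_ (hT1 x hx)) (not_lt.1 fun h2 => h ?_)
          · rw [norm_neg, norm_div]; exact div_le_one_of_le₀ hcd (norm_nonneg _)
          · exact hu x ⟨hx, (hϖ _).1 h2⟩
        have h2 : ‖g 1 0 * x + g 1 1‖ = ‖(ϖ : F)‖ ^ k := by
          rw [hfac, norm_neg, norm_mul, h1, hc, mul_one]
        rw [ev _ k (by rw [r10, norm_mul, hc, ← hz1]; exact hlt k) (by rw [r11, h2])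
          (Or.inr (by rw [r11, h2])), d1]
        congr 3
        ring
    rw [← Finset.add_sum_erase _ _ hx₀, hval x₀ hx₀, if_pos rfl,
      Finset.sum_congr rfl fun x hx => (hval x (Finset.mem_of_mem_erase hx)).trans
        (if_neg (Finset.ne_of_mem_erase hx)),
      Finset.sum_const, Finset.card_erase_of_mem hx₀, hT3,
      ev (g * diagGL 1 ϖ) k (by rw [s10, hc]) (by
        rw [s11, norm_mul]
        exact (mul_le_of_le_one_right (norm_nonneg _) hϖ.norm_lt_one.le).trans (hcd.trans hc.le))
        (Or.inl (by rw [s10, hc])), d2,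
      ev g k hc.le (hcd.trans hc.le) (Or.inl hc)]
    have hcard : 1 ≤ residueCard F := by
      rw [← hT3]; exact Finset.card_pos.2 ⟨x₀, hx₀⟩
    rw [nsmul_eq_mul, Nat.cast_sub hcard, Nat.cast_one,
      show ord ϖ (g.det : F) + 1 - k = ord ϖ (g.det : F) - k + 1 by ring,
      zpow_add_one₀ hM, zpow_add_one₀ hN]
    field_simp
    linear_combination ((μ ϖ : ℂ)) * f.1 1 * hq
  · rw [not_le] at hcd
    have hd0 : g 1 1 ≠ 0 := norm_pos_iff.1 ((norm_nonneg _).trans_lt hcd)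
    set k := ord ϖ (g 1 1) with hk
    have hd : ‖g 1 1‖ = ‖(ϖ : F)‖ ^ k := hϖ.norm_eq hd0
    have hc' : ‖g 1 0‖ ≤ ‖(ϖ : F)‖ ^ (k + 1) := by
      by_cases hc0 : g 1 0 = 0
      · rw [hc0, norm_zero]; exact zpow_nonneg h0.le _
      · have h1 : ‖g 1 0 / g 1 1‖ < 1 := by
          rw [norm_div]; exact (div_lt_one ((norm_nonneg _).trans_lt hcd)).2 hcd
        rw [hϖ, norm_div, div_le_iff₀ ((norm_nonneg _).trans_lt hcd), hd] at h1
        rw [hz1, mul_comm]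
        exact h1
    have hval : ∀ x ∈ T, f.1 (g * (nUp x * diagGL ϖ 1)) =
        ((μ ϖ : ℂ) * absChar F (1 / 2) ϖ) ^ (ord ϖ (g.det : F) - k + 1) *
          ((ν ϖ : ℂ) / absChar F (1 / 2) ϖ) ^ k * f.1 1 := by
      intro x hx
      have h1 : ‖g 1 0 * x‖ < ‖g 1 1‖ := by
        rw [norm_mul]
        exact (mul_le_of_le_one_right (norm_nonneg _) (hT1 x hx)).trans_lt hcd
      have h2 : ‖g 1 0 * x + g 1 1‖ = ‖(ϖ : F)‖ ^ k := by
        rw [IsUltrametricDist.norm_add_eq_max_of_norm_ne_norm h1.ne, max_eq_right h1.le, hd]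
      rw [ev _ k (by
        rw [r10, norm_mul]
        exact (mul_le_of_le_one_right (norm_nonneg _) hϖ.norm_lt_one.le).trans
          (hcd.le.trans hd.le)) (by rw [r11, h2]) (Or.inr (by rw [r11, h2])), d1]
      congr 3
      ring
    rw [Finset.sum_congr rfl hval, Finset.sum_const, hT3,
      ev (g * diagGL 1 ϖ) (k + 1) (by rw [s10]; exact hc') (by rw [s11, norm_mul, hd, hz1])
        (Or.inr (by rw [s11, norm_mul, hd, hz1])), d2,
      ev g k (hcd.le.trans hd.le) hd.le (Or.inr hd), nsmul_eq_mul,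
      show ord ϖ (g.det : F) + 1 - (k + 1) = ord ϖ (g.det : F) - k by ring,
      zpow_add_one₀ hM, zpow_add_one₀ hN]
    field_simp
    linear_combination ((μ ϖ : ℂ)) * f.1 1 * hq

/-- Shintani's formula for the spherical Whittaker function. -/
theorem spherical_isLocalData [LocallyCompactSpace F] (hϖ : IsUniformizer ϖ)
    (hnorm : ‖(ϖ : F)‖ = (residueCard F : ℝ)⁻¹) {ψ : AddChar F Circle}
    (hψ : ∀ x : F, ‖x‖ ≤ 1 → ψ x = 1) (hψ' : ∃ x : F, ‖x‖ ≤ ‖(ϖ : F)‖⁻¹ ∧ ψ x ≠ 1)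
    (hμ : IsUnramified μ) (hν : IsUnramified ν) (hirr : (principalSeries μ ν).IsIrreducible)
    {W : GL (Fin 2) F → ℂ} (hW : W ∈ whittakerModel ψ (principalSeries μ ν))
    (hK : ∀ g, ∀ k ∈ maxCompact F, W (g * k) = W g) (h1 : ∀ k ∈ maxCompact F, W k = 1) :
    let A := sphData ((absChar F (1 / 2) ϖ : ℂ) * ((μ ϖ : ℂ) + ν ϖ))
      ((‖(ϖ : F)‖ : ℂ) * ((μ ϖ : ℂ) * ν ϖ))
    IsLocalData ϖ ψ W A A ((μ ϖ : ℂ) * ν ϖ) := by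
  intro A
  have h0' : (‖(ϖ : F)‖ : ℂ) ≠ 0 := by simp
  obtain ⟨ℓ, hℓ, f, hf⟩ := hW
  have hone : (1 : GL (Fin 2) F) ∈ maxCompact F := by
    refine ⟨fun i j => ?_, by simp⟩
    fin_cases i <;> fin_cases j <;> simp
  have hWn : ∀ x g, W (nUp x * g) = (ψ x : ℂ) * W g := fun x g => by
    rw [hf, map_mul, Module.End.mul_apply, hℓ, ← hf]
  have hWz : ∀ (z : Fˣ) g, W (g * diagGL z z) = ((μ ϖ : ℂ) * ν ϖ) ^ ord ϖ (z : F) * W g := by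
    intro z g
    rw [hf, map_mul, Module.End.mul_apply, principalSeries_central, map_smul, map_smul, ← hf,
      hμ.coe_apply hϖ, hν.coe_apply hϖ, ← mul_zpow, smul_eq_mul]
  -- the vector is fixed by the maximal compact subgroup
  have hfix : ∀ k ∈ maxCompact F, ∀ g, f.1 (g * k) = f.1 g := by
    intro k hk
    -- The vectors with zero Whittaker function form a subrepresentation. It does not contain f
    -- because W(1) = 1, so it is zero by irreducibility; hence the invariance of W passes to f.
    let S : Subrepresentation (principalSeries μ ν) :=
      { toSubmodule :=
          { carrier := {v | ∀ g, ℓ (principalSeries μ ν g v) = 0}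
            zero_mem' := by simp
            add_mem' := fun hv hw g => by rw [map_add, map_add, hv, hw, add_zero]
            smul_mem' := fun c v hv g => by rw [map_smul, map_smul, hv, smul_zero] }
        apply_mem_toSubmodule := fun h v hv g => by
          have := hv (g * h)
          rwa [map_mul, Module.End.mul_apply] at this }
    have hmem : principalSeries μ ν k f - f ∈ S.toSubmodule := fun g => by
      rw [map_sub, map_sub, ← Module.End.mul_apply, ← map_mul, ← hf, ← hf, hK g k hk, sub_self]
    have hbot : S = ⊥ := by
      refine (hirr.eq_bot_or_eq_top S).resolve_right fun h => ?_
      have hfS : f ∈ S.toSubmodule := by rw [h]; trivial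
      have h2 := hfS 1
      rw [← hf, h1 1 hone] at h2
      exact one_ne_zero h2
    have h3 : principalSeries μ ν k f - f = 0 := by
      rw [hbot] at hmem
      exact hmem
    intro g
    have h4 := congrArg (fun v => v.1 g) (sub_eq_zero.1 h3)
    exact h4
  obtain ⟨T, hT1, hT2, hT3⟩ := exists_residue_reps hϖ
  have hH := hecke_spherical hϖ hnorm hμ hν f hfix hT1 hT2 hT3
  have hHW : ∀ g, ∑ x ∈ T, W (g * (nUp x * diagGL ϖ 1)) + W (g * diagGL 1 ϖ) =
      (((μ ϖ : ℂ) + ν ϖ) / absChar F (1 / 2) ϖ) * W g := by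
    intro g
    have := congrArg (fun v => ℓ (principalSeries μ ν g v)) hH
    simp only [map_add, map_sum, map_smul, smul_eq_mul] at this
    simp only [hf, map_mul, Module.End.mul_apply] at this ⊢
    exact this
  have hWord : ∀ a : Fˣ, W (diagGL a 1) = W (diagGL (ϖ ^ ord ϖ (a : F)) 1) := by
    intro a
    have hu : ‖((a / ϖ ^ ord ϖ (a : F) : Fˣ) : F)‖ = 1 := by
      rw [Units.val_div_eq_div_val, Units.val_zpow_eq_zpow_val, norm_div, norm_zpow,
        ← hϖ.norm_eq a.ne_zero, div_self (norm_unit_pos a).ne']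
    have hk : diagGL (a / ϖ ^ ord ϖ (a : F)) 1 ∈ maxCompact F := by
      refine ⟨fun i j => ?_, ?_⟩
      · fin_cases i <;> fin_cases j <;> simp only [coe_diagGL] <;> first | exact hu.le | simp
      · rw [GeneralLinearGroup.val_det_apply, coe_diagGL, det_fin_two]
        simpa using hu
    rw [← hK (diagGL (ϖ ^ ord ϖ (a : F)) 1) _ hk, diagGL_mul]
    simp
  -- The Hecke eigenvalue equation at diag(ϖ^m, 1): for m ≥ 0 the q upper triangular cosets all give
  -- the same value, since ψ is trivial at ϖ^m x for integral x.
  have hstep : ∀ m : ℤ, 0 ≤ m → W (diagGL (ϖ ^ (m + 1)) 1) =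
      ((absChar F (1 / 2) ϖ : ℂ) * ((μ ϖ : ℂ) + ν ϖ)) * W (diagGL (ϖ ^ m) 1) -
        ((‖(ϖ : F)‖ : ℂ) * ((μ ϖ : ℂ) * ν ϖ)) * W (diagGL (ϖ ^ (m - 1)) 1) := by
    intro m hm
    have h2 := hHW (diagGL (ϖ ^ m) 1)
    have h3 : ∀ x ∈ T, W (diagGL (ϖ ^ m) 1 * (nUp x * diagGL ϖ 1)) =
        W (diagGL (ϖ ^ (m + 1)) 1) := by
      intro x hx
      rw [← mul_assoc, diagGL_mul_nUp, mul_assoc, diagGL_mul, hWn, hψ, _root_.zpow_add_one, mul_one]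
      · simp
      · simp only [Units.val_zpow_eq_zpow_val, Units.val_one, div_one, norm_mul, norm_zpow]
        refine mul_le_one₀ ?_ (norm_nonneg _) (hT1 x hx)
        rw [← zpow_zero ‖(ϖ : F)‖]
        exact hϖ.zpow_le_zpow_iff.2 hm
    have h4 : diagGL (ϖ ^ m) 1 * diagGL 1 ϖ = diagGL (ϖ ^ (m - 1)) 1 * diagGL ϖ ϖ := by
      rw [diagGL_mul, diagGL_mul, mul_one, _root_.zpow_sub_one, inv_mul_cancel_right]
    have hord1 : ord ϖ (ϖ : F) = 1 := hϖ.ord_eq (by simp)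
    rw [Finset.sum_congr rfl h3, Finset.sum_const, hT3, h4, hWz, hord1, zpow_one,
      nsmul_eq_mul] at h2
    have hq : (residueCard F : ℂ) = (‖(ϖ : F)‖ : ℂ)⁻¹ := by rw [hnorm]; simp
    have hρ : (absChar F (1 / 2) ϖ : ℂ) ≠ 0 := Units.ne_zero _
    have hρ2 : (absChar F (1 / 2) ϖ : ℂ) ^ 2 = (‖(ϖ : F)‖ : ℂ) := absChar_half_sq
    rw [hq] at h2
    field_simp at h2
    have h5 : (absChar F (1 / 2) ϖ : ℂ) * W (diagGL (ϖ ^ (m + 1)) 1) =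
        (absChar F (1 / 2) ϖ : ℂ) *
        (((absChar F (1 / 2) ϖ : ℂ) * ((μ ϖ : ℂ) + ν ϖ)) * W (diagGL (ϖ ^ m) 1) -
        ((‖(ϖ : F)‖ : ℂ) * ((μ ϖ : ℂ) * ν ϖ)) * W (diagGL (ϖ ^ (m - 1)) 1)) := by
      linear_combination h2 - ((μ ϖ : ℂ) + ν ϖ) * W (diagGL (ϖ ^ m) 1) * hρ2
    exact mul_left_cancel₀ hρ h5
  -- Right translation by the integral element n(ϖ^(-m) y) fixes W, but moved to the left it
  -- multiplies W by ψ(y) ≠ 1.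
  have hneg : ∀ m : ℤ, m < 0 → W (diagGL (ϖ ^ m) 1) = 0 := by
    intro m hm
    obtain ⟨y, hy, hy1⟩ := hψ'
    have hle : ‖((ϖ : F) ^ m)⁻¹ * y‖ ≤ 1 := by
      rw [norm_mul, norm_inv, norm_zpow, inv_mul_le_one₀ (zpow_pos (norm_unit_pos ϖ) m)]
      refine hy.trans ?_
      rw [← _root_.zpow_neg_one]
      exact hϖ.zpow_le_zpow_iff.2 (by lia)
    have hk : nUp (((ϖ : F) ^ m)⁻¹ * y) ∈ maxCompact F := by
      refine ⟨fun i j => ?_, ?_⟩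
      · fin_cases i <;> fin_cases j <;> simp only [coe_nUp] <;> first | exact hle | simp
      · simp [GeneralLinearGroup.val_det_apply, det_fin_two]
    have h2 := hK (diagGL (ϖ ^ m) 1) _ hk
    have h3 : ((ϖ ^ m : Fˣ) : F) * (((ϖ : F) ^ m)⁻¹ * y) / ((1 : Fˣ) : F) = y := by
      rw [Units.val_zpow_eq_zpow_val, mul_inv_cancel_left₀ (zpow_ne_zero _ ϖ.ne_zero)]
      simp
    rw [diagGL_mul_nUp, h3, hWn] at h2
    have h4 : ((ψ y : ℂ) - 1) * W (diagGL (ϖ ^ m) 1) = 0 := by rw [sub_mul, one_mul, h2, sub_self]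
    refine (mul_eq_zero.1 h4).resolve_left fun h5 => hy1 ?_
    rw [sub_eq_zero] at h5
    ext
    simpa using h5
  have hW0 : W (diagGL (ϖ ^ (0 : ℤ)) 1) = 1 := by
    rw [zpow_zero]
    have : diagGL (1 : Fˣ) 1 = 1 := by
      ext i j
      fin_cases i <;> fin_cases j <;> simp
    rw [this, h1 1 hone]
  have hnat : ∀ n : ℕ, W (diagGL (ϖ ^ (n : ℤ)) 1) =
      homSum ((absChar F (1 / 2) ϖ : ℂ) * ((μ ϖ : ℂ) + ν ϖ))
        ((‖(ϖ : F)‖ : ℂ) * ((μ ϖ : ℂ) * ν ϖ)) n ∧ W (diagGL (ϖ ^ ((n : ℤ) + 1)) 1) =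
      homSum ((absChar F (1 / 2) ϖ : ℂ) * ((μ ϖ : ℂ) + ν ϖ))
        ((‖(ϖ : F)‖ : ℂ) * ((μ ϖ : ℂ) * ν ϖ)) (n + 1) := by
    intro n
    induction n with
    | zero =>
      refine ⟨hW0, ?_⟩
      rw [Nat.cast_zero, hstep 0 le_rfl, hW0, hneg _ (by lia)]
      simp [homSum]
    | succ n ih =>
      refine ⟨by exact_mod_cast ih.2, ?_⟩
      rw [hstep _ (by lia), show ((n + 1 : ℕ) : ℤ) - 1 = n by push_cast; ring, ih.1,
        show ((n + 1 : ℕ) : ℤ) = (n : ℤ) + 1 by push_cast; ring, ih.2]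
      rfl
  have hA : ∀ a : Fˣ, W (diagGL a 1) = A (ord ϖ (a : F)) := by
    intro a
    rw [hWord]
    simp only [A, sphData]
    split_ifs with h
    · obtain ⟨n, hn⟩ := Int.eq_ofNat_of_zero_le h
      rw [hn, (hnat n).1, Int.toNat_natCast]
    · exact hneg _ (by lia)
  refine IsLocalData.of_iwahori hϖ hWn hWz (fun u g hu => hK _ _ ?_) (fun x g hx => hK _ _ ?_) hA
    fun a => ?_
  · refine ⟨fun i j => ?_, ?_⟩
    · fin_cases i <;> fin_cases j <;> simp only [coe_nLow] <;> first | exact hu.le | simp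
    · simp [GeneralLinearGroup.val_det_apply, det_fin_two]
  · refine ⟨fun i j => ?_, ?_⟩
    · fin_cases i <;> fin_cases j <;> simp only [coe_nUp] <;> first | exact hx | simp
    · simp [GeneralLinearGroup.val_det_apply, det_fin_two]
  · rw [hK, hA]
    refine ⟨fun i j => ?_, ?_⟩
    · fin_cases i <;> fin_cases j <;> simp
    · simp [GeneralLinearGroup.val_det_apply, det_fin_two]

end Spherical


/-! ### The Whittaker function of the Steinberg representation -/

/-- The function `x^m` on nonnegative integers, extended by zero. -/
def steinLow (x : ℂ) (m : ℤ) : ℂ := if 0 ≤ m then x ^ m else 0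

/-- The function `-r x^m` on integers `m ≥ -1`, extended by zero. -/
def steinBig (r x : ℂ) (m : ℤ) : ℂ := if -1 ≤ m then -r * x ^ m else 0

section Steinberg

variable {F : Type*} [NontriviallyNormedField F] {ϖ : Fˣ} {σ : Fˣ →* ℂˣ}

/-- The principal series which has `St ⊗ σ` as a quotient. -/
abbrev steinbergSpace (σ : Fˣ →* ℂˣ) : Submodule ℂ (GL (Fin 2) F → ℂ) :=
  principalSeriesSpace (σ * absChar F (-1 / 2)) (σ * absChar F (1 / 2))

/-- The half-integral powers of |·| cancel the normalizing factor, so the Borel subgroup acts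
through σ ∘ det. This simple transformation law is the one used for St ⊗ σ throughout. -/
theorem steinberg_factor (σ : Fˣ →* ℂˣ) (a d : Fˣ) :
    (((σ * absChar F (-1 / 2)) a : ℂˣ) : ℂ) * ((σ * absChar F (1 / 2)) d : ℂˣ) *
      (absChar F (1 / 2) (a / d) : ℂ) = (σ (a * d) : ℂ) := by
  have h : ∀ a : Fˣ, (absChar F (-1 / 2) a : ℂ) * (absChar F (1 / 2) a : ℂ) = 1 := fun a => by
    change (‖(a : F)‖ : ℂ) ^ (-1 / 2 : ℂ) * (‖(a : F)‖ : ℂ) ^ (1 / 2 : ℂ) = 1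
    rw [← Complex.cpow_add _ _ (by simp)]
    norm_num
  have hd : (absChar F (1 / 2) d : ℂ) ≠ 0 := Units.ne_zero _
  simp only [MonoidHom.mul_apply, Units.val_mul, map_div, map_mul, Units.val_div_eq_div_val]
  have ha := h a
  generalize (absChar F (-1 / 2) a : ℂ) = X at ha ⊢
  field_simp
  linear_combination ha

theorem steinbergSpace_apply (f : steinbergSpace (F := F) σ) (a d : Fˣ) (b : F)
    (g : GL (Fin 2) F) : f.1 (nUp b * diagGL a d * g) = (σ (a * d) : ℂ) * f.1 g := by
  rw [f.2.2, steinberg_factor]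

/-- Smoothness only needs a neighbourhood of 1: the stabiliser of f is a subgroup containing it,
hence open. -/
theorem mem_steinbergSpace {f : GL (Fin 2) F → ℂ}
    (h1 : ∀ (a d : Fˣ) (b : F) (g : GL (Fin 2) F),
      f (nUp b * diagGL a d * g) = (σ (a * d) : ℂ) * f g)
    {s : Set (GL (Fin 2) F)} (hs : s ∈ nhds 1) (h2 : ∀ u ∈ s, ∀ g, f (g * u) = f g) :
    f ∈ steinbergSpace (F := F) σ := by
  refine ⟨?_, fun a d b g => by rw [steinberg_factor, h1]⟩
  let U : Subgroup (GL (Fin 2) F) :=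
    { carrier := {u | ∀ g, f (g * u) = f g}
      one_mem' := by simp
      mul_mem' := fun {u v} hu hv g => by rw [← mul_assoc, hv, hu]
      inv_mem' := fun {u} hu g => by rw [← hu, inv_mul_cancel_right] }
  exact ⟨U, U.isOpen_of_mem_nhds (g := 1) (Filter.mem_of_superset hs h2), fun u hu => hu⟩

theorem eq_of_entry_ne_zero (g : GL (Fin 2) F) (h : g 1 0 ≠ 0) :
    g = nUp (g 0 0 / g 1 0) * diagGL (g.det / Units.mk0 _ h) (Units.mk0 _ h) *
      (weyl F * nUp (g 1 1 / g 1 0)) := by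
  have hdet : (g.det : F) = g 0 0 * g 1 1 - g 0 1 * g 1 0 := by
    rw [GeneralLinearGroup.val_det_apply, det_fin_two]
  ext i j
  fin_cases i <;> fin_cases j <;> simp [Matrix.mul_apply, Fin.sum_univ_two, hdet] <;> field_simp
  ring

theorem eq_of_entry_eq_zero (g : GL (Fin 2) F) (h : g 1 0 = 0) (h1 : g 1 1 ≠ 0) :
    g = nUp (g 0 1 / g 1 1) * diagGL (g.det / Units.mk0 _ h1) (Units.mk0 _ h1) * 1 := by
  have hdet : (g.det : F) = g 0 0 * g 1 1 - g 0 1 * g 1 0 := by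
    rw [GeneralLinearGroup.val_det_apply, det_fin_two]
  ext i j
  fin_cases i <;> fin_cases j <;> simp [Matrix.mul_apply, Fin.sum_univ_two, hdet, h] <;> field_simp

theorem entry_ne_zero (g : GL (Fin 2) F) (h : g 1 0 = 0) : g 1 1 ≠ 0 := by
  intro h1
  have hdet : (g.det : F) = g 0 0 * g 1 1 - g 0 1 * g 1 0 := by
    rw [GeneralLinearGroup.val_det_apply, det_fin_two]
  exact g.det.ne_zero (by rw [hdet, h, h1]; ring)

theorem steinbergSpace_eval (f : steinbergSpace (F := F) σ) (g : GL (Fin 2) F) (h : g 1 0 ≠ 0) :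
    f.1 g = (σ g.det : ℂ) * f.1 (weyl F * nUp (g 1 1 / g 1 0)) := by
  conv_lhs => rw [eq_of_entry_ne_zero g h]
  rw [steinbergSpace_apply, div_mul_cancel]

theorem steinbergSpace_eval_zero (f : steinbergSpace (F := F) σ) (g : GL (Fin 2) F)
    (h : g 1 0 = 0) : f.1 g = (σ g.det : ℂ) * f.1 1 := by
  conv_lhs => rw [eq_of_entry_eq_zero g h (entry_ne_zero g h)]
  rw [steinbergSpace_apply, div_mul_cancel]

/-- The conditions defining the Iwahori subgroup. -/
def iwahori (F : Type*) [NontriviallyNormedField F] : Set (GL (Fin 2) F) :=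
  {u | ‖u 0 0‖ = 1 ∧ ‖u 1 1‖ = 1 ∧ ‖u 1 0‖ < 1 ∧ ‖u 0 1‖ ≤ 1}

theorem nUp_mem_iwahori {x : F} (hx : ‖x‖ ≤ 1) : nUp x ∈ iwahori F := by
  refine ⟨?_, ?_, ?_, ?_⟩ <;> simp [hx]

theorem nLow_mem_iwahori {x : F} (hx : ‖x‖ < 1) : nLow x ∈ iwahori F := by
  refine ⟨?_, ?_, ?_, ?_⟩ <;> simp [hx]

theorem diagGL_mem_iwahori {a d : Fˣ} (ha : ‖(a : F)‖ = 1) (hd : ‖(d : F)‖ = 1) :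
    diagGL a d ∈ iwahori F := by
  refine ⟨?_, ?_, ?_, ?_⟩ <;> simp [ha, hd]

variable [IsUltrametricDist F]

theorem norm_det_iwahori {u : GL (Fin 2) F} (hu : u ∈ iwahori F) : ‖(u.det : F)‖ = 1 := by
  obtain ⟨h00, h11, h10, h01⟩ := hu
  have hdet : (u.det : F) = u 0 0 * u 1 1 + -(u 0 1 * u 1 0) := by
    rw [GeneralLinearGroup.val_det_apply, det_fin_two, sub_eq_add_neg]
  have h1 : ‖u 0 0 * u 1 1‖ = 1 := by rw [norm_mul, h00, h11, mul_one]
  have h2 : ‖-(u 0 1 * u 1 0)‖ < 1 := by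
    rw [norm_neg, norm_mul]
    exact mul_lt_one_of_nonneg_of_lt_one_right h01 (norm_nonneg _) h10
  rw [hdet, IsUltrametricDist.norm_add_eq_max_of_norm_ne_norm (by rw [h1]; exact h2.ne'), h1,
    max_eq_left h2.le]

theorem iwahori_mem_nhds : iwahori F ∈ nhds 1 := by
  have hc : ∀ i j, Continuous fun u : GL (Fin 2) F => u i j := fun i j =>
    (Units.continuous_val (M := Matrix (Fin 2) (Fin 2) F)).matrix_elem i j
  have key : ∀ x : F, ‖x - 1‖ < 1 → ‖x‖ = 1 := fun x hx => by
    have h := IsUltrametricDist.norm_add_eq_max_of_norm_ne_norm (x := x - 1) (y := 1)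
      (by rw [norm_one]; exact hx.ne)
    rwa [sub_add_cancel, norm_one, max_eq_right hx.le] at h
  have h1 : ∀ᶠ u : GL (Fin 2) F in nhds 1, ‖u 0 0 - 1‖ < 1 :=
    ((hc 0 0).sub continuous_const).norm.continuousAt.eventually_lt continuousAt_const (by simp)
  have h2 : ∀ᶠ u : GL (Fin 2) F in nhds 1, ‖u 1 1 - 1‖ < 1 :=
    ((hc 1 1).sub continuous_const).norm.continuousAt.eventually_lt continuousAt_const (by simp)
  have h3 : ∀ᶠ u : GL (Fin 2) F in nhds 1, ‖u 1 0‖ < 1 :=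
    (hc 1 0).norm.continuousAt.eventually_lt continuousAt_const (by simp)
  have h4 : ∀ᶠ u : GL (Fin 2) F in nhds 1, ‖u 0 1‖ < 1 :=
    (hc 0 1).norm.continuousAt.eventually_lt continuousAt_const (by simp)
  filter_upwards [h1, h2, h3, h4] with u h1 h2 h3 h4
  exact ⟨key _ h1, key _ h2, h3, h4.le⟩

/-- Right translation by the Iwahori subgroup does not change whether `|d| ≤ |c|`. -/
theorem iwahori_row {u : GL (Fin 2) F} (hu : u ∈ iwahori F) (g : GL (Fin 2) F) :
    ‖(g * u).1 1 1‖ ≤ ‖(g * u).1 1 0‖ ↔ ‖g 1 1‖ ≤ ‖g 1 0‖ := by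
  obtain ⟨h00, h11, h10, h01⟩ := hu
  have e1 : (g * u).1 1 1 = g 1 0 * u 0 1 + g 1 1 * u 1 1 := by
    simp [Matrix.mul_apply, Fin.sum_univ_two]
  have e0 : (g * u).1 1 0 = g 1 0 * u 0 0 + g 1 1 * u 1 0 := by
    simp [Matrix.mul_apply, Fin.sum_univ_two]
  have n01 : ‖g 1 0 * u 0 1‖ ≤ ‖g 1 0‖ := by
    rw [norm_mul]; exact mul_le_of_le_one_right (norm_nonneg _) h01
  have n11 : ‖g 1 1 * u 1 1‖ = ‖g 1 1‖ := by rw [norm_mul, h11, mul_one]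
  have n00 : ‖g 1 0 * u 0 0‖ = ‖g 1 0‖ := by rw [norm_mul, h00, mul_one]
  have n10 : ‖g 1 1 * u 1 0‖ ≤ ‖g 1 1‖ := by
    rw [norm_mul]; exact mul_le_of_le_one_right (norm_nonneg _) h10.le
  rw [e1, e0]
  by_cases h : ‖g 1 1‖ ≤ ‖g 1 0‖
  · have hpos : 0 < ‖g 1 0‖ := by
      by_contra h'
      have h0 : g 1 0 = 0 := by simpa using h'
      exact entry_ne_zero g h0 (by simpa [h0] using h)
    have hlt : ‖g 1 1 * u 1 0‖ < ‖g 1 0‖ := by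
      rw [norm_mul]
      calc ‖g 1 1‖ * ‖u 1 0‖ ≤ ‖g 1 0‖ * ‖u 1 0‖ := by gcongr
        _ < ‖g 1 0‖ := mul_lt_of_lt_one_right hpos h10
    have h2 : ‖g 1 0 * u 0 0 + g 1 1 * u 1 0‖ = ‖g 1 0‖ := by
      rw [IsUltrametricDist.norm_add_eq_max_of_norm_ne_norm (by rw [n00]; exact hlt.ne'), n00,
        max_eq_left hlt.le]
    rw [h2]
    exact ⟨fun _ => h, fun _ => ultra_add_le n01 (n11.le.trans h)⟩
  · rw [not_le] at h
    have hlt : ‖g 1 0 * u 0 1‖ < ‖g 1 1 * u 1 1‖ := by rw [n11]; exact n01.trans_lt h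
    have hlt2 : ‖g 1 1 * u 1 0‖ < ‖g 1 1‖ := by
      rw [norm_mul]
      exact mul_lt_of_lt_one_right ((norm_nonneg _).trans_lt h) h10
    have h2 : ‖g 1 0 * u 0 1 + g 1 1 * u 1 1‖ = ‖g 1 1‖ := by
      rw [IsUltrametricDist.norm_add_eq_max_of_norm_ne_norm hlt.ne, max_eq_right hlt.le, n11]
    rw [h2]
    exact ⟨fun h3 => absurd (h3.trans_lt (ultra_add_lt (n00.trans_lt h) hlt2)) (lt_irrefl _),
      fun h3 => absurd h (not_lt.2 h3)⟩

open Classical in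
/-- The Iwahori-fixed function supported on the big cell. -/
def iwahoriVector (hσ : IsUnramified σ) : steinbergSpace (F := F) σ :=
  ⟨fun g => if ‖g 1 1‖ ≤ ‖g 1 0‖ then (σ g.det : ℂ) else 0, by
    refine mem_steinbergSpace ?_ (s := iwahori F) iwahori_mem_nhds fun u hu g => ?_
    · intro a d b g
      have e1 : (nUp b * diagGL a d * g).1 1 1 = d * g 1 1 := by
        simp [Matrix.mul_apply, Fin.sum_univ_two]
      have e0 : (nUp b * diagGL a d * g).1 1 0 = d * g 1 0 := by
        simp [Matrix.mul_apply, Fin.sum_univ_two]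
      have ed : (nUp b * diagGL a d * g).det = a * d * g.det := by
        rw [map_mul, map_mul]
        congr 1
        ext
        simp [GeneralLinearGroup.val_det_apply, det_fin_two]
      have hiff : ‖(nUp b * diagGL a d * g).1 1 1‖ ≤ ‖(nUp b * diagGL a d * g).1 1 0‖ ↔
          ‖g 1 1‖ ≤ ‖g 1 0‖ := by
        rw [e1, e0, norm_mul, norm_mul, mul_le_mul_iff_right₀ (norm_unit_pos d)]
      by_cases h : ‖g 1 1‖ ≤ ‖g 1 0‖
      · rw [if_pos (hiff.2 h), if_pos h, ed, map_mul, Units.val_mul]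
      · rw [if_neg (mt hiff.1 h), if_neg h, mul_zero]
    · refine if_congr (iwahori_row hu g) ?_ rfl
      rw [map_mul, map_mul, hσ _ (norm_det_iwahori hu), mul_one]⟩

/-- The vector `σ ∘ det`. -/
def detVector (hσ : IsUnramified σ) : steinbergSpace (F := F) σ :=
  ⟨fun g => (σ g.det : ℂ), by
    refine mem_steinbergSpace ?_ (s := iwahori F) iwahori_mem_nhds fun u hu g => ?_
    · intro a d b g
      rw [map_mul, map_mul, map_mul, Units.val_mul]
      congr 3
      ext
      simp [GeneralLinearGroup.val_det_apply, det_fin_two]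
    · rw [map_mul, map_mul, hσ _ (norm_det_iwahori hu), mul_one]⟩

open Classical in
theorem iwahoriVector_apply (hσ : IsUnramified σ) (g : GL (Fin 2) F) :
    (iwahoriVector hσ).1 g = if ‖g 1 1‖ ≤ ‖g 1 0‖ then (σ g.det : ℂ) else 0 := rfl

theorem iwahoriVector_fixed (hσ : IsUnramified σ) {u : GL (Fin 2) F} (hu : u ∈ iwahori F) :
    principalSeries _ _ u (iwahoriVector hσ) = iwahoriVector hσ := by
  ext g
  rw [principalSeries_apply, iwahoriVector_apply, iwahoriVector_apply]
  refine if_congr (iwahori_row hu g) ?_ rfl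
  rw [map_mul, map_mul, hσ _ (norm_det_iwahori hu), mul_one]

/-- A comparison of supports in terms of the bottom row (c, d): w moves |d| ≤ |c| to |c| ≤ |d|, and
the complement |d| ≤ |cϖ| is the support of the translate by diag(ϖ, 1). Modulo σ ∘ det this
expresses the Whittaker function on the coset of w through its values on the diagonal torus. -/
theorem weyl_iwahoriVector (hϖ : IsUniformizer ϖ) (hσ : IsUnramified σ) :
    principalSeries _ _ (weyl F) (iwahoriVector hσ) = detVector hσ -
      ((σ ϖ : ℂ)⁻¹) • principalSeries _ _ (diagGL ϖ 1) (iwahoriVector hσ) := by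
  classical
  ext g
  change (iwahoriVector hσ).1 (g * weyl F) =
    (σ g.det : ℂ) - (σ ϖ : ℂ)⁻¹ * (iwahoriVector hσ).1 (g * diagGL ϖ 1)
  have hw : (g * weyl F).det = g.det := by
    rw [map_mul]
    have : (weyl F).det = 1 := by ext; simp [GeneralLinearGroup.val_det_apply]
    rw [this, mul_one]
  have hd : (g * diagGL ϖ 1).det = g.det * ϖ := by
    rw [map_mul]
    congr 1
    ext
    simp [GeneralLinearGroup.val_det_apply]
  have e1 : (g * weyl F).1 1 1 = -g 1 0 := by simp [Matrix.mul_apply, Fin.sum_univ_two]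
  have e2 : (g * weyl F).1 1 0 = g 1 1 := by simp [Matrix.mul_apply, Fin.sum_univ_two]
  have e3 : (g * diagGL ϖ 1).1 1 1 = g 1 1 := by simp [Matrix.mul_apply, Fin.sum_univ_two]
  have e4 : (g * diagGL ϖ 1).1 1 0 = g 1 0 * ϖ := by simp [Matrix.mul_apply, Fin.sum_univ_two]
  have hiff : ‖g 1 1‖ ≤ ‖g 1 0 * ϖ‖ ↔ ¬ ‖g 1 0‖ ≤ ‖g 1 1‖ := by
    rw [not_le, norm_mul]
    by_cases h0 : g 1 0 = 0
    · have h1 := norm_pos_iff.2 (entry_ne_zero g h0)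
      simp only [h0, norm_zero, zero_mul]
      exact ⟨fun h => absurd h (not_le.2 h1), fun h => absurd h (not_lt.2 h1.le)⟩
    · have hp : 0 < ‖g 1 0‖ := norm_pos_iff.2 h0
      have h := hϖ (g 1 1 / g 1 0)
      rw [norm_div, div_lt_one hp, div_le_iff₀ hp, mul_comm] at h
      exact h.symm
  rw [iwahoriVector_apply, iwahoriVector_apply, hw, hd, e1, e2, e3, e4, norm_neg]
  simp only [hiff, map_mul, Units.val_mul]
  by_cases h : ‖g 1 0‖ ≤ ‖g 1 1‖
  · simp [h]
  · rw [if_neg h, if_pos h]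
    field_simp [Units.ne_zero]
    simp

end Steinberg


/-! ### Kirillov functions and Fourier inversion for the Steinberg representation -/

section Steinberg

variable {F : Type*} [NontriviallyNormedField F] {ϖ : Fˣ} {σ : Fˣ →* ℂˣ}

/-- A function in `I(σ|·|^{-1/2}, σ|·|^{1/2})` vanishing at `1` has compact support on the big cell
and is uniformly locally constant there. -/
theorem steinbergSpace_support (hϖ : IsUniformizer ϖ) (f : steinbergSpace (F := F) σ)
    (hf : f.1 1 = 0) : ∃ m : ℕ, (∀ x : F, ¬ ‖x‖ ≤ ‖(ϖ : F)‖ ^ (-(m : ℤ)) →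
      f.1 (weyl F * nUp x) = 0) ∧ ∀ x y : F, ‖x - y‖ ≤ ‖(ϖ : F)‖ ^ (m : ℤ) →
      f.1 (weyl F * nUp x) = f.1 (weyl F * nUp y) := by
  obtain ⟨⟨U, hU, hfU⟩, -⟩ := f.2
  have hU1 : (U : Set (GL (Fin 2) F)) ∈ nhds 1 := hU.mem_nhds U.one_mem
  have h1 : ∀ᶠ x : F in nhds 0, nUp x ∈ U :=
    continuous_nUp.continuousAt (by rw [nUp_zero]; exact hU1)
  have h2 : ∀ᶠ x : F in nhds 0, nLow x ∈ U :=
    continuous_nLow.continuousAt (by rw [nLow_zero]; exact hU1)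
  obtain ⟨ε, hε, hball⟩ := Metric.eventually_nhds_iff.1 (h1.and h2)
  obtain ⟨m, hm⟩ := exists_pow_lt_of_lt_one hε hϖ.norm_lt_one
  refine ⟨m, fun x hx => ?_, fun x y hxy => ?_⟩
  · have hx0 : x ≠ 0 := by
      rintro rfl
      exact hx (by simp)
    have hinv : ‖x⁻¹‖ < ε := by
      rw [norm_inv]
      refine lt_trans (inv_lt_of_inv_lt₀ (pow_pos (norm_unit_pos ϖ) m) ?_) hm
      rw [_root_.zpow_neg, zpow_natCast, not_le] at hx
      exact hx
    -- For large x the element w n(x) lies in B n⁻(x⁻¹), and n⁻(x⁻¹) stabilises f, so the value is a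
    -- multiple of f(1) = 0.
    have e : weyl F * nUp x = nUp (-x⁻¹) * diagGL (Units.mk0 x hx0)⁻¹ (Units.mk0 x hx0) *
        (1 * nLow x⁻¹) := by
      ext i j
      fin_cases i <;> fin_cases j <;> simp [Matrix.mul_apply, Fin.sum_univ_two, hx0]
    rw [e, steinbergSpace_apply, hfU _ (hball (by simpa [dist_eq_norm] using hinv)).2, hf, mul_zero]
  · have e : weyl F * nUp x = weyl F * nUp y * nUp (x - y) := by
      rw [mul_assoc, nUp_mul_nUp, add_sub_cancel]
    rw [e, hfU _ (hball _).1]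
    rw [dist_eq_norm, sub_zero]
    exact hxy.trans_lt (by rwa [zpow_natCast])

variable [IsUltrametricDist F]

/-- The translates of `iwahoriVector` which are supported on small balls. -/
def smallVector (ϖ : Fˣ) (hσ : IsUnramified σ) (m : ℕ) : steinbergSpace (F := F) σ :=
  ((σ ϖ : ℂ) ^ m)⁻¹ • principalSeries _ _ (diagGL (ϖ ^ m) 1) (iwahoriVector hσ)

open Classical in
theorem smallVector_apply (hσ : IsUnramified σ) (m : ℕ) (g : GL (Fin 2) F) :
    (smallVector ϖ hσ m).1 g =
      if ‖g 1 1‖ ≤ ‖g 1 0‖ * ‖(ϖ : F)‖ ^ (m : ℤ) then (σ g.det : ℂ) else 0 := by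
  have hd : (g * diagGL (ϖ ^ m) 1).det = g.det * ϖ ^ m := by
    rw [map_mul]
    congr 1
    ext
    simp [GeneralLinearGroup.val_det_apply]
  have e1 : (g * diagGL (ϖ ^ m) 1).1 1 1 = g 1 1 := by
    simp [Matrix.mul_apply, Fin.sum_univ_two]
  have e2 : (g * diagGL (ϖ ^ m) 1).1 1 0 = g 1 0 * ϖ ^ m := by
    simp [Matrix.mul_apply, Fin.sum_univ_two]
  change ((σ ϖ : ℂ) ^ m)⁻¹ * (iwahoriVector hσ).1 (g * diagGL (ϖ ^ m) 1) = _
  rw [iwahoriVector_apply, hd, e1, e2, norm_mul, norm_pow, zpow_natCast]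
  split_ifs
  · rw [map_mul, map_pow, Units.val_mul, Units.val_pow_eq_pow_val, mul_comm, mul_assoc,
      mul_inv_cancel₀ (pow_ne_zero _ (Units.ne_zero _)), mul_one]
  · rw [mul_zero]

/-- Expansion of a function on the big cell in translates of `smallVector`. -/
theorem eq_sum_smallVector (hσ : IsUnramified σ) (f : steinbergSpace (F := F) σ)
    (hf : f.1 1 = 0) {m : ℕ} {R : ℝ} (hR : ‖(ϖ : F)‖ ^ (m : ℤ) ≤ R)
    (h1 : ∀ x : F, ¬ ‖x‖ ≤ R → f.1 (weyl F * nUp x) = 0)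
    (h2 : ∀ x y : F, ‖x - y‖ ≤ ‖(ϖ : F)‖ ^ (m : ℤ) →
      f.1 (weyl F * nUp x) = f.1 (weyl F * nUp y))
    {T : Finset F} (hT1 : ∀ y ∈ T, ‖y‖ ≤ R)
    (hT2 : ∀ x : F, ‖x‖ ≤ R → ∃! y, y ∈ T ∧ ‖x - y‖ ≤ ‖(ϖ : F)‖ ^ (m : ℤ)) :
    f = ∑ y ∈ T, f.1 (weyl F * nUp y) • principalSeries _ _ (nUp (-y)) (smallVector ϖ hσ m) := by
  classical
  ext g
  have hsum : (∑ y ∈ T, f.1 (weyl F * nUp y) •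
      principalSeries _ _ (nUp (-y)) (smallVector ϖ hσ m)).1 g =
      ∑ y ∈ T, f.1 (weyl F * nUp y) * (smallVector ϖ hσ m).1 (g * nUp (-y)) := by
    simp
  rw [hsum]
  have e1 : ∀ y, (g * nUp (-y)).1 1 1 = g 1 1 - g 1 0 * y := fun y => by
    simp [Matrix.mul_apply, Fin.sum_univ_two]
    ring
  have e2 : ∀ y, (g * nUp (-y)).1 1 0 = g 1 0 := fun y => by
    simp [Matrix.mul_apply, Fin.sum_univ_two]
  have ed : ∀ y, (g * nUp (-y)).det = g.det := fun y => by
    rw [map_mul]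
    have : (nUp (-y)).det = 1 := by ext; simp [GeneralLinearGroup.val_det_apply]
    rw [this, mul_one]
  simp only [smallVector_apply, e1, e2, ed]
  by_cases hc : g 1 0 = 0
  · rw [steinbergSpace_eval_zero f g hc, hf, mul_zero]
    refine (Finset.sum_eq_zero fun y _ => ?_).symm
    rw [if_neg, mul_zero]
    simpa [hc] using entry_ne_zero g hc
  · rw [steinbergSpace_eval f g hc]
    have hiff : ∀ y, ‖g 1 1 - g 1 0 * y‖ ≤ ‖g 1 0‖ * ‖(ϖ : F)‖ ^ (m : ℤ) ↔
        ‖g 1 1 / g 1 0 - y‖ ≤ ‖(ϖ : F)‖ ^ (m : ℤ) := fun y => by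
      have : g 1 1 - g 1 0 * y = g 1 0 * (g 1 1 / g 1 0 - y) := by field_simp
      rw [this, norm_mul, mul_le_mul_iff_right₀ (norm_pos_iff.2 hc)]
    simp only [hiff]
    by_cases hx : ‖g 1 1 / g 1 0‖ ≤ R
    · obtain ⟨y, ⟨hy, hxy⟩, hu⟩ := hT2 _ hx
      rw [Finset.sum_eq_single_of_mem y hy, if_pos hxy, h2 _ _ hxy, mul_comm]
      intro z hz hzy
      rw [if_neg (fun h => hzy (hu z ⟨hz, h⟩)), mul_zero]
    · rw [h1 _ hx, mul_zero]
      refine (Finset.sum_eq_zero fun y hy => ?_).symm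
      rw [if_neg, mul_zero]
      intro h
      exact hx (by simpa using ultra_add_le (h.trans hR) (hT1 y hy))

variable [LocallyCompactSpace F] [MeasurableSpace F] [BorelSpace F]

/-- The Kirillov function of `iwahoriVector`. -/
theorem kirillov_iwahoriVector (hϖ : IsUniformizer ϖ)
    (hnorm : ‖(ϖ : F)‖ = (residueCard F : ℝ)⁻¹) (dx : Measure F) [dx.IsAddHaarMeasure]
    (hdx : dx {x | ‖x‖ ≤ 1} = 1) {ψ : AddChar F Circle} (hψ : ∀ x : F, ‖x‖ ≤ 1 → ψ x = 1)
    (hσ : IsUnramified σ) (ℓ : steinbergSpace (F := F) σ →ₗ[ℂ] ℂ)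
    (hℓ : ∀ (x : F) v, ℓ (principalSeries _ _ (nUp x) v) = (ψ x : ℂ) * ℓ v) (k : ℕ) :
    ℓ (principalSeries _ _ (diagGL (ϖ ^ k) 1) (iwahoriVector hσ)) =
      ((σ ϖ : ℂ) * (‖(ϖ : F)‖ : ℂ)) ^ k * ℓ (iwahoriVector hσ) := by
  have h0 := norm_unit_pos ϖ
  have hk : ‖(ϖ : F)‖ ^ (k : ℤ) ≤ 1 := by
    rw [← zpow_zero ‖(ϖ : F)‖]
    exact hϖ.zpow_le_zpow_iff.2 (by lia)
  obtain ⟨T, hT1, hT2⟩ := exists_ball_reps (F := F) (zpow_pos h0 (k : ℤ)) hk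
  have hcard : (T.card : ℂ) * (‖(ϖ : F)‖ : ℂ) ^ k = 1 := by
    have h := measure_ball_eq_card_mul dx hk hT1 hT2
    rw [hdx, measure_ball hϖ hnorm dx hdx] at h
    have h' := congrArg ENNReal.toReal h
    rw [ENNReal.toReal_one, ENNReal.toReal_mul, ENNReal.toReal_natCast,
      ENNReal.toReal_ofReal (zpow_nonneg h0.le _), zpow_natCast] at h'
    exact_mod_cast h'.symm
  classical
  have hval : ∀ x : F, (iwahoriVector hσ).1 (weyl F * nUp x) = if ‖x‖ ≤ 1 then 1 else 0 := by
    intro x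
    have hd : (weyl F * nUp x).det = 1 := by
      ext; simp [GeneralLinearGroup.val_det_apply]
    rw [iwahoriVector_apply, hd]
    simp
  -- The Iwahori vector is a sum of q^k translates of `smallVector` by integral unipotent elements.
  -- ℓ takes the same value on all of them because ψ is trivial on 𝔬.
  have hexp := eq_sum_smallVector (ϖ := ϖ) (m := k) hσ (iwahoriVector hσ)
    (by rw [iwahoriVector_apply]; simp) hk
    (fun x hx => by rw [hval, if_neg hx])
    (fun x y hxy => by
      rw [hval, hval]
      refine if_congr ⟨fun h => ?_, fun h => ?_⟩ rfl rfl
      · simpa using ultra_sub_le h (hxy.trans hk)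
      · simpa using ultra_add_le (hxy.trans hk) h) hT1 hT2
  have h3 := congrArg ℓ hexp
  rw [map_sum, Finset.sum_congr rfl (g := fun _ => ℓ (smallVector ϖ hσ k)) (fun y hy => by
    rw [map_smul, hℓ, hψ _ (by rw [norm_neg]; exact hT1 y hy), hval, if_pos (hT1 y hy)]
    simp), Finset.sum_const, smallVector, map_smul, nsmul_eq_mul, smul_eq_mul] at h3
  have hs : (σ ϖ : ℂ) ≠ 0 := Units.ne_zero _
  rw [h3, mul_pow]
  field_simp
  linear_combination -ℓ (principalSeries _ _ (diagGL (ϖ ^ k) 1) (iwahoriVector hσ)) * hcard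

theorem kirillov_iwahoriVector_units (hϖ : IsUniformizer ϖ)
    (hnorm : ‖(ϖ : F)‖ = (residueCard F : ℝ)⁻¹) (dx : Measure F) [dx.IsAddHaarMeasure]
    (hdx : dx {x | ‖x‖ ≤ 1} = 1) {ψ : AddChar F Circle} (hψ : ∀ x : F, ‖x‖ ≤ 1 → ψ x = 1)
    (hσ : IsUnramified σ) (ℓ : steinbergSpace (F := F) σ →ₗ[ℂ] ℂ)
    (hℓ : ∀ (x : F) v, ℓ (principalSeries _ _ (nUp x) v) = (ψ x : ℂ) * ℓ v) (a : Fˣ)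
    (ha : ‖(a : F)‖ ≤ 1) :
    ℓ (principalSeries _ _ (diagGL a 1) (iwahoriVector hσ)) =
      (σ a : ℂ) * (‖(a : F)‖ : ℂ) * ℓ (iwahoriVector hσ) := by
  obtain ⟨k, hk⟩ := Int.eq_ofNat_of_zero_le ((hϖ.norm_le_one_iff a.ne_zero).1 ha)
  have hn : ‖(a : F)‖ = ‖(ϖ : F)‖ ^ k := by rw [hϖ.norm_eq a.ne_zero, hk, zpow_natCast]
  have hu : ‖((a / ϖ ^ k : Fˣ) : F)‖ = 1 := by
    rw [Units.val_div_eq_div_val, Units.val_pow_eq_pow_val, norm_div, norm_pow, hn,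
      div_self (pow_ne_zero _ (norm_unit_pos ϖ).ne')]
  have h : diagGL a 1 = diagGL (ϖ ^ k) 1 * diagGL (a / ϖ ^ k) 1 := by
    rw [diagGL_mul]; simp
  rw [h, map_mul, Module.End.mul_apply, iwahoriVector_fixed hσ
    (diagGL_mem_iwahori hu (by simp)), kirillov_iwahoriVector hϖ hnorm dx hdx hψ hσ ℓ hℓ,
    hσ.coe_apply hϖ a, hk, hn, zpow_natCast, mul_pow, Complex.ofReal_pow]

/-- A vector of `St ⊗ σ` whose Kirillov function is `σ(a) |a| 𝟙_𝔬(a)` is fixed by the Iwahori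
subgroup. -/
theorem smul_eq_iwahoriVector (hϖ : IsUniformizer ϖ)
    (hnorm : ‖(ϖ : F)‖ = (residueCard F : ℝ)⁻¹) (dx : Measure F) [dx.IsAddHaarMeasure]
    (hdx : dx {x | ‖x‖ ≤ 1} = 1) {ψ : AddChar F Circle} (hψ : ∀ x : F, ‖x‖ ≤ 1 → ψ x = 1)
    (hψ' : ∃ x : F, ‖x‖ ≤ ‖(ϖ : F)‖⁻¹ ∧ ψ x ≠ 1)
    (hσ : IsUnramified σ) (ℓ : steinbergSpace (F := F) σ →ₗ[ℂ] ℂ)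
    (hℓ : ∀ (x : F) v, ℓ (principalSeries _ _ (nUp x) v) = (ψ x : ℂ) * ℓ v)
    (f : steinbergSpace (F := F) σ) (hf : f.1 1 = 0)
    (hW : ∀ a : Fˣ, ℓ (principalSeries _ _ (diagGL a 1) f) =
        open Classical in if ‖(a : F)‖ ≤ 1 then (σ a : ℂ) * (‖(a : F)‖ : ℂ) else 0) :
    ℓ (iwahoriVector hσ) • f = iwahoriVector hσ := by
  classical
  have h0 := norm_unit_pos ϖ
  have h0' : (‖(ϖ : F)‖ : ℂ) ≠ 0 := by simp
  have hs : (σ ϖ : ℂ) ≠ 0 := Units.ne_zero _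
  obtain ⟨m, h1, h2⟩ := steinbergSpace_support hϖ f hf
  have hR : ‖(ϖ : F)‖ ^ (m : ℤ) ≤ ‖(ϖ : F)‖ ^ (-(m : ℤ)) := hϖ.zpow_le_zpow_iff.2 (by lia)
  obtain ⟨T, hT1, hT2⟩ := exists_ball_reps (F := F) (zpow_pos h0 (m : ℤ)) hR
  have hexp := eq_sum_smallVector (ϖ := ϖ) hσ f hf hR h1 h2 hT1 hT2
  set φ : F → ℂ := fun x => f.1 (weyl F * nUp x) with hφ
  set c : ℂ := ℓ (iwahoriVector hσ) with hc
  -- the Fourier transform of `φ`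
  have hunit : ∀ a : Fˣ, ‖(a : F)‖ ≤ ‖(ϖ : F)‖ ^ (-(m : ℤ)) →
      c * (‖(ϖ : F)‖ : ℂ) ^ m * ∑ y ∈ T, φ y * (ψ (-(a * y)) : ℂ) =
        if ‖(a : F)‖ ≤ 1 then 1 else 0 := by
    intro a ha
    have ham : ‖((a * ϖ ^ m : Fˣ) : F)‖ ≤ 1 := by
      rw [Units.val_mul, Units.val_pow_eq_pow_val, norm_mul, norm_pow]
      rw [_root_.zpow_neg, zpow_natCast] at ha
      calc _ ≤ (‖(ϖ : F)‖ ^ m)⁻¹ * ‖(ϖ : F)‖ ^ m := by gcongr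
        _ = 1 := inv_mul_cancel₀ (pow_ne_zero _ h0.ne')
    have hterm : ∀ y, principalSeries _ _ (diagGL a 1) (principalSeries _ _ (nUp (-y))
        (smallVector ϖ hσ m)) = principalSeries _ _ (nUp (-(a * y)))
          (((σ ϖ : ℂ) ^ m)⁻¹ • principalSeries _ _ (diagGL (a * ϖ ^ m) 1)
            (iwahoriVector hσ)) := by
      intro y
      rw [← Module.End.mul_apply, ← map_mul, diagGL_mul_nUp, map_mul, Module.End.mul_apply,
        smallVector, map_smul, ← Module.End.mul_apply (principalSeries _ _ (diagGL a 1)),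
        ← map_mul, diagGL_mul]
      simp
    have h3 := hW a
    rw [hexp, map_sum, map_sum, Finset.sum_congr rfl (g := fun y => (σ a : ℂ) * (‖(a : F)‖ : ℂ) *
      (c * (‖(ϖ : F)‖ : ℂ) ^ m * (φ y * (ψ (-(a * y)) : ℂ)))) (fun y hy => by
        rw [map_smul, map_smul, hterm, hℓ, map_smul,
          kirillov_iwahoriVector_units hϖ hnorm dx hdx hψ hσ ℓ hℓ _ ham, map_mul, map_pow]
        simp only [Units.val_mul, Units.val_pow_eq_pow_val, norm_mul, norm_pow, smul_eq_mul,
          Complex.ofReal_mul, Complex.ofReal_pow]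
        field_simp
        exact mul_comm _ _), ← Finset.mul_sum, ← Finset.mul_sum] at h3
    have hsa : (σ a : ℂ) * (‖(a : F)‖ : ℂ) ≠ 0 := mul_ne_zero (Units.ne_zero _) (by simp)
    refine mul_left_cancel₀ hsa (h3.trans ?_)
    split_ifs <;> simp
  have hfour : ∀ a : F, ‖a‖ ≤ ‖(ϖ : F)‖ ^ (-(m : ℤ)) →
      c * (‖(ϖ : F)‖ : ℂ) ^ m * ∑ y ∈ T, φ y * (ψ (-(a * y)) : ℂ) =
        if ‖a‖ ≤ 1 then 1 else 0 := by
    intro a ha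
    by_cases ha0 : a = 0
    -- At a = 0 there is no torus element, but the sum has the same value as at a = ϖ^m, since ϖ^m y
    -- is integral for every y in T.
    · have hm1 : ‖((ϖ ^ m : Fˣ) : F)‖ ≤ 1 := by
        rw [Units.val_pow_eq_pow_val, norm_pow]
        exact pow_le_one₀ h0.le hϖ.norm_lt_one.le
      rw [ha0, norm_zero, if_pos zero_le_one, ← if_pos hm1 (t := (1 : ℂ)) (e := 0),
        ← hunit (ϖ ^ m) (hm1.trans (by
          rw [← zpow_zero ‖(ϖ : F)‖]; exact hϖ.zpow_le_zpow_iff.2 (by lia)))]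
      congr 1
      refine Finset.sum_congr rfl fun y hy => ?_
      rw [zero_mul, neg_zero, AddChar.map_zero_eq_one, hψ]
      rw [norm_neg, norm_mul, Units.val_pow_eq_pow_val, norm_pow]
      have := hT1 y hy
      rw [_root_.zpow_neg, zpow_natCast] at this
      calc _ ≤ ‖(ϖ : F)‖ ^ m * (‖(ϖ : F)‖ ^ m)⁻¹ := by gcongr
        _ = 1 := mul_inv_cancel₀ (pow_ne_zero _ h0.ne')
    · exact hunit (Units.mk0 a ha0) ha
  -- Fourier inversion
  have hinv : ∀ x : F, c * φ x = if ‖x‖ ≤ 1 then 1 else 0 := by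
    intro x
    set D : Set F := {a | ‖a‖ ≤ ‖(ϖ : F)‖ ^ (-(m : ℤ))} with hD
    have hcont : ∀ h : F, IntegrableOn (fun a => (ψ (h * a) : ℂ)) D dx := fun h => by
      refine Measure.integrableOn_of_bounded (M := 1) ?_
        ((continuous_of_trivial hψ).comp (continuous_const_mul h)).aestronglyMeasurable
        (Filter.Eventually.of_forall fun x => (Circle.norm_coe _).le)
      rw [hD, measure_ball hϖ hnorm dx hdx]
      exact ENNReal.ofReal_ne_top
    -- Orthogonality of characters selects the single y in T with |x - y| ≤ |ϖ|^m, where φ(y) =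
    -- φ(x); the volume |ϖ|^(-m) of D cancels the factor |ϖ|^m.
    have hL : ∫ a in D, (c * (‖(ϖ : F)‖ : ℂ) ^ m * ∑ y ∈ T, φ y * (ψ (-(a * y)) : ℂ)) *
        (ψ (x * a) : ℂ) ∂dx = c * φ x := by
      have e1 : ∀ a, (c * (‖(ϖ : F)‖ : ℂ) ^ m * ∑ y ∈ T, φ y * (ψ (-(a * y)) : ℂ)) *
          (ψ (x * a) : ℂ) = c * (‖(ϖ : F)‖ : ℂ) ^ m *
            ∑ y ∈ T, φ y * (ψ ((x - y) * a) : ℂ) := by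
        intro a
        rw [mul_assoc, Finset.sum_mul]
        congr 1
        refine Finset.sum_congr rfl fun y _ => ?_
        rw [show (x - y) * a = -(a * y) + x * a by ring, AddChar.map_add_eq_mul, Circle.coe_mul,
          mul_assoc]
      simp only [e1]
      rw [integral_const_mul, integral_finsetSum _ fun y _ => (hcont _).const_mul _]
      simp only [integral_const_mul, hD]
      simp only [setIntegral_ball_char_mul hϖ hnorm dx hdx hψ hψ', neg_neg]
      by_cases hx : ‖x‖ ≤ ‖(ϖ : F)‖ ^ (-(m : ℤ))
      · obtain ⟨y, ⟨hy, hxy⟩, hu⟩ := hT2 _ hx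
        rw [Finset.sum_eq_single_of_mem y hy, if_pos hxy, hφ]
        · simp only [h2 _ _ hxy, _root_.zpow_neg, zpow_natCast]
          field_simp
        · intro z hz hzy
          rw [if_neg (fun h => hzy (hu z ⟨hz, h⟩)), mul_zero]
      · rw [hφ]
        simp only [h1 _ hx, mul_zero]
        rw [Finset.sum_eq_zero, mul_zero]
        intro y hy
        rw [if_neg, mul_zero]
        intro h
        exact hx (by simpa using ultra_add_le (h.trans hR) (hT1 y hy))
    have hRt : ∫ a in D, (c * (‖(ϖ : F)‖ : ℂ) ^ m * ∑ y ∈ T, φ y * (ψ (-(a * y)) : ℂ)) *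
        (ψ (x * a) : ℂ) ∂dx = if ‖x‖ ≤ 1 then 1 else 0 := by
      have hsub : {a : F | ‖a‖ ≤ ‖(ϖ : F)‖ ^ (0 : ℤ)} ⊆ D := fun a ha =>
        le_trans ha (hϖ.zpow_le_zpow_iff.2 (by lia))
      rw [setIntegral_congr_fun (g := {a : F | ‖a‖ ≤ ‖(ϖ : F)‖ ^ (0 : ℤ)}.indicator
          fun a => (ψ (x * a) : ℂ)) (measurableSet_ball_le _) (fun a ha => by
            beta_reduce
            rw [hfour a ha]
            by_cases h : ‖a‖ ≤ 1
            · rw [if_pos h, one_mul, Set.indicator_of_mem]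
              simpa using h
            · rw [if_neg h, zero_mul, Set.indicator_of_notMem]
              simpa using h),
        setIntegral_indicator (measurableSet_ball_le _), Set.inter_eq_right.2 hsub,
        setIntegral_ball_char_mul hϖ hnorm dx hdx hψ hψ']
      simp
    rw [← hL, hRt]
  ext g
  change c * f.1 g = (iwahoriVector hσ).1 g
  rw [iwahoriVector_apply]
  by_cases hg : g 1 0 = 0
  · rw [steinbergSpace_eval_zero f g hg, hf, mul_zero, mul_zero, if_neg]
    simpa [hg] using entry_ne_zero g hg
  · rw [steinbergSpace_eval f g hg, mul_left_comm]
    have := hinv (g 1 1 / g 1 0)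
    rw [hφ] at this
    simp only at this
    rw [this]
    simp only [norm_div, div_le_one (norm_pos_iff.2 hg)]
    simp

/-- ℓ factors through the quotient and kills σ ∘ det, so a lift of the vector may be corrected to
vanish at 1; `smul_eq_iwahoriVector` then makes it proportional to the Iwahori vector. On the coset
of w, `weyl_iwahoriVector` gives -σ(ϖ)⁻¹ W(diag(aϖ, 1)), which explains both the factor -r and the
support in orders at least -1 of `steinBig`. -/
theorem steinberg_isLocalData (hϖ : IsUniformizer ϖ)
    (hnorm : ‖(ϖ : F)‖ = (residueCard F : ℝ)⁻¹) (dx : Measure F) [dx.IsAddHaarMeasure]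
    (hdx : dx {x | ‖x‖ ≤ 1} = 1) {ψ : AddChar F Circle} (hψ : ∀ x : F, ‖x‖ ≤ 1 → ψ x = 1)
    (hψ' : ∃ x : F, ‖x‖ ≤ ‖(ϖ : F)‖⁻¹ ∧ ψ x ≠ 1) (hσ : IsUnramified σ)
    {W : GL (Fin 2) F → ℂ} (hW : W ∈ whittakerModel ψ (steinberg σ))
    (hWd : ∀ a : Fˣ, W (diagGL a 1) =
      open Classical in if ‖(a : F)‖ ≤ 1 then (σ a : ℂ) * (‖(a : F)‖ : ℂ) else 0) :
    IsLocalData ϖ ψ W (steinLow ((σ ϖ : ℂ) * (‖(ϖ : F)‖ : ℂ)))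
      (steinBig (‖(ϖ : F)‖ : ℂ) ((σ ϖ : ℂ) * (‖(ϖ : F)‖ : ℂ))) ((σ ϖ : ℂ) ^ 2) := by
  classical
  have h0' : (‖(ϖ : F)‖ : ℂ) ≠ 0 := by simp
  have hs : (σ ϖ : ℂ) ≠ 0 := Units.ne_zero _
  obtain ⟨ℓ', hℓ', v, hv⟩ := hW
  obtain ⟨f', rfl⟩ := Submodule.mkQ_surjective _ v
  set ℓ := ℓ' ∘ₗ Submodule.mkQ (detLine (σ * absChar F (-1 / 2)) (σ * absChar F (1 / 2)) σ)
  have hℓ : ∀ (x : F) v, ℓ (principalSeries _ _ (nUp x) v) = (ψ x : ℂ) * ℓ v := fun x v =>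
    hℓ' x (Submodule.mkQ _ v)
  have hdet0 : ∀ g, ℓ (principalSeries _ _ g (detVector hσ)) = 0 := by
    intro g
    have : principalSeries _ _ g (detVector hσ) ∈
        detLine (σ * absChar F (-1 / 2)) (σ * absChar F (1 / 2)) σ := by
      refine ⟨(σ g.det : ℂ), fun h => ?_⟩
      change (σ (h * g).det : ℂ) = _
      rw [map_mul, map_mul, Units.val_mul, mul_comm]
    change ℓ' (Submodule.mkQ _ _) = 0
    rw [Submodule.mkQ_apply, (Submodule.Quotient.mk_eq_zero _).2 this, map_zero]
  set f := f' - f'.1 1 • detVector hσ with hfdef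
  have hWf : ∀ g, W g = ℓ (principalSeries _ _ g f) := by
    intro g
    rw [hfdef, map_sub, map_smul, map_sub, map_smul, hdet0, smul_zero, sub_zero]
    exact hv g
  have hf1 : f.1 1 = 0 := by
    change f'.1 1 - f'.1 1 * (σ (1 : GL (Fin 2) F).det : ℂ) = 0
    simp
  have hvec := smul_eq_iwahoriVector hϖ hnorm dx hdx hψ hψ' hσ ℓ hℓ f hf1
    (fun a => by rw [← hWf, hWd])
  set c := ℓ (iwahoriVector hσ)
  -- Otherwise `hvec` would make the Iwahori vector zero, while its value at w is not.
  have hc : c ≠ 0 := by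
    intro h
    rw [h, zero_smul] at hvec
    have := congrArg (fun v => v.1 (weyl F)) hvec
    beta_reduce at this
    rw [iwahoriVector_apply, if_pos (by simp)] at this
    exact (Units.ne_zero _) this.symm
  have hWv : ∀ g, W g = c⁻¹ * ℓ (principalSeries _ _ g (iwahoriVector hσ)) := by
    intro g
    rw [← hvec, map_smul, map_smul, smul_eq_mul, inv_mul_cancel_left₀ hc, hWf]
  have hWmul : ∀ g, ∀ u ∈ iwahori F, W (g * u) = W g := fun g u hu => by
    rw [hWv, hWv, map_mul, Module.End.mul_apply, iwahoriVector_fixed hσ hu]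
  refine IsLocalData.of_iwahori hϖ (fun x g => ?_) (fun z g => ?_)
    (fun u g hu => hWmul g _ (nLow_mem_iwahori hu)) (fun x g hx => hWmul g _ (nUp_mem_iwahori hx))
    (fun a => ?_) (fun a => ?_)
  · rw [hWf, map_mul, Module.End.mul_apply, hℓ, hWf]
  · have e : principalSeries _ _ (diagGL z z) (iwahoriVector hσ) =
        (σ (z * z) : ℂ) • iwahoriVector hσ := by
      ext h
      have := steinbergSpace_apply (iwahoriVector hσ) z z 0 h
      rw [nUp_zero, one_mul, diagGL_central_comm] at this
      exact this
    rw [hWv, map_mul, Module.End.mul_apply, e, map_smul, map_smul, hWv, map_mul, Units.val_mul,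
      hσ.coe_apply hϖ z, smul_eq_mul, ← mul_zpow, ← pow_two]
    ring
  · rw [hWd, steinLow]
    refine if_congr (hϖ.norm_le_one_iff a.ne_zero) ?_ rfl
    rw [hσ.coe_apply hϖ, hϖ.norm_eq a.ne_zero, mul_zpow]
    push_cast
    rfl
  · have e : W (diagGL a 1 * weyl F) = -(σ ϖ : ℂ)⁻¹ * W (diagGL (a * ϖ) 1) := by
      rw [hWv, map_mul, Module.End.mul_apply, weyl_iwahoriVector hϖ hσ, map_sub, map_sub, hdet0,
        map_smul, map_smul, ← Module.End.mul_apply, ← map_mul, diagGL_mul, mul_one, hWv,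
        smul_eq_mul]
      ring
    have hord : ord ϖ ((a * ϖ : Fˣ) : F) = ord ϖ (a : F) + 1 := by
      rw [Units.val_mul, hϖ.ord_mul a.ne_zero ϖ.ne_zero, hϖ.ord_eq (x := (ϖ : F)) (k := 1) (by simp)]
    rw [e, hWd, steinBig, mul_ite, mul_zero]
    refine if_congr ?_ ?_ rfl
    · rw [hϖ.norm_le_one_iff (Units.ne_zero _), hord]
      lia
    · rw [hσ.coe_apply hϖ (a * ϖ), hϖ.norm_eq (Units.ne_zero (a * ϖ)), hord, mul_zpow,
        zpow_add_one₀ hs]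
      push_cast
      rw [zpow_add_one₀ h0']
      field_simp

end Steinberg


/-! ### Invariance of the Siegel section in terms of its lower blocks -/

section LowerBlocks

variable {F : Type*} [NontriviallyNormedField F] {ω χ : Fˣ →* ℂˣ}

/-- The value of `h⁰_ω(χ)` on an element with similitude `ν` and lower blocks `C`, `D`. -/
def lowerSection (ω χ : Fˣ →* ℂˣ) (ν : Fˣ) (C D : Matrix (Fin 3) (Fin 3) F) : ℂ :=
  open Classical in
  if h : IsUnit C.det then
    (ω (ν / h.unit) : ℂ) * (χ (ν ^ 3 / h.unit ^ 2) : ℂ) *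
      (‖((ν ^ 3 / h.unit ^ 2 : Fˣ) : F)‖ : ℂ) * integralIndicator (C⁻¹ * D)
  else 0

theorem hZero_eq_lowerSection (g : GSp6 F) :
    hZero ω χ g = lowerSection ω χ (similitude g) g.1.1.toBlocks₂₁ g.1.1.toBlocks₂₂ := rfl

theorem lowerSection_of_det (ν δ : Fˣ) {C D z : Matrix (Fin 3) (Fin 3) F} (h : C.det = δ)
    (hz : C * z = D) :
    lowerSection ω χ ν C D = (ω (ν / δ) : ℂ) * (χ (ν ^ 3 / δ ^ 2) : ℂ) *
      (‖((ν ^ 3 / δ ^ 2 : Fˣ) : F)‖ : ℂ) * integralIndicator z := by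
  have hu : IsUnit C.det := ⟨δ, h.symm⟩
  have he : hu.unit = δ := by ext; exact h
  rw [lowerSection, dif_pos hu, he, ← hz, Matrix.nonsing_inv_mul_cancel_left _ _ hu]

theorem lowerSection_of_det_eq_zero (ν : Fˣ) {C D : Matrix (Fin 3) (Fin 3) F} (h : C.det = 0) :
    lowerSection ω χ ν C D = 0 := by
  rw [lowerSection, dif_neg (by simp [h])]

theorem lowerSection_ne_zero {ν : Fˣ} {C D : Matrix (Fin 3) (Fin 3) F}
    (h : lowerSection ω χ ν C D ≠ 0) : IsUnit C.det ∧ ∀ i j, ‖(C⁻¹ * D) i j‖ ≤ 1 := by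
  by_cases hu : IsUnit C.det
  · refine ⟨hu, ?_⟩
    by_contra hc
    exact h (by rw [lowerSection, dif_pos hu, integralIndicator, if_neg hc, mul_zero])
  · exact absurd (by rw [lowerSection, dif_neg hu]) h

variable [IsUltrametricDist F]

/-- Right translation by n(diag y) with integral y: it adds diag y to C⁻¹ D, which does not affect
integrality. -/
theorem lowerSection_add_mul_diagonal (ν : Fˣ) (C D : Matrix (Fin 3) (Fin 3) F) (y : Fin 3 → F)
    (hy : ∀ i, ‖y i‖ ≤ 1) :
    lowerSection ω χ ν C (D + C * diagonal y) = lowerSection ω χ ν C D := by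
  by_cases hu : IsUnit C.det
  · rw [lowerSection, lowerSection, dif_pos hu, dif_pos hu, Matrix.mul_add,
      Matrix.nonsing_inv_mul_cancel_left _ _ hu]
    congr 1
    have hd : ∀ i j, ‖(diagonal y : Matrix (Fin 3) (Fin 3) F) i j‖ ≤ 1 := by
      intro i j
      by_cases h : i = j
      · rw [h, diagonal_apply_eq]; exact hy j
      · rw [diagonal_apply_ne _ h]; simp
    rw [integralIndicator, integralIndicator]
    refine if_congr (forall₂_congr fun i j => ?_) rfl rfl
    rw [Matrix.add_apply]
    refine ⟨fun h => ?_, fun h => ultra_add_le h (hd i j)⟩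
    simpa using ultra_sub_le h (hd i j)
  · rw [lowerSection, lowerSection, dif_neg hu, dif_neg hu]

/-- Right translation by n⁻(u) in the i-th factor. With z = C⁻¹ D integral, det C is multiplied by 1
+ u zᵢᵢ, a unit, and z changes by a rank-one correction with this unit as denominator, hence stays
integral. -/
theorem lowerSection_add_mul_single_of_ne_zero (hω : IsUnramified ω) (hχ : IsUnramified χ) (ν : Fˣ)
    (C D : Matrix (Fin 3) (Fin 3) F) (i : Fin 3) (u : F) (hu : ‖u‖ < 1)
    (h : lowerSection ω χ ν C D ≠ 0) :
    lowerSection ω χ ν (C + D * single i i u) D = lowerSection ω χ ν C D := by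
  obtain ⟨hC, hz⟩ := lowerSection_ne_zero h
  obtain ⟨δ, hδ⟩ := hC
  set z := C⁻¹ * D with hzdef
  have hCz : C * z = D := Matrix.mul_nonsing_inv_cancel_left _ _ ⟨δ, hδ⟩
  have hn : ‖u * z i i‖ < 1 := by
    rw [norm_mul]
    exact (mul_le_of_le_one_right (norm_nonneg _) (hz i i)).trans_lt hu
  have hn1 : ‖1 + u * z i i‖ = 1 := by
    rw [add_comm, IsUltrametricDist.norm_add_eq_max_of_norm_ne_norm (by simpa using hn.ne)]
    simpa using hn.le
  have h0 : 1 + u * z i i ≠ 0 := by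
    rw [← norm_ne_zero_iff, hn1]; exact one_ne_zero
  have hdet : (C + D * single i i u).det = ((δ * Units.mk0 _ h0 : Fˣ) : F) := by
    rw [show C + D * single i i u = C * (1 + z * single i i u) by
        rw [Matrix.mul_add, Matrix.mul_one, ← Matrix.mul_assoc, hCz], det_mul, ← hδ, Units.val_mul,
      Units.val_mk0]
    congr 1
    clear_value z
    rw [det_fin_three]
    fin_cases i <;> simp [Matrix.mul_apply, single_apply] <;> ring
  set z' : Matrix (Fin 3) (Fin 3) F := of fun j k => z j k - u * z j i * z i k / (1 + u * z i i)
  have hz' : (C + D * single i i u) * z' = D := by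
    rw [show C + D * single i i u = C * (1 + z * single i i u) by
        rw [Matrix.mul_add, Matrix.mul_one, ← Matrix.mul_assoc, hCz], Matrix.mul_assoc]
    refine Eq.trans ?_ hCz
    congr 1
    clear_value z
    ext j k
    rw [Matrix.add_mul, Matrix.one_mul, Matrix.add_apply, Matrix.mul_assoc, Matrix.mul_apply,
      Finset.sum_eq_single i]
    · simp only [z', of_apply, single_mul_apply_same]
      field_simp
      ring
    · intro b _ hb
      rw [single_mul_apply_of_ne _ _ _ _ _ hb, mul_zero]
    · simp
  have hint : integralIndicator z' = integralIndicator z := by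
    rw [integralIndicator, integralIndicator, if_pos hz, if_pos]
    intro j k
    refine ultra_sub_le (hz j k) ?_
    rw [norm_div, hn1, div_one, norm_mul, norm_mul]
    exact mul_le_one₀ (mul_le_one₀ hu.le (norm_nonneg _) (hz j i)) (norm_nonneg _) (hz i k)
  have hunit : ‖((Units.mk0 _ h0 : Fˣ) : F)‖ = 1 := hn1
  rw [lowerSection_of_det ν _ hdet hz', lowerSection_of_det ν δ hδ.symm hCz, hint]
  simp only [map_div, map_mul, map_pow, hω _ hunit, hχ _ hunit, mul_one, mul_pow, one_pow,
    Units.val_div_eq_div_val, Units.val_mul, Units.val_pow_eq_pow_val, norm_div, norm_mul,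
    norm_pow, hunit]

theorem lowerSection_add_mul_single (hω : IsUnramified ω) (hχ : IsUnramified χ) (ν : Fˣ)
    (C D : Matrix (Fin 3) (Fin 3) F) (i : Fin 3) (u : F) (hu : ‖u‖ < 1) :
    lowerSection ω χ ν (C + D * single i i u) D = lowerSection ω χ ν C D := by
  by_cases h : lowerSection ω χ ν C D = 0
  -- If only the translated value were non-zero, translating back by -u would give a contradiction.
  · by_contra hc
    rw [h] at hc
    have := lowerSection_add_mul_single_of_ne_zero hω hχ ν _ D i (-u) (by rwa [norm_neg]) hc
    rw [add_assoc, ← Matrix.mul_add, ← single_add, add_neg_cancel, single_zero, Matrix.mul_zero,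
      add_zero, h] at this
    exact hc this.symm
  · exact lowerSection_add_mul_single_of_ne_zero hω hχ ν C D i u hu h

end LowerBlocks

/-! ### The section on the cell coordinates -/

section EtaIota

variable {F : Type*} [NontriviallyNormedField F] {ω χ : Fˣ →* ℂˣ}

theorem eta_lower_mul_diagonal (a c : Fin 3 → F) :
    !![1, 1, 1; 0, 0, 0; 0, 0, 0] * diagonal a + !![0, 0, 0; -1, 1, 0; -1, 0, 1] * diagonal c =
      !![a 0, a 1, a 2; -c 0, c 1, 0; -c 0, 0, c 2] := by
  ext i j
  rw [Matrix.add_apply, Matrix.mul_diagonal, Matrix.mul_diagonal]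
  fin_cases i <;> fin_cases j <;> simp

theorem hZero_eta_iota (h : H F) :
    hZero ω χ (eta F * iota h) = lowerSection ω χ h.1.1.det
      !![h.1.1.1 0 0, h.1.2.1.1 0 0, h.1.2.2.1 0 0; -h.1.1.1 1 0, h.1.2.1.1 1 0, 0;
        -h.1.1.1 1 0, 0, h.1.2.2.1 1 0]
      !![h.1.1.1 0 1, h.1.2.1.1 0 1, h.1.2.2.1 0 1; -h.1.1.1 1 1, h.1.2.1.1 1 1, 0;
        -h.1.1.1 1 1, 0, h.1.2.2.1 1 1] := by
  have hs : similitude (eta F * iota h) = h.1.1.det := by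
    rw [similitude_mul, eta, iota, similitude_mk', similitude_mk', one_mul]
  rw [hZero_eq_lowerSection, hs]
  rw [show (eta F * iota h).1.1 = fromBlocks _ _ _ _ * fromBlocks _ _ _ _ from rfl,
    fromBlocks_multiply, toBlocks_fromBlocks₂₁, toBlocks_fromBlocks₂₂]
  rw [eta_lower_mul_diagonal, eta_lower_mul_diagonal]
  rfl

theorem add_mul_single_apply (C D : Matrix (Fin 3) (Fin 3) F) (k i j : Fin 3) (w : F) :
    (C + D * single k k w) i j = C i j + if j = k then D i k * w else 0 := by
  rw [Matrix.add_apply]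
  split_ifs with h
  · rw [h, mul_single_apply_same]
  · rw [mul_single_apply_of_ne _ _ _ _ _ h]

/-- The lower left block of `𝛈 ι(cell (x, (a, b, c), (u₁, u₂, u₃)))`. -/
def cellLower (x : F) (a b c : Fˣ) (u₁ u₂ u₃ : F) : Matrix (Fin 3) (Fin 3) F :=
  !![a + x * u₁, a * b, a * c; -u₁, u₂ / b, 0; -u₁, 0, u₃ / c]

/-- A small uᵢ is replaced by 0, using invariance under n⁻(uᵢ); for a large uᵢ, translation by the
integral n(-1/uᵢ) simplifies the lower right block. The convention 0⁻¹ = 0 lets one formula cover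
both cases. -/
theorem hZero_cell [IsUltrametricDist F] (hω : IsUnramified ω) (hχ : IsUnramified χ) (x : F)
    (a b c : Fˣ) (u₁ u₂ u₃ u₁' u₂' u₃' : F)
    (h₁ : ‖u₁‖ < 1 ∧ u₁' = 0 ∨ 1 ≤ ‖u₁‖ ∧ u₁' = u₁)
    (h₂ : ‖u₂‖ < 1 ∧ u₂' = 0 ∨ 1 ≤ ‖u₂‖ ∧ u₂' = u₂)
    (h₃ : ‖u₃‖ < 1 ∧ u₃' = 0 ∨ 1 ≤ ‖u₃‖ ∧ u₃' = u₃) :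
    hZero ω χ (eta F * iota (cell (x, (a, b, c), (u₁, u₂, u₃)))) = lowerSection ω χ a
      (cellLower x a b c u₁' u₂' u₃')
      !![x - (a + x * u₁') / u₁', -(a * b / u₂'), -(a * c / u₃');
        -1 + u₁' / u₁', (1 - u₂' / u₂') / b, 0; -1 + u₁' / u₁', 0, (1 - u₃' / u₃') / c] := by
  have hd : (cell (x, (a, b, c), (u₁, u₂, u₃))).1.1.det = a := by
    ext
    simp [cell, GeneralLinearGroup.val_det_apply, det_fin_two]
  rw [hZero_eta_iota, hd]
  let C := cellLower x a b c
  set D : Matrix (Fin 3) (Fin 3) F := !![x, 0, 0; -1, (b : F)⁻¹, 0; -1, 0, (c : F)⁻¹] with hD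
  have e1 : ∀ v₁ v₂ v₃ w : F, C (v₁ + w) v₂ v₃ = C v₁ v₂ v₃ + D * single 0 0 w := by
    intro v₁ v₂ v₃ w
    ext i j
    rw [add_mul_single_apply]
    fin_cases i <;> fin_cases j <;> simp [C, cellLower, hD] <;> ring
  have e2 : ∀ v₁ v₂ v₃ w : F, C v₁ (v₂ + w) v₃ = C v₁ v₂ v₃ + D * single 1 1 w := by
    intro v₁ v₂ v₃ w
    ext i j
    rw [add_mul_single_apply]
    fin_cases i <;> fin_cases j <;> simp [C, cellLower, hD]
    ring
  have e3 : ∀ v₁ v₂ v₃ w : F, C v₁ v₂ (v₃ + w) = C v₁ v₂ v₃ + D * single 2 2 w := by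
    intro v₁ v₂ v₃ w
    ext i j
    rw [add_mul_single_apply]
    fin_cases i <;> fin_cases j <;> simp [C, cellLower, hD]
    ring
  have f1 : ∀ v₂ v₃ : F, lowerSection ω χ a (C u₁ v₂ v₃) D = lowerSection ω χ a (C u₁' v₂ v₃) D := by
    intro v₂ v₃
    obtain ⟨h, rfl⟩ | ⟨_, rfl⟩ := h₁
    · have := e1 0 v₂ v₃ u₁
      rw [zero_add] at this
      rw [this, lowerSection_add_mul_single hω hχ _ _ _ _ _ h]
    · rfl
  have f2 : ∀ v₁ v₃ : F, lowerSection ω χ a (C v₁ u₂ v₃) D = lowerSection ω χ a (C v₁ u₂' v₃) D := by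
    intro v₁ v₃
    obtain ⟨h, rfl⟩ | ⟨_, rfl⟩ := h₂
    · have := e2 v₁ 0 v₃ u₂
      rw [zero_add] at this
      rw [this, lowerSection_add_mul_single hω hχ _ _ _ _ _ h]
    · rfl
  have f3 : ∀ v₁ v₂ : F, lowerSection ω χ a (C v₁ v₂ u₃) D = lowerSection ω χ a (C v₁ v₂ u₃') D := by
    intro v₁ v₂
    obtain ⟨h, rfl⟩ | ⟨_, rfl⟩ := h₃
    · have := e3 v₁ v₂ 0 u₃
      rw [zero_add] at this
      rw [this, lowerSection_add_mul_single hω hχ _ _ _ _ _ h]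
    · rfl
  have hi : ∀ {u u' : F}, (‖u‖ < 1 ∧ u' = 0 ∨ 1 ≤ ‖u‖ ∧ u' = u) → ‖-u'⁻¹‖ ≤ 1 := by
    rintro u u' (⟨_, rfl⟩ | ⟨h, rfl⟩)
    · simp
    · rw [norm_neg, norm_inv]
      exact inv_le_one_of_one_le₀ h
  have g := lowerSection_add_mul_diagonal (ω := ω) (χ := χ) a (C u₁' u₂' u₃') D
    ![-u₁'⁻¹, -u₂'⁻¹, -u₃'⁻¹] (fun i => by
      fin_cases i
      exacts [hi h₁, hi h₂, hi h₃])
  rw [← f3, ← f2, ← f1] at g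
  convert g.symm using 1
  · congr 1 <;> ext i j <;> fin_cases i <;> fin_cases j <;> simp [C, cellLower, hD, cell] <;> ring
  · congr 1
    ext i j
    rw [Matrix.add_apply, Matrix.mul_diagonal]
    fin_cases i <;> fin_cases j <;> simp [C, cellLower, hD] <;> ring

variable {ϖ : Fˣ}

theorem lowerSection_ord (hϖ : IsUniformizer ϖ) (hω : IsUnramified ω) (hχ : IsUnramified χ)
    (ν Y t₁ t₂ t₃ : Fˣ) {C D z : Matrix (Fin 3) (Fin 3) F}
    (h : C.det = (Y : F) / (t₁ * t₂ * t₃)) (hz : C * z = D) :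
    lowerSection ω χ ν C D =
      (ω ϖ : ℂ) ^ (ord ϖ (ν : F) + ord ϖ (t₁ : F) + ord ϖ (t₂ : F) + ord ϖ (t₃ : F)
        - ord ϖ (Y : F)) *
      ((χ ϖ : ℂ) * (‖(ϖ : F)‖ : ℂ)) ^ (3 * ord ϖ (ν : F) + 2 * (ord ϖ (t₁ : F) + ord ϖ (t₂ : F)
        + ord ϖ (t₃ : F)) - 2 * ord ϖ (Y : F)) * integralIndicator z := by
  have hδ : C.det = ((Y / (t₁ * t₂ * t₃) : Fˣ) : F) := by rw [h]; simp
  rw [lowerSection_of_det ν _ hδ hz, hω.coe_apply hϖ (ν / _), hχ.coe_apply hϖ (ν ^ 3 / _),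
    hϖ.norm_eq (Units.ne_zero (ν ^ 3 / _)), Complex.ofReal_zpow, mul_zpow, mul_assoc (_ ^ _)]
  have e1 : ord ϖ ((Y / (t₁ * t₂ * t₃) : Fˣ) : F) = ord ϖ (Y : F) -
      (ord ϖ (t₁ : F) + ord ϖ (t₂ : F) + ord ϖ (t₃ : F)) := by
    rw [Units.val_div_eq_div_val, hϖ.ord_div Y.ne_zero (Units.ne_zero _), Units.val_mul,
      hϖ.ord_mul (Units.ne_zero _) (Units.ne_zero _), Units.val_mul,
      hϖ.ord_mul (Units.ne_zero _) (Units.ne_zero _)]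
  have e2 : ord ϖ ((ν / (Y / (t₁ * t₂ * t₃)) : Fˣ) : F) = ord ϖ (ν : F) + ord ϖ (t₁ : F) +
      ord ϖ (t₂ : F) + ord ϖ (t₃ : F) - ord ϖ (Y : F) := by
    rw [Units.val_div_eq_div_val, hϖ.ord_div ν.ne_zero (Units.ne_zero _), e1]
    ring
  have e3 : ord ϖ ((ν ^ 3 / (Y / (t₁ * t₂ * t₃)) ^ 2 : Fˣ) : F) = 3 * ord ϖ (ν : F) +
      2 * (ord ϖ (t₁ : F) + ord ϖ (t₂ : F) + ord ϖ (t₃ : F)) - 2 * ord ϖ (Y : F) := by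
    rw [Units.val_div_eq_div_val, hϖ.ord_div (Units.ne_zero _) (Units.ne_zero _),
      Units.val_pow_eq_pow_val, Units.val_pow_eq_pow_val, hϖ.ord_pow (Units.ne_zero _),
      hϖ.ord_pow (Units.ne_zero _), e1]
    push_cast
    ring
  rw [e2, e3]

/-- The matrix is -(a/X) t tᵗ: the order of an off-diagonal entry is the mean of the orders of two
diagonal ones, so the diagonal decides integrality. -/
theorem integralIndicator_big (hϖ : IsUniformizer ϖ) (a X : Fˣ) (t : Fin 3 → Fˣ) :
    integralIndicator (of fun i j => -((a : F) * t i * t j / X)) =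
      if ∀ i, ord ϖ (X : F) ≤ ord ϖ (a : F) + 2 * ord ϖ (t i : F) then 1 else 0 := by
  have h : ∀ i j, ‖-((a : F) * t i * t j / X)‖ ≤ 1 ↔
      ord ϖ (X : F) ≤ ord ϖ (a : F) + ord ϖ (t i : F) + ord ϖ (t j : F) := by
    intro i j
    rw [norm_neg, hϖ.norm_le_one_iff (by simp), hϖ.ord_div (by simp) (by simp),
      hϖ.ord_mul (by simp) (by simp), hϖ.ord_mul (by simp) (by simp)]
    lia
  rw [integralIndicator]
  refine if_congr ?_ rfl rfl
  simp only [of_apply, h]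
  refine ⟨fun h i => by have := h i i; lia, fun h i j => ?_⟩
  have h1 := h i
  have h2 := h j
  lia

theorem integralIndicator_low (hϖ : IsUniformizer ϖ) (a X : Fˣ) (t : Fin 3 → Fˣ) (i : Fin 3) :
    integralIndicator (of fun j k => if j = i then if k = i then (X : F) / (a * t i ^ 2)
        else -(t k / t i : F) else if k = i then -(t j / t i : F) else 0) =
      if ord ϖ (a : F) + 2 * ord ϖ (t i : F) ≤ ord ϖ (X : F) ∧
        ∀ j, ord ϖ (t i : F) ≤ ord ϖ (t j : F) then 1 else 0 := by
  have h1 : ∀ j, ‖-(t j / t i : F)‖ ≤ 1 ↔ ord ϖ (t i : F) ≤ ord ϖ (t j : F) := by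
    intro j
    rw [norm_neg, hϖ.norm_le_one_iff (by simp), hϖ.ord_div (by simp) (by simp), sub_nonneg]
  have h2 : ‖(X : F) / (a * t i ^ 2)‖ ≤ 1 ↔
      ord ϖ (a : F) + 2 * ord ϖ (t i : F) ≤ ord ϖ (X : F) := by
    rw [hϖ.norm_le_one_iff (by simp), hϖ.ord_div (by simp) (by simp), sub_nonneg,
      hϖ.ord_mul (by simp) (by simp), hϖ.ord_pow (by simp)]
    push_cast
    rfl
  rw [integralIndicator]
  refine if_congr ?_ rfl rfl
  simp only [of_apply]
  constructor
  · intro h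
    refine ⟨h2.1 (by simpa only [if_true] using h i i), fun j => ?_⟩
    by_cases hj : j = i
    · rw [hj]
    · simpa only [hj, if_false, if_true, h1] using h j i
  · rintro ⟨h, h'⟩ j k
    split_ifs
    · exact h2.2 h
    · exact (h1 k).2 (h' k)
    · exact (h1 j).2 (h' j)
    · simp

/-- The value of the section in terms of orders: `α`, `τᵢ`, `n` are the orders of `a`, `tᵢ`, `X`,
and `N` the order of the leading term of `X, a t₁², a t₂², a t₃²`. -/
def sectionValue (w c : ℂ) (α τ₁ τ₂ τ₃ N n : ℤ) : ℂ :=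
  if N ≤ n ∧ N ≤ α + 2 * τ₁ ∧ N ≤ α + 2 * τ₂ ∧ N ≤ α + 2 * τ₃ then
    w ^ (α + τ₁ + τ₂ + τ₃ - N) * c ^ (3 * α + 2 * (τ₁ + τ₂ + τ₃) - 2 * N) else 0

theorem lowerSection_low (hϖ : IsUniformizer ϖ) (hω : IsUnramified ω) (hχ : IsUnramified χ)
    (a X : Fˣ) (t : Fin 3 → Fˣ) (i : Fin 3) {C D : Matrix (Fin 3) (Fin 3) F}
    (h : C.det = ((a * t i ^ 2 : Fˣ) : F) / (t 0 * t 1 * t 2))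
    (hz : C * (of fun j k => if j = i then if k = i then (X : F) / (a * t i ^ 2)
        else -(t k / t i : F) else if k = i then -(t j / t i : F) else 0) = D) :
    lowerSection ω χ a C D = sectionValue (ω ϖ) ((χ ϖ : ℂ) * (‖(ϖ : F)‖ : ℂ)) (ord ϖ (a : F))
      (ord ϖ (t 0 : F)) (ord ϖ (t 1 : F)) (ord ϖ (t 2 : F))
      (ord ϖ (a : F) + 2 * ord ϖ (t i : F)) (ord ϖ (X : F)) := by
  have e : ord ϖ ((a * t i ^ 2 : Fˣ) : F) = ord ϖ (a : F) + 2 * ord ϖ (t i : F) := by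
    rw [Units.val_mul, hϖ.ord_mul a.ne_zero (Units.ne_zero _), Units.val_pow_eq_pow_val,
      hϖ.ord_pow (Units.ne_zero _)]
    rfl
  rw [lowerSection_ord hϖ hω hχ a _ _ _ _ h hz, integralIndicator_low hϖ, e, sectionValue,
    mul_ite, mul_one, mul_zero]
  refine if_congr ?_ rfl rfl
  simp only [Fin.forall_fin_succ, Fin.forall_fin_zero, and_true, Fin.succ_zero_eq_one,
    Fin.succ_one_eq_two]
  refine and_congr_right fun _ => and_congr ?_ (and_congr ?_ ?_) <;> constructor <;> intro h <;> lia

/-- The origin of the shear: with t = (1/u₁, b/u₂, c/u₃) the lower left block has determinant X /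
(t₁t₂t₃), where X = x + at₁²u₁ + at₂²u₂ + at₃²u₃, and after the simplification C⁻¹ D is -(a/X) t tᵗ.
-/
theorem hZero_cell_big [IsUltrametricDist F] (hϖ : IsUniformizer ϖ) (hω : IsUnramified ω) (hχ : IsUnramified χ)
    (X a b c u₁ u₂ u₃ : Fˣ) (h₁ : 1 ≤ ‖(u₁ : F)‖) (h₂ : 1 ≤ ‖(u₂ : F)‖)
    (h₃ : 1 ≤ ‖(u₃ : F)‖) :
    hZero ω χ (eta F * iota (cell ((X : F) - (a / u₁ + a * b ^ 2 / u₂ + a * c ^ 2 / u₃),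
      (a, b, c), ((u₁ : F), (u₂ : F), (u₃ : F))))) =
    sectionValue (ω ϖ) ((χ ϖ : ℂ) * (‖(ϖ : F)‖ : ℂ)) (ord ϖ (a : F)) (-ord ϖ (u₁ : F))
      (ord ϖ (b : F) - ord ϖ (u₂ : F)) (ord ϖ (c : F) - ord ϖ (u₃ : F)) (ord ϖ (X : F))
      (ord ϖ (X : F)) := by
  rw [hZero_cell hω hχ _ a b c _ _ _ u₁ u₂ u₃ (Or.inr ⟨h₁, rfl⟩) (Or.inr ⟨h₂, rfl⟩)
    (Or.inr ⟨h₃, rfl⟩),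
    lowerSection_ord hϖ hω hχ a X u₁⁻¹ (b / u₂) (c / u₃)
      (z := of fun i j => -((a : F) * (![u₁⁻¹, b / u₂, c / u₃] i : Fˣ) *
        (![u₁⁻¹, b / u₂, c / u₃] j : Fˣ) / X)), integralIndicator_big hϖ]
  · simp only [Fin.forall_fin_succ, Units.val_inv_eq_inv_val, Units.val_div_eq_div_val,
      hϖ.ord_inv u₁.ne_zero, hϖ.ord_div b.ne_zero u₂.ne_zero, hϖ.ord_div c.ne_zero u₃.ne_zero]
    simp [sectionValue, hϖ.ord_inv, hϖ.ord_div]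
  · simp [cellLower, det_fin_three]
    field_simp
    ring
  · ext i j
    fin_cases i <;> fin_cases j <;>
      simp [cellLower, Matrix.mul_apply, Fin.sum_univ_three] <;> field_simp <;> ring

/-- With u₁ replaced by 0 and t₁ = 1, the term a t₁² takes over the role of X: the determinant is a
t₁² / (t₁t₂t₃), and X survives only in one entry of C⁻¹ D. The cases of a small u₂ or u₃ are the
same with t₂ = b or t₃ = c. -/
theorem hZero_cell_low1 [IsUltrametricDist F] (hϖ : IsUniformizer ϖ) (hω : IsUnramified ω) (hχ : IsUnramified χ)
    (X a b c u₁ u₂ u₃ : Fˣ) (h₁ : ‖(u₁ : F)‖ < 1) (h₂ : 1 ≤ ‖(u₂ : F)‖)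
    (h₃ : 1 ≤ ‖(u₃ : F)‖) :
    hZero ω χ (eta F * iota (cell ((X : F) - (a * b ^ 2 / u₂ + a * c ^ 2 / u₃),
      (a, b, c), ((u₁ : F), (u₂ : F), (u₃ : F))))) =
    sectionValue (ω ϖ) ((χ ϖ : ℂ) * (‖(ϖ : F)‖ : ℂ)) (ord ϖ (a : F)) 0
      (ord ϖ (b : F) - ord ϖ (u₂ : F)) (ord ϖ (c : F) - ord ϖ (u₃ : F))
      (ord ϖ (a : F)) (ord ϖ (X : F)) := by
  rw [hZero_cell hω hχ _ a b c _ _ _ 0 u₂ u₃ (Or.inl ⟨h₁, rfl⟩) (Or.inr ⟨h₂, rfl⟩) (Or.inr ⟨h₃, rfl⟩),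
    lowerSection_low hϖ hω hχ a X ![1, b / u₂, c / u₃] 0]
  · simp [hϖ.ord_inv, hϖ.ord_div, hϖ.ord_one]
  · simp [cellLower, det_fin_three]
    field_simp
  · ext i j
    fin_cases i <;> fin_cases j <;>
      simp [cellLower, Matrix.mul_apply, Fin.sum_univ_three] <;> field_simp <;> ring

theorem hZero_cell_low2 [IsUltrametricDist F] (hϖ : IsUniformizer ϖ) (hω : IsUnramified ω) (hχ : IsUnramified χ)
    (X a b c u₁ u₂ u₃ : Fˣ) (h₁ : 1 ≤ ‖(u₁ : F)‖) (h₂ : ‖(u₂ : F)‖ < 1)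
    (h₃ : 1 ≤ ‖(u₃ : F)‖) :
    hZero ω χ (eta F * iota (cell ((X : F) - (a / u₁ + a * c ^ 2 / u₃),
      (a, b, c), ((u₁ : F), (u₂ : F), (u₃ : F))))) =
    sectionValue (ω ϖ) ((χ ϖ : ℂ) * (‖(ϖ : F)‖ : ℂ)) (ord ϖ (a : F)) (-ord ϖ (u₁ : F))
      (ord ϖ (b : F)) (ord ϖ (c : F) - ord ϖ (u₃ : F))
      (ord ϖ (a : F) + 2 * ord ϖ (b : F)) (ord ϖ (X : F)) := by
  rw [hZero_cell hω hχ _ a b c _ _ _ u₁ 0 u₃ (Or.inr ⟨h₁, rfl⟩) (Or.inl ⟨h₂, rfl⟩) (Or.inr ⟨h₃, rfl⟩),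
    lowerSection_low hϖ hω hχ a X ![u₁⁻¹, b, c / u₃] 1]
  · simp [hϖ.ord_inv, hϖ.ord_div, hϖ.ord_one]
  · simp [cellLower, det_fin_three]
    field_simp
  · ext i j
    fin_cases i <;> fin_cases j <;>
      simp [cellLower, Matrix.mul_apply, Fin.sum_univ_three] <;> field_simp <;> ring

theorem hZero_cell_low3 [IsUltrametricDist F] (hϖ : IsUniformizer ϖ) (hω : IsUnramified ω) (hχ : IsUnramified χ)
    (X a b c u₁ u₂ u₃ : Fˣ) (h₁ : 1 ≤ ‖(u₁ : F)‖) (h₂ : 1 ≤ ‖(u₂ : F)‖)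
    (h₃ : ‖(u₃ : F)‖ < 1) :
    hZero ω χ (eta F * iota (cell ((X : F) - (a / u₁ + a * b ^ 2 / u₂),
      (a, b, c), ((u₁ : F), (u₂ : F), (u₃ : F))))) =
    sectionValue (ω ϖ) ((χ ϖ : ℂ) * (‖(ϖ : F)‖ : ℂ)) (ord ϖ (a : F)) (-ord ϖ (u₁ : F))
      (ord ϖ (b : F) - ord ϖ (u₂ : F)) (ord ϖ (c : F))
      (ord ϖ (a : F) + 2 * ord ϖ (c : F)) (ord ϖ (X : F)) := by
  rw [hZero_cell hω hχ _ a b c _ _ _ u₁ u₂ 0 (Or.inr ⟨h₁, rfl⟩) (Or.inr ⟨h₂, rfl⟩) (Or.inl ⟨h₃, rfl⟩),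
    lowerSection_low hϖ hω hχ a X ![u₁⁻¹, b / u₂, c] 2]
  · simp [hϖ.ord_inv, hϖ.ord_div, hϖ.ord_one]
  · simp [cellLower, det_fin_three]
    field_simp
  · ext i j
    fin_cases i <;> fin_cases j <;>
      simp [cellLower, Matrix.mul_apply, Fin.sum_univ_three] <;> field_simp <;> ring

theorem lowerSection_cellLower_eq_zero (ν : Fˣ) (x : F) (a b c : Fˣ) (u₁ u₂ u₃ : F)
    {D : Matrix (Fin 3) (Fin 3) F} (h : u₁ = 0 ∧ u₂ = 0 ∨ u₁ = 0 ∧ u₃ = 0 ∨ u₂ = 0 ∧ u₃ = 0) :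
    lowerSection ω χ ν (cellLower x a b c u₁ u₂ u₃) D = 0 := by
  refine lowerSection_of_det_eq_zero ν ?_
  obtain ⟨rfl, rfl⟩ | ⟨rfl, rfl⟩ | ⟨rfl, rfl⟩ := h <;> simp [cellLower, det_fin_three]

/-- Two small coordinates can both be replaced by 0, and the lower left block is then singular. -/
theorem hZero_cell_zero [IsUltrametricDist F] (hω : IsUnramified ω) (hχ : IsUnramified χ) (x : F)
    (a b c : Fˣ) (u₁ u₂ u₃ : F)
    (h : ‖u₁‖ < 1 ∧ ‖u₂‖ < 1 ∨ ‖u₁‖ < 1 ∧ ‖u₃‖ < 1 ∨ ‖u₂‖ < 1 ∧ ‖u₃‖ < 1) :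
    hZero ω χ (eta F * iota (cell (x, (a, b, c), (u₁, u₂, u₃)))) = 0 := by
  classical
  have hu : ∀ u : F, ∃ u', (‖u‖ < 1 ∧ u' = 0 ∨ 1 ≤ ‖u‖ ∧ u' = u) ∧ (‖u‖ < 1 → u' = 0) := by
    intro u
    by_cases hu : ‖u‖ < 1
    · exact ⟨0, Or.inl ⟨hu, rfl⟩, fun _ => rfl⟩
    · exact ⟨u, Or.inr ⟨not_lt.1 hu, rfl⟩, fun h => absurd h hu⟩
  obtain ⟨v₁, h₁, k₁⟩ := hu u₁
  obtain ⟨v₂, h₂, k₂⟩ := hu u₂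
  obtain ⟨v₃, h₃, k₃⟩ := hu u₃
  rw [hZero_cell hω hχ x a b c _ _ _ v₁ v₂ v₃ h₁ h₂ h₃,
    lowerSection_cellLower_eq_zero _ _ _ _ _ _ _ _ (h.imp (fun h => ⟨k₁ h.1, k₂ h.2⟩)
      (Or.imp (fun h => ⟨k₁ h.1, k₃ h.2⟩) fun h => ⟨k₂ h.1, k₃ h.2⟩))]

end EtaIota


/-! ### The integral as a sum over shells -/

section ShellSum

variable {F : Type*} [NontriviallyNormedField F] {ϖ : Fˣ}

/-- The set of coordinates `(x, (a, b, c), (u₁, u₂, u₃))` with given orders. -/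
def cellShell (ϖ : Fˣ) (k : ℤ × (ℤ × ℤ × ℤ) × (ℤ × ℤ × ℤ)) :
    Set (F × (Fˣ × Fˣ × Fˣ) × (F × F × F)) :=
  {x | ‖x‖ = ‖(ϖ : F)‖ ^ k.1} ×ˢ
    ({t : Fˣ | ‖(t : F)‖ = ‖(ϖ : F)‖ ^ k.2.1.1} ×ˢ {t : Fˣ | ‖(t : F)‖ = ‖(ϖ : F)‖ ^ k.2.1.2.1} ×ˢ
      {t : Fˣ | ‖(t : F)‖ = ‖(ϖ : F)‖ ^ k.2.1.2.2}) ×ˢ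
    ({u | ‖u‖ = ‖(ϖ : F)‖ ^ k.2.2.1} ×ˢ {u | ‖u‖ = ‖(ϖ : F)‖ ^ k.2.2.2.1} ×ˢ
      {u | ‖u‖ = ‖(ϖ : F)‖ ^ k.2.2.2.2})

/-- The volume of the sphere of order `k` in `F`. -/
def shellVol (r : ℝ) (k : ℤ) : ℝ := r ^ k * (1 - r)

theorem mem_cellShell_iff (hϖ : IsUniformizer ϖ) (k : ℤ × (ℤ × ℤ × ℤ) × (ℤ × ℤ × ℤ))
    (p : F × (Fˣ × Fˣ × Fˣ) × (F × F × F)) :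
    p ∈ cellShell ϖ k ↔ p.1 ≠ 0 ∧ p.2.2.1 ≠ 0 ∧ p.2.2.2.1 ≠ 0 ∧ p.2.2.2.2 ≠ 0 ∧
      k = (ord ϖ p.1, (ord ϖ (p.2.1.1 : F), ord ϖ (p.2.1.2.1 : F), ord ϖ (p.2.1.2.2 : F)),
        (ord ϖ p.2.2.1, ord ϖ p.2.2.2.1, ord ϖ p.2.2.2.2)) := by
  have h1 : ∀ (x : F) (k : ℤ), ‖x‖ = ‖(ϖ : F)‖ ^ k ↔ x ≠ 0 ∧ k = ord ϖ x := by
    intro x k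
    constructor
    · intro h
      exact ⟨norm_pos_iff.1 (h ▸ zpow_pos (norm_unit_pos ϖ) k), (hϖ.ord_eq h).symm⟩
    · rintro ⟨h, rfl⟩
      exact hϖ.norm_eq h
  obtain ⟨x, ⟨a, b, c⟩, u, v, w⟩ := p
  obtain ⟨k, ⟨k1, k2, k3⟩, k4, k5, k6⟩ := k
  simp only [cellShell, Set.mem_prod, Set.mem_ofPred_eq, h1, Prod.mk.injEq, Units.ne_zero, ne_eq,
    not_false_eq_true, true_and]
  tauto

variable [MeasurableSpace F] [BorelSpace F]

theorem measurableSet_cellShell (k : ℤ × (ℤ × ℤ × ℤ) × (ℤ × ℤ × ℤ)) :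
    MeasurableSet (cellShell ϖ k) :=
  (measurableSet_shell _).prod (((measurableSet_unitShell _).prod ((measurableSet_unitShell _).prod
    (measurableSet_unitShell _))).prod ((measurableSet_shell _).prod ((measurableSet_shell _).prod
    (measurableSet_shell _))))

variable [IsUltrametricDist F] [LocallyCompactSpace F]

/-- The shells partition the domain up to the null set where an additive coordinate vanishes. On
each shell the integrand is ψ of the first coordinate times a constant; its absolute integral sees
the volume `shellVol` of the first sphere, while its integral sees the character sum `shellChar`. -/
theorem integrable_of_cellShell (hϖ : IsUniformizer ϖ)
    (hnorm : ‖(ϖ : F)‖ = (residueCard F : ℝ)⁻¹) (dx : Measure F) [dx.IsAddHaarMeasure]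
    (hdx : dx {x | ‖x‖ ≤ 1} = 1) (dt : Measure Fˣ) [dt.IsHaarMeasure]
    (hdt : dt {t | ‖(t : F)‖ = 1} = 1)
    {ψ : AddChar F Circle} (hψ : ∀ x : F, ‖x‖ ≤ 1 → ψ x = 1)
    (hψ' : ∃ x : F, ‖x‖ ≤ ‖(ϖ : F)‖⁻¹ ∧ ψ x ≠ 1)
    (f : F × (Fˣ × Fˣ × Fˣ) × (F × F × F) → ℂ) (g : ℤ × (ℤ × ℤ × ℤ) × (ℤ × ℤ × ℤ) → ℂ)
    (hf : ∀ k, ∀ p ∈ cellShell ϖ k, f p = (ψ p.1 : ℂ) * g k)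
    (hg : Summable fun k => ‖g k‖ * (shellVol ‖(ϖ : F)‖ k.1 * (shellVol ‖(ϖ : F)‖ k.2.2.1 *
      (shellVol ‖(ϖ : F)‖ k.2.2.2.1 * shellVol ‖(ϖ : F)‖ k.2.2.2.2)))) :
    Integrable f (cellMeasure dx dt) ∧ ∫ p, f p ∂(cellMeasure dx dt) =
      ∑' k, g k * (shellChar ‖(ϖ : F)‖ k.1 * ((shellVol ‖(ϖ : F)‖ k.2.2.1 *
      (shellVol ‖(ϖ : F)‖ k.2.2.2.1 * shellVol ‖(ϖ : F)‖ k.2.2.2.2) : ℝ) : ℂ)) := by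
  have : ProperSpace F := ProperSpace.of_locallyCompactSpace F
  have := sigmaFinite_units hϖ dt hdt
  set μ := cellMeasure dx dt with hμ
  have hreal : ∀ k, dx.real {x | ‖x‖ = ‖(ϖ : F)‖ ^ k} = shellVol ‖(ϖ : F)‖ k :=
    measureReal_shell hϖ hnorm dx hdx
  have hreal' : ∀ k : ℤ, dt.real {t | ‖(t : F)‖ = ‖(ϖ : F)‖ ^ k} = 1 := fun k => by
    rw [Measure.real, measure_unitShell dt hdt, ENNReal.toReal_one]
  have hfin := measure_shell_lt_top hϖ hnorm dx hdx
  have hae : ∀ᵐ p ∂μ, p ∈ ⋃ k, cellShell ϖ k := by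
    have h0 : ∀ᵐ x ∂dx, x ≠ 0 := Measure.ae_ne dx 0
    have h1 : ∀ᵐ p ∂μ, p.1 ≠ 0 := Measure.quasiMeasurePreserving_fst.ae h0
    have h2 : ∀ᵐ p ∂μ, p.2.2.1 ≠ 0 := Measure.quasiMeasurePreserving_snd.ae
      (Measure.quasiMeasurePreserving_snd.ae (Measure.quasiMeasurePreserving_fst.ae h0))
    have h3 : ∀ᵐ p ∂μ, p.2.2.2.1 ≠ 0 := Measure.quasiMeasurePreserving_snd.ae
      (Measure.quasiMeasurePreserving_snd.ae (Measure.quasiMeasurePreserving_snd.ae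
        (Measure.quasiMeasurePreserving_fst.ae h0)))
    have h4 : ∀ᵐ p ∂μ, p.2.2.2.2 ≠ 0 := Measure.quasiMeasurePreserving_snd.ae
      (Measure.quasiMeasurePreserving_snd.ae (Measure.quasiMeasurePreserving_snd.ae
        (Measure.quasiMeasurePreserving_snd.ae h0)))
    filter_upwards [h1, h2, h3, h4] with p h1 h2 h3 h4
    exact Set.mem_iUnion.2 ⟨_, (mem_cellShell_iff hϖ _ p).2 ⟨h1, h2, h3, h4, rfl⟩⟩
  have hrestrict : μ.restrict (⋃ k, cellShell ϖ k) = μ :=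
    Measure.restrict_eq_self_of_ae_mem hae
  have hdisj : Pairwise (Function.onFun Disjoint (cellShell (F := F) ϖ)) := by
    intro k l hkl
    refine Set.disjoint_left.2 fun p hk hl => hkl ?_
    rw [mem_cellShell_iff hϖ] at hk hl
    rw [hk.2.2.2.2, hl.2.2.2.2]
  have hvol : ∀ k, μ (cellShell ϖ k) < ⊤ := by
    intro k
    rw [hμ, cellMeasure, cellShell]
    simp only [Measure.prod_prod, measure_unitShell dt hdt, one_mul]
    exact ENNReal.mul_lt_top (hfin _) (ENNReal.mul_lt_top (hfin _)
      (ENNReal.mul_lt_top (hfin _) (hfin _)))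
  have hreal2 : ∀ k, μ.real (cellShell ϖ k) = shellVol ‖(ϖ : F)‖ k.1 * (shellVol ‖(ϖ : F)‖ k.2.2.1 *
      (shellVol ‖(ϖ : F)‖ k.2.2.2.1 * shellVol ‖(ϖ : F)‖ k.2.2.2.2)) := by
    intro k
    rw [hμ, cellMeasure, cellShell]
    simp only [measureReal_prod_prod, hreal, hreal', one_mul]
  have hint : ∀ k, IntegrableOn f (cellShell ϖ k) μ := by
    intro k
    refine IntegrableOn.congr_fun (f := fun p => (ψ p.1 : ℂ) * g k) ?_
      (fun p hp => (hf k p hp).symm) (measurableSet_cellShell k)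
    refine Measure.integrableOn_of_bounded (M := ‖g k‖) (hvol k).ne ?_
      (Filter.Eventually.of_forall fun p => ?_)
    · exact (((continuous_of_trivial hψ).measurable.comp measurable_fst).mul_const
        _).aestronglyMeasurable
    · rw [norm_mul, Circle.norm_coe, one_mul]
  have hnormint : ∀ k, ∫ p in cellShell ϖ k, ‖f p‖ ∂μ = ‖g k‖ * μ.real (cellShell ϖ k) := by
    intro k
    rw [setIntegral_congr_fun (g := fun _ => ‖g k‖) (measurableSet_cellShell k) (fun p hp => by
      rw [hf k p hp, norm_mul, Circle.norm_coe, one_mul]), setIntegral_const, smul_eq_mul, mul_comm]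
  have hI : IntegrableOn f (⋃ k, cellShell ϖ k) μ := by
    refine integrableOn_iUnion_of_summable_integral_norm hint ?_
    simpa only [hnormint, hreal2] using hg
  have hterm : ∀ k, ∫ p in cellShell ϖ k, f p ∂μ = g k * (shellChar ‖(ϖ : F)‖ k.1 *
      ((shellVol ‖(ϖ : F)‖ k.2.2.1 *
        (shellVol ‖(ϖ : F)‖ k.2.2.2.1 * shellVol ‖(ϖ : F)‖ k.2.2.2.2) : ℝ) : ℂ)) := by
    intro k
    rw [setIntegral_congr_fun (g := fun p => (ψ p.1 : ℂ) * g k) (measurableSet_cellShell k)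
      (fun p hp => hf k p hp), hμ, cellMeasure, cellShell,
      setIntegral_prod_mul (fun x => (ψ x : ℂ)) (fun _ => g k),
      setIntegral_shell_char hϖ hnorm dx hdx hψ hψ', setIntegral_const]
    simp only [measureReal_prod_prod, hreal, hreal', one_mul, Complex.real_smul]
    ring
  have hs := hasSum_integral_iUnion measurableSet_cellShell hdisj hI
  rw [hrestrict] at hs
  refine ⟨by rwa [IntegrableOn, hrestrict] at hI, ?_⟩
  rw [← hs.tsum_eq]
  exact tsum_congr hterm

/-- The integral of `f`, computed after the translation of the first coordinate by a function `s`
of the others. -/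
theorem integrable_of_cellShell_shear (hϖ : IsUniformizer ϖ)
    (hnorm : ‖(ϖ : F)‖ = (residueCard F : ℝ)⁻¹) (dx : Measure F) [dx.IsAddHaarMeasure]
    (hdx : dx {x | ‖x‖ ≤ 1} = 1) (dt : Measure Fˣ) [dt.IsHaarMeasure]
    (hdt : dt {t | ‖(t : F)‖ = 1} = 1)
    {ψ : AddChar F Circle} (hψ : ∀ x : F, ‖x‖ ≤ 1 → ψ x = 1)
    (hψ' : ∃ x : F, ‖x‖ ≤ ‖(ϖ : F)‖⁻¹ ∧ ψ x ≠ 1)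
    (f : F × (Fˣ × Fˣ × Fˣ) × (F × F × F) → ℂ) (g : ℤ × (ℤ × ℤ × ℤ) × (ℤ × ℤ × ℤ) → ℂ)
    (s : (Fˣ × Fˣ × Fˣ) × (F × F × F) → F) (hs : Measurable s)
    (hf : ∀ k, ∀ p ∈ cellShell ϖ k, f (p.1 - s p.2, p.2) = (ψ p.1 : ℂ) * g k)
    (hg : Summable fun k => ‖g k‖ * (shellVol ‖(ϖ : F)‖ k.1 * (shellVol ‖(ϖ : F)‖ k.2.2.1 *
      (shellVol ‖(ϖ : F)‖ k.2.2.2.1 * shellVol ‖(ϖ : F)‖ k.2.2.2.2)))) :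
    Integrable f (cellMeasure dx dt) ∧ ∫ p, f p ∂(cellMeasure dx dt) =
      ∑' k, g k * (shellChar ‖(ϖ : F)‖ k.1 * ((shellVol ‖(ϖ : F)‖ k.2.2.1 *
      (shellVol ‖(ϖ : F)‖ k.2.2.2.1 * shellVol ‖(ϖ : F)‖ k.2.2.2.2) : ℝ) : ℂ)) := by
  obtain ⟨hI, hv⟩ := integrable_of_cellShell hϖ hnorm dx hdx dt hdt hψ hψ'
    (fun p => f (p.1 - s p.2, p.2)) g hf hg
  have : ProperSpace F := ProperSpace.of_locallyCompactSpace F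
  have := sigmaFinite_units hϖ dt hdt
  -- For fixed values of the other coordinates this is a translation of F. The swaps bring the base
  -- of the skew product into first place.
  have hmp : MeasurePreserving (fun p : F × (Fˣ × Fˣ × Fˣ) × (F × F × F) => (p.1 + s p.2, p.2))
      (cellMeasure dx dt) (cellMeasure dx dt) := by
    have h1 := (MeasurePreserving.id ((dt.prod (dt.prod dt)).prod (dx.prod (dx.prod dx)))).skew_product
      (μc := dx) (μd := dx) (g := fun y x => x + s y)
      (measurable_snd.add (hs.comp measurable_fst))
      (Filter.Eventually.of_forall fun y => map_add_right_eq_self dx (s y))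
    exact (Measure.measurePreserving_swap.comp h1).comp Measure.measurePreserving_swap
  have he : (fun p : F × (Fˣ × Fˣ × Fˣ) × (F × F × F) => f (p.1 - s p.2, p.2)) ∘
      (fun p => (p.1 + s p.2, p.2)) = f := by
    funext p
    simp
  constructor
  · rw [← he]
    exact hmp.integrable_comp_of_integrable hI
  · rw [← hv]
    conv_rhs => rw [← hmp.map_eq]
    rw [integral_map hmp.measurable.aemeasurable (by rw [hmp.map_eq]; exact hI.1)]
    simp

end ShellSum


/-! ### The integrand as a function of orders -/

section Integrand

/-- The product of three local Whittaker values and of the section, in terms of orders. -/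
def shellTerm (w₁ w₂ w₃ c : ℂ) (P₁ P₂ P₃ : ℤ → ℂ) (α τ₁ τ₂ τ₃ N n : ℤ) : ℂ :=
  w₁ ^ (-τ₁) * P₁ (α + 2 * τ₁) * (w₂ ^ (-τ₂) * P₂ (α + 2 * τ₂)) *
    (w₃ ^ (-τ₃) * P₃ (α + 2 * τ₃)) * sectionValue (w₁ * w₂ * w₃) c α τ₁ τ₂ τ₃ N n

/-- Invariance under the centre: replacing a by a s⁻² and each tᵢ by s tᵢ multiplies every diag(a
tᵢ, tᵢ⁻¹) by the scalar s⁻¹. It serves to normalise τ₁ to 0. -/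
theorem shellTerm_shift {w₁ w₂ w₃ : ℂ} (h₁ : w₁ ≠ 0) (h₂ : w₂ ≠ 0) (h₃ : w₃ ≠ 0) (c : ℂ)
    (P₁ P₂ P₃ : ℤ → ℂ) (α τ₁ τ₂ τ₃ N n t : ℤ) :
    shellTerm w₁ w₂ w₃ c P₁ P₂ P₃ (α - 2 * t) (τ₁ + t) (τ₂ + t) (τ₃ + t) N n =
      shellTerm w₁ w₂ w₃ c P₁ P₂ P₃ α τ₁ τ₂ τ₃ N n := by
  have e : ∀ τ, α - 2 * t + 2 * (τ + t) = α + 2 * τ := fun τ => by ring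
  have e' : ∀ {x : ℂ} (τ : ℤ), x ≠ 0 → x ^ (-(τ + t)) = x ^ (-τ) / x ^ t := fun τ hx => by
    rw [neg_add', zpow_sub₀ hx]
  simp only [shellTerm, sectionValue, e, e' _ h₁, e' _ h₂, e' _ h₃]
  split_ifs
  · rw [show α - 2 * t + (τ₁ + t) + (τ₂ + t) + (τ₃ + t) - N = α + τ₁ + τ₂ + τ₃ - N + t by ring,
      show 3 * (α - 2 * t) + 2 * (τ₁ + t + (τ₂ + t) + (τ₃ + t)) - 2 * N =
        3 * α + 2 * (τ₁ + τ₂ + τ₃) - 2 * N by ring, zpow_add₀ (by simp [h₁, h₂, h₃]),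
      mul_zpow _ w₃ t, mul_zpow w₁ w₂ t]
    field_simp
  · simp

/-- The value of the integrand of the zeta integral on the set of coordinates of given orders,
up to a constant. -/
def cellCoeff (A₁ A₂ A₃ B₁ B₂ B₃ : ℤ → ℂ) (w₁ w₂ w₃ c : ℂ) (r : ℝ)
    (k : ℤ × (ℤ × ℤ × ℤ) × (ℤ × ℤ × ℤ)) : ℂ :=
  let n := k.1
  let α := k.2.1.1
  let β := k.2.1.2.1
  let γ := k.2.1.2.2
  let k₁ := k.2.2.1
  let k₂ := k.2.2.2.1
  let k₃ := k.2.2.2.2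
  let T := shellTerm w₁ w₂ w₃ c
  (r : ℂ) ^ (-(3 * α + 2 * β + 2 * γ)) *
    if k₁ ≤ 0 then
      if k₂ ≤ 0 then
        if k₃ ≤ 0 then T B₁ B₂ B₃ α (-k₁) (β - k₂) (γ - k₃) n n
        else T B₁ B₂ A₃ α (-k₁) (β - k₂) γ (α + 2 * γ) n
      else if k₃ ≤ 0 then T B₁ A₂ B₃ α (-k₁) β (γ - k₃) (α + 2 * β) n else 0
    else if k₂ ≤ 0 then
      if k₃ ≤ 0 then T A₁ B₂ B₃ α 0 (β - k₂) (γ - k₃) α n else 0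
    else 0

variable {F : Type*} [NontriviallyNormedField F]

/-- The inverse of `u` if `1 ≤ ‖u‖`, and zero otherwise. -/
def bigInv (u : F) : F := open Classical in if ‖u‖ < 1 then 0 else u⁻¹

/-- The translation which makes the integrand a multiple of `ψ(x)`. -/
def cellShear (y : (Fˣ × Fˣ × Fˣ) × (F × F × F)) : F :=
  y.1.1 * bigInv y.2.1 + y.1.1 * y.1.2.1 ^ 2 * bigInv y.2.2.1 +
    y.1.1 * y.1.2.2 ^ 2 * bigInv y.2.2.2

theorem measurable_cellShear [MeasurableSpace F] [BorelSpace F] [LocallyCompactSpace F] :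
    Measurable (cellShear (F := F)) := by
  have : ProperSpace F := ProperSpace.of_locallyCompactSpace F
  have h : Measurable (bigInv (F := F)) :=
    Measurable.ite (measurableSet_lt measurable_norm measurable_const) measurable_const
      measurable_inv
  have hu := measurable_units_val (F := F)
  unfold cellShear
  exact (((hu.comp (measurable_fst.comp measurable_fst)).mul
    (h.comp (measurable_fst.comp measurable_snd))).add
    (((hu.comp (measurable_fst.comp measurable_fst)).mul
      ((hu.comp (measurable_fst.comp (measurable_snd.comp measurable_fst))).pow_const 2)).mul
      (h.comp (measurable_fst.comp (measurable_snd.comp measurable_snd))))).add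
    (((hu.comp (measurable_fst.comp measurable_fst)).mul
      ((hu.comp (measurable_snd.comp (measurable_snd.comp measurable_fst))).pow_const 2)).mul
      (h.comp (measurable_snd.comp (measurable_snd.comp measurable_snd))))

variable {ϖ : Fˣ} {ψ : AddChar F Circle} {ω χ : Fˣ →* ℂˣ}

theorem IsLocalData.cell_low {W : GL (Fin 2) F → ℂ} {A B : ℤ → ℂ} {w : ℂ}
    (hW : IsLocalData ϖ ψ W A B w) (hϖ : IsUniformizer ϖ) (a b : Fˣ) (u : F) (hu : ‖u‖ < 1) :
    W (diagGL (a * b) b⁻¹ * nLow u) =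
      w ^ (-ord ϖ (b : F)) * A (ord ϖ (a : F) + 2 * ord ϖ (b : F)) := by
  have := hW.low (a * b) b⁻¹ 0 u hu
  rw [nUp_zero, one_mul, AddChar.map_zero_eq_one, Circle.coe_one, one_mul, Units.val_mul,
    Units.val_inv_eq_inv_val, hϖ.ord_mul a.ne_zero b.ne_zero, hϖ.ord_inv b.ne_zero] at this
  rw [this]
  congr 2
  ring

theorem IsLocalData.cell_big {W : GL (Fin 2) F → ℂ} {A B : ℤ → ℂ} {w : ℂ}
    (hW : IsLocalData ϖ ψ W A B w) (hϖ : IsUniformizer ϖ) (a b u : Fˣ) (hu : 1 ≤ ‖(u : F)‖) :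
    W (diagGL (a * b) b⁻¹ * nLow (u : F)) = (ψ (a * b ^ 2 / u) : ℂ) *
      (w ^ (-(ord ϖ (b : F) - ord ϖ (u : F))) *
        B (ord ϖ (a : F) + 2 * (ord ϖ (b : F) - ord ϖ (u : F)))) := by
  have := hW.big (a * b) b⁻¹ 0 u hu
  rw [nUp_zero, one_mul, zero_add, Units.val_mul,
    Units.val_inv_eq_inv_val, hϖ.ord_mul a.ne_zero b.ne_zero, hϖ.ord_inv b.ne_zero] at this
  rw [this, mul_assoc]
  congr 2
  · rw [show (a : F) * b / ((b : F)⁻¹ * u) = a * b ^ 2 / u by field_simp]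
  · congr 1
    ring
  · congr 1
    ring

theorem IsLocalData.cell_low_first {W : GL (Fin 2) F → ℂ} {A B : ℤ → ℂ} {w : ℂ}
    (hW : IsLocalData ϖ ψ W A B w) (hϖ : IsUniformizer ϖ) (a : Fˣ) (x u : F) (hu : ‖u‖ < 1) :
    W (nUp x * diagGL a 1 * nLow u) = (ψ x : ℂ) * (w ^ (-0 : ℤ) * A (ord ϖ (a : F) + 2 * 0)) := by
  rw [hW.low a 1 x u hu, Units.val_one, hϖ.ord_one]
  simp

theorem IsLocalData.cell_big_first {W : GL (Fin 2) F → ℂ} {A B : ℤ → ℂ} {w : ℂ}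
    (hW : IsLocalData ϖ ψ W A B w) (hϖ : IsUniformizer ϖ) (a u : Fˣ) (x : F)
    (hu : 1 ≤ ‖(u : F)‖) :
    W (nUp x * diagGL a 1 * nLow (u : F)) = (ψ (x + a / u) : ℂ) *
      (w ^ (-(-ord ϖ (u : F))) * B (ord ϖ (a : F) + 2 * (-ord ϖ (u : F)))) := by
  rw [hW.big a 1 x u hu, Units.val_one, hϖ.ord_one, mul_assoc]
  congr 2
  · rw [one_mul]
  · congr 1
    ring
  · congr 1
    ring

/-- Every large uᵢ contributes a value of ψ through the Whittaker function, and its argument is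
exactly the corresponding summand of `cellShear`. Together with ψ(x - shear) from the first factor
they give ψ(x). A small uᵢ contributes to neither. -/
theorem zetaIntegrand_cell [IsUltrametricDist F] (hϖ : IsUniformizer ϖ)
    (hnorm : ‖(ϖ : F)‖ = (residueCard F : ℝ)⁻¹) (hω : IsUnramified ω) (hχ : IsUnramified χ)
    {W : Fin 3 → GL (Fin 2) F → ℂ} {A B : Fin 3 → ℤ → ℂ} {w : Fin 3 → ℂ}
    (hW : ∀ i, IsLocalData ϖ ψ (W i) (A i) (B i) (w i)) (hw : (ω ϖ : ℂ) = w 0 * w 1 * w 2)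
    (k : ℤ × (ℤ × ℤ × ℤ) × (ℤ × ℤ × ℤ)) (p : F × (Fˣ × Fˣ × Fˣ) × (F × F × F))
    (hp : p ∈ cellShell ϖ k) :
    (cellWeight (p.1 - cellShear p.2, p.2) : ℂ) *
      zetaIntegrand W (hZero ω χ) (cell (p.1 - cellShear p.2, p.2)) =
    (ψ p.1 : ℂ) * (((1 + (‖(ϖ : F)‖ : ℂ)) ^ 3)⁻¹ * cellCoeff (A 0) (A 1) (A 2) (B 0) (B 1) (B 2)
      (w 0) (w 1) (w 2) ((χ ϖ : ℂ) * (‖(ϖ : F)‖ : ℂ)) ‖(ϖ : F)‖ k) := by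
  rw [mem_cellShell_iff hϖ] at hp
  obtain ⟨x, ⟨a, b, c⟩, u₁, u₂, u₃⟩ := p
  obtain ⟨hx, h1, h2, h3, rfl⟩ := hp
  lift x to Fˣ using hx.isUnit with X
  lift u₁ to Fˣ using h1.isUnit with v₁
  lift u₂ to Fˣ using h2.isUnit with v₂
  lift u₃ to Fˣ using h3.isUnit with v₃
  have hlt : ∀ v : Fˣ, ‖(v : F)‖ < 1 ↔ ¬ ord ϖ (v : F) ≤ 0 := fun v => by
    rw [hϖ.norm_lt_one_iff v.ne_zero]
    lia
  have hwt : ∀ y : F, (cellWeight (y, (a, b, c), ((v₁ : F), (v₂ : F), (v₃ : F))) : ℂ) =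
      ((1 + (‖(ϖ : F)‖ : ℂ)) ^ 3)⁻¹ * (‖(ϖ : F)‖ : ℂ) ^
        (-(3 * ord ϖ (a : F) + 2 * ord ϖ (b : F) + 2 * ord ϖ (c : F))) := by
    intro y
    have h0 : (‖(ϖ : F)‖ : ℂ) ≠ 0 := by simp
    have e : ∀ k n : ℤ, (‖(ϖ : F)‖ : ℂ) ^ (k * n) = ((‖(ϖ : F)‖ : ℂ) ^ n) ^ k := fun k n => by
      rw [mul_comm, _root_.zpow_mul]
    rw [cellWeight, ← hnorm, hϖ.norm_eq a.ne_zero, hϖ.norm_eq b.ne_zero, hϖ.norm_eq c.ne_zero,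
      _root_.zpow_neg, zpow_add₀ h0, zpow_add₀ h0, e 3, e 2, e 2]
    push_cast
    rfl
  rw [hwt]
  have hsum : ∀ y₁ y₂ y₃ : F, y₁ + y₂ + y₃ = X →
      (ψ X : ℂ) = (ψ y₁ : ℂ) * (ψ y₂ : ℂ) * (ψ y₃ : ℂ) := by
    intro y₁ y₂ y₃ h
    rw [← h, AddChar.map_add_eq_mul, AddChar.map_add_eq_mul, Circle.coe_mul, Circle.coe_mul]
  have hzero : ∀ z : F, ‖(v₁ : F)‖ < 1 ∧ ‖(v₂ : F)‖ < 1 ∨ ‖(v₁ : F)‖ < 1 ∧ ‖(v₃ : F)‖ < 1 ∨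
      ‖(v₂ : F)‖ < 1 ∧ ‖(v₃ : F)‖ < 1 → zetaIntegrand W (hZero ω χ)
        (cell (z, (a, b, c), ((v₁ : F), (v₂ : F), (v₃ : F)))) = 0 := fun z h => by
    rw [zetaIntegrand, hZero_cell_zero hω hχ _ _ _ _ _ _ _ h, mul_zero]
  -- Of the eight cases, the four with at least two small uᵢ vanish; each of the others belongs to
  -- one orbit.
  by_cases k₁ : ord ϖ (v₁ : F) ≤ 0 <;> by_cases k₂ : ord ϖ (v₂ : F) ≤ 0 <;>
    by_cases k₃ : ord ϖ (v₃ : F) ≤ 0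
  · have hs : cellShear ((a, b, c), ((v₁ : F), (v₂ : F), (v₃ : F))) =
        a / v₁ + a * b ^ 2 / v₂ + a * c ^ 2 / v₃ := by
      simp [cellShear, bigInv, hlt, k₁, k₂, k₃, div_eq_mul_inv]
    rw [zetaIntegrand, hs, hZero_cell_big hϖ hω hχ X a b c v₁ v₂ v₃ (not_lt.1 (mt (hlt v₁).1 (not_not.2 k₁)))
      (not_lt.1 (mt (hlt v₂).1 (not_not.2 k₂))) (not_lt.1 (mt (hlt v₃).1 (not_not.2 k₃))), hw]
    simp only [cell, cellCoeff, shellTerm, k₁, k₂, k₃, if_true, if_false]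
    rw [(hW 0).cell_big_first hϖ a v₁ _ (not_lt.1 (mt (hlt v₁).1 (not_not.2 k₁))), (hW 1).cell_big hϖ a b v₂ (not_lt.1 (mt (hlt v₂).1 (not_not.2 k₂))),
      (hW 2).cell_big hϖ a c v₃ (not_lt.1 (mt (hlt v₃).1 (not_not.2 k₃))),
      hsum (((X : F) - (a / v₁ + a * b ^ 2 / v₂ + a * c ^ 2 / v₃)) + a / v₁) (a * b ^ 2 / v₂) (a * c ^ 2 / v₃) (by ring)]
    ring
  · have hs : cellShear ((a, b, c), ((v₁ : F), (v₂ : F), (v₃ : F))) =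
        a / v₁ + a * b ^ 2 / v₂ := by
      simp [cellShear, bigInv, hlt, k₁, k₂, k₃, div_eq_mul_inv]
    rw [zetaIntegrand, hs, hZero_cell_low3 hϖ hω hχ X a b c v₁ v₂ v₃ (not_lt.1 (mt (hlt v₁).1 (not_not.2 k₁)))
      (not_lt.1 (mt (hlt v₂).1 (not_not.2 k₂))) ((hlt v₃).2 k₃), hw]
    simp only [cell, cellCoeff, shellTerm, k₁, k₂, k₃, if_true, if_false]
    rw [(hW 0).cell_big_first hϖ a v₁ _ (not_lt.1 (mt (hlt v₁).1 (not_not.2 k₁))), (hW 1).cell_big hϖ a b v₂ (not_lt.1 (mt (hlt v₂).1 (not_not.2 k₂))),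
      (hW 2).cell_low hϖ a c _ ((hlt v₃).2 k₃),
      hsum (((X : F) - (a / v₁ + a * b ^ 2 / v₂)) + a / v₁) (a * b ^ 2 / v₂) (0) (by ring)]
    simp only [AddChar.map_zero_eq_one, Circle.coe_one]
    ring
  · have hs : cellShear ((a, b, c), ((v₁ : F), (v₂ : F), (v₃ : F))) =
        a / v₁ + a * c ^ 2 / v₃ := by
      simp [cellShear, bigInv, hlt, k₁, k₂, k₃, div_eq_mul_inv]
    rw [zetaIntegrand, hs, hZero_cell_low2 hϖ hω hχ X a b c v₁ v₂ v₃ (not_lt.1 (mt (hlt v₁).1 (not_not.2 k₁)))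
      ((hlt v₂).2 k₂) (not_lt.1 (mt (hlt v₃).1 (not_not.2 k₃))), hw]
    simp only [cell, cellCoeff, shellTerm, k₁, k₂, k₃, if_true, if_false]
    rw [(hW 0).cell_big_first hϖ a v₁ _ (not_lt.1 (mt (hlt v₁).1 (not_not.2 k₁))), (hW 1).cell_low hϖ a b _ ((hlt v₂).2 k₂),
      (hW 2).cell_big hϖ a c v₃ (not_lt.1 (mt (hlt v₃).1 (not_not.2 k₃))),
      hsum (((X : F) - (a / v₁ + a * c ^ 2 / v₃)) + a / v₁) (0) (a * c ^ 2 / v₃) (by ring)]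
    simp only [AddChar.map_zero_eq_one, Circle.coe_one]
    ring
  · rw [hzero _ (Or.inr (Or.inr ⟨((hlt v₂).2 k₂), ((hlt v₃).2 k₃)⟩))]
    simp [cellCoeff, k₁, k₂, k₃]
  · have hs : cellShear ((a, b, c), ((v₁ : F), (v₂ : F), (v₃ : F))) =
        a * b ^ 2 / v₂ + a * c ^ 2 / v₃ := by
      simp [cellShear, bigInv, hlt, k₁, k₂, k₃, div_eq_mul_inv]
    rw [zetaIntegrand, hs, hZero_cell_low1 hϖ hω hχ X a b c v₁ v₂ v₃ ((hlt v₁).2 k₁)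
      (not_lt.1 (mt (hlt v₂).1 (not_not.2 k₂))) (not_lt.1 (mt (hlt v₃).1 (not_not.2 k₃))), hw]
    simp only [cell, cellCoeff, shellTerm, k₁, k₂, k₃, if_true, if_false]
    rw [(hW 0).cell_low_first hϖ a _ _ ((hlt v₁).2 k₁), (hW 1).cell_big hϖ a b v₂ (not_lt.1 (mt (hlt v₂).1 (not_not.2 k₂))),
      (hW 2).cell_big hϖ a c v₃ (not_lt.1 (mt (hlt v₃).1 (not_not.2 k₃))),
      hsum (((X : F) - (a * b ^ 2 / v₂ + a * c ^ 2 / v₃))) (a * b ^ 2 / v₂) (a * c ^ 2 / v₃) (by ring)]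
    ring
  · rw [hzero _ (Or.inr (Or.inl ⟨((hlt v₁).2 k₁), ((hlt v₃).2 k₃)⟩))]
    simp [cellCoeff, k₁, k₂, k₃]
  · rw [hzero _ (Or.inl ⟨((hlt v₁).2 k₁), ((hlt v₂).2 k₂)⟩)]
    simp [cellCoeff, k₁, k₂, k₃]
  · rw [hzero _ (Or.inl ⟨((hlt v₁).2 k₁), ((hlt v₂).2 k₂)⟩)]
    simp [cellCoeff, k₁, k₂, k₃]

end Integrand


/-! ### Summing out the orders of the uᵢ -/

section OrbitSum

/-- The change of variables which removes the orders of the `uᵢ` from the summand. -/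
def shiftEquiv : ℤ × (ℤ × ℤ × ℤ) × (ℤ × ℤ × ℤ) ≃ (ℤ × ℤ × ℤ) × (ℤ × ℤ × ℤ × ℤ) where
  toFun k := (k.2.2, (k.1, k.2.1.1 - 2 * min k.2.2.1 0,
    k.2.1.2.1 + min k.2.2.1 0 - min k.2.2.2.1 0, k.2.1.2.2 + min k.2.2.1 0 - min k.2.2.2.2 0))
  invFun p := (p.2.1, (p.2.2.1 + 2 * min p.1.1 0,
    p.2.2.2.1 - min p.1.1 0 + min p.1.2.1 0, p.2.2.2.2 - min p.1.1 0 + min p.1.2.2 0), p.1)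
  left_inv k := by
    obtain ⟨n, ⟨a, b, c⟩, k₁, k₂, k₃⟩ := k
    simp only [Prod.mk.injEq, and_true, true_and]
    refine ⟨?_, ?_, ?_⟩ <;> ring
  right_inv p := by
    obtain ⟨⟨k₁, k₂, k₃⟩, n, a, b, c⟩ := p
    simp only [Prod.mk.injEq, true_and]
    refine ⟨?_, ?_, ?_⟩ <;> ring

theorem hasSum_mul_of_summable_norm {𝕜 ι κ : Type*} [NormedField 𝕜] [CompleteSpace 𝕜] {f : ι → 𝕜}
    {g : κ → 𝕜} {a b : 𝕜} (hf : HasSum f a) (hf' : Summable fun i => ‖f i‖) (hg : HasSum g b)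
    (hg' : Summable fun i => ‖g i‖) : HasSum (fun p : ι × κ => f p.1 * g p.2) (a * b) :=
  hf.mul hg (summable_mul_of_summable_norm hf' hg')

theorem hasSum_shift {𝕜 : Type*} [NormedField 𝕜] [CompleteSpace 𝕜] {f₁ f₂ f₃ : ℤ → 𝕜}
    {s₁ s₂ s₃ : 𝕜} (h₁ : HasSum f₁ s₁) (h₂ : HasSum f₂ s₂) (h₃ : HasSum f₃ s₃)
    (h₁' : Summable fun i => ‖f₁ i‖) (h₂' : Summable fun i => ‖f₂ i‖)
    (h₃' : Summable fun i => ‖f₃ i‖) {V : ℤ × ℤ × ℤ × ℤ → 𝕜} (hV : Summable fun p => ‖V p‖) :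
    HasSum (fun k : ℤ × (ℤ × ℤ × ℤ) × (ℤ × ℤ × ℤ) => f₁ k.2.2.1 * (f₂ k.2.2.2.1 * f₃ k.2.2.2.2) *
      V (shiftEquiv k).2) (s₁ * (s₂ * s₃) * ∑' p, V p) := by
  have h₂₃ := hasSum_mul_of_summable_norm h₂ h₂' h₃ h₃'
  have h₂₃' := h₂'.mul_norm h₃'
  have h₁₂₃ := hasSum_mul_of_summable_norm h₁ h₁' h₂₃ h₂₃'
  have h₁₂₃' := h₁'.mul_norm h₂₃'
  have h := hasSum_mul_of_summable_norm h₁₂₃ h₁₂₃' hV.of_norm.hasSum hV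
  exact shiftEquiv.hasSum_iff.2 h

/-- The weight of the domain `‖u‖ = r ^ k` with `1 ≤ ‖u‖`. -/
def bigWeight (r : ℝ) (k : ℤ) : ℝ := if k ≤ 0 then r ^ (-2 * k) else 0

/-- The indicator function of `‖u‖ < 1` in terms of the order of `u`. -/
def lowWeight (k : ℤ) : ℝ := if k ≤ 0 then 0 else 1

theorem bigWeight_nonneg {r : ℝ} (h0 : 0 < r) (k : ℤ) : 0 ≤ bigWeight r k := by
  rw [bigWeight]
  split_ifs <;> positivity

theorem lowWeight_nonneg (k : ℤ) : 0 ≤ lowWeight k := by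
  rw [lowWeight]
  split_ifs <;> positivity

theorem shellVol_nonneg {r : ℝ} (h0 : 0 < r) (h1 : r < 1) (k : ℤ) : 0 ≤ shellVol r k :=
  mul_nonneg (zpow_nonneg h0.le k) (by linarith)

/-- For k = -j ≤ 0 the weight times the volume is r^j (1 - r). -/
theorem hasSum_bigWeight {r : ℝ} (h0 : 0 < r) (h1 : r < 1) :
    HasSum (fun k => bigWeight r k * shellVol r k) 1 := by
  have hi : Function.Injective fun j : ℕ => -(j : ℤ) := fun a b h => by
    simpa using h
  rw [← hi.hasSum_iff]
  · have h := (hasSum_geometric_of_lt_one h0.le h1).mul_right (1 - r)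
    rw [inv_mul_cancel₀ (by linarith)] at h
    refine h.congr_fun fun j => ?_
    simp only [Function.comp, bigWeight, shellVol]
    rw [if_pos (by lia), ← mul_assoc, ← zpow_add₀ h0.ne', ← zpow_natCast]
    congr 2
    ring
  · intro k hk
    rw [bigWeight, if_neg, zero_mul]
    intro h
    exact hk ⟨(-k).toNat, by change -(((-k).toNat : ℕ) : ℤ) = k; lia⟩

/-- The shells of positive order make up 𝔭, of volume r. -/
theorem hasSum_lowWeight {r : ℝ} (h0 : 0 < r) (h1 : r < 1) :
    HasSum (fun k => lowWeight k * shellVol r k) r := by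
  have hi : Function.Injective fun j : ℕ => (j : ℤ) + 1 := fun a b h => by
    simpa using h
  rw [← hi.hasSum_iff]
  · have h := (hasSum_geometric_of_lt_one h0.le h1).mul_right (r * (1 - r))
    rw [mul_left_comm, inv_mul_cancel₀ (by linarith), mul_one] at h
    refine h.congr_fun fun j => ?_
    simp only [Function.comp, lowWeight, shellVol]
    rw [if_neg (by lia), zpow_add_one₀ h0.ne', zpow_natCast]
    ring
  · intro k hk
    rw [lowWeight, if_pos, zero_mul]
    by_contra h
    exact hk ⟨(k - 1).toNat, by change (((k - 1).toNat : ℕ) : ℤ) + 1 = k; lia⟩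

/-- Absolute convergence of sums against `shellVol` carries over to `shellChar`. The summand r / (1
- r) of the constant is there for order -1, where `shellChar` is -1 and the volume is (1 - r)/r. -/
theorem norm_shellChar_le {r : ℝ} (h0 : 0 < r) (h1 : r < 1) (k : ℤ) :
    ‖shellChar r k‖ ≤ (1 + r / (1 - r)) * shellVol r k := by
  have h2 : 0 < 1 - r := by linarith
  have h3 := shellVol_nonneg h0 h1 k
  rw [shellChar]
  split_ifs with h h'
  · have e : (r : ℂ) ^ k * (1 - r) = ((shellVol r k : ℝ) : ℂ) := by
      rw [shellVol]; push_cast; rfl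
    rw [e, Complex.norm_real, Real.norm_of_nonneg h3]
    exact le_mul_of_one_le_left h3 (by simp; positivity)
  · rw [h', shellVol, norm_neg, norm_one, _root_.zpow_neg_one]
    field_simp
    linarith
  · rw [norm_zero]
    positivity

/-- In the coordinates of `shiftEquiv` the three sums over the orders of the uᵢ split off as
factors. They are all 1 for the open orbit, and for the three others the small coordinate supplies a
single factor r. -/
theorem hasSum_orbits {r : ℝ} (h0 : 0 < r) (h1 : r < 1) {U₀ U₁ U₂ U₃ : ℤ × ℤ × ℤ × ℤ → ℂ}
    (hU₀ : Summable fun p => ‖U₀ p‖ * shellVol r p.1)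
    (hU₁ : Summable fun p => ‖U₁ p‖ * shellVol r p.1)
    (hU₂ : Summable fun p => ‖U₂ p‖ * shellVol r p.1)
    (hU₃ : Summable fun p => ‖U₃ p‖ * shellVol r p.1)
    {g : ℤ × (ℤ × ℤ × ℤ) × (ℤ × ℤ × ℤ) → ℂ}
    (hg : ∀ k, g k =
      ((bigWeight r k.2.2.1 * (bigWeight r k.2.2.2.1 * bigWeight r k.2.2.2.2) : ℝ) : ℂ) *
        U₀ (shiftEquiv k).2 +
      ((lowWeight k.2.2.1 * (bigWeight r k.2.2.2.1 * bigWeight r k.2.2.2.2) : ℝ) : ℂ) *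
        U₁ (shiftEquiv k).2 +
      ((bigWeight r k.2.2.1 * (lowWeight k.2.2.2.1 * bigWeight r k.2.2.2.2) : ℝ) : ℂ) *
        U₂ (shiftEquiv k).2 +
      ((bigWeight r k.2.2.1 * (bigWeight r k.2.2.2.1 * lowWeight k.2.2.2.2) : ℝ) : ℂ) *
        U₃ (shiftEquiv k).2) :
    (Summable fun k => ‖g k‖ * (shellVol r k.1 * (shellVol r k.2.2.1 *
      (shellVol r k.2.2.2.1 * shellVol r k.2.2.2.2)))) ∧
    ∑' k, g k * (shellChar r k.1 * ((shellVol r k.2.2.1 *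
      (shellVol r k.2.2.2.1 * shellVol r k.2.2.2.2) : ℝ) : ℂ)) =
      (∑' p, U₀ p * shellChar r p.1) + r * (∑' p, U₁ p * shellChar r p.1) +
        r * (∑' p, U₂ p * shellChar r p.1) + r * ∑' p, U₃ p * shellChar r p.1 := by
  have hb := hasSum_bigWeight h0 h1
  have hl := hasSum_lowWeight h0 h1
  have hbn : Summable fun k => ‖bigWeight r k * shellVol r k‖ := hb.summable.norm
  have hln : Summable fun k => ‖lowWeight k * shellVol r k‖ := hl.summable.norm
  have hb' : HasSum (fun k => ((bigWeight r k * shellVol r k : ℝ) : ℂ)) 1 := by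
    simpa only [Complex.ofReal_one] using Complex.hasSum_ofReal.2 hb
  have hl' : HasSum (fun k => ((lowWeight k * shellVol r k : ℝ) : ℂ)) r := Complex.hasSum_ofReal.2 hl
  have hbn' : Summable fun k => ‖((bigWeight r k * shellVol r k : ℝ) : ℂ)‖ := by
    simpa only [Complex.norm_real] using hbn
  have hln' : Summable fun k => ‖((lowWeight k * shellVol r k : ℝ) : ℂ)‖ := by
    simpa only [Complex.norm_real] using hln
  have hn : ∀ {U : ℤ × ℤ × ℤ × ℤ → ℂ}, (Summable fun p => ‖U p‖ * shellVol r p.1) →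
      Summable fun p => ‖‖U p‖ * shellVol r p.1‖ := fun h => h.norm
  have hc : ∀ {U : ℤ × ℤ × ℤ × ℤ → ℂ}, (Summable fun p => ‖U p‖ * shellVol r p.1) →
      Summable fun p => ‖U p * shellChar r p.1‖ := fun {U} h => by
    refine Summable.of_nonneg_of_le (fun _ => norm_nonneg _) (fun p => ?_)
      (h.mul_left (1 + r / (1 - r)))
    rw [norm_mul, mul_left_comm]
    exact mul_le_mul_of_nonneg_left (norm_shellChar_le h0 h1 _) (norm_nonneg _)
  have hw := shellVol_nonneg h0 h1
  have hbw := bigWeight_nonneg h0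
  have hlw := lowWeight_nonneg
  constructor
  · have s := (((hasSum_shift hb hb hb hbn hbn hbn (hn hU₀)).add
      (hasSum_shift hl hb hb hln hbn hbn (hn hU₁))).add
      (hasSum_shift hb hl hb hbn hln hbn (hn hU₂))).add
      (hasSum_shift hb hb hl hbn hbn hln (hn hU₃))
    refine Summable.of_nonneg_of_le (fun k => ?_) (fun k => ?_) s.summable
    · exact mul_nonneg (norm_nonneg _) (mul_nonneg (hw _) (mul_nonneg (hw _)
        (mul_nonneg (hw _) (hw _))))
    · have h4 : ‖g k‖ ≤ bigWeight r k.2.2.1 * (bigWeight r k.2.2.2.1 * bigWeight r k.2.2.2.2) *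
          ‖U₀ (shiftEquiv k).2‖ +
          lowWeight k.2.2.1 * (bigWeight r k.2.2.2.1 * bigWeight r k.2.2.2.2) *
          ‖U₁ (shiftEquiv k).2‖ +
          bigWeight r k.2.2.1 * (lowWeight k.2.2.2.1 * bigWeight r k.2.2.2.2) *
          ‖U₂ (shiftEquiv k).2‖ +
          bigWeight r k.2.2.1 * (bigWeight r k.2.2.2.1 * lowWeight k.2.2.2.2) *
          ‖U₃ (shiftEquiv k).2‖ := by
        rw [hg]
        refine (norm_add_le _ _).trans (add_le_add ((norm_add_le _ _).trans (add_le_add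
          ((norm_add_le _ _).trans (add_le_add ?_ ?_)) ?_)) ?_) <;>
          rw [norm_mul, Complex.norm_real, Real.norm_of_nonneg] <;>
          exact mul_nonneg (by first | exact hbw _ | exact hlw _)
            (mul_nonneg (by first | exact hbw _ | exact hlw _)
              (by first | exact hbw _ | exact hlw _))
      refine (mul_le_mul_of_nonneg_right h4 (mul_nonneg (hw _) (mul_nonneg (hw _)
        (mul_nonneg (hw _) (hw _))))).trans_eq ?_
      change _ * (shellVol r (shiftEquiv k).2.1 * _) = _
      ring
  · have s := (((hasSum_shift hb' hb' hb' hbn' hbn' hbn' (hc hU₀)).add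
      (hasSum_shift hl' hb' hb' hln' hbn' hbn' (hc hU₁))).add
      (hasSum_shift hb' hl' hb' hbn' hln' hbn' (hc hU₂))).add
      (hasSum_shift hb' hb' hl' hbn' hbn' hln' (hc hU₃))
    refine (tsum_congr fun k => ?_).trans (s.tsum_eq.trans ?_)
    · rw [hg]
      change _ * (shellChar r (shiftEquiv k).2.1 * _) = _
      push_cast
      ring
    · ring

end OrbitSum


/-! ### Decomposition into four orbits -/

section Orbits

/-- The contribution of one orbit to the zeta integral, as a function of the orders
`(n, α, β, γ)`. -/
def orbitTerm (r : ℝ) (w₁ w₂ w₃ c : ℂ) (P₁ P₂ P₃ : ℤ → ℂ) (N : ℤ × ℤ × ℤ × ℤ → ℤ)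
    (p : ℤ × ℤ × ℤ × ℤ) : ℂ :=
  (r : ℂ) ^ (-(3 * p.2.1 + 2 * p.2.2.1 + 2 * p.2.2.2)) *
    shellTerm w₁ w₂ w₃ c P₁ P₂ P₃ p.2.1 0 p.2.2.1 p.2.2.2 (N p) p.1

/-- `shellTerm_shift` with t = min(k₁, 0) makes τ₁ equal to 0. In the new variables the modulus
factor changes by exactly one power r^(-2kᵢ) for each large uᵢ, which is `bigWeight`. -/
theorem cellCoeff_eq_orbits {r : ℝ} (hr : 0 < r) {w₁ w₂ w₃ : ℂ} (h₁ : w₁ ≠ 0) (h₂ : w₂ ≠ 0)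
    (h₃ : w₃ ≠ 0) (A₁ A₂ A₃ B₁ B₂ B₃ : ℤ → ℂ) (c : ℂ) (k : ℤ × (ℤ × ℤ × ℤ) × (ℤ × ℤ × ℤ)) :
    cellCoeff A₁ A₂ A₃ B₁ B₂ B₃ w₁ w₂ w₃ c r k =
      ((bigWeight r k.2.2.1 * (bigWeight r k.2.2.2.1 * bigWeight r k.2.2.2.2) : ℝ) : ℂ) *
        orbitTerm r w₁ w₂ w₃ c B₁ B₂ B₃ (fun p => p.1) (shiftEquiv k).2 +
      ((lowWeight k.2.2.1 * (bigWeight r k.2.2.2.1 * bigWeight r k.2.2.2.2) : ℝ) : ℂ) *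
        orbitTerm r w₁ w₂ w₃ c A₁ B₂ B₃ (fun p => p.2.1) (shiftEquiv k).2 +
      ((bigWeight r k.2.2.1 * (lowWeight k.2.2.2.1 * bigWeight r k.2.2.2.2) : ℝ) : ℂ) *
        orbitTerm r w₁ w₂ w₃ c B₁ A₂ B₃ (fun p => p.2.1 + 2 * p.2.2.1) (shiftEquiv k).2 +
      ((bigWeight r k.2.2.1 * (bigWeight r k.2.2.2.1 * lowWeight k.2.2.2.2) : ℝ) : ℂ) *
        orbitTerm r w₁ w₂ w₃ c B₁ B₂ A₃ (fun p => p.2.1 + 2 * p.2.2.2) (shiftEquiv k).2 := by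
  obtain ⟨n, ⟨α, β, γ⟩, k₁, k₂, k₃⟩ := k
  have hr' : (r : ℂ) ≠ 0 := by exact_mod_cast hr.ne'
  have key : ∀ (P₁ P₂ P₃ : ℤ → ℂ) (N κ₁ κ₂ κ₃ : ℤ),
      (r : ℂ) ^ (-(3 * α + 2 * β + 2 * γ)) *
        shellTerm w₁ w₂ w₃ c P₁ P₂ P₃ α (-κ₁) (β - κ₂) (γ - κ₃) N n =
      (r : ℂ) ^ (-2 * κ₁) * ((r : ℂ) ^ (-2 * κ₂) * (r : ℂ) ^ (-2 * κ₃)) *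
        ((r : ℂ) ^ (-(3 * (α - 2 * κ₁) + 2 * (β + κ₁ - κ₂) + 2 * (γ + κ₁ - κ₃))) *
          shellTerm w₁ w₂ w₃ c P₁ P₂ P₃ (α - 2 * κ₁) 0 (β + κ₁ - κ₂) (γ + κ₁ - κ₃) N n) := by
    intro P₁ P₂ P₃ N κ₁ κ₂ κ₃
    rw [← shellTerm_shift h₁ h₂ h₃ c P₁ P₂ P₃ α _ _ _ N n κ₁, ← mul_assoc, ← zpow_add₀ hr',
      ← zpow_add₀ hr', ← zpow_add₀ hr', neg_add_cancel, show β - κ₂ + κ₁ = β + κ₁ - κ₂ by ring,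
      show γ - κ₃ + κ₁ = γ + κ₁ - κ₃ by ring]
    congr 2
    ring
  by_cases l₁ : k₁ ≤ 0 <;> by_cases l₂ : k₂ ≤ 0 <;> by_cases l₃ : k₃ ≤ 0
  · have := key B₁ B₂ B₃ n k₁ k₂ k₃
    simp [cellCoeff, bigWeight, lowWeight, l₁, l₂, l₃, orbitTerm, shiftEquiv]
    simpa using this
  · have := key B₁ B₂ A₃ (α + 2 * γ) k₁ k₂ 0
    simp [cellCoeff, bigWeight, lowWeight, l₁, l₂, l₃, orbitTerm, shiftEquiv,
      min_eq_right (not_le.1 l₃).le, show α - 2 * k₁ + 2 * (γ + k₁) = α + 2 * γ by ring]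
    simpa using this
  · have := key B₁ A₂ B₃ (α + 2 * β) k₁ 0 k₃
    simp [cellCoeff, bigWeight, lowWeight, l₁, l₂, l₃, orbitTerm, shiftEquiv,
      min_eq_right (not_le.1 l₂).le, show α - 2 * k₁ + 2 * (β + k₁) = α + 2 * β by ring]
    simpa using this
  · simp [cellCoeff, bigWeight, lowWeight, l₁, l₂, l₃]
  · have := key A₁ B₂ B₃ α 0 k₂ k₃
    simp [cellCoeff, bigWeight, lowWeight, l₁, l₂, l₃, orbitTerm, shiftEquiv,
      min_eq_right (not_le.1 l₁).le]
    simpa using this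
  · simp [cellCoeff, bigWeight, lowWeight, l₁, l₂, l₃]
  · simp [cellCoeff, bigWeight, lowWeight, l₁, l₂, l₃]
  · simp [cellCoeff, bigWeight, lowWeight, l₁, l₂, l₃]

end Orbits

/-! ### Growth bounds and the sums over the orbits with one small uᵢ -/

section Growth

/-- `P` vanishes below `l` and grows at most exponentially. -/
structure HasGrowth (K D : ℝ) (l : ℤ) (P : ℤ → ℂ) : Prop where
  zero : ∀ m < l, P m = 0
  le : ∀ m, ‖P m‖ ≤ K * D ^ (m + 1).toNat

theorem HasGrowth.mono {K D K' D' : ℝ} {l : ℤ} {P : ℤ → ℂ} (h : HasGrowth K D l P) (hK : 0 ≤ K)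
    (hD : 0 ≤ D) (hK' : K ≤ K') (hD' : D ≤ D') : HasGrowth K' D' l P :=
  ⟨h.zero, fun m => (h.le m).trans (by have := hK.trans hK'; gcongr)⟩

/-- `∑ₖ P(m + 2k) vᵏ`. -/
def stepSum (P : ℤ → ℂ) (v : ℂ) (m : ℤ) : ℂ := ∑' k : ℕ, P (m + 2 * k) * v ^ k

theorem HasGrowth.norm_step_le {K D : ℝ} {l : ℤ} {P : ℤ → ℂ} (h : HasGrowth K D l P) (hK : 0 ≤ K)
    (hD : 1 ≤ D) (v : ℂ) (m : ℤ) (k : ℕ) :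
    ‖P (m + 2 * k) * v ^ k‖ ≤ K * D ^ (m + 1).toNat * (D ^ 2 * ‖v‖) ^ k := by
  rw [norm_mul, norm_pow, mul_pow, ← pow_mul]
  calc ‖P (m + 2 * k)‖ * ‖v‖ ^ k ≤ K * D ^ (m + 2 * k + 1).toNat * ‖v‖ ^ k := by
        gcongr; exact h.le _
    _ ≤ K * D ^ ((m + 1).toNat + 2 * k) * ‖v‖ ^ k := by
        gcongr
        lia
    _ = _ := by rw [pow_add]; ring

theorem HasGrowth.summable_step {K D : ℝ} {l : ℤ} {P : ℤ → ℂ} (h : HasGrowth K D l P) (hK : 0 ≤ K)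
    (hD : 1 ≤ D) {v : ℂ} (hv : D ^ 2 * ‖v‖ < 1) (m : ℤ) :
    Summable fun k : ℕ => ‖P (m + 2 * k) * v ^ k‖ :=
  Summable.of_nonneg_of_le (fun _ => norm_nonneg _) (h.norm_step_le hK hD v m)
    ((summable_geometric_of_lt_one (by positivity) hv).mul_left _)

theorem HasGrowth.hasSum_step {K D : ℝ} {l : ℤ} {P : ℤ → ℂ} (h : HasGrowth K D l P) (hK : 0 ≤ K)
    (hD : 1 ≤ D) {v : ℂ} (hv : D ^ 2 * ‖v‖ < 1) (m : ℤ) :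
    HasSum (fun k : ℕ => P (m + 2 * k) * v ^ k) (stepSum P v m) :=
  (h.summable_step hK hD hv m).of_norm.hasSum

/-- The closed orbit terms in the coordinates `N`, `n = N + j`, `k`, `k'`. -/
def lowSummand (C : ℂ) (r : ℝ) (P Q R : ℤ → ℂ) (v v' : ℂ) (p : ℕ × ℕ × ℕ × ℕ) : ℂ :=
  C ^ p.1 * ((r : ℂ) ^ (2 * p.1))⁻¹ * P p.1 *
    (Q (p.1 + 2 * p.2.2.1) * v ^ p.2.2.1 * (R (p.1 + 2 * p.2.2.2) * v' ^ p.2.2.2))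

/-- Domination by a product of four geometric series. The index N collects three factors D^N, the
factor ‖C‖^N, and r^(-2N) against the volume r^N, whence the condition on ‖C‖ D³ / r. -/
theorem summable_lowSummand {K D r : ℝ} (hK : 0 ≤ K) (hD : 1 ≤ D) (hr : 0 < r) (hr1 : r < 1)
    {P Q R : ℤ → ℂ} {lP lQ lR : ℤ} (hP : HasGrowth K D lP P) (hQ : HasGrowth K D lQ Q)
    (hR : HasGrowth K D lR R) {C v v' : ℂ} (hv : D ^ 2 * ‖v‖ < 1) (hv' : D ^ 2 * ‖v'‖ < 1)
    (hC : ‖C‖ * D ^ 3 / r < 1) :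
    Summable fun p : ℕ × ℕ × ℕ × ℕ => ‖lowSummand C r P Q R v v' p‖ * shellVol r (p.1 + p.2.1) := by
  have s1 := summable_geometric_of_lt_one (r := ‖C‖ * D ^ 3 / r) (by positivity) hC
  have s2 := summable_geometric_of_lt_one hr.le hr1
  have s3 := summable_geometric_of_lt_one (by positivity) hv
  have s4 := summable_geometric_of_lt_one (by positivity) hv'
  have s34 := s3.mul_of_nonneg s4 (fun _ => by positivity) (fun _ => by positivity)
  have s234 := s2.mul_of_nonneg s34 (fun _ => by positivity) (fun _ => by
    change (0 : ℝ) ≤ _ * _; positivity)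
  have s := s1.mul_of_nonneg s234 (fun _ => by positivity) (fun _ => by
    change (0 : ℝ) ≤ _ * (_ * _); positivity)
  refine Summable.of_nonneg_of_le
    (fun p => mul_nonneg (norm_nonneg _) (shellVol_nonneg hr hr1 _)) (fun p => ?_)
    (s.mul_left (K ^ 3 * D ^ 3 * (1 - r)))
  obtain ⟨N, j, k, k'⟩ := p
  have hQ' := hQ.norm_step_le hK hD v N k
  have hR' := hR.norm_step_le hK hD v' N k'
  have hP' := hP.le N
  rw [show ((N : ℤ) + 1).toNat = N + 1 by lia] at hP' hQ' hR'
  have h1r : 0 < 1 - r := by linarith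
  simp only [lowSummand, shellVol]
  rw [norm_mul, norm_mul, norm_mul, norm_mul, norm_pow, norm_inv, norm_pow, Complex.norm_real,
    Real.norm_of_nonneg hr.le]
  calc ‖C‖ ^ N * (r ^ (2 * N))⁻¹ * ‖P N‖ * (‖Q (N + 2 * k) * v ^ k‖ * ‖R (N + 2 * k') * v' ^ k'‖) *
        (r ^ ((N : ℤ) + j) * (1 - r)) 
      ≤ ‖C‖ ^ N * (r ^ (2 * N))⁻¹ * (K * D ^ (N + 1)) * ((K * D ^ (N + 1) * (D ^ 2 * ‖v‖) ^ k) *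
        (K * D ^ (N + 1) * (D ^ 2 * ‖v'‖) ^ k')) * (r ^ ((N : ℤ) + j) * (1 - r)) := by gcongr
    _ = _ := by
      rw [zpow_add₀ hr.ne', zpow_natCast, zpow_natCast, div_pow, mul_pow ‖C‖]
      field_simp
      ring

/-- Here n = N + j ≥ 0, so the character sums are plain volumes, and summing over j gives the volume
r^N of a ball. The sums over k and k' are step sums. -/
theorem lowSummand_sum {K D r : ℝ} (hK : 0 ≤ K) (hD : 1 ≤ D) (hr : 0 < r) (hr1 : r < 1)
    {P Q R : ℤ → ℂ} {lP lQ lR : ℤ} (hP : HasGrowth K D lP P) (hQ : HasGrowth K D lQ Q)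
    (hR : HasGrowth K D lR R) {C v v' : ℂ} (hv : D ^ 2 * ‖v‖ < 1) (hv' : D ^ 2 * ‖v'‖ < 1)
    (hC : ‖C‖ * D ^ 3 / r < 1) :
    HasSum (fun N : ℕ => (C / r) ^ N * P N * stepSum Q v N * stepSum R v' N)
      (∑' p : ℕ × ℕ × ℕ × ℕ, lowSummand C r P Q R v v' p * shellChar r (p.1 + p.2.1)) := by
  have hs : Summable fun p : ℕ × ℕ × ℕ × ℕ =>
      lowSummand C r P Q R v v' p * shellChar r (p.1 + p.2.1) := by
    refine Summable.of_norm (Summable.of_nonneg_of_le (fun _ => norm_nonneg _) (fun p => ?_)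
      ((summable_lowSummand hK hD hr hr1 hP hQ hR hv hv' hC).mul_left (1 + r / (1 - r))))
    rw [norm_mul, mul_left_comm]
    exact mul_le_mul_of_nonneg_left (norm_shellChar_le hr hr1 _) (norm_nonneg _)
  refine hs.hasSum.prod_fiberwise fun N => ?_
  have hrc : (r : ℂ) ≠ 0 := by exact_mod_cast hr.ne'
  have h1 : HasSum (fun j : ℕ => (r : ℂ) ^ j * (1 - r)) 1 := by
    have := (hasSum_geometric_of_lt_one hr.le hr1).mul_right (1 - r)
    rw [inv_mul_cancel₀ (by linarith)] at this
    have := Complex.hasSum_ofReal.2 this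
    push_cast at this
    exact this
  have h1' : Summable fun j : ℕ => ‖(r : ℂ) ^ j * (1 - r)‖ := by
    have := (summable_geometric_of_lt_one hr.le hr1).mul_right ‖1 - (r : ℂ)‖
    refine this.congr fun j => ?_
    rw [norm_mul, norm_pow, Complex.norm_real, Real.norm_of_nonneg hr.le]
  have h2 := hasSum_mul_of_summable_norm (hQ.hasSum_step hK hD hv N) (hQ.summable_step hK hD hv N)
    (hR.hasSum_step hK hD hv' N) (hR.summable_step hK hD hv' N)
  have h2' := (hQ.summable_step hK hD hv N).mul_norm (hR.summable_step hK hD hv' N)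
  have h3 := (hasSum_mul_of_summable_norm h1 h1' h2 h2').mul_left ((C / r) ^ N * P N)
  rw [one_mul, ← mul_assoc] at h3
  refine h3.congr_fun fun p => ?_
  obtain ⟨j, k, k'⟩ := p
  simp only [lowSummand, shellChar]
  rw [if_pos (by lia), zpow_add₀ hrc, zpow_natCast, zpow_natCast, div_pow]
  field_simp
  ring

end Growth


/-! ### Parametrising the supports of the orbits with one small uᵢ -/

section Reindex

theorem orbit_reindex {ι : Type*} {r : ℝ} {U : ℤ × ℤ × ℤ × ℤ → ℂ} {i : ι → ℤ × ℤ × ℤ × ℤ}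
    (hi : Function.Injective i) {f : ι → ℂ} (hf : ∀ p, U (i p) = f p)
    (h0 : ∀ p, p ∉ Set.range i → U p = 0) (hs : Summable fun p => ‖f p‖ * shellVol r (i p).1) :
    (Summable fun p => ‖U p‖ * shellVol r p.1) ∧
      ∑' p, U p * shellChar r p.1 = ∑' p, f p * shellChar r (i p).1 := by
  constructor
  · refine (hi.summable_iff fun p hp => ?_).1 (hs.congr fun p => ?_)
    · rw [h0 p hp, norm_zero, zero_mul]
    · simp only [Function.comp, hf]
  · rw [← hi.tsum_eq (f := fun p => U p * shellChar r p.1)]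
    · exact tsum_congr fun p => by rw [hf]
    · intro p hp
      by_contra h
      exact hp (by simp [h0 p h])

/-- The section contributes powers of χ(ϖ)|ϖ| = C r. On the support its powers of r combine with the
modulus factor into r^(-2N), leaving a pure power of C. -/
theorem orbitTerm_eq {r : ℝ} (hr : 0 < r) {w₁ w₂ w₃ C : ℂ} (h₂ : w₂ ≠ 0)
    (h₃ : w₃ ≠ 0) (P₁ P₂ P₃ : ℤ → ℂ) (N : ℤ × ℤ × ℤ × ℤ → ℤ)
    (p : ℤ × ℤ × ℤ × ℤ) (hp : N p ≤ p.1 ∧ N p ≤ p.2.1 ∧ N p ≤ p.2.1 + 2 * p.2.2.1 ∧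
      N p ≤ p.2.1 + 2 * p.2.2.2) :
    orbitTerm r w₁ w₂ w₃ (C * r) P₁ P₂ P₃ N p =
      C ^ (3 * p.2.1 + 2 * (p.2.2.1 + p.2.2.2) - 2 * N p) * (r : ℂ) ^ (-(2 * N p)) *
        (w₁ ^ (p.2.1 + p.2.2.1 + p.2.2.2 - N p) * w₂ ^ (p.2.1 + p.2.2.2 - N p) *
          w₃ ^ (p.2.1 + p.2.2.1 - N p)) *
        (P₁ p.2.1 * P₂ (p.2.1 + 2 * p.2.2.1) * P₃ (p.2.1 + 2 * p.2.2.2)) := by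
  have hr' : (r : ℂ) ≠ 0 := by exact_mod_cast hr.ne'
  obtain ⟨n, α, β, γ⟩ := p
  simp only [orbitTerm, shellTerm, sectionValue] at hp ⊢
  rw [if_pos (by simpa using hp), mul_zpow, mul_zpow, mul_zpow,
    show α + γ - N (n, α, β, γ) = (α + 0 + β + γ - N (n, α, β, γ)) + -β by ring,
    show α + β - N (n, α, β, γ) = (α + 0 + β + γ - N (n, α, β, γ)) + -γ by ring,
    zpow_add₀ h₂, zpow_add₀ h₃,
    show -(2 * N (n, α, β, γ)) = -(3 * α + 2 * β + 2 * γ) +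
      (3 * α + 2 * (0 + β + γ) - 2 * N (n, α, β, γ)) by ring, zpow_add₀ hr']
  simp only [add_zero, mul_zero, neg_zero, zpow_zero, zero_add]
  ring

theorem orbitTerm_eq_zero {r : ℝ} {w₁ w₂ w₃ c : ℂ} (P₁ P₂ P₃ : ℤ → ℂ) (N : ℤ × ℤ × ℤ × ℤ → ℤ)
    (p : ℤ × ℤ × ℤ × ℤ) (hp : ¬ (N p ≤ p.1 ∧ N p ≤ p.2.1 ∧ N p ≤ p.2.1 + 2 * p.2.2.1 ∧
      N p ≤ p.2.1 + 2 * p.2.2.2)) : orbitTerm r w₁ w₂ w₃ c P₁ P₂ P₃ N p = 0 := by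
  rw [orbitTerm, shellTerm, sectionValue, if_neg (by simpa using hp), mul_zero, mul_zero]

variable {r K D : ℝ} {w₁ w₂ w₃ C : ℂ} {P Q R : ℤ → ℂ} {lQ lR : ℤ}

/-- On the support n ≥ α, β ≥ 0 and γ ≥ 0, and α ≥ 0 since P vanishes on negative integers. So N =
α, n - α, β and γ run freely over the natural numbers. -/
theorem orbitTerm_low1 (hK : 0 ≤ K) (hD : 1 ≤ D) (hr : 0 < r) (hr1 : r < 1)
    (h₂ : w₂ ≠ 0) (h₃ : w₃ ≠ 0) (hP : HasGrowth K D 0 P) (hQ : HasGrowth K D lQ Q)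
    (hR : HasGrowth K D lR R) (hv₂ : D ^ 2 * ‖C ^ 2 * (w₁ * w₃)‖ < 1)
    (hv₃ : D ^ 2 * ‖C ^ 2 * (w₁ * w₂)‖ < 1) (hC : ‖C‖ * D ^ 3 / r < 1) :
    (Summable fun p => ‖orbitTerm r w₁ w₂ w₃ (C * r) P Q R (fun p => p.2.1) p‖ *
      shellVol r p.1) ∧
    ∑' p, orbitTerm r w₁ w₂ w₃ (C * r) P Q R (fun p => p.2.1) p * shellChar r p.1 =
      ∑' p : ℕ × ℕ × ℕ × ℕ, lowSummand C r P Q R (C ^ 2 * (w₁ * w₃)) (C ^ 2 * (w₁ * w₂)) p *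
        shellChar r (p.1 + p.2.1) := by
  refine orbit_reindex (i := fun p : ℕ × ℕ × ℕ × ℕ =>
    ((p.1 : ℤ) + p.2.1, (p.1 : ℤ), (p.2.2.1 : ℤ), (p.2.2.2 : ℤ))) ?_ (fun p => ?_) ?_
    (summable_lowSummand hK hD hr hr1 hP hQ hR hv₂ hv₃ hC)
  · rintro ⟨N, j, k, k'⟩ ⟨N', j', l, l'⟩ h
    simp only [Prod.mk.injEq] at h ⊢
    lia
  · obtain ⟨N, j, k, k'⟩ := p
    rw [orbitTerm_eq hr h₂ h₃ _ _ _ _ _ (by simp)]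
    simp only [lowSummand]
    rw [show 3 * (N : ℤ) + 2 * (k + k') - 2 * N = ((N + 2 * k + 2 * k' : ℕ) : ℤ) by lia,
      show (N : ℤ) + k + k' - N = ((k + k' : ℕ) : ℤ) by lia,
      show (N : ℤ) + k' - N = ((k' : ℕ) : ℤ) by lia, show (N : ℤ) + k - N = ((k : ℕ) : ℤ) by lia,
      show -(2 * (N : ℤ)) = -((2 * N : ℕ) : ℤ) by lia, _root_.zpow_neg]
    simp only [zpow_natCast]
    ring
  · rintro ⟨n, α, β, γ⟩ hp
    by_cases h : α ≤ n ∧ 0 ≤ α ∧ 0 ≤ β ∧ 0 ≤ γ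
    · refine absurd ⟨(α.toNat, (n - α).toNat, β.toNat, γ.toNat), ?_⟩ hp
      simp only [Prod.mk.injEq]
      lia
    · by_cases hα : α < 0
      · simp [orbitTerm, shellTerm, hP.zero _ hα]
      · refine orbitTerm_eq_zero _ _ _ _ _ ?_
        simp only
        lia

/-- Now N = α + 2β dominates, so that β ≤ 0 and γ ≥ β; the free parameters besides N and n - N are
-β and γ - β. -/
theorem orbitTerm_low2 (hK : 0 ≤ K) (hD : 1 ≤ D) (hr : 0 < r) (hr1 : r < 1)
    (h₂ : w₂ ≠ 0) (h₃ : w₃ ≠ 0) (hP : HasGrowth K D 0 P) (hQ : HasGrowth K D lQ Q)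
    (hR : HasGrowth K D lR R) (hv₁ : D ^ 2 * ‖C ^ 2 * (w₂ * w₃)‖ < 1)
    (hv₃ : D ^ 2 * ‖C ^ 2 * (w₁ * w₂)‖ < 1) (hC : ‖C‖ * D ^ 3 / r < 1) :
    (Summable fun p => ‖orbitTerm r w₁ w₂ w₃ (C * r) Q P R (fun p => p.2.1 + 2 * p.2.2.1) p‖ *
      shellVol r p.1) ∧
    ∑' p, orbitTerm r w₁ w₂ w₃ (C * r) Q P R (fun p => p.2.1 + 2 * p.2.2.1) p * shellChar r p.1 =
      ∑' p : ℕ × ℕ × ℕ × ℕ, lowSummand C r P Q R (C ^ 2 * (w₂ * w₃)) (C ^ 2 * (w₁ * w₂)) p *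
        shellChar r (p.1 + p.2.1) := by
  refine orbit_reindex (i := fun p : ℕ × ℕ × ℕ × ℕ =>
    ((p.1 : ℤ) + p.2.1, (p.1 : ℤ) + 2 * p.2.2.1, -(p.2.2.1 : ℤ), (p.2.2.2 : ℤ) - p.2.2.1)) ?_
    (fun p => ?_) ?_ (summable_lowSummand hK hD hr hr1 hP hQ hR hv₁ hv₃ hC)
  · rintro ⟨N, j, k, k'⟩ ⟨N', j', l, l'⟩ h
    simp only [Prod.mk.injEq] at h ⊢
    lia
  · obtain ⟨N, j, k, k'⟩ := p
    rw [orbitTerm_eq hr h₂ h₃ _ _ _ _ _ (by simp only; lia)]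
    simp only [lowSummand]
    rw [show (N : ℤ) + 2 * k + 2 * -k = N by lia,
      show (N : ℤ) + 2 * k + 2 * (k' - k) = N + 2 * k' by lia,
      show 3 * ((N : ℤ) + 2 * k) + 2 * (-k + (k' - k)) - 2 * N = ((N + 2 * k + 2 * k' : ℕ) : ℤ) by lia,
      show (N : ℤ) + 2 * k + -k + (k' - k) - N = ((k' : ℕ) : ℤ) by lia,
      show (N : ℤ) + 2 * k + (k' - k) - N = ((k + k' : ℕ) : ℤ) by lia,
      show (N : ℤ) + 2 * k + -k - N = ((k : ℕ) : ℤ) by lia,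
      show -(2 * (N : ℤ)) = -((2 * N : ℕ) : ℤ) by lia, _root_.zpow_neg]
    simp only [zpow_natCast]
    ring
  · rintro ⟨n, α, β, γ⟩ hp
    by_cases h : α + 2 * β ≤ n ∧ 0 ≤ α + 2 * β ∧ β ≤ 0 ∧ β ≤ γ
    · refine absurd ⟨((α + 2 * β).toNat, (n - (α + 2 * β)).toNat, (-β).toNat, (γ - β).toNat), ?_⟩ hp
      simp only [Prod.mk.injEq]
      lia
    · by_cases hα : α + 2 * β < 0
      · simp [orbitTerm, shellTerm, hP.zero _ hα]
      · refine orbitTerm_eq_zero _ _ _ _ _ ?_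
        simp only
        lia

/-- The mirror image of the previous case, with γ in the role of β. -/
theorem orbitTerm_low3 (hK : 0 ≤ K) (hD : 1 ≤ D) (hr : 0 < r) (hr1 : r < 1)
    (h₂ : w₂ ≠ 0) (h₃ : w₃ ≠ 0) (hP : HasGrowth K D 0 P) (hQ : HasGrowth K D lQ Q)
    (hR : HasGrowth K D lR R) (hv₁ : D ^ 2 * ‖C ^ 2 * (w₂ * w₃)‖ < 1)
    (hv₂ : D ^ 2 * ‖C ^ 2 * (w₁ * w₃)‖ < 1) (hC : ‖C‖ * D ^ 3 / r < 1) :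
    (Summable fun p => ‖orbitTerm r w₁ w₂ w₃ (C * r) Q R P (fun p => p.2.1 + 2 * p.2.2.2) p‖ *
      shellVol r p.1) ∧
    ∑' p, orbitTerm r w₁ w₂ w₃ (C * r) Q R P (fun p => p.2.1 + 2 * p.2.2.2) p * shellChar r p.1 =
      ∑' p : ℕ × ℕ × ℕ × ℕ, lowSummand C r P Q R (C ^ 2 * (w₂ * w₃)) (C ^ 2 * (w₁ * w₃)) p *
        shellChar r (p.1 + p.2.1) := by
  refine orbit_reindex (i := fun p : ℕ × ℕ × ℕ × ℕ =>
    ((p.1 : ℤ) + p.2.1, (p.1 : ℤ) + 2 * p.2.2.1, (p.2.2.2 : ℤ) - p.2.2.1, -(p.2.2.1 : ℤ))) ?_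
    (fun p => ?_) ?_ (summable_lowSummand hK hD hr hr1 hP hQ hR hv₁ hv₂ hC)
  · rintro ⟨N, j, k, k'⟩ ⟨N', j', l, l'⟩ h
    simp only [Prod.mk.injEq] at h ⊢
    lia
  · obtain ⟨N, j, k, k'⟩ := p
    rw [orbitTerm_eq hr h₂ h₃ _ _ _ _ _ (by simp only; lia)]
    simp only [lowSummand]
    rw [show (N : ℤ) + 2 * k + 2 * -k = N by lia,
      show (N : ℤ) + 2 * k + 2 * (k' - k) = N + 2 * k' by lia,
      show 3 * ((N : ℤ) + 2 * k) + 2 * ((k' - k) + -k) - 2 * N = ((N + 2 * k + 2 * k' : ℕ) : ℤ) by lia,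
      show (N : ℤ) + 2 * k + (k' - k) + -k - N = ((k' : ℕ) : ℤ) by lia,
      show (N : ℤ) + 2 * k + (k' - k) - N = ((k + k' : ℕ) : ℤ) by lia,
      show (N : ℤ) + 2 * k + -k - N = ((k : ℕ) : ℤ) by lia,
      show -(2 * (N : ℤ)) = -((2 * N : ℕ) : ℤ) by lia, _root_.zpow_neg]
    simp only [zpow_natCast]
    ring
  · rintro ⟨n, α, β, γ⟩ hp
    by_cases h : α + 2 * γ ≤ n ∧ 0 ≤ α + 2 * γ ∧ γ ≤ 0 ∧ γ ≤ β
    · refine absurd ⟨((α + 2 * γ).toNat, (n - (α + 2 * γ)).toNat, (-γ).toNat, (β - γ).toNat), ?_⟩ hp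
      simp only [Prod.mk.injEq]
      lia
    · by_cases hα : α + 2 * γ < 0
      · simp [orbitTerm, shellTerm, hP.zero _ hα]
      · refine orbitTerm_eq_zero _ _ _ _ _ ?_
        simp only
        lia

end Reindex


/-! ### The open orbit -/

section BigOrbit

/-- The open orbit terms in the coordinates `n`, `e`, `k₁`, `k₂`, `k₃`, where `mᵢ = n + e + 2kᵢ`. -/
def bigSummand (C X : ℂ) (r : ℝ) (P Q R : ℤ → ℂ) (v₁ v₂ v₃ : ℂ) (p : ℤ × Fin 2 × ℕ × ℕ × ℕ) : ℂ :=
  C ^ p.1 * (r : ℂ) ^ (-(2 * p.1)) * X ^ (p.2.1 : ℕ) *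
    (P (p.1 + (p.2.1 : ℕ) + 2 * p.2.2.1) * v₁ ^ p.2.2.1 *
    (Q (p.1 + (p.2.1 : ℕ) + 2 * p.2.2.2.1) * v₂ ^ p.2.2.2.1 *
    (R (p.1 + (p.2.1 : ℕ) + 2 * p.2.2.2.2) * v₃ ^ p.2.2.2.2)))

theorem summable_pow_natAbs {ρ : ℝ} (h0 : 0 ≤ ρ) (h1 : ρ < 1) :
    Summable fun n : ℤ => ρ ^ n.natAbs := by
  refine Summable.of_nat_of_neg ?_ ?_ <;>
    simpa using summable_geometric_of_lt_one h0 h1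

/-- The exponent estimate behind the convergence of the open orbit sum. -/
theorem pow_bound_of_orders {ε : ℝ} (h0 : 0 < ε) (h1 : ε < 1) {n : ℤ} {e k₁ k₂ k₃ : ℕ}
    (hk₁ : -1 ≤ n + e + 2 * k₁) (hk₂ : -1 ≤ n + e + 2 * k₂) :
    (ε ^ 2) ^ (n + 3 * e + 2 * (k₁ + k₂ + k₃)) ≤ (ε⁻¹) ^ 5 * ε ^ (n.natAbs + k₁ + k₂ + k₃) := by
  have : (ε⁻¹) ^ 5 * ε ^ (n.natAbs + k₁ + k₂ + k₃) =
      ε ^ (((n.natAbs + k₁ + k₂ + k₃ : ℕ) : ℤ) - 5) := by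
    rw [zpow_sub₀ h0.ne', zpow_natCast, inv_pow, div_eq_mul_inv, mul_comm]
    rfl
  rw [this, ← zpow_natCast ε 2, ← _root_.zpow_mul]
  refine zpow_le_zpow_right_of_le_one₀ h0 h1.le ?_
  simp only [Nat.cast_add]
  lia

variable {K D M r : ℝ} {C X v₁ v₂ v₃ : ℂ} {P Q R : ℤ → ℂ}

/-- Here n may be negative, which makes the power of C and the rest compete. As the data vanish
below -1, a very negative n forces large kᵢ, and `pow_bound_of_orders` trades the power of ‖C‖ for
powers of √‖C‖ in |n| and all kᵢ. All other growth is absorbed by M². -/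
theorem norm_bigSummand_le (hK : 0 ≤ K) (hD : 1 ≤ D) (hr : 0 < r) (hr1 : r < 1)
    (hP : HasGrowth K D (-1) P) (hQ : HasGrowth K D (-1) Q) (hR : HasGrowth K D (-1) R)
    (hM : 1 ≤ M) (hDM : D ^ 3 ≤ M) (hrM : r⁻¹ ≤ M) (hC0 : C ≠ 0) (hC1 : ‖C‖ < 1)
    (hX : ‖X‖ ≤ ‖C‖ ^ 3 * M ^ 2)
    (hv₁ : ‖v₁‖ ≤ ‖C‖ ^ 2 * M) (hv₂ : ‖v₂‖ ≤ ‖C‖ ^ 2 * M) (hv₃ : ‖v₃‖ ≤ ‖C‖ ^ 2 * M)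
    (p : ℤ × Fin 2 × ℕ × ℕ × ℕ) :
    ‖bigSummand C X r P Q R v₁ v₂ v₃ p‖ * shellVol r p.1 ≤
      K ^ 3 * M ^ 4 * (√‖C‖)⁻¹ ^ 5 * ((√‖C‖ * M ^ 2) ^ p.1.natAbs * (1 *
        ((√‖C‖ * M ^ 2) ^ p.2.2.1 * ((√‖C‖ * M ^ 2) ^ p.2.2.2.1 *
          (√‖C‖ * M ^ 2) ^ p.2.2.2.2)))) := by
  obtain ⟨n, e, k₁, k₂, k₃⟩ := p
  obtain ⟨e, he⟩ := e
  have hc0 : 0 < ‖C‖ := norm_pos_iff.2 hC0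
  set ε := √‖C‖ with hε
  have hε0 : 0 < ε := Real.sqrt_pos.2 hc0
  have hε2 : ε ^ 2 = ‖C‖ := Real.sq_sqrt hc0.le
  have hε1 : ε < 1 := by
    rw [hε, Real.sqrt_lt' one_pos, one_pow]
    exact hC1
  have hM0 : 0 < M := by linarith
  simp only [bigSummand, shellVol]
  by_cases hneg : n + e + 2 * k₁ < -1 ∨ n + e + 2 * k₂ < -1 ∨ n + e + 2 * k₃ < -1
  · have hz : P (n + e + 2 * k₁) * (Q (n + e + 2 * k₂) * R (n + e + 2 * k₃)) = 0 := by
      rcases hneg with h | h | h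
      · rw [hP.zero _ h, zero_mul]
      · rw [hQ.zero _ h, zero_mul, mul_zero]
      · rw [hR.zero _ h, mul_zero, mul_zero]
    have : P (n + e + 2 * k₁) * v₁ ^ k₁ * (Q (n + e + 2 * k₂) * v₂ ^ k₂ *
        (R (n + e + 2 * k₃) * v₃ ^ k₃)) = 0 := by
      linear_combination (v₁ ^ k₁ * v₂ ^ k₂ * v₃ ^ k₃) * hz
    rw [this, mul_zero, norm_zero, zero_mul]
    positivity
  · simp only [not_or, not_lt] at hneg
    obtain ⟨g₁, g₂, g₃⟩ := hneg
    -- The weight and the volume of the shell combine to r^(-n), which is at most M^|n| for either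
    -- sign of n.
    have b1 : r ^ (-(2 * n)) * (r ^ n * (1 - r)) ≤ M ^ n.natAbs := by
      rw [← mul_assoc, ← zpow_add₀ hr.ne', show -(2 * n) + n = -n by ring]
      calc r ^ (-n) * (1 - r) ≤ r ^ (-n) * 1 := by gcongr; linarith
        _ ≤ M ^ n.natAbs := by
          rw [mul_one]
          rcases le_total 0 n with h | h
          · rw [_root_.zpow_neg, ← _root_.inv_zpow]
            obtain ⟨m, rfl⟩ := Int.eq_ofNat_of_zero_le h
            simp only [zpow_natCast, Int.natAbs_natCast]
            gcongr
          · obtain ⟨m, hm⟩ := Int.eq_ofNat_of_zero_le (neg_nonneg.2 h)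
            rw [hm, zpow_natCast]
            exact (pow_le_one₀ hr.le hr1.le).trans (one_le_pow₀ hM)
    have b2 : ‖X‖ ^ e ≤ ‖C‖ ^ (3 * e) * M ^ 2 := by
      obtain rfl | rfl : e = 0 ∨ e = 1 := by lia
      · simp only [pow_zero, mul_zero, one_mul]
        exact one_le_pow₀ hM
      · simpa using hX
    have b4 : ∀ {v : ℂ} (k : ℕ), ‖v‖ ≤ ‖C‖ ^ 2 * M → ‖v‖ ^ k ≤ ‖C‖ ^ (2 * k) * M ^ k :=
      fun k hv => by
        rw [pow_mul, ← mul_pow]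
        exact pow_le_pow_left₀ (norm_nonneg _) hv k
    set a₁ := (n + e + 2 * k₁ + 1).toNat with ha₁
    set a₂ := (n + e + 2 * k₂ + 1).toNat with ha₂
    set a₃ := (n + e + 2 * k₃ + 1).toNat with ha₃
    -- Each aᵢ is at most |n| + 2 + 2kᵢ, and D³ ≤ M.
    have b5 : D ^ a₁ * D ^ a₂ * D ^ a₃ ≤ M ^ (n.natAbs + 2 + k₁ + k₂ + k₃) := by
      rw [← pow_add, ← pow_add]
      calc D ^ (a₁ + a₂ + a₃) ≤ D ^ (3 * (n.natAbs + 2 + k₁ + k₂ + k₃)) := by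
            refine pow_le_pow_right₀ hD ?_
            lia
        _ ≤ _ := by
          rw [pow_mul]
          gcongr
    have b6 := pow_bound_of_orders hε0 hε1 (n := n) (k₃ := k₃) g₁ g₂
    rw [hε2] at b6
    simp only [norm_mul, norm_pow, norm_zpow, Complex.norm_real, Real.norm_of_nonneg hr.le]
    have p₁ := hP.le (n + e + 2 * k₁)
    have p₂ := hQ.le (n + e + 2 * k₂)
    have p₃ := hR.le (n + e + 2 * k₃)
    rw [← ha₁] at p₁
    rw [← ha₂] at p₂
    rw [← ha₃] at p₃
    calc ‖C‖ ^ n * r ^ (-(2 * n)) * ‖X‖ ^ e * (‖P (n + e + 2 * k₁)‖ * ‖v₁‖ ^ k₁ *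
          (‖Q (n + e + 2 * k₂)‖ * ‖v₂‖ ^ k₂ * (‖R (n + e + 2 * k₃)‖ * ‖v₃‖ ^ k₃))) *
          (r ^ n * (1 - r))
        = ‖C‖ ^ n * (r ^ (-(2 * n)) * (r ^ n * (1 - r))) * ‖X‖ ^ e *
          (‖P (n + e + 2 * k₁)‖ * ‖v₁‖ ^ k₁ *
          (‖Q (n + e + 2 * k₂)‖ * ‖v₂‖ ^ k₂ * (‖R (n + e + 2 * k₃)‖ * ‖v₃‖ ^ k₃))) := by ring
      _ ≤ ‖C‖ ^ n * M ^ n.natAbs * (‖C‖ ^ (3 * e) * M ^ 2) *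
          (K * D ^ a₁ * (‖C‖ ^ (2 * k₁) * M ^ k₁) *
          (K * D ^ a₂ * (‖C‖ ^ (2 * k₂) * M ^ k₂) * (K * D ^ a₃ * (‖C‖ ^ (2 * k₃) * M ^ k₃)))) := by
        have := b4 k₁ hv₁
        have := b4 k₂ hv₂
        have := b4 k₃ hv₃
        gcongr
      _ = ‖C‖ ^ (n + 3 * e + 2 * (k₁ + k₂ + k₃)) * (M ^ n.natAbs * M ^ 2 * K ^ 3 *
          (D ^ a₁ * D ^ a₂ * D ^ a₃) * (M ^ k₁ * M ^ k₂ * M ^ k₃)) := by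
        rw [show n + 3 * (e : ℤ) + 2 * (k₁ + k₂ + k₃) =
          n + ((3 * e + 2 * k₁ + 2 * k₂ + 2 * k₃ : ℕ) : ℤ) by push_cast; ring, zpow_add₀ hc0.ne',
          zpow_natCast]
        ring
      _ ≤ ((ε⁻¹) ^ 5 * ε ^ (n.natAbs + k₁ + k₂ + k₃)) * (M ^ n.natAbs * M ^ 2 * K ^ 3 *
          M ^ (n.natAbs + 2 + k₁ + k₂ + k₃) * (M ^ k₁ * M ^ k₂ * M ^ k₃)) := by gcongr
      _ = _ := by ring

theorem summable_bigSummand (hK : 0 ≤ K) (hD : 1 ≤ D) (hr : 0 < r) (hr1 : r < 1)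
    (hP : HasGrowth K D (-1) P) (hQ : HasGrowth K D (-1) Q) (hR : HasGrowth K D (-1) R)
    (hM : 1 ≤ M) (hDM : D ^ 3 ≤ M) (hrM : r⁻¹ ≤ M) (hC0 : C ≠ 0) (hCM : ‖C‖ * M ^ 4 < 1)
    (hX : ‖X‖ ≤ ‖C‖ ^ 3 * M ^ 2)
    (hv₁ : ‖v₁‖ ≤ ‖C‖ ^ 2 * M) (hv₂ : ‖v₂‖ ≤ ‖C‖ ^ 2 * M) (hv₃ : ‖v₃‖ ≤ ‖C‖ ^ 2 * M) :
    Summable fun p => ‖bigSummand C X r P Q R v₁ v₂ v₃ p‖ * shellVol r p.1 := by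
  have hC1 : ‖C‖ < 1 := (le_mul_of_one_le_right (norm_nonneg _) (one_le_pow₀ hM)).trans_lt hCM
  have hM0 : 0 < M := by linarith
  set ρ := √‖C‖ * M ^ 2 with hρ
  have hρ0 : 0 ≤ ρ := by positivity
  have hρ1 : ρ < 1 := by
    have : ρ ^ 2 < 1 := by
      rw [hρ, mul_pow, Real.sq_sqrt (norm_nonneg _), ← pow_mul]
      exact hCM
    exact (sq_lt_one_iff₀ hρ0).1 this
  have s := summable_geometric_of_lt_one hρ0 hρ1
  have s2 := s.mul_of_nonneg s (fun _ => by positivity) (fun _ => by positivity)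
  have s3 := s.mul_of_nonneg s2 (fun _ => by positivity)
    (fun _ => by change (0 : ℝ) ≤ _ * _; positivity)
  have s4 := (Summable.of_finite (f := fun _ : Fin 2 => (1 : ℝ))).mul_of_nonneg s3
    (fun _ => zero_le_one) (fun _ => by change (0 : ℝ) ≤ _ * (_ * _); positivity)
  have s5 := (summable_pow_natAbs hρ0 hρ1).mul_of_nonneg s4 (fun _ => by positivity)
    (fun _ => by change (0 : ℝ) ≤ 1 * (_ * (_ * _)); positivity)
  exact Summable.of_nonneg_of_le
    (fun p => mul_nonneg (norm_nonneg _) (shellVol_nonneg hr hr1 _))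
    (norm_bigSummand_le hK hD hr hr1 hP hQ hR hM hDM hrM hC0 hC1 hX hv₁ hv₂ hv₃)
    (s5.mul_left _)

theorem hasSum_mul_triple {𝕜 ι : Type*} [NormedField 𝕜] [CompleteSpace 𝕜] {f₁ f₂ f₃ : ι → 𝕜}
    {s₁ s₂ s₃ : 𝕜} (h₁ : HasSum f₁ s₁) (h₂ : HasSum f₂ s₂) (h₃ : HasSum f₃ s₃)
    (h₁' : Summable fun i => ‖f₁ i‖) (h₂' : Summable fun i => ‖f₂ i‖)
    (h₃' : Summable fun i => ‖f₃ i‖) :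
    HasSum (fun k : ι × ι × ι => f₁ k.1 * (f₂ k.2.1 * f₃ k.2.2)) (s₁ * (s₂ * s₃)) := by
  have h₂₃ := hasSum_mul_of_summable_norm h₂ h₂' h₃ h₃'
  have h₂₃' := h₂'.mul_norm h₃'
  have h := hasSum_mul_of_summable_norm h₁ h₁' h₂₃ h₂₃'
  exact h

theorem hasSum_fin_two_prod {κ : Type*} {f : Fin 2 × κ → ℂ} (hf : Summable f) {a b : ℂ}
    (h0 : HasSum (fun k => f (0, k)) a) (h1 : HasSum (fun k => f (1, k)) b) :
    HasSum f (a + b) := by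
  have h : ∑' i : Fin 2, ∑' k, f (i, k) = a + b := by
    rw [tsum_fintype, Fin.sum_univ_two, h0.tsum_eq, h1.tsum_eq]
  rw [← h, ← hf.tsum_prod]
  exact hf.hasSum

/-- For fixed n the sum factors: e = 0 gives the step sums at n, and e = 1 those at n + 1 with the
factor X. Since `shellChar` vanishes below -1, the order n is j - 1 with j a natural number. -/
theorem bigSummand_sum (hK : 0 ≤ K) (hD : 1 ≤ D) (hr : 0 < r) (hr1 : r < 1)
    (hP : HasGrowth K D (-1) P) (hQ : HasGrowth K D (-1) Q) (hR : HasGrowth K D (-1) R)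
    (hM : 1 ≤ M) (hDM : D ^ 3 ≤ M) (hrM : r⁻¹ ≤ M) (hC0 : C ≠ 0) (hCM : ‖C‖ * M ^ 4 < 1)
    (hX : ‖X‖ ≤ ‖C‖ ^ 3 * M ^ 2)
    (hv₁ : ‖v₁‖ ≤ ‖C‖ ^ 2 * M) (hv₂ : ‖v₂‖ ≤ ‖C‖ ^ 2 * M) (hv₃ : ‖v₃‖ ≤ ‖C‖ ^ 2 * M) :
    HasSum (fun j : ℕ => C ^ ((j : ℤ) - 1) * (r : ℂ) ^ (-(2 * ((j : ℤ) - 1))) *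
      (stepSum P v₁ (j - 1) * (stepSum Q v₂ (j - 1) * stepSum R v₃ (j - 1)) +
        X * (stepSum P v₁ j * (stepSum Q v₂ j * stepSum R v₃ j))) * shellChar r (j - 1))
      (∑' p, bigSummand C X r P Q R v₁ v₂ v₃ p * shellChar r p.1) := by
  have hs : Summable fun p => bigSummand C X r P Q R v₁ v₂ v₃ p * shellChar r p.1 := by
    refine Summable.of_norm (Summable.of_nonneg_of_le (fun _ => norm_nonneg _) (fun p => ?_)
      ((summable_bigSummand hK hD hr hr1 hP hQ hR hM hDM hrM hC0 hCM hX hv₁ hv₂ hv₃).mul_left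
        (1 + r / (1 - r))))
    rw [norm_mul, mul_left_comm]
    exact mul_le_mul_of_nonneg_left (norm_shellChar_le hr hr1 _) (norm_nonneg _)
  have hC1 : ‖C‖ < 1 := (le_mul_of_one_le_right (norm_nonneg _) (one_le_pow₀ hM)).trans_lt hCM
  have hD2 : ∀ {v : ℂ}, ‖v‖ ≤ ‖C‖ ^ 2 * M → D ^ 2 * ‖v‖ < 1 := fun {v} hv => by
    have h1 : D ^ 2 ≤ M := (pow_le_pow_right₀ hD (by lia)).trans hDM
    calc D ^ 2 * ‖v‖ ≤ M * (‖C‖ ^ 2 * M) := by gcongr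
      _ = (‖C‖ * M) ^ 2 := by ring
      _ ≤ (‖C‖ * M ^ 4) ^ 2 := by
        gcongr
        exact le_self_pow₀ hM (by lia)
      _ < 1 := pow_lt_one₀ (by positivity) hCM (by lia)
  have hd₁ := hD2 hv₁
  have hd₂ := hD2 hv₂
  have hd₃ := hD2 hv₃
  have h3 := fun m : ℤ => hasSum_mul_triple (hP.hasSum_step hK hD hd₁ m)
    (hQ.hasSum_step hK hD hd₂ m) (hR.hasSum_step hK hD hd₃ m) (hP.summable_step hK hD hd₁ m)
    (hQ.summable_step hK hD hd₂ m) (hR.summable_step hK hD hd₃ m)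
  have hfib : HasSum (fun n : ℤ => C ^ n * (r : ℂ) ^ (-(2 * n)) *
      (stepSum P v₁ n * (stepSum Q v₂ n * stepSum R v₃ n) +
        X * (stepSum P v₁ (n + 1) * (stepSum Q v₂ (n + 1) * stepSum R v₃ (n + 1)))) *
        shellChar r n) (∑' p, bigSummand C X r P Q R v₁ v₂ v₃ p * shellChar r p.1) := by
    refine hs.hasSum.prod_fiberwise fun n => ?_
    have a0 := (h3 n).mul_left (C ^ n * (r : ℂ) ^ (-(2 * n)) * shellChar r n)
    have a1 := (h3 (n + 1)).mul_left (C ^ n * (r : ℂ) ^ (-(2 * n)) * X * shellChar r n)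
    have a := hasSum_fin_two_prod (hs.prod_factor n) (a0.congr_fun fun k => ?_)
      (a1.congr_fun fun k => ?_)
    · convert a using 1
      ring
    · simp only [bigSummand, Fin.val_zero, pow_zero, Nat.cast_zero, add_zero]
      ring
    · simp only [bigSummand, Fin.val_one, pow_one, Nat.cast_one]
      ring
  have hi : Function.Injective fun j : ℕ => (j : ℤ) - 1 := fun a b h => by simpa using h
  have := (hi.hasSum_iff ?_).2 hfib
  · refine this.congr_fun fun j => ?_
    simp only [Function.comp, sub_add_cancel]
  · intro n hn
    have : n < -1 := by
      by_contra h
      exact hn ⟨(n + 1).toNat, by change (((n + 1).toNat : ℕ) : ℤ) - 1 = n; lia⟩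
    rw [shellChar, if_neg (by lia), if_neg (by lia), mul_zero]

/-- The coordinates of `bigSummand`. -/
def bigCoord (p : ℤ × Fin 2 × ℕ × ℕ × ℕ) : ℤ × ℤ × ℤ × ℤ :=
  (p.1, p.1 + (p.2.1 : ℕ) + 2 * p.2.2.1, (p.2.2.2.1 : ℤ) - p.2.2.1, (p.2.2.2.2 : ℤ) - p.2.2.1)

/-- On the support the orders α, α + 2β, α + 2γ are at least n and have the same parity, so they are
n + e + 2kᵢ with one e in {0, 1} for all three. The factor gained by e = 1 is w₁w₂w₃C³. -/
theorem orbitTerm_big {w₁ w₂ w₃ : ℂ} (hK : 0 ≤ K) (hD : 1 ≤ D) (hr : 0 < r) (hr1 : r < 1)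
    (h₂ : w₂ ≠ 0) (h₃ : w₃ ≠ 0)
    (hP : HasGrowth K D (-1) P) (hQ : HasGrowth K D (-1) Q) (hR : HasGrowth K D (-1) R)
    (hM : 1 ≤ M) (hDM : D ^ 3 ≤ M) (hrM : r⁻¹ ≤ M) (hC0 : C ≠ 0) (hCM : ‖C‖ * M ^ 4 < 1)
    (hX : ‖w₁ * w₂ * w₃ * C ^ 3‖ ≤ ‖C‖ ^ 3 * M ^ 2)
    (hv₁ : ‖C ^ 2 * (w₂ * w₃)‖ ≤ ‖C‖ ^ 2 * M) (hv₂ : ‖C ^ 2 * (w₁ * w₃)‖ ≤ ‖C‖ ^ 2 * M)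
    (hv₃ : ‖C ^ 2 * (w₁ * w₂)‖ ≤ ‖C‖ ^ 2 * M) :
    (Summable fun p => ‖orbitTerm r w₁ w₂ w₃ (C * r) P Q R (fun p => p.1) p‖ *
      shellVol r p.1) ∧
    ∑' p, orbitTerm r w₁ w₂ w₃ (C * r) P Q R (fun p => p.1) p * shellChar r p.1 =
      ∑' p, bigSummand C (w₁ * w₂ * w₃ * C ^ 3) r P Q R (C ^ 2 * (w₂ * w₃)) (C ^ 2 * (w₁ * w₃))
        (C ^ 2 * (w₁ * w₂)) p * shellChar r p.1 := by
  refine orbit_reindex (i := bigCoord) ?_ (fun p => ?_) ?_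
    (summable_bigSummand hK hD hr hr1 hP hQ hR hM hDM hrM hC0 hCM hX hv₁ hv₂ hv₃)
  · rintro ⟨n, ⟨e, he⟩, k₁, k₂, k₃⟩ ⟨n', ⟨e', he'⟩, l₁, l₂, l₃⟩ h
    simp only [bigCoord, Prod.mk.injEq, Fin.mk.injEq] at h ⊢
    lia
  · obtain ⟨n, ⟨e, he⟩, k₁, k₂, k₃⟩ := p
    rw [orbitTerm_eq hr h₂ h₃ _ _ _ _ _ (by simp only [bigCoord]; lia)]
    simp only [bigCoord, bigSummand]
    rw [show n + e + 2 * (k₁ : ℤ) + 2 * (k₂ - k₁) = n + e + 2 * k₂ by ring,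
      show n + e + 2 * (k₁ : ℤ) + 2 * (k₃ - k₁) = n + e + 2 * k₃ by ring,
      show 3 * (n + e + 2 * (k₁ : ℤ)) + 2 * (k₂ - k₁ + (k₃ - k₁)) - 2 * n =
        n + ((3 * e + 2 * k₁ + 2 * k₂ + 2 * k₃ : ℕ) : ℤ) by push_cast; ring,
      show n + e + 2 * (k₁ : ℤ) + (k₂ - k₁) + (k₃ - k₁) - n = ((e + k₂ + k₃ : ℕ) : ℤ) by
        push_cast; ring,
      show n + e + 2 * (k₁ : ℤ) + (k₃ - k₁) - n = ((e + k₁ + k₃ : ℕ) : ℤ) by push_cast; ring,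
      show n + e + 2 * (k₁ : ℤ) + (k₂ - k₁) - n = ((e + k₁ + k₂ : ℕ) : ℤ) by push_cast; ring,
      zpow_add₀ hC0]
    simp only [zpow_natCast]
    ring
  · rintro ⟨n, α, β, γ⟩ hp
    by_cases h : n ≤ α ∧ n ≤ α + 2 * β ∧ n ≤ α + 2 * γ
    · refine absurd ⟨(n, ⟨((α - n) % 2).toNat, by lia⟩, ((α - n) / 2).toNat,
        (β + (α - n) / 2).toNat, (γ + (α - n) / 2).toNat), ?_⟩ hp
      simp only [bigCoord, Prod.mk.injEq]
      lia
    · refine orbitTerm_eq_zero _ _ _ _ _ ?_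
      simp only
      lia

end BigOrbit


/-! ### Step sums, exponential bounds and telescoping series -/

section StepSums

variable {K D : ℝ} {P : ℤ → ℂ} {v : ℂ}

theorem HasGrowth.stepSum_eq {l : ℤ} (h : HasGrowth K D l P) (hK : 0 ≤ K) (hD : 1 ≤ D)
    (hv : D ^ 2 * ‖v‖ < 1) (m : ℤ) : stepSum P v m = P m + v * stepSum P v (m + 2) := by
  have h1 := (h.hasSum_step hK hD hv m).summable.tsum_eq_zero_add
  have h2 := (h.hasSum_step hK hD hv (m + 2)).mul_left v
  rw [← h2.tsum_eq, stepSum, h1]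
  congr 1
  · simp
  · refine tsum_congr fun k => ?_
    rw [show m + 2 * ((k + 1 : ℕ) : ℤ) = m + 2 + 2 * k by push_cast; ring, pow_succ]
    ring

/-- A sequence which grows at most like `Dⁿ`. -/
def ExpBounded (D : ℝ) (a : ℕ → ℂ) : Prop := ∃ K : ℝ, 0 ≤ K ∧ ∀ n, ‖a n‖ ≤ K * D ^ n

theorem ExpBounded.shift {a : ℕ → ℂ} (h : ExpBounded D a) (hD : 0 ≤ D) :
    ExpBounded D fun n => a (n + 1) := by
  obtain ⟨K, hK, h⟩ := h
  exact ⟨K * D, by positivity, fun n => (h (n + 1)).trans (by rw [pow_succ]; exact le_of_eq (by ring))⟩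

theorem HasGrowth.expBounded {l : ℤ} (h : HasGrowth K D l P) (hK : 0 ≤ K) (hD : 0 ≤ D) :
    ExpBounded D fun n : ℕ => P n :=
  ⟨K * D, by positivity, fun n => (h.le n).trans (le_of_eq (by
    rw [show ((n : ℤ) + 1).toNat = n + 1 by lia, pow_succ]; ring))⟩

theorem HasGrowth.expBounded_stepSum {l : ℤ} (h : HasGrowth K D l P) (hK : 0 ≤ K) (hD : 1 ≤ D)
    (hv : D ^ 2 * ‖v‖ < 1) : ExpBounded D fun n : ℕ => stepSum P v n := by
  have h1 : 0 < 1 - D ^ 2 * ‖v‖ := by linarith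
  refine ⟨K * D * (1 - D ^ 2 * ‖v‖)⁻¹, by positivity, fun n => ?_⟩
  have h2 := ((hasSum_geometric_of_lt_one (by positivity) hv).mul_left (K * D ^ ((n : ℤ) + 1).toNat))
  have h3 := tsum_of_norm_bounded h2 (h.norm_step_le hK hD v n)
  refine h3.trans (le_of_eq ?_)
  rw [show ((n : ℤ) + 1).toNat = n + 1 by lia, pow_succ]
  ring

theorem ExpBounded.tendsto_triple {a b c : ℕ → ℂ} (ha : ExpBounded D a) (hb : ExpBounded D b)
    (hc : ExpBounded D c) (hD : 0 ≤ D) {z : ℂ} (hz : ‖z‖ * D ^ 3 < 1) :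
    Filter.Tendsto (fun n => z ^ n * (a n * (b n * c n))) Filter.atTop (nhds 0) := by
  obtain ⟨K₁, h₁, ha⟩ := ha
  obtain ⟨K₂, h₂, hb⟩ := hb
  obtain ⟨K₃, h₃, hc⟩ := hc
  have ht := (tendsto_pow_atTop_nhds_zero_of_lt_one (by positivity) hz).const_mul (K₁ * (K₂ * K₃))
  rw [mul_zero] at ht
  refine squeeze_zero_norm (fun n => ?_) ht
  rw [norm_mul, norm_mul, norm_mul, norm_pow]
  calc ‖z‖ ^ n * (‖a n‖ * (‖b n‖ * ‖c n‖))
      ≤ ‖z‖ ^ n * ((K₁ * D ^ n) * ((K₂ * D ^ n) * (K₃ * D ^ n))) := by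
        have := ha n
        have := hb n
        have := hc n
        gcongr
    _ = _ := by rw [mul_pow]; ring

theorem HasSum.eq_of_telescope {f E : ℕ → ℂ} {S d : ℂ} (hf : HasSum f S)
    (h : ∀ n, d * f n = E n - E (n + 1)) (hE : Filter.Tendsto E Filter.atTop (nhds 0)) :
    d * S = E 0 := by
  have h1 := (hf.mul_left d).tendsto_sum_nat
  have h2 : (fun n => ∑ i ∈ Finset.range n, d * f i) = fun n => E 0 - E n := by
    funext n
    simp_rw [h]
    exact Finset.sum_range_sub' E n
  rw [h2] at h1
  have h3 := hE.const_sub (E 0)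
  rw [sub_zero] at h3
  exact tendsto_nhds_unique h1 h3

end StepSums

/-! ### Data of principal series and of twists of the Steinberg representation -/

section Data

variable {K D r : ℝ}

/-- The values of a distinguished Whittaker function on the two cells of `GL₂(𝔬)`, and the value
of the central character at a prime element. -/
structure SeriesData where
  low : ℤ → ℂ
  big : ℤ → ℂ
  w : ℂ

/-- The data of an unramified principal series. -/
def sphSeries (r : ℝ) (s w : ℂ) : SeriesData := ⟨sphData s (r * w), sphData s (r * w), w⟩

/-- The data of an unramified twist of the Steinberg representation. -/
def steinSeries (r : ℝ) (t : ℂ) : SeriesData := ⟨steinLow (t * r), steinBig r (t * r), t ^ 2⟩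

/-- Bounds which control all the series attached to the data. -/
structure SeriesData.Bounded (d : SeriesData) (K D : ℝ) : Prop where
  low : HasGrowth K D 0 d.low
  big : HasGrowth K D (-1) d.big
  norm_w : ‖d.w‖ ≤ D
  w_ne : d.w ≠ 0

theorem SeriesData.Bounded.mono {d : SeriesData} {K' D' : ℝ} (h : d.Bounded K D) (hK : 0 ≤ K)
    (hD : 0 ≤ D) (hK' : K ≤ K') (hD' : D ≤ D') : d.Bounded K' D' :=
  ⟨h.low.mono hK hD hK' hD', h.big.mono hK hD hK' hD', h.norm_w.trans hD', h.w_ne⟩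

theorem norm_homSum_le {s e : ℂ} (hD : 1 ≤ D) (hs : ‖s‖ + ‖e‖ ≤ D) (n : ℕ) :
    ‖homSum s e n‖ ≤ D ^ n := by
  induction n using Nat.twoStepInduction with
  | zero => simp [homSum]
  | one =>
    simp only [homSum, pow_one]
    linarith [norm_nonneg e]
  | more n h0 h1 =>
    calc ‖homSum s e (n + 2)‖ ≤ ‖s‖ * D ^ (n + 1) + ‖e‖ * D ^ n := by
          rw [homSum]
          refine (norm_sub_le _ _).trans ?_
          rw [norm_mul, norm_mul]
          gcongr
      _ ≤ ‖s‖ * D ^ (n + 1) + ‖e‖ * D ^ (n + 1) := by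
          gcongr
          all_goals first | exact hD | lia
      _ ≤ D * D ^ (n + 1) := by
          rw [← add_mul]
          gcongr
      _ = _ := by ring

theorem hasGrowth_sphData {s e : ℂ} (hD : 1 ≤ D) (hs : ‖s‖ + ‖e‖ ≤ D) :
    HasGrowth 1 D 0 (sphData s e) := by
  refine ⟨fun m hm => by rw [sphData, if_neg (by lia)], fun m => ?_⟩
  rw [sphData, one_mul]
  split_ifs with h
  · refine (norm_homSum_le hD hs _).trans (pow_le_pow_right₀ hD ?_)
    lia
  · rw [norm_zero]
    positivity

theorem sphSeries_bounded {s w : ℂ} (hw : w ≠ 0) :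
    ∃ K D : ℝ, 0 ≤ K ∧ 1 ≤ D ∧ (sphSeries r s w).Bounded K D := by
  refine ⟨1, 1 + ‖s‖ + ‖r * w‖ + ‖w‖, zero_le_one, ?_, ?_⟩
  · linarith [norm_nonneg s, norm_nonneg (r * w), norm_nonneg w]
  · have h := hasGrowth_sphData (s := s) (e := r * w) (D := 1 + ‖s‖ + ‖r * w‖ + ‖w‖)
      (by linarith [norm_nonneg s, norm_nonneg (r * w), norm_nonneg w])
      (by linarith [norm_nonneg w])
    refine ⟨h, ⟨fun m hm => h.zero m (by lia), h.le⟩, ?_, hw⟩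
    change ‖w‖ ≤ _
    linarith [norm_nonneg s, norm_nonneg (r * w)]

theorem steinSeries_bounded (hr : 0 < r) {t : ℂ} (ht : t ≠ 0) :
    ∃ K D : ℝ, 0 ≤ K ∧ 1 ≤ D ∧ (steinSeries r t).Bounded K D := by
  set D : ℝ := 1 + ‖t * r‖ + ‖t ^ 2‖ with hD
  -- The three terms bound `steinLow`, `steinBig` at nonnegative orders, and the one extra value of
  -- `steinBig` at order -1.
  set K : ℝ := 1 + r + r / ‖t * r‖ with hK
  have h1 : 1 ≤ D := by linarith [norm_nonneg (t * r), norm_nonneg (t ^ 2)]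
  have hx : ‖t * r‖ ≤ D := by linarith [norm_nonneg (t ^ 2)]
  have hK1 : 1 ≤ K := by
    have : 0 ≤ r / ‖t * r‖ := by positivity
    linarith
  have hKr : r ≤ K := by
    have : 0 ≤ r / ‖t * r‖ := by positivity
    linarith
  have hpow : ∀ m : ℤ, 0 ≤ m → ‖t * r‖ ^ m ≤ D ^ (m + 1).toNat := fun m hm => by
    obtain ⟨n, rfl⟩ := Int.eq_ofNat_of_zero_le hm
    rw [zpow_natCast]
    exact (pow_le_pow_left₀ (norm_nonneg _) hx n).trans (pow_le_pow_right₀ h1 (by lia))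
  refine ⟨K, D, by linarith, h1, ⟨⟨fun m hm => ?_, fun m => ?_⟩, ⟨fun m hm => ?_, fun m => ?_⟩,
    ?_, pow_ne_zero 2 ht⟩⟩
  · simp only [steinSeries, steinLow]
    rw [if_neg (by lia)]
  · simp only [steinSeries, steinLow]
    split_ifs with h
    · rw [norm_zpow]
      exact (hpow m h).trans (le_mul_of_one_le_left (by positivity) hK1)
    · rw [norm_zero]
      positivity
  · simp only [steinSeries, steinBig]
    rw [if_neg (by lia)]
  · simp only [steinSeries, steinBig]
    split_ifs with h
    · rw [norm_mul, norm_neg, Complex.norm_real, Real.norm_of_nonneg hr.le, norm_zpow]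
      by_cases h0 : 0 ≤ m
      · have := hpow m h0
        gcongr
      · obtain rfl : m = -1 := by lia
        rw [_root_.zpow_neg_one, ← div_eq_mul_inv]
        simp only [neg_add_cancel, Int.toNat_zero, pow_zero, mul_one]
        linarith
    · rw [norm_zero]
      positivity
  · change ‖t ^ 2‖ ≤ D
    linarith [norm_nonneg (t * r)]

/-- Extension by zero keeps the recurrence valid at m = -1. It fails at m = -2, which is why the
step sums are used only from -1 on. -/
theorem sphData_add_two (s e : ℂ) {m : ℤ} (hm : -1 ≤ m) :
    sphData s e (m + 2) = s * sphData s e (m + 1) - e * sphData s e m := by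
  obtain rfl | h : m = -1 ∨ 0 ≤ m := by lia
  · norm_num [sphData, homSum]
  · obtain ⟨n, rfl⟩ := Int.eq_ofNat_of_zero_le h
    simp only [sphData]
    rw [if_pos (by lia), if_pos (by lia), if_pos (by lia),
      show ((n : ℤ) + 2).toNat = n + 2 by lia, show ((n : ℤ) + 1).toNat = n + 1 by lia,
      Int.toNat_natCast, homSum]

/-- The step sums of the data of a principal series satisfy a linear recurrence. -/
theorem stepSum_sphData (hK : 0 ≤ K) (hD : 1 ≤ D) {s e v : ℂ}
    (h : HasGrowth K D 0 (sphData s e)) (he : ‖e‖ ≤ D) (hv : D ^ 2 * ‖v‖ < 1) :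
    (∀ m, -1 ≤ m → stepSum (sphData s e) v (m + 2) =
      s * stepSum (sphData s e) v (m + 1) - e * stepSum (sphData s e) v m) ∧
    (∀ m, -1 ≤ m → sphData s e m = (1 + v * e) * stepSum (sphData s e) v m -
      v * s * stepSum (sphData s e) v (m + 1)) ∧
    ∃ k, k * ((1 + v * e) ^ 2 - v * s ^ 2) = 1 ∧ stepSum (sphData s e) v (-1) = v * s * k ∧
      stepSum (sphData s e) v 0 = (1 + v * e) * k := by
  have hrec : ∀ m, -1 ≤ m → stepSum (sphData s e) v (m + 2) =
      s * stepSum (sphData s e) v (m + 1) - e * stepSum (sphData s e) v m := fun m hm => by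
    have h1 := (h.hasSum_step hK hD hv (m + 1)).mul_left s
    have h0 := (h.hasSum_step hK hD hv m).mul_left e
    have h2 := h.hasSum_step hK hD hv (m + 2)
    refine h2.unique ((h1.sub h0).congr_fun fun k => ?_)
    rw [show m + 2 + 2 * (k : ℤ) = m + 2 * k + 2 by ring, sphData_add_two _ _ (by lia),
      show m + 1 + 2 * (k : ℤ) = m + 2 * k + 1 by ring]
    ring
  have hlin : ∀ m, -1 ≤ m → sphData s e m = (1 + v * e) * stepSum (sphData s e) v m -
      v * s * stepSum (sphData s e) v (m + 1) := fun m hm => by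
    have := h.stepSum_eq hK hD hv m
    rw [hrec m hm] at this
    linear_combination -this
  refine ⟨hrec, hlin, ?_⟩
  -- The two relations at -1 and 0 form a linear system for the two initial values. The number (1 +
  -- ve)² - vs² is its determinant up to the factor 1 + ve, which is non-zero because |ve| < 1.
  have a := hlin (-1) le_rfl
  have b := hlin 0 (by lia)
  have c := hrec (-1) le_rfl
  norm_num [sphData, homSum] at a b c
  have hne : 1 + v * e ≠ 0 := by
    intro h0
    have h1 : ‖v * e‖ = 1 := by rw [show v * e = -1 by linear_combination h0]; simp
    have h2 : ‖v * e‖ < 1 := by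
      rw [norm_mul, mul_comm]
      refine lt_of_le_of_lt ?_ hv
      gcongr
      exact he.trans (le_self_pow₀ hD (by lia))
    linarith
  have key : stepSum (sphData s e) v 0 * ((1 + v * e) ^ 2 - v * s ^ 2) = 1 + v * e := by
    rw [c] at b
    linear_combination -(1 + v * e) * b + v * s * e * a
  have hd : (1 + v * e) ^ 2 - v * s ^ 2 ≠ 0 := by
    intro h0
    rw [h0, mul_zero] at key
    exact hne key.symm
  refine ⟨((1 + v * e) ^ 2 - v * s ^ 2)⁻¹, inv_mul_cancel₀ hd, ?_, ?_⟩
  · have : (1 + v * e) * (stepSum (sphData s e) v (-1) * ((1 + v * e) ^ 2 - v * s ^ 2)) =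
        (1 + v * e) * (v * s) := by
      linear_combination v * s * key - ((1 + v * e) ^ 2 - v * s ^ 2) * a
    rw [← mul_left_cancel₀ hne this, mul_inv_cancel_right₀ hd]
  · rw [← div_eq_mul_inv, eq_div_iff hd, key]

theorem stepSum_steinBig {x v : ℂ} (hx : x ≠ 0) (hv : ‖x ^ 2 * v‖ < 1) {m : ℤ} (hm : -1 ≤ m) :
    stepSum (steinBig r x) v m = -r * x ^ m * (1 - x ^ 2 * v)⁻¹ := by
  rw [← ((hasSum_geometric_of_norm_lt_one hv).mul_left _).tsum_eq]
  refine tsum_congr fun k => ?_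
  rw [steinBig, if_pos (by lia), zpow_add₀ hx, mul_pow, ← pow_mul,
    show 2 * (k : ℤ) = ((2 * k : ℕ) : ℤ) by push_cast; rfl, zpow_natCast]
  ring

end Data


/-! ### Closed formulas for the normalized zeta integral -/

section Totals

/-- The step sums of the data of a representation at nonnegative integers. -/
def SeriesData.step (d : SeriesData) (v : ℂ) (n : ℕ) : ℂ := stepSum d.big v n

/-- The step sum of the data of a representation at `-1`. -/
def SeriesData.stepNeg (d : SeriesData) (v : ℂ) : ℂ := stepSum d.big v (-1)

/-- The contribution of the shell `‖x‖ = rⁿ`, `0 ≤ n`, to the normalized zeta integral. -/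
def totalSummand (r : ℝ) (C X : ℂ) (A₁ A₂ A₃ G₁ G₂ G₃ : ℕ → ℂ) (n : ℕ) : ℂ :=
  (C / r) ^ n * ((1 - r) * (G₁ n * (G₂ n * G₃ n) + X * (G₁ (n + 1) * (G₂ (n + 1) * G₃ (n + 1)))) +
    r * (A₁ n * (G₂ n * G₃ n) + A₂ n * (G₁ n * G₃ n) + A₃ n * (G₁ n * G₂ n)))

/-- `T` is the value of the normalized zeta integral, expressed by a single series. -/
def IsTotal (r : ℝ) (C : ℂ) (d₁ d₂ d₃ : SeriesData) (T : ℂ) : Prop :=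
  HasSum (totalSummand r C (d₁.w * d₂.w * d₃.w * C ^ 3) (fun n => d₁.low n) (fun n => d₂.low n)
      (fun n => d₃.low n) (d₁.step (C ^ 2 * (d₂.w * d₃.w))) (d₂.step (C ^ 2 * (d₁.w * d₃.w)))
      (d₃.step (C ^ 2 * (d₁.w * d₂.w))))
    (T + r ^ 2 / C * (d₁.stepNeg (C ^ 2 * (d₂.w * d₃.w)) * (d₂.stepNeg (C ^ 2 * (d₁.w * d₃.w)) *
        d₃.stepNeg (C ^ 2 * (d₁.w * d₂.w))) +
      d₁.w * d₂.w * d₃.w * C ^ 3 * (d₁.step (C ^ 2 * (d₂.w * d₃.w)) 0 *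
        (d₂.step (C ^ 2 * (d₁.w * d₃.w)) 0 * d₃.step (C ^ 2 * (d₁.w * d₂.w)) 0))))

variable {r K D : ℝ} {C T : ℂ} {d₁ d₂ d₃ : SeriesData}

theorem IsTotal.swap₁₂ (h : IsTotal r C d₁ d₂ d₃ T) : IsTotal r C d₂ d₁ d₃ T := by
  rw [IsTotal] at h ⊢
  rw [mul_comm d₂.w d₁.w]
  convert h using 1
  · funext n
    simp only [totalSummand]
    ring
  · ring

theorem IsTotal.swap₂₃ (h : IsTotal r C d₁ d₂ d₃ T) : IsTotal r C d₁ d₃ d₂ T := by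
  rw [IsTotal] at h ⊢
  rw [mul_comm d₃.w d₂.w]
  convert h using 1
  · funext n
    simp only [totalSummand]
    ring
  · ring

theorem norm_mul_lt_one_of_small (hD : 1 ≤ D) (hr : 0 < r) (hr1 : r < 1)
    (hC : ‖C‖ * D ^ 3 / r < 1) {w w' : ℂ} (hw : ‖w‖ ≤ D) (hw' : ‖w'‖ ≤ D) :
    D ^ 2 * ‖C ^ 2 * (w * w')‖ < 1 := by
  have h1 : ‖C‖ * D ^ 3 < 1 := by
    rw [div_lt_one hr] at hC
    linarith
  calc D ^ 2 * ‖C ^ 2 * (w * w')‖ ≤ D ^ 2 * (‖C‖ ^ 2 * (D * D)) := by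
        rw [norm_mul, norm_mul, norm_pow]
        gcongr
    _ = (‖C‖ * D ^ 2) ^ 2 := by ring
    _ ≤ (‖C‖ * D ^ 3) ^ 2 := by
        gcongr
        all_goals first | exact hD | lia
    _ < 1 := pow_lt_one₀ (by positivity) h1 (by lia)

theorem norm_div_lt_one_of_small (hr : 0 < r) (hC : ‖C‖ * D ^ 3 / r < 1) :
    ‖C / r‖ * D ^ 3 < 1 := by
  rw [norm_div, Complex.norm_real, Real.norm_of_nonneg hr.le]
  convert hC using 1
  ring

/-- The linear factor attached to a Steinberg representation is a square. -/
theorem norm_steinStep_lt_one (hr : 0 < r) (hr1 : r < 1) {t v : ℂ} (ht : ‖t ^ 2‖ ≤ D) (hD : 1 ≤ D)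
    (hv : D ^ 2 * ‖v‖ < 1) : ‖(t * r) ^ 2 * v‖ < 1 := by
  refine lt_of_le_of_lt ?_ hv
  rw [norm_mul, mul_pow, norm_mul, norm_pow (r : ℂ), Complex.norm_real, Real.norm_of_nonneg hr.le]
  have h1 : ‖t ^ 2‖ * r ^ 2 ≤ D ^ 2 * 1 := by
    gcongr
    · exact ht.trans (le_self_pow₀ hD (by lia))
    · exact pow_le_one₀ hr.le hr1.le
  rw [mul_one] at h1
  gcongr

/-- The determinant `∏ (1 - y αᵢ βⱼ)`, where `αᵢ`, `βⱼ` are the roots of `X² - s X + r w` and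
`X² - s' X + r w'`. -/
def rankinDet (y r s w s' w' : ℂ) : ℂ :=
  1 - y * s * s' + y ^ 2 * r * w * s' ^ 2 + y ^ 2 * r * s ^ 2 * w' - 2 * y ^ 2 * r ^ 2 * w * w' -
    y ^ 3 * r ^ 2 * s * w * s' * w' + y ^ 4 * r ^ 4 * w ^ 2 * w' ^ 2

theorem ExpBounded.add_right {P : ℕ → ℂ} (hP : ExpBounded D P) (hD : 0 ≤ D) (i : ℕ) :
    ExpBounded D fun n => P (n + i) := by
  induction i with
  | zero => exact hP
  | succ i ih =>
    have := ih.shift hD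
    simpa only [add_assoc, add_comm 1 i] using this

/-- The products G(n+i) H(n+j) with i, j in {0, 1} span a space on which the shift n ↦ n + 1 acts
linearly. The four conditions say that the boundary term yⁿ κ ∑ cᵢⱼ G(n+i) H(n+j) drops by δ f(n)
from n to n + 1. -/
theorem HasSum.telescope_two {y r s w s' w' κ m₀₀ m₀₁ m₁₀ m₁₁ c₀₀ c₀₁ c₁₀ c₁₁ δ S : ℂ}
    {f G H : ℕ → ℂ} (hf : HasSum f S)
    (hG : ∀ n, G (n + 2) = s * G (n + 1) - r * w * G n)
    (hH : ∀ n, H (n + 2) = s' * H (n + 1) - r * w' * H n)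
    (ht : ∀ i j, Filter.Tendsto (fun n => y ^ n * (G (n + i) * H (n + j))) Filter.atTop (nhds 0))
    (hfn : ∀ n, f n = y ^ n * (κ * (m₀₀ * (G n * H n) + m₀₁ * (G n * H (n + 1)) +
      m₁₀ * (G (n + 1) * H n) + m₁₁ * (G (n + 1) * H (n + 1)))))
    (h₀₀ : δ * m₀₀ = c₀₀ - y * (c₁₁ * (r * w) * (r * w')))
    (h₀₁ : δ * m₀₁ = c₀₁ + y * (c₁₀ * (r * w) + c₁₁ * (r * w) * s'))
    (h₁₀ : δ * m₁₀ = c₁₀ + y * (c₀₁ * (r * w') + c₁₁ * s * (r * w')))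
    (h₁₁ : δ * m₁₁ = c₁₁ - y * (c₀₀ + c₀₁ * s' + c₁₀ * s + c₁₁ * s * s')) :
    δ * S = κ * (c₀₀ * (G 0 * H 0) + c₀₁ * (G 0 * H 1) + c₁₀ * (G 1 * H 0) +
        c₁₁ * (G 1 * H 1)) := by
  have h1 := ((((ht 0 0).const_mul (κ * c₀₀)).add ((ht 0 1).const_mul (κ * c₀₁))).add
    ((ht 1 0).const_mul (κ * c₁₀))).add ((ht 1 1).const_mul (κ * c₁₁))
  simp only [mul_zero, add_zero] at h1
  rw [HasSum.eq_of_telescope hf (fun n => ?_) h1]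
  · simp only [pow_zero, zero_add, one_mul]
    ring
  · have e1 : G (n + 1 + 1) = s * G (n + 1) - r * w * G n := hG n
    have e2 : H (n + 1 + 1) = s' * H (n + 1) - r * w' * H n := hH n
    rw [hfn, pow_succ, e1, e2]
    linear_combination y ^ n * κ * (G n * H n * h₀₀ + G n * H (n + 1) * h₀₁ +
      G (n + 1) * H n * h₁₀ + G (n + 1) * H (n + 1) * h₁₁)

/-- `rankinDet` is the determinant of 1 - y · shift on the four products, so the system for the cᵢⱼ
has a polynomial solution by Cramer's rule. The fifth identity is the evaluation of the boundary
term at 0, corrected by the shell of order -1; its right-hand side has the factors that the initial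
values carry as denominators. -/
theorem exists_telescope_coeff (y r s w s' w' : ℂ) : ∃ c₀₀ c₀₁ c₁₀ c₁₁ : ℂ,
    rankinDet y r s w s' w' * ((1 - r) * -r + r * (1 - y ^ 2 * r ^ 2 * w * w' -
      r * (1 + y ^ 2 * w' * (r * w) + (1 + y ^ 2 * w * (r * w'))))) =
      c₀₀ - y * (c₁₁ * (r * w) * (r * w')) ∧
    rankinDet y r s w s' w' * (r ^ 2 * (y ^ 2 * w * s')) =
      c₀₁ + y * (c₁₀ * (r * w) + c₁₁ * (r * w) * s') ∧
    rankinDet y r s w s' w' * (r ^ 2 * (y ^ 2 * w' * s)) =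
      c₁₀ + y * (c₀₁ * (r * w') + c₁₁ * s * (r * w')) ∧
    rankinDet y r s w s' w' * ((1 - r) * -r * (y ^ 3 * r * w * w')) =
      c₁₁ - y * (c₀₀ + c₀₁ * s' + c₁₀ * s + c₁₁ * s * s') ∧
    y * (c₀₀ * ((1 + y ^ 2 * w' * (r * w)) * (1 + y ^ 2 * w * (r * w'))) +
      c₀₁ * ((1 + y ^ 2 * w' * (r * w)) * s') + c₁₀ * (s * (1 + y ^ 2 * w * (r * w'))) +
      c₁₁ * (s * s')) + rankinDet y r s w s' w' * (r ^ 2 * (y ^ 2 * w' * s * (y ^ 2 * w * s') +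
        y ^ 3 * r * w * w' * ((1 + y ^ 2 * w' * (r * w)) * (1 + y ^ 2 * w * (r * w'))))) =
      -(y * r ^ 2 * ((1 + y ^ 2 * w' * (r * w)) ^ 2 - y ^ 2 * w' * s ^ 2) *
        ((1 + y ^ 2 * w * (r * w')) ^ 2 - y ^ 2 * w * s' ^ 2) * (1 - y ^ 2 * r ^ 2 * w * w')) := by
  refine ⟨-r ^ 2 + y * r ^ 2 * s * s' - 3 * y ^ 2 * r ^ 3 * w * w' - y ^ 2 * r ^ 3 * w * s' ^ 2 -
      y ^ 2 * r ^ 3 * s ^ 2 * w' + y ^ 2 * r ^ 4 * w * w' + 3 * y ^ 3 * r ^ 3 * s * w * s' * w' +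
          y ^ 3 * r ^ 4 * s * w * s' * w' - y ^ 4 * r ^ 4 * w ^ 2 * w' ^ 2 -
          2 * y ^ 4 * r ^ 4 * w ^ 2 * s' ^ 2 * w' - 2 * y ^ 4 * r ^ 4 * s ^ 2 * w * w' ^ 2 +
          4 * y ^ 4 * r ^ 5 * w ^ 2 * w' ^ 2 + y ^ 5 * r ^ 5 * s * w ^ 2 * s' * w' ^ 2 +
          y ^ 6 * r ^ 6 * w ^ 3 * w' ^ 3 - y ^ 6 * r ^ 7 * w ^ 3 * w' ^ 3,
    y ^ 2 * r ^ 2 * w * s' + y ^ 2 * r ^ 3 * w * s' - y ^ 3 * r ^ 2 * s * w * s' ^ 2 -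
        y ^ 3 * r ^ 3 * s * w * w' - y ^ 3 * r ^ 4 * s * w * w' +
        y ^ 4 * r ^ 3 * w ^ 2 * s' * w' + y ^ 4 * r ^ 3 * s ^ 2 * w * s' * w' +
        y ^ 4 * r ^ 4 * w ^ 2 * s' * w' - y ^ 5 * r ^ 4 * s * w ^ 2 * w' ^ 2 -
        y ^ 5 * r ^ 5 * s * w ^ 2 * w' ^ 2,
    y ^ 2 * r ^ 2 * s * w' + y ^ 2 * r ^ 3 * s * w' - y ^ 3 * r ^ 2 * s ^ 2 * s' * w' -
        y ^ 3 * r ^ 3 * w * s' * w' - y ^ 3 * r ^ 4 * w * s' * w' +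
        y ^ 4 * r ^ 3 * s * w * w' ^ 2 + y ^ 4 * r ^ 3 * s * w * s' ^ 2 * w' +
        y ^ 4 * r ^ 4 * s * w * w' ^ 2 - y ^ 5 * r ^ 4 * w ^ 2 * s' * w' ^ 2 -
        y ^ 5 * r ^ 5 * w ^ 2 * s' * w' ^ 2,
    -y * r ^ 2 - y ^ 3 * r ^ 2 * w * w' + y ^ 3 * r ^ 2 * w * s' ^ 2 +
        y ^ 3 * r ^ 2 * s ^ 2 * w' - 2 * y ^ 3 * r ^ 3 * w * w' + y ^ 3 * r ^ 4 * w * w' -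
        2 * y ^ 4 * r ^ 3 * s * w * s' * w' + y ^ 5 * r ^ 4 * w ^ 2 * w' ^ 2 +
        2 * y ^ 5 * r ^ 5 * w ^ 2 * w' ^ 2,
    ?_, ?_, ?_, ?_, ?_⟩ <;> rw [rankinDet] <;> ring

/-- The same device for a single recurrence: 1 - yrs + y²r³w is the determinant of 1 - yr · shift on
the pair G(n), G(n+1). -/
theorem HasSum.telescope_one {y r s w κ S : ℂ} {f G g : ℕ → ℂ} (hf : HasSum f S)
    (hG : ∀ n, G (n + 2) = s * G (n + 1) - r * w * G n)
    (hg : ∀ n, g n = (1 + y ^ 2 * (r * w)) * G n - y ^ 2 * s * G (n + 1))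
    (hκ : κ * (1 - y ^ 2 * r ^ 2 * w) = 1)
    (ht : ∀ i, Filter.Tendsto (fun n => (y * r) ^ n * G (n + i)) Filter.atTop (nhds 0))
    (hfn : ∀ n, f n = (y * r) ^ n * ((1 - r) * (r * κ) ^ 2 *
      (G n + y ^ 3 * r ^ 2 * w * G (n + 1)) + r * (-2 * r * κ * G n + (r * κ) ^ 2 * g n))) :
    (1 - y * r * s + y ^ 2 * r ^ 3 * w) * S = κ ^ 2 * ((-r ^ 2 + y * r ^ 3 * s +
        3 * y ^ 2 * r ^ 4 * w - 2 * y ^ 3 * r ^ 5 * s * w - y ^ 4 * r ^ 6 * w ^ 2 +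
        y ^ 4 * r ^ 7 * w ^ 2) * G 0 +
      (-y * r ^ 3 - y ^ 2 * r ^ 3 * s + y ^ 3 * r ^ 4 * w + 2 * y ^ 3 * r ^ 5 * w) * G 1) := by
  have h1 := ((ht 0).const_mul (κ ^ 2 * (-r ^ 2 + y * r ^ 3 * s + 3 * y ^ 2 * r ^ 4 * w -
      2 * y ^ 3 * r ^ 5 * s * w - y ^ 4 * r ^ 6 * w ^ 2 + y ^ 4 * r ^ 7 * w ^ 2))).add
    ((ht 1).const_mul (κ ^ 2 * (-y * r ^ 3 - y ^ 2 * r ^ 3 * s + y ^ 3 * r ^ 4 * w +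
        2 * y ^ 3 * r ^ 5 * w)))
  simp only [mul_zero, add_zero] at h1
  rw [HasSum.eq_of_telescope hf (fun n => ?_) h1]
  · simp only [pow_zero, zero_add, one_mul]
    ring
  · rw [hfn, hg, pow_succ]
    have e1 : G (n + 1 + 1) = s * G (n + 1) - r * w * G n := hG n
    rw [e1]
    linear_combination 2 * (1 - y * r * s + y ^ 2 * r ^ 3 * w) * (y * r) ^ n * r ^ 2 * κ * G n * hκ

/-- The bounds on the data give all the convergence statements used for the closed formulas. -/
theorem SeriesData.Bounded.norm_real_mul_le {d : SeriesData} (h : d.Bounded K D) (hr : 0 < r)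
    (hr1 : r < 1) : ‖(r : ℂ) * d.w‖ ≤ D := by
  rw [norm_mul, Complex.norm_real, Real.norm_of_nonneg hr.le]
  exact (mul_le_of_le_one_left (norm_nonneg _) hr1.le).trans h.norm_w

theorem steinSeries_low_natCast (t : ℂ) (n : ℕ) : (steinSeries r t).low n = (t * r) ^ n := by
  simp [steinSeries, steinLow]

theorem steinSeries_step (hD : 1 ≤ D) (hr : 0 < r) (hr1 : r < 1) {t v : ℂ} (ht : t ≠ 0)
    (b : (steinSeries r t).Bounded K D) (hv : D ^ 2 * ‖v‖ < 1) :
    ∃ κ : ℂ, κ * (1 - (t * r) ^ 2 * v) = 1 ∧ t * (steinSeries r t).stepNeg v = -κ ∧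
      ∀ n : ℕ, (steinSeries r t).step v n = -r * (t * r) ^ n * κ := by
  have hrc : (r : ℂ) ≠ 0 := by exact_mod_cast hr.ne'
  have n₁ := norm_steinStep_lt_one hr hr1 b.norm_w hD hv
  have hκ : 1 - (t * r) ^ 2 * v ≠ 0 := by
    intro h0
    rw [← sub_eq_zero.1 h0, norm_one] at n₁
    exact lt_irrefl _ n₁
  have g := fun {m : ℤ} => stepSum_steinBig (r := r) (m := m) (mul_ne_zero ht hrc) n₁
  refine ⟨(1 - (t * r) ^ 2 * v)⁻¹, inv_mul_cancel₀ hκ, ?_, fun n => ?_⟩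
  · rw [SeriesData.stepNeg, steinSeries, g le_rfl, _root_.zpow_neg_one]
    field_simp
  · rw [SeriesData.step, steinSeries, g (by lia), zpow_natCast]

theorem sphSeries_step (hK : 0 ≤ K) (hD : 1 ≤ D) (hr : 0 < r) (hr1 : r < 1) {s w v : ℂ}
    (b : (sphSeries r s w).Bounded K D) (hv : D ^ 2 * ‖v‖ < 1) :
    (∀ n, (sphSeries r s w).step v (n + 2) =
      s * (sphSeries r s w).step v (n + 1) - r * w * (sphSeries r s w).step v n) ∧
    (∀ n : ℕ, (sphSeries r s w).low n = (1 + v * (r * w)) * (sphSeries r s w).step v n -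
      v * s * (sphSeries r s w).step v (n + 1)) ∧
    ExpBounded D ((sphSeries r s w).step v) ∧
    ∃ k, k * ((1 + v * (r * w)) ^ 2 - v * s ^ 2) = 1 ∧ (sphSeries r s w).stepNeg v = v * s * k ∧
      (sphSeries r s w).step v 0 = (1 + v * (r * w)) * k ∧ (sphSeries r s w).step v 1 = s * k := by
  obtain ⟨g, l, k, hk, i, j⟩ := stepSum_sphData hK hD b.low (b.norm_real_mul_le hr hr1) hv
  refine ⟨fun n => ?_, fun n => ?_, b.low.expBounded_stepSum hK hD hv, k, hk, i, j, ?_⟩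
  · have := g n (by lia)
    simp only [SeriesData.step, Nat.cast_add, Nat.cast_ofNat, Nat.cast_one]
    exact this
  · have := l n (by lia)
    simp only [SeriesData.step, Nat.cast_add, Nat.cast_one]
    exact this
  · have h1 := g (-1) le_rfl
    change stepSum (sphData s (r * w)) v 1 = _
    norm_num at h1
    rw [h1, i, j]
    ring

/-- The geometric Steinberg factor only turns the ratio C/r into y = Ct. What remains is a bilinear
form in two solutions of second order recurrences, to which `HasSum.telescope_two` applies. -/
theorem hasSum_two_spherical (hr : 0 < r) (hD : 0 ≤ D) (hC0 : C ≠ 0) (hC : ‖C / r‖ * D ^ 3 < 1)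
    {t s w s' w' κ k k' gm Gm Hm : ℂ} {G₁ G H g h : ℕ → ℂ} (ht : t ≠ 0)
    (hS : HasSum (totalSummand r C (t ^ 2 * w * w' * C ^ 3) (fun n => (t * r) ^ n) g h G₁ G H)
      (T + r ^ 2 / C * (gm * (Gm * Hm) + t ^ 2 * w * w' * C ^ 3 * (G₁ 0 * (G 0 * H 0)))))
    (hκ : κ * (1 - (t * r) ^ 2 * (C ^ 2 * (w * w'))) = 1) (hgm : t * gm = -κ)
    (hG₁ : ∀ n : ℕ, G₁ n = -r * (t * r) ^ n * κ)
    (eG : ExpBounded D G) (eH : ExpBounded D H) (e₁ : ExpBounded D fun n => (t * r) ^ n)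
    (rG : ∀ n, G (n + 2) = s * G (n + 1) - r * w * G n)
    (rH : ∀ n, H (n + 2) = s' * H (n + 1) - r * w' * H n)
    (lG : ∀ n, g n = (1 + C ^ 2 * (t ^ 2 * w') * (r * w)) * G n - C ^ 2 * (t ^ 2 * w') * s * G (n + 1))
    (lH : ∀ n, h n = (1 + C ^ 2 * (t ^ 2 * w) * (r * w')) * H n - C ^ 2 * (t ^ 2 * w) * s' * H (n + 1))
    (hk : k * ((1 + C ^ 2 * (t ^ 2 * w') * (r * w)) ^ 2 - C ^ 2 * (t ^ 2 * w') * s ^ 2) = 1)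
    (hk' : k' * ((1 + C ^ 2 * (t ^ 2 * w) * (r * w')) ^ 2 - C ^ 2 * (t ^ 2 * w) * s' ^ 2) = 1)
    (hGm : Gm = C ^ 2 * (t ^ 2 * w') * s * k) (hHm : Hm = C ^ 2 * (t ^ 2 * w) * s' * k')
    (hG0 : G 0 = (1 + C ^ 2 * (t ^ 2 * w') * (r * w)) * k) (hG1 : G 1 = s * k)
    (hH0 : H 0 = (1 + C ^ 2 * (t ^ 2 * w) * (r * w')) * k') (hH1 : H 1 = s' * k') :
    rankinDet (C * t) r s w s' w' * T = -r ^ 2 := by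
  have hrc : (r : ℂ) ≠ 0 := by exact_mod_cast hr.ne'
  have hy : ∀ n : ℕ, (C / r) ^ n * (t * r) ^ n = (C * t) ^ n := fun n => by
    rw [← mul_pow]
    congr 1
    field_simp
  obtain ⟨c₀₀, c₀₁, c₁₀, c₁₁, h₀₀, h₀₁, h₁₀, h₁₁, hc⟩ := exists_telescope_coeff (C * t) r s w s' w'
  have htend : ∀ i j, Filter.Tendsto (fun n => (C * t) ^ n * (G (n + i) * H (n + j)))
      Filter.atTop (nhds 0) := fun i j => by
    refine (e₁.tendsto_triple (eG.add_right hD i) (eH.add_right hD j) hD hC).congr fun n => ?_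
    rw [← hy]
    ring
  have key := HasSum.telescope_two (κ := κ) hS rG rH htend (fun n => ?_) h₀₀ h₀₁ h₁₀ h₁₁
  · have hy0 : C * t ≠ 0 := mul_ne_zero hC0 ht
    -- Multiplication by Ct clears the denominators C and t of the term coming from the shell of
    -- order -1.
    refine mul_left_cancel₀ hy0 ?_
    have hcanc : C * (r ^ 2 / C) = (r : ℂ) ^ 2 := mul_div_cancel₀ _ hC0
    rw [hG₁ 0, pow_zero, hG0, hG1, hH0, hH1, hGm, hHm] at key
    generalize rankinDet (C * t) r s w s' w' = δ at *
    generalize (r : ℂ) ^ 2 / C = z at *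
    linear_combination C * t * key - t * δ * (gm * (C ^ 2 * (t ^ 2 * w') * s * k *
        (C ^ 2 * (t ^ 2 * w) * s' * k')) + t ^ 2 * w * w' * C ^ 3 * (-r * κ *
        ((1 + C ^ 2 * (t ^ 2 * w') * (r * w)) * k *
          ((1 + C ^ 2 * (t ^ 2 * w) * (r * w')) * k')))) * hcanc -
      δ * r ^ 2 * (C ^ 2 * (t ^ 2 * w') * s * k * (C ^ 2 * (t ^ 2 * w) * s' * k')) * hgm +
      κ * k * k' * hc - C * t * r ^ 2 * (k' * ((1 + C ^ 2 * (t ^ 2 * w) * (r * w')) ^ 2 -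
        C ^ 2 * (t ^ 2 * w) * s' ^ 2) * (κ * (1 - (t * r) ^ 2 * (C ^ 2 * (w * w')))) * hk +
        κ * (1 - (t * r) ^ 2 * (C ^ 2 * (w * w'))) * hk' + hκ)
  · rw [totalSummand, hG₁, hG₁, lG, lH, ← hy]
    linear_combination -((C / r) ^ n * (t * r) ^ n * (r * (G n * H n))) * hκ

theorem IsTotal.steinberg_spherical_spherical (hK : 0 ≤ K) (hD : 1 ≤ D) (hr : 0 < r) (hr1 : r < 1)
    (hC0 : C ≠ 0) (hC : ‖C‖ * D ^ 3 / r < 1) {t s w s' w' : ℂ} (ht : t ≠ 0)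
    (b₁ : (steinSeries r t).Bounded K D) (b₂ : (sphSeries r s w).Bounded K D)
    (b₃ : (sphSeries r s' w').Bounded K D)
    (h : IsTotal r C (steinSeries r t) (sphSeries r s w) (sphSeries r s' w') T) :
    rankinDet (C * t) r s w s' w' * T = -r ^ 2 := by
  have hrc : (r : ℂ) ≠ 0 := by exact_mod_cast hr.ne'
  have w₁ : (steinSeries r t).w = t ^ 2 := rfl
  have w₂ : (sphSeries r s w).w = w := rfl
  have w₃ : (sphSeries r s' w').w = w' := rfl
  have n₁ := norm_mul_lt_one_of_small hD hr hr1 hC b₂.norm_w b₃.norm_w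
  have n₂ := norm_mul_lt_one_of_small hD hr hr1 hC b₁.norm_w b₃.norm_w
  have n₃ := norm_mul_lt_one_of_small hD hr hr1 hC b₁.norm_w b₂.norm_w
  rw [IsTotal, w₁, w₂, w₃] at h
  rw [w₂, w₃] at n₁
  rw [w₁, w₃] at n₂
  rw [w₁, w₂] at n₃
  obtain ⟨κ, hκ, gm, g⟩ := steinSeries_step hD hr hr1 ht b₁ n₁
  obtain ⟨r₂, l₂, e₂, k, hk, m₂, i₂, j₂⟩ := sphSeries_step hK hD hr hr1 b₂ n₂
  obtain ⟨r₃, l₃, e₃, k', hk', m₃, i₃, j₃⟩ := sphSeries_step hK hD hr hr1 b₃ n₃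
  have e₁ := b₁.low.expBounded hK (by linarith)
  simp only [steinSeries_low_natCast] at e₁ h
  exact hasSum_two_spherical hr (by linarith) hC0 (norm_div_lt_one_of_small hr hC) ht h hκ gm g e₂ e₃ e₁
    r₂ r₃ l₂ l₃ hk hk' m₂ m₃ i₂ j₂ i₃ j₃

/-- The product of the linear factors of `π₁ × π₂ × π₃` for two twists of the Steinberg
representation and a principal series. -/
def steinSteinDet (y r s w : ℂ) : ℂ :=
  (1 - y * r * s + y ^ 2 * r ^ 3 * w) * (1 - y * s + y ^ 2 * r * w)

/-- Telescoping produces the first factor of `steinSteinDet`, with y = Ctt'. The second divides (1 +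
y²rw)² - y²s², the denominator of the initial values of the spherical step sum. -/
theorem IsTotal.steinberg_steinberg_spherical (hK : 0 ≤ K) (hD : 1 ≤ D) (hr : 0 < r) (hr1 : r < 1)
    (hC0 : C ≠ 0) (hC : ‖C‖ * D ^ 3 / r < 1) {t t' s w : ℂ} (ht : t ≠ 0) (ht' : t' ≠ 0)
    (b₁ : (steinSeries r t).Bounded K D) (b₂ : (steinSeries r t').Bounded K D)
    (b₃ : (sphSeries r s w).Bounded K D)
    (h : IsTotal r C (steinSeries r t) (steinSeries r t') (sphSeries r s w) T) :
    steinSteinDet (C * t * t') r s w * T = -r ^ 2 := by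
  have hrc : (r : ℂ) ≠ 0 := by exact_mod_cast hr.ne'
  have w₁ : (steinSeries r t).w = t ^ 2 := rfl
  have w₂ : (steinSeries r t').w = t' ^ 2 := rfl
  have w₃ : (sphSeries r s w).w = w := rfl
  have n₁ := norm_mul_lt_one_of_small hD hr hr1 hC b₂.norm_w b₃.norm_w
  have n₂ := norm_mul_lt_one_of_small hD hr hr1 hC b₁.norm_w b₃.norm_w
  have n₃ := norm_mul_lt_one_of_small hD hr hr1 hC b₁.norm_w b₂.norm_w
  rw [IsTotal, w₁, w₂, w₃] at h
  rw [w₂, w₃] at n₁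
  rw [w₁, w₃] at n₂
  rw [w₁, w₂] at n₃
  obtain ⟨κ₁, hκ₁, m₁, g₁⟩ := steinSeries_step hD hr hr1 ht b₁ n₁
  obtain ⟨κ, hκ, m₂, g₂⟩ := steinSeries_step hD hr hr1 ht' b₂ n₂
  obtain ⟨r₃, l₃, e₃, k, hk, m₃, i₃, j₃⟩ := sphSeries_step hK hD hr hr1 b₃ n₃
  have e₁ := b₁.low.expBounded hK (by linarith)
  have e₂ := b₂.low.expBounded hK (by linarith)
  simp only [steinSeries_low_natCast] at e₁ e₂ h
  -- Both are the inverse of 1 - r²C²w₁w₂w₃, which is symmetric in the three representations.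
  have hκκ : κ₁ = κ := by linear_combination κ * hκ₁ - κ₁ * hκ
  rw [hκκ] at m₁ g₁
  clear hκ₁ hκκ
  generalize (steinSeries r t).step (C ^ 2 * (t' ^ 2 * w)) = G₁ at *
  generalize (steinSeries r t').step (C ^ 2 * (t ^ 2 * w)) = G₂ at *
  generalize (sphSeries r s w).step (C ^ 2 * (t ^ 2 * t' ^ 2)) = G at *
  generalize (steinSeries r t).stepNeg (C ^ 2 * (t' ^ 2 * w)) = gm₁ at *
  generalize (steinSeries r t').stepNeg (C ^ 2 * (t ^ 2 * w)) = gm₂ at *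
  generalize (sphSeries r s w).stepNeg (C ^ 2 * (t ^ 2 * t' ^ 2)) = gm at *
  have hy : ∀ n : ℕ, (C / r) ^ n * (t * r) ^ n * (t' * r) ^ n = (C * t * t' * r) ^ n := fun n => by
    rw [← mul_pow, ← mul_pow]
    congr 1
    field_simp
  have htend : ∀ i, Filter.Tendsto (fun n => (C * t * t' * r) ^ n * G (n + i))
      Filter.atTop (nhds 0) := fun i => by
    refine (e₁.tendsto_triple e₂ (e₃.add_right (by linarith) i) (by linarith)
      (norm_div_lt_one_of_small hr hC)).congr fun n => ?_
    rw [← hy]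
    ring
  have key := HasSum.telescope_one (y := C * t * t') (r := r) (s := s) (w := w) (κ := κ) h r₃
    (fun n => (l₃ n).trans (by ring)) (by linear_combination hκ) htend (fun n => ?_)
  · have hy0 : C * t * t' ≠ 0 := mul_ne_zero (mul_ne_zero hC0 ht) ht'
    refine mul_left_cancel₀ hy0 ?_
    have hcanc : C * (r ^ 2 / C) = (r : ℂ) ^ 2 := mul_div_cancel₀ _ hC0
    rw [g₁ 0, g₂ 0, pow_zero, pow_zero, i₃, j₃, m₃] at key
    rw [steinSteinDet]
    generalize (r : ℂ) ^ 2 / C = z at *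
    linear_combination (C * t * t') * (1 - (C * t * t') * s + (C * t * t') ^ 2 * r * w) * key -
      (1 - (C * t * t') * r * s + (C * t * t') ^ 2 * r ^ 3 * w) *
        (1 - (C * t * t') * s + (C * t * t') ^ 2 * r * w) * (t * t' *
          (gm₁ * (gm₂ * (C ^ 2 * (t ^ 2 * t' ^ 2) * s * k)) + t ^ 2 * t' ^ 2 * w * C ^ 3 *
            (-r * κ * (-r * κ * ((1 + C ^ 2 * (t ^ 2 * t' ^ 2) * (r * w)) * k)))) * hcanc +
          r ^ 2 * (C ^ 2 * (t ^ 2 * t' ^ 2) * s * k) * (t' * gm₂ * m₁ - κ * m₂)) -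
      (C * t * t') * r ^ 2 * ((κ * (1 - (t' * r) ^ 2 * (C ^ 2 * (t ^ 2 * w)))) ^ 2 * hk +
        (κ * (1 - (t' * r) ^ 2 * (C ^ 2 * (t ^ 2 * w))) + 1) * hκ)
  · rw [totalSummand, g₁, g₁, g₂, g₂, ← hy]
    ring

/-- All three step sums are geometric, so the total is a geometric series of ratio yr with y =
Ctt't''r, plus the shell of order -1. With κ = (1 - y²)⁻¹ the two combine to y(1 - yr)T = r³κ²(1 +
y)², whence the factor (1 - y)². -/
theorem IsTotal.steinberg_steinberg_steinberg (hD : 1 ≤ D) (hr : 0 < r) (hr1 : r < 1)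
    (hC0 : C ≠ 0) (hC : ‖C‖ * D ^ 3 / r < 1) {t t' t'' : ℂ} (ht : t ≠ 0) (ht' : t' ≠ 0)
    (ht'' : t'' ≠ 0)
    (b₁ : (steinSeries r t).Bounded K D) (b₂ : (steinSeries r t').Bounded K D)
    (b₃ : (steinSeries r t'').Bounded K D)
    (h : IsTotal r C (steinSeries r t) (steinSeries r t') (steinSeries r t'') T) :
    C * t * t' * t'' * r * ((1 - C * t * t' * t'' * r ^ 2) * (1 - C * t * t' * t'' * r) ^ 2) * T =
      r ^ 3 := by
  have hrc : (r : ℂ) ≠ 0 := by exact_mod_cast hr.ne'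
  have w₁ : (steinSeries r t).w = t ^ 2 := rfl
  have w₂ : (steinSeries r t').w = t' ^ 2 := rfl
  have w₃ : (steinSeries r t'').w = t'' ^ 2 := rfl
  have n₁ := norm_mul_lt_one_of_small hD hr hr1 hC b₂.norm_w b₃.norm_w
  have n₂ := norm_mul_lt_one_of_small hD hr hr1 hC b₁.norm_w b₃.norm_w
  have n₃ := norm_mul_lt_one_of_small hD hr hr1 hC b₁.norm_w b₂.norm_w
  rw [IsTotal, w₁, w₂, w₃] at h
  rw [w₂, w₃] at n₁
  rw [w₁, w₃] at n₂
  rw [w₁, w₂] at n₃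
  obtain ⟨κ₁, hκ₁, m₁, g₁⟩ := steinSeries_step hD hr hr1 ht b₁ n₁
  obtain ⟨κ₂, hκ₂, m₂, g₂⟩ := steinSeries_step hD hr hr1 ht' b₂ n₂
  obtain ⟨κ, hκ, m₃, g₃⟩ := steinSeries_step hD hr hr1 ht'' b₃ n₃
  have hκκ : κ₁ = κ := by linear_combination κ * hκ₁ - κ₁ * hκ
  have hκκ' : κ₂ = κ := by linear_combination κ * hκ₂ - κ₂ * hκ
  rw [hκκ] at m₁ g₁
  rw [hκκ'] at m₂ g₂
  clear hκ₁ hκ₂ hκκ hκκ'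
  simp only [steinSeries_low_natCast] at h
  generalize (steinSeries r t).step (C ^ 2 * (t' ^ 2 * t'' ^ 2)) = G₁ at *
  generalize (steinSeries r t').step (C ^ 2 * (t ^ 2 * t'' ^ 2)) = G₂ at *
  generalize (steinSeries r t'').step (C ^ 2 * (t ^ 2 * t' ^ 2)) = G₃ at *
  generalize (steinSeries r t).stepNeg (C ^ 2 * (t' ^ 2 * t'' ^ 2)) = gm₁ at *
  generalize (steinSeries r t').stepNeg (C ^ 2 * (t ^ 2 * t'' ^ 2)) = gm₂ at *
  generalize (steinSeries r t'').stepNeg (C ^ 2 * (t ^ 2 * t' ^ 2)) = gm₃ at *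
  have hy : ∀ n : ℕ, (C / r) ^ n * (t * r) ^ n * (t' * r) ^ n * (t'' * r) ^ n =
      (C * t * t' * t'' * r ^ 2) ^ n := fun n => by
    rw [← mul_pow, ← mul_pow, ← mul_pow]
    congr 1
    field_simp
  have hsmall : ‖C * t * t' * t'' * r ^ 2‖ < 1 := by
    refine (sq_lt_one_iff₀ (norm_nonneg _)).1 (lt_of_le_of_lt ?_ n₃)
    have h1 : ‖t'' ^ 2‖ * (r ^ 2) ^ 2 ≤ D ^ 2 * 1 := by
      gcongr
      · exact (w₃ ▸ b₃.norm_w).trans (le_self_pow₀ hD (by lia))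
      · exact pow_le_one₀ (by positivity) (pow_le_one₀ hr.le hr1.le)
    rw [mul_one] at h1
    calc ‖C * t * t' * t'' * r ^ 2‖ ^ 2 = ‖t'' ^ 2‖ * (r ^ 2) ^ 2 * ‖C ^ 2 * (t ^ 2 * t' ^ 2)‖ := by
          simp only [norm_mul, norm_pow, Complex.norm_real, Real.norm_of_nonneg hr.le]
          ring
      _ ≤ _ := by gcongr
  set y := C * t * t' * t'' * r with hydef
  have hgeo := (hasSum_geometric_of_norm_lt_one hsmall).mul_left
    ((1 - r) * (-r ^ 3 * κ ^ 3 * (1 + y ^ 3)) + 3 * r ^ 3 * κ ^ 2)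
  have hT := h.unique (hgeo.congr_fun fun n => ?_)
  · have hu : (1 - C * t * t' * t'' * r ^ 2) * (1 - C * t * t' * t'' * r ^ 2)⁻¹ = 1 := by
      refine mul_inv_cancel₀ fun h0 => ?_
      rw [← sub_eq_zero.1 h0, norm_one] at hsmall
      exact lt_irrefl _ hsmall
    have hcanc : C * (r ^ 2 / C) = (r : ℂ) ^ 2 := mul_div_cancel₀ _ hC0
    have hκy : κ * (1 - y ^ 2) = 1 := by
      rw [hydef]
      linear_combination hκ
    rw [g₁ 0, g₂ 0, g₃ 0, pow_zero, pow_zero, pow_zero] at hT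
    generalize (r : ℂ) ^ 2 / C = z at *
    generalize (1 - C * t * t' * t'' * r ^ 2)⁻¹ = u at *
    have e1 : y * T = r ^ 3 * κ ^ 3 * (1 + y ^ 3) +
        y * ((1 - r) * (-r ^ 3 * κ ^ 3 * (1 + y ^ 3)) + 3 * r ^ 3 * κ ^ 2) * u := by
      have e2 : y * (z * (gm₁ * (gm₂ * gm₃) + t ^ 2 * t' ^ 2 * t'' ^ 2 * C ^ 3 *
          (-r * 1 * κ * (-r * 1 * κ * (-r * 1 * κ))))) = -(r ^ 3 * κ ^ 3 * (1 + y ^ 3)) := by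
        rw [hydef]
        linear_combination t * t' * t'' * r * (gm₁ * (gm₂ * gm₃) + t ^ 2 * t' ^ 2 * t'' ^ 2 * C ^ 3 *
          (-r * 1 * κ * (-r * 1 * κ * (-r * 1 * κ)))) * hcanc + r ^ 3 * (t' * gm₂ * (t'' * gm₃) * m₁ -
            κ * (t'' * gm₃) * m₂ + κ ^ 2 * m₃)
      linear_combination y * hT - e2
    have hY : C * t * t' * t'' * r ^ 2 = y * r := by
      rw [hydef]
      ring
    rw [hY] at hu ⊢
    linear_combination (1 - y * r) * (1 - y) ^ 2 * e1 +
      y * ((1 - r) * (-r ^ 3 * κ ^ 3 * (1 + y ^ 3)) + 3 * r ^ 3 * κ ^ 2) * (1 - y) ^ 2 * hu -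
      3 * y * r ^ 3 * κ ^ 2 * (1 - y) ^ 2 * hκy +
      r ^ 3 * ((κ * (1 - y ^ 2)) ^ 2 + κ * (1 - y ^ 2) + 1) * hκy
  · rw [totalSummand, g₁, g₁, g₂, g₂, g₃, g₃, ← hy, hydef]
    ring

end Totals


/-! ### Adding up the four orbits -/

section Assembly

variable {r K D : ℝ} {C : ℂ} {d₁ d₂ d₃ : SeriesData}

theorem HasSum.of_eq {f g : ℕ → ℂ} {a b : ℂ} (h : HasSum f a) (hf : ∀ n, g n = f n) (hab : b = a) :
    HasSum g b := by
  rw [hab, show g = f from funext hf]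
  exact h

/-- The four orbit sums are added shell by shell over n ≥ 0. Only the open orbit reaches n = -1,
where `shellChar` is -1; moving that term to the other side gives the correction r²/C (...) in
`IsTotal`. -/
theorem cellCoeff_isTotal (hK : 0 ≤ K) (hD : 1 ≤ D) (hr : 0 < r) (hr1 : r < 1)
    (hC0 : C ≠ 0) (hCM : ‖C‖ * (D ^ 3 / r) ^ 4 < 1)
    (b₁ : d₁.Bounded K D) (b₂ : d₂.Bounded K D) (b₃ : d₃.Bounded K D) :
    (Summable fun k : ℤ × (ℤ × ℤ × ℤ) × (ℤ × ℤ × ℤ) =>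
      ‖cellCoeff d₁.low d₂.low d₃.low d₁.big d₂.big d₃.big d₁.w d₂.w d₃.w (C * r) r k‖ *
        (shellVol r k.1 * (shellVol r k.2.2.1 * (shellVol r k.2.2.2.1 * shellVol r k.2.2.2.2)))) ∧
    IsTotal r C d₁ d₂ d₃ (∑' k : ℤ × (ℤ × ℤ × ℤ) × (ℤ × ℤ × ℤ),
      cellCoeff d₁.low d₂.low d₃.low d₁.big d₂.big d₃.big d₁.w d₂.w d₃.w (C * r) r k *
        (shellChar r k.1 * ((shellVol r k.2.2.1 * (shellVol r k.2.2.2.1 *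
          shellVol r k.2.2.2.2) : ℝ) : ℂ))) := by
  have hrc : (r : ℂ) ≠ 0 := by exact_mod_cast hr.ne'
  -- M bounds both D³ and r⁻¹, so the single condition ‖C‖ M⁴ < 1 implies every convergence
  -- condition.
  set M := D ^ 3 / r with hM
  have hD3 : 1 ≤ D ^ 3 := one_le_pow₀ hD
  have hDM : D ^ 3 ≤ M := by
    rw [hM, le_div_iff₀ hr]
    exact mul_le_of_le_one_right (by positivity) hr1.le
  have hM1 : 1 ≤ M := hD3.trans hDM
  have hrM : r⁻¹ ≤ M := by
    rw [hM, div_eq_mul_inv]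
    exact le_mul_of_one_le_left (by positivity) hD3
  have hC : ‖C‖ * D ^ 3 / r < 1 := by
    rw [mul_div_assoc]
    refine lt_of_le_of_lt ?_ hCM
    gcongr
    exact le_self_pow₀ hM1 (by lia)
  have hww : ∀ {w w' : ℂ}, ‖w‖ ≤ D → ‖w'‖ ≤ D → ‖C ^ 2 * (w * w')‖ ≤ ‖C‖ ^ 2 * M :=
    fun {w w'} hw hw' => by
      rw [norm_mul, norm_mul, norm_pow]
      have : ‖w‖ * ‖w'‖ ≤ M := by
        calc ‖w‖ * ‖w'‖ ≤ D * D := by gcongr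
          _ = D ^ 2 := by ring
          _ ≤ D ^ 3 := pow_le_pow_right₀ hD (by lia)
          _ ≤ M := hDM
      gcongr
  have hX : ‖d₁.w * d₂.w * d₃.w * C ^ 3‖ ≤ ‖C‖ ^ 3 * M ^ 2 := by
    have h1 := b₁.norm_w
    have h2 := b₂.norm_w
    have h3 := b₃.norm_w
    rw [norm_mul, norm_mul, norm_mul, norm_pow, mul_comm]
    have : ‖d₁.w‖ * ‖d₂.w‖ * ‖d₃.w‖ ≤ M ^ 2 := by
      calc ‖d₁.w‖ * ‖d₂.w‖ * ‖d₃.w‖ ≤ D * D * D := by gcongr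
        _ = D ^ 3 := by ring
        _ ≤ M := hDM
        _ ≤ M ^ 2 := le_self_pow₀ hM1 (by lia)
    gcongr
  have n₁ := norm_mul_lt_one_of_small hD hr hr1 hC b₂.norm_w b₃.norm_w
  have n₂ := norm_mul_lt_one_of_small hD hr hr1 hC b₁.norm_w b₃.norm_w
  have n₃ := norm_mul_lt_one_of_small hD hr hr1 hC b₁.norm_w b₂.norm_w
  have t₀ := orbitTerm_big hK hD hr hr1 b₂.w_ne b₃.w_ne b₁.big b₂.big b₃.big hM1 hDM hrM hC0 hCM hX
    (hww b₂.norm_w b₃.norm_w) (hww b₁.norm_w b₃.norm_w) (hww b₁.norm_w b₂.norm_w)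
  have t₁ := orbitTerm_low1 hK hD hr hr1 b₂.w_ne b₃.w_ne b₁.low b₂.big b₃.big n₂ n₃ hC
  have t₂ := orbitTerm_low2 hK hD hr hr1 b₂.w_ne b₃.w_ne b₂.low b₁.big b₃.big n₁ n₃ hC
  have t₃ := orbitTerm_low3 hK hD hr hr1 b₂.w_ne b₃.w_ne b₃.low b₁.big b₂.big n₁ n₂ hC
  have s₀ := bigSummand_sum hK hD hr hr1 b₁.big b₂.big b₃.big hM1 hDM hrM hC0 hCM hX
    (hww b₂.norm_w b₃.norm_w) (hww b₁.norm_w b₃.norm_w) (hww b₁.norm_w b₂.norm_w)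
  have s₁ := lowSummand_sum hK hD hr hr1 b₁.low b₂.big b₃.big n₂ n₃ hC
  have s₂ := lowSummand_sum hK hD hr hr1 b₂.low b₁.big b₃.big n₁ n₃ hC
  have s₃ := lowSummand_sum hK hD hr hr1 b₃.low b₁.big b₂.big n₁ n₂ hC
  have h := hasSum_orbits hr hr1 t₀.1 t₁.1 t₂.1 t₃.1
    (cellCoeff_eq_orbits hr b₁.w_ne b₂.w_ne b₃.w_ne d₁.low d₂.low d₃.low d₁.big d₂.big d₃.big (C * r))
  refine ⟨h.1, ?_⟩
  rw [h.2, t₀.2, t₁.2, t₂.2, t₃.2]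
  have s₀' := (hasSum_nat_add_iff' 1).2 s₀
  have s := ((s₀'.add (s₁.mul_left (r : ℂ))).add (s₂.mul_left (r : ℂ))).add (s₃.mul_left (r : ℂ))
  rw [IsTotal]
  refine HasSum.of_eq s (fun n => ?_) ?_
  · have h1 : (((n + 1 : ℕ) : ℤ) - 1) = n := by push_cast; ring
    rw [h1, shellChar, if_pos (by lia), totalSummand, _root_.zpow_neg, zpow_natCast, zpow_natCast,
      show (2 * (n : ℤ)) = ((2 * n : ℕ) : ℤ) by push_cast; ring, zpow_natCast, pow_mul', div_pow]
    simp only [SeriesData.step]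
    field_simp
    ring
  · rw [Finset.sum_range_one, Nat.cast_zero, zero_sub, shellChar, if_neg (by lia), if_pos rfl,
      _root_.zpow_neg_one, show -(2 * (-1 : ℤ)) = ((2 : ℕ) : ℤ) by norm_num, zpow_natCast]
    simp only [SeriesData.step, SeriesData.stepNeg, Nat.cast_zero]
    ring

end Assembly


/-! ### L- and ε-factors in diagonal coordinates -/

section WeilDeligne

theorem LinearMap.det_eq_prod_of_diagonal {ι V : Type*} [Fintype ι] [DecidableEq ι]
    [AddCommGroup V] [Module ℂ V] (f : V →ₗ[ℂ] V) (e : V ≃ₗ[ℂ] (ι → ℂ)) (l : ι → ℂ)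
    (h : ∀ v i, e (f v) i = l i * e v i) : LinearMap.det f = ∏ i, l i := by
  rw [← LinearMap.det_conj f e]
  have h1 : (e : V →ₗ[ℂ] (ι → ℂ)) ∘ₗ f ∘ₗ (e.symm : (ι → ℂ) →ₗ[ℂ] V) =
      LinearMap.pi fun i => (l i • (LinearMap.id : ℂ →ₗ[ℂ] ℂ)) ∘ₗ LinearMap.proj i := by
    refine LinearMap.ext fun v => funext fun i => ?_
    simp [h]
  rw [h1, LinearMap.det_pi]
  simp

variable {c : ℂ} {V : Type*} [AddCommGroup V] [Module ℂ V]

/-- Coordinates in which the Frobenius is diagonal with entries `l`, and in which the kernel of the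
monodromy operator is spanned by the coordinate vectors in `p`. -/
structure WDRep.HasCoords (ρ : WDRep c V) {ι : Type*} (e : V ≃ₗ[ℂ] (ι → ℂ)) (l : ι → ℂ)
    (p : ι → Prop) : Prop where
  frob : ∀ v i, e (ρ.frob v) i = l i * e v i
  ker : ∀ v, ρ.mono v = 0 ↔ ∀ i, ¬ p i → e v i = 0

variable {ρ : WDRep c V} {ι : Type*} {e : V ≃ₗ[ℂ] (ι → ℂ)} {l : ι → ℂ} {p : ι → Prop}

theorem WDRep.HasCoords.frobS (h : ρ.HasCoords e l p) (s : ℂ) (v : V) (i : ι) :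
    e (ρ.frobS s v) i = c ^ s * l i * e v i := by
  simp [WDRep.frobS, h.frob, mul_assoc]

theorem WDRep.HasCoords.lFactorInv_eq [Fintype ι] [DecidableEq ι] [DecidablePred p]
    (h : ρ.HasCoords e l p) (s : ℂ) :
    ρ.lFactorInv s = ∏ i, if p i then 1 - c ^ s * l i else 1 := by
  let e' : LinearMap.ker ρ.mono ≃ₗ[ℂ] ({i // p i} → ℂ) :=
    { toFun := fun v i => e v.1 i
      map_add' := fun v w => by ext i; simp
      map_smul' := fun a v => by ext i; simp
      invFun := fun x => ⟨e.symm fun i => if hi : p i then x ⟨i, hi⟩ else 0, by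
        rw [LinearMap.mem_ker, h.ker]
        intro i hi
        simp [hi]⟩
      left_inv := fun v => by
        apply Subtype.ext
        apply e.injective
        funext i
        have hv := (h.ker v.1).1 v.2 i
        by_cases hi : p i
        · simp [hi]
        · simp [hi, hv hi]
      right_inv := fun x => by
        funext i
        simp [i.2] }
  rw [WDRep.lFactorInv, LinearMap.det_eq_prod_of_diagonal _ e' fun i => 1 - c ^ s * l i.1]
  · rw [← Finset.prod_filter, Finset.prod_subtype _ (p := p) (by simp)]
  · intro v i
    change e (v.1 - ρ.frobS s v.1) i.1 = (1 - c ^ s * l i.1) * e v.1 i.1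
    rw [map_sub, Pi.sub_apply, h.frobS]
    ring

theorem WDRep.HasCoords.epsFactor_eq [Fintype ι] [DecidableEq ι] [DecidablePred p]
    (h : ρ.HasCoords e l p) (s : ℂ) :
    ρ.epsFactor s = ∏ i, if p i then 1 else -(c ^ s * l i) := by
  let g : V →ₗ[ℂ] ({i // ¬ p i} → ℂ) :=
    { toFun := fun v i => e v i
      map_add' := fun v w => by ext i; simp
      map_smul' := fun a v => by ext i; simp }
  have hg : Function.Surjective g := fun x => by
    refine ⟨e.symm fun i => if hi : p i then 0 else x ⟨i, hi⟩, ?_⟩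
    funext i
    simp [g, i.2]
  have hker : LinearMap.ker ρ.mono = LinearMap.ker g := by
    ext v
    rw [LinearMap.mem_ker, LinearMap.mem_ker, h.ker]
    constructor
    · intro hv
      funext i
      exact hv i.1 i.2
    · intro hv i hi
      exact congrFun hv ⟨i, hi⟩
  let e' := (Submodule.quotEquivOfEq _ _ hker).trans (g.quotKerEquivOfSurjective hg)
  rw [WDRep.epsFactor, LinearMap.det_eq_prod_of_diagonal _ e' fun i => -(c ^ s * l i.1)]
  · rw [Finset.prod_congr rfl fun i _ => (ite_not (p := p i) (-(c ^ s * l i)) 1).symm,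
      ← Finset.prod_filter, Finset.prod_subtype _ (p := fun i => ¬ p i) (by simp)]
  · intro v i
    obtain ⟨v, rfl⟩ := Submodule.mkQ_surjective _ v
    change e (-ρ.frobS s v) i.1 = -(c ^ s * l i.1) * e v i.1
    rw [map_neg, Pi.neg_apply, h.frobS]
    ring

/-- The coordinate change which adds the coordinate `b` to the coordinate `a`. -/
def shearEquiv [DecidableEq ι] {a b : ι} (hab : a ≠ b) : (ι → ℂ) ≃ₗ[ℂ] (ι → ℂ) where
  toFun x := x + Pi.single a (x b)
  map_add' x y := by
    rw [Pi.add_apply, Pi.single_add]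
    abel
  map_smul' t x := by
    rw [Pi.smul_apply, Pi.single_smul, smul_add, RingHom.id_apply]
  invFun x := x - Pi.single a (x b)
  left_inv x := by simp [hab.symm]
  right_inv x := by simp [hab.symm]

theorem shearEquiv_self [DecidableEq ι] {a b : ι} (hab : a ≠ b) (x : ι → ℂ) :
    shearEquiv hab x a = x a + x b := by simp [shearEquiv]

theorem shearEquiv_of_ne [DecidableEq ι] {a b i : ι} (hab : a ≠ b) (x : ι → ℂ) (hi : i ≠ a) :
    shearEquiv hab x i = x i := by simp [shearEquiv, hi]

theorem shearEquiv_diagonal [DecidableEq ι] {a b : ι} (hab : a ≠ b) (hl : l a = l b) (x y : ι → ℂ)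
    (h : ∀ i, y i = l i * x i) (i : ι) : shearEquiv hab y i = l i * shearEquiv hab x i := by
  by_cases hi : i = a
  · subst hi
    rw [shearEquiv_self, shearEquiv_self, h, h, ← hl]
    ring
  · rw [shearEquiv_of_ne hab _ hi, shearEquiv_of_ne hab _ hi, h]

end WeilDeligne

/-! ### Coordinates on the eight-dimensional space -/

section TripleCoordinates

variable {F : Type*} [NontriviallyNormedField F]

/-- The coordinates of a vector in `ℂ²`. -/
def pairCoord (x : ℂ × ℂ) : Fin 2 → ℂ := ![x.1, x.2]

/-- The eigenvalues of the Frobenius of `π`. -/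
def RepType.frobEig (ϖ : Fˣ) : RepType F → Fin 2 → ℂ
  | principal μ ν => ![(μ ϖ : ℂ), (ν ϖ : ℂ)]
  | steinberg σ => ![(((σ * absChar F (1 / 2)) ϖ : ℂˣ) : ℂ), (((σ * absChar F (-1 / 2)) ϖ : ℂˣ) : ℂ)]

/-- The entries of the monodromy operator of `π`. -/
def RepType.monoCoeff : RepType F → Fin 2 → ℂ
  | principal _ _ => ![0, 0]
  | steinberg _ => ![1, 0]

theorem RepType.pairCoord_frob (ϖ : Fˣ) (π : RepType F) (x : ℂ × ℂ) (i : Fin 2) :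
    pairCoord ((π.wd ϖ).frob x) i = π.frobEig ϖ i * pairCoord x i := by
  cases π <;> fin_cases i <;> rfl

theorem RepType.pairCoord_mono (ϖ : Fˣ) (π : RepType F) (x : ℂ × ℂ) (i : Fin 2) :
    pairCoord ((π.wd ϖ).mono x) i = π.monoCoeff i * pairCoord x 1 := by
  cases π <;> fin_cases i <;>
    simp [pairCoord, RepType.wd, RepType.monoCoeff, WDRep.ofPrincipal, WDRep.ofSteinberg]

/-- The coordinates on `ℂ² ⊗ ℂ² ⊗ ℂ²`. -/
def tripleCoord : ((ℂ × ℂ) ⊗[ℂ] (ℂ × ℂ)) ⊗[ℂ] (ℂ × ℂ) ≃ₗ[ℂ] ((Fin 2 × Fin 2) × Fin 2 → ℂ) :=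
  (((Module.Basis.finTwoProd ℂ).tensorProduct (Module.Basis.finTwoProd ℂ)).tensorProduct
    (Module.Basis.finTwoProd ℂ)).equivFun

theorem tripleCoord_tmul (x y z : ℂ × ℂ) (i j k : Fin 2) :
    tripleCoord ((x ⊗ₜ y) ⊗ₜ z) ((i, j), k) = pairCoord x i * pairCoord y j * pairCoord z k := by
  simp [tripleCoord, pairCoord]
  ring

theorem tripleCoord_induction {P : ((ℂ × ℂ) ⊗[ℂ] (ℂ × ℂ)) ⊗[ℂ] (ℂ × ℂ) → Prop} (h0 : P 0)
    (ht : ∀ x y z, P ((x ⊗ₜ y) ⊗ₜ z)) (ha : ∀ v w, P v → P w → P (v + w)) (v) : P v := by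
  induction v using TensorProduct.induction_on with
  | zero => exact h0
  | tmul u z =>
    induction u using TensorProduct.induction_on with
    | zero => rwa [TensorProduct.zero_tmul]
    | tmul x y => exact ht x y z
    | add u u' h h' => rw [TensorProduct.add_tmul]; exact ha _ _ h h'
  | add v w h h' => exact ha _ _ h h'

variable (ϖ : Fˣ) (π : Fin 3 → RepType F) (χ : Fˣ →* ℂˣ)

/-- The eigenvalues of the Frobenius of `π₁ × π₂ × π₃ ⊗ χ`. -/
def tripleEig (i : (Fin 2 × Fin 2) × Fin 2) : ℂ :=
  (χ ϖ : ℂ) * ((π 0).frobEig ϖ i.1.1 * (π 1).frobEig ϖ i.1.2 * (π 2).frobEig ϖ i.2)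

theorem tripleCoord_frob (v) (i : (Fin 2 × Fin 2) × Fin 2) :
    tripleCoord ((tripleWD ϖ π χ).frob v) i = tripleEig ϖ π χ i * tripleCoord v i := by
  obtain ⟨⟨i, j⟩, k⟩ := i
  induction v using tripleCoord_induction with
  | h0 => simp
  | ht x y z =>
    have : (tripleWD ϖ π χ).frob ((x ⊗ₜ y) ⊗ₜ z) = (χ ϖ : ℂ) • ((((π 0).wd ϖ).frob x ⊗ₜ
        ((π 1).wd ϖ).frob y) ⊗ₜ ((π 2).wd ϖ).frob z) := by
      simp [tripleWD, WDRep.twist, WDRep.tensor, LinearEquiv.smulOfUnit, Units.smul_def]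
    rw [this, map_smul, Pi.smul_apply, tripleCoord_tmul, tripleCoord_tmul, RepType.pairCoord_frob,
      RepType.pairCoord_frob, RepType.pairCoord_frob, tripleEig, smul_eq_mul]
    ring
  | ha v w h h' => rw [map_add, map_add, map_add, Pi.add_apply, Pi.add_apply, h, h', mul_add]

theorem tripleCoord_mono (v) (i j k : Fin 2) :
    tripleCoord ((tripleWD ϖ π χ).mono v) ((i, j), k) =
      (π 0).monoCoeff i * tripleCoord v ((1, j), k) +
      (π 1).monoCoeff j * tripleCoord v ((i, 1), k) +
      (π 2).monoCoeff k * tripleCoord v ((i, j), 1) := by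
  induction v using tripleCoord_induction with
  | h0 => simp
  | ht x y z =>
    have : (tripleWD ϖ π χ).mono ((x ⊗ₜ y) ⊗ₜ z) =
        (((π 0).wd ϖ).mono x ⊗ₜ y) ⊗ₜ z + (x ⊗ₜ ((π 1).wd ϖ).mono y) ⊗ₜ z +
          (x ⊗ₜ y) ⊗ₜ ((π 2).wd ϖ).mono z := by
      simp [tripleWD, WDRep.twist, WDRep.tensor]
    rw [this, map_add, map_add, Pi.add_apply, Pi.add_apply]
    simp only [tripleCoord_tmul, RepType.pairCoord_mono]
    ring
  | ha v w h h' =>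
    simp only [map_add, Pi.add_apply, h, h']
    ring

theorem tripleMono_eq_zero_iff (v) : (tripleWD ϖ π χ).mono v = 0 ↔ ∀ i j k,
    (π 0).monoCoeff i * tripleCoord v ((1, j), k) +
      (π 1).monoCoeff j * tripleCoord v ((i, 1), k) +
      (π 2).monoCoeff k * tripleCoord v ((i, j), 1) = 0 := by
  rw [← tripleCoord.map_eq_zero_iff]
  constructor
  · intro h i j k
    rw [← tripleCoord_mono, h, Pi.zero_apply]
  · intro h
    funext i
    obtain ⟨⟨i, j⟩, k⟩ := i
    rw [tripleCoord_mono, h, Pi.zero_apply]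

end TripleCoordinates


/-! ### The kernel of the monodromy operator -/

section TripleKernels

theorem shearEquiv_trans_diagonal {ι V : Type*} [DecidableEq ι] [AddCommGroup V] [Module ℂ V]
    {c : ℂ} (ρ : WDRep c V) (e : V ≃ₗ[ℂ] (ι → ℂ)) {l : ι → ℂ}
    (h : ∀ v i, e (ρ.frob v) i = l i * e v i) {a b : ι}
    (hab : a ≠ b) (hl : l a = l b) (v : V) (i : ι) :
    e.trans (shearEquiv hab) (ρ.frob v) i = l i * e.trans (shearEquiv hab) v i :=
  shearEquiv_diagonal hab hl _ _ (h v) i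

variable {F : Type*} [NontriviallyNormedField F] {ϖ : Fˣ} {π : Fin 3 → RepType F} {χ : Fˣ →* ℂˣ}

theorem hasCoords_fst (h0 : (π 0).monoCoeff = ![1, 0]) (h1 : (π 1).monoCoeff = ![0, 0]) (h2 : (π 2).monoCoeff = ![0, 0]) :
    (tripleWD ϖ π χ).HasCoords tripleCoord (tripleEig ϖ π χ) fun i => i.1.1 = 0 where
  frob := tripleCoord_frob ϖ π χ
  ker v := by
    rw [tripleMono_eq_zero_iff, h0, h1, h2]
    generalize tripleCoord v = x
    simp [Fin.forall_fin_two]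

theorem hasCoords_snd (h0 : (π 0).monoCoeff = ![0, 0]) (h1 : (π 1).monoCoeff = ![1, 0]) (h2 : (π 2).monoCoeff = ![0, 0]) :
    (tripleWD ϖ π χ).HasCoords tripleCoord (tripleEig ϖ π χ) fun i => i.1.2 = 0 where
  frob := tripleCoord_frob ϖ π χ
  ker v := by
    rw [tripleMono_eq_zero_iff, h0, h1, h2]
    generalize tripleCoord v = x
    simp [Fin.forall_fin_two]

theorem hasCoords_trd (h0 : (π 0).monoCoeff = ![0, 0]) (h1 : (π 1).monoCoeff = ![0, 0]) (h2 : (π 2).monoCoeff = ![1, 0]) :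
    (tripleWD ϖ π χ).HasCoords tripleCoord (tripleEig ϖ π χ) fun i => i.2 = 0 where
  frob := tripleCoord_frob ϖ π χ
  ker v := by
    rw [tripleMono_eq_zero_iff, h0, h1, h2]
    generalize tripleCoord v = x
    simp [Fin.forall_fin_two]

/-- For each k the kernel is given by x(1,1,k) = 0 and x(0,1,k) + x(1,0,k) = 0. A shear turns the
second equation into a coordinate condition, and it commutes with Frobenius because `h` equates the
two eigenvalues involved. -/
theorem hasCoords_fst_snd (h0 : (π 0).monoCoeff = ![1, 0]) (h1 : (π 1).monoCoeff = ![1, 0]) (h2 : (π 2).monoCoeff = ![0, 0])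
    (h : (π 0).frobEig ϖ 0 * (π 1).frobEig ϖ 1 = (π 0).frobEig ϖ 1 * (π 1).frobEig ϖ 0) :
    (tripleWD ϖ π χ).HasCoords ((tripleCoord.trans
      (shearEquiv (show (((0, 1), 0) : (Fin 2 × Fin 2) × Fin 2) ≠ ((1, 0), 0) by simp))).trans
      (shearEquiv (show (((0, 1), 1) : (Fin 2 × Fin 2) × Fin 2) ≠ ((1, 0), 1) by simp)))
      (tripleEig ϖ π χ) fun i => i.1.2 = 0 where
  frob := by
    refine shearEquiv_trans_diagonal (tripleWD ϖ π χ) _ (shearEquiv_trans_diagonal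
      (tripleWD ϖ π χ) tripleCoord (l := tripleEig ϖ π χ) (tripleCoord_frob ϖ π χ) _ ?_) _ ?_
    · simp only [tripleEig]
      linear_combination (χ ϖ : ℂ) * (π 2).frobEig ϖ 0 * h
    · simp only [tripleEig]
      linear_combination (χ ϖ : ℂ) * (π 2).frobEig ϖ 1 * h
  ker v := by
    rw [tripleMono_eq_zero_iff, h0, h1, h2]
    generalize hx : tripleCoord v = x
    simp [Fin.forall_fin_two, shearEquiv, Pi.single_apply, hx]
    grind

theorem hasCoords_fst_trd (h0 : (π 0).monoCoeff = ![1, 0]) (h1 : (π 1).monoCoeff = ![0, 0]) (h2 : (π 2).monoCoeff = ![1, 0])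
    (h : (π 0).frobEig ϖ 0 * (π 2).frobEig ϖ 1 = (π 0).frobEig ϖ 1 * (π 2).frobEig ϖ 0) :
    (tripleWD ϖ π χ).HasCoords ((tripleCoord.trans
      (shearEquiv (show (((0, 0), 1) : (Fin 2 × Fin 2) × Fin 2) ≠ ((1, 0), 0) by simp))).trans
      (shearEquiv (show (((0, 1), 1) : (Fin 2 × Fin 2) × Fin 2) ≠ ((1, 1), 0) by simp)))
      (tripleEig ϖ π χ) fun i => i.2 = 0 where
  frob := by
    refine shearEquiv_trans_diagonal (tripleWD ϖ π χ) _ (shearEquiv_trans_diagonal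
      (tripleWD ϖ π χ) tripleCoord (l := tripleEig ϖ π χ) (tripleCoord_frob ϖ π χ) _ ?_) _ ?_
    · simp only [tripleEig]
      linear_combination (χ ϖ : ℂ) * (π 1).frobEig ϖ 0 * h
    · simp only [tripleEig]
      linear_combination (χ ϖ : ℂ) * (π 1).frobEig ϖ 1 * h
  ker v := by
    rw [tripleMono_eq_zero_iff, h0, h1, h2]
    generalize hx : tripleCoord v = x
    simp [Fin.forall_fin_two, shearEquiv, Pi.single_apply, hx]
    grind

theorem hasCoords_snd_trd (h0 : (π 0).monoCoeff = ![0, 0]) (h1 : (π 1).monoCoeff = ![1, 0]) (h2 : (π 2).monoCoeff = ![1, 0])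
    (h : (π 1).frobEig ϖ 0 * (π 2).frobEig ϖ 1 = (π 1).frobEig ϖ 1 * (π 2).frobEig ϖ 0) :
    (tripleWD ϖ π χ).HasCoords ((tripleCoord.trans
      (shearEquiv (show (((0, 0), 1) : (Fin 2 × Fin 2) × Fin 2) ≠ ((0, 1), 0) by simp))).trans
      (shearEquiv (show (((1, 0), 1) : (Fin 2 × Fin 2) × Fin 2) ≠ ((1, 1), 0) by simp)))
      (tripleEig ϖ π χ) fun i => i.2 = 0 where
  frob := by
    refine shearEquiv_trans_diagonal (tripleWD ϖ π χ) _ (shearEquiv_trans_diagonal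
      (tripleWD ϖ π χ) tripleCoord (l := tripleEig ϖ π χ) (tripleCoord_frob ϖ π χ) _ ?_) _ ?_
    · simp only [tripleEig]
      linear_combination (χ ϖ : ℂ) * (π 0).frobEig ϖ 0 * h
    · simp only [tripleEig]
      linear_combination (χ ϖ : ℂ) * (π 0).frobEig ϖ 1 * h
  ker v := by
    rw [tripleMono_eq_zero_iff, h0, h1, h2]
    generalize hx : tripleCoord v = x
    simp [Fin.forall_fin_two, shearEquiv, Pi.single_apply, hx]
    grind

/-- The equations say that the pairwise sums of x(0,1,1), x(1,0,1), x(1,1,0) vanish, hence all three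
do, that x(1,1,1) = 0, and that x(1,0,0) + x(0,1,0) + x(0,0,1) = 0. Only this last equation needs
shears; the kernel has dimension three. -/
theorem hasCoords_all (h0 : (π 0).monoCoeff = ![1, 0]) (h1 : (π 1).monoCoeff = ![1, 0])
    (h2 : (π 2).monoCoeff = ![1, 0])
    (h : (π 1).frobEig ϖ 0 * (π 2).frobEig ϖ 1 = (π 1).frobEig ϖ 1 * (π 2).frobEig ϖ 0)
    (h' : (π 0).frobEig ϖ 0 * (π 2).frobEig ϖ 1 = (π 0).frobEig ϖ 1 * (π 2).frobEig ϖ 0) :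
    (tripleWD ϖ π χ).HasCoords ((tripleCoord.trans
      (shearEquiv (show (((0, 0), 1) : (Fin 2 × Fin 2) × Fin 2) ≠ ((0, 1), 0) by simp))).trans
      (shearEquiv (show (((0, 0), 1) : (Fin 2 × Fin 2) × Fin 2) ≠ ((1, 0), 0) by simp)))
      (tripleEig ϖ π χ) (fun i => i.2 = 0 ∧ (i.1.1 = 0 ∨ i.1.2 = 0)) where
  frob := by
    refine shearEquiv_trans_diagonal (tripleWD ϖ π χ) _ (shearEquiv_trans_diagonal
      (tripleWD ϖ π χ) tripleCoord (l := tripleEig ϖ π χ) (tripleCoord_frob ϖ π χ) _ ?_) _ ?_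
    · simp only [tripleEig]
      linear_combination (χ ϖ : ℂ) * (π 0).frobEig ϖ 0 * h
    · simp only [tripleEig]
      linear_combination (χ ϖ : ℂ) * (π 1).frobEig ϖ 0 * h'
  ker v := by
    rw [tripleMono_eq_zero_iff, h0, h1, h2]
    generalize hx : tripleCoord v = x
    simp [Fin.forall_fin_two, shearEquiv, Pi.single_apply, hx]
    grind

end TripleKernels


/-! ### The data and the Frobenius eigenvalues of a representation -/

section SeriesOfRep

variable {F : Type*} [NontriviallyNormedField F]

/-- The data of `π`. -/
def RepType.series (ϖ : Fˣ) : RepType F → SeriesData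
  | principal μ ν => sphSeries ‖(ϖ : F)‖ ((absChar F (1 / 2) ϖ : ℂ) * ((μ ϖ : ℂ) + ν ϖ))
      ((μ ϖ : ℂ) * ν ϖ)
  | steinberg σ => steinSeries ‖(ϖ : F)‖ (σ ϖ)

theorem RepType.series_w (ϖ : Fˣ) (π : RepType F) : (π.series ϖ).w = (π.centralChar ϖ : ℂ) := by
  cases π <;> simp [RepType.series, sphSeries, steinSeries, RepType.centralChar]

theorem RepType.series_bounded {ϖ : Fˣ} (π : RepType F) :
    ∃ K D : ℝ, 0 ≤ K ∧ 1 ≤ D ∧ (π.series ϖ).Bounded K D := by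
  cases π with
  | principal μ ν => exact sphSeries_bounded (mul_ne_zero (Units.ne_zero _) (Units.ne_zero _))
  | steinberg σ => exact steinSeries_bounded (by simp) (Units.ne_zero _)

theorem RepType.series_isLocalData [IsUltrametricDist F] [LocallyCompactSpace F]
    [MeasurableSpace F] [BorelSpace F] {ϖ : Fˣ} (hϖ : IsUniformizer ϖ)
    (hnorm : ‖(ϖ : F)‖ = (residueCard F : ℝ)⁻¹) (dx : Measure F) [dx.IsAddHaarMeasure]
    (hdx : dx {x | ‖x‖ ≤ 1} = 1) {ψ : AddChar F Circle} (hψ : ∀ x : F, ‖x‖ ≤ 1 → ψ x = 1)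
    (hψ' : ∃ x : F, ‖x‖ ≤ ‖(ϖ : F)‖⁻¹ ∧ ψ x ≠ 1) {π : RepType F} (hπ : π.IsAdmissible)
    {W : GL (Fin 2) F → ℂ} (hW : π.IsDistinguished ψ W) :
    IsLocalData ϖ ψ W (π.series ϖ).low (π.series ϖ).big (π.series ϖ).w := by
  cases π with
  | principal μ ν => exact spherical_isLocalData hϖ hnorm hψ hψ' hπ.1 hπ.2.1 hπ.2.2 hW.1 hW.2.1 hW.2.2
  | steinberg σ => exact steinberg_isLocalData hϖ hnorm dx hdx hψ hψ' hπ hW.1 hW.2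

theorem absChar_neg_half (ϖ : Fˣ) :
    (absChar F (-1 / 2) ϖ : ℂ) = (absChar F (1 / 2) ϖ : ℂ)⁻¹ := by
  have h : (‖(ϖ : F)‖ : ℂ) ≠ 0 := by simp
  simp only [absChar, MonoidHom.coe_mk, OneHom.coe_mk, Units.val_mk0]
  rw [neg_div, Complex.cpow_neg]

theorem RepType.frobEig_steinberg (ϖ : Fˣ) (σ : Fˣ →* ℂˣ) : (steinberg σ).frobEig ϖ =
    ![(σ ϖ : ℂ) * (absChar F (1 / 2) ϖ : ℂ), (σ ϖ : ℂ) * (absChar F (1 / 2) ϖ : ℂ)⁻¹] := by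
  simp only [RepType.frobEig, MonoidHom.mul_apply, Units.val_mul, absChar_neg_half]

theorem RepType.frobEig_principal (ϖ : Fˣ) (μ ν : Fˣ →* ℂˣ) : (principal μ ν).frobEig ϖ =
    ![(μ ϖ : ℂ), (ν ϖ : ℂ)] := rfl

theorem RepType.frobEig_ne_zero (ϖ : Fˣ) (π : RepType F) (i : Fin 2) : π.frobEig ϖ i ≠ 0 := by
  cases π <;> fin_cases i <;> simp [RepType.frobEig]

/-- For every twist of the Steinberg representation the ratio of the two eigenvalues is |ϖ|. This
makes the shears commute with Frobenius. -/
theorem steinberg_frobEig_cross (ϖ : Fˣ) (σ τ : Fˣ →* ℂˣ) :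
    (RepType.steinberg σ).frobEig ϖ 0 * (RepType.steinberg τ).frobEig ϖ 1 =
      (RepType.steinberg σ).frobEig ϖ 1 * (RepType.steinberg τ).frobEig ϖ 0 := by
  simp only [RepType.frobEig_steinberg, Matrix.cons_val_zero, Matrix.cons_val_one]
  ring

end SeriesOfRep

/-! ### Comparison of the zeta integral with L and ε -/

section Comparison

variable {F : Type*} [NontriviallyNormedField F] {ϖ : Fˣ} {π : Fin 3 → RepType F} {χ : Fˣ →* ℂˣ}

/-- The coordinates do not depend on the twist. -/
theorem exists_hasCoords (ϖ : Fˣ) (hSt : ∃ i, (π i).IsSteinberg) :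
    ∃ (e : ((ℂ × ℂ) ⊗[ℂ] (ℂ × ℂ)) ⊗[ℂ] (ℂ × ℂ) ≃ₗ[ℂ] ((Fin 2 × Fin 2) × Fin 2 → ℂ))
      (p : (Fin 2 × Fin 2) × Fin 2 → Prop), ∀ χ : Fˣ →* ℂˣ,
      (tripleWD ϖ π χ).HasCoords e (tripleEig ϖ π χ) p := by
  rcases h0 : π 0 with ⟨μ₁, ν₁⟩ | σ₁ <;> rcases h1 : π 1 with ⟨μ₂, ν₂⟩ | σ₂ <;>
    rcases h2 : π 2 with ⟨μ₃, ν₃⟩ | σ₃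
  · obtain ⟨i, hi⟩ := hSt
    fin_cases i <;> simp [h0, h1, h2, RepType.IsSteinberg] at hi
  · exact ⟨_, _, fun χ => hasCoords_trd (by rw [h0]; rfl) (by rw [h1]; rfl) (by rw [h2]; rfl)⟩
  · exact ⟨_, _, fun χ => hasCoords_snd (by rw [h0]; rfl) (by rw [h1]; rfl) (by rw [h2]; rfl)⟩
  · exact ⟨_, _, fun χ => hasCoords_snd_trd (by rw [h0]; rfl) (by rw [h1]; rfl) (by rw [h2]; rfl)
      (by rw [h1, h2]; exact steinberg_frobEig_cross _ _ _)⟩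
  · exact ⟨_, _, fun χ => hasCoords_fst (by rw [h0]; rfl) (by rw [h1]; rfl) (by rw [h2]; rfl)⟩
  · exact ⟨_, _, fun χ => hasCoords_fst_trd (by rw [h0]; rfl) (by rw [h1]; rfl) (by rw [h2]; rfl)
      (by rw [h0, h2]; exact steinberg_frobEig_cross _ _ _)⟩
  · exact ⟨_, _, fun χ => hasCoords_fst_snd (by rw [h0]; rfl) (by rw [h1]; rfl) (by rw [h2]; rfl)
      (by rw [h0, h1]; exact steinberg_frobEig_cross _ _ _)⟩
  · exact ⟨_, _, fun χ => hasCoords_all (by rw [h0]; rfl) (by rw [h1]; rfl) (by rw [h2]; rfl)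
      (by rw [h1, h2]; exact steinberg_frobEig_cross _ _ _)
      (by rw [h0, h2]; exact steinberg_frobEig_cross _ _ _)⟩

variable {K D : ℝ} {T : ℂ}

theorem exists_eq_mul {ρ : ℂ} (hρ : ρ ≠ 0) (x : ℂ) : ∃ y, x = y * ρ :=
  ⟨x * ρ⁻¹, (inv_mul_cancel_right₀ hρ x).symm⟩

/-- The product of the normalized zeta integral with `L⁻¹` and `ε` is a monomial. -/
theorem IsTotal.mul_lFactorInv_mul_epsFactor (hK : 0 ≤ K) (hD : 1 ≤ D) (hr1 : ‖(ϖ : F)‖ < 1)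
    (hC : ‖(χ ϖ : ℂ)‖ * D ^ 3 / ‖(ϖ : F)‖ < 1) (b : ∀ i, ((π i).series ϖ).Bounded K D)
    (hSt : ∃ i, (π i).IsSteinberg)
    (h : IsTotal ‖(ϖ : F)‖ (χ ϖ) ((π 0).series ϖ) ((π 1).series ϖ) ((π 2).series ϖ) T) :
    T * (tripleWD ϖ π χ).lFactorInv (1 / 2) * (tripleWD ϖ π χ).epsFactor (1 / 2) =
      -((((π 0).series ϖ).w * ((π 1).series ϖ).w * ((π 2).series ϖ).w) ^ 2 * (χ ϖ : ℂ) ^ 4 *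
        (‖(ϖ : F)‖ : ℂ) ^ 2) := by
  have hr : 0 < ‖(ϖ : F)‖ := by simp
  have hC0 : (χ ϖ : ℂ) ≠ 0 := Units.ne_zero _
  have hρ0 : (absChar F (1 / 2) ϖ : ℂ) ≠ 0 := Units.ne_zero _
  have hρ : (absChar F (1 / 2) ϖ : ℂ) ^ 2 = (‖(ϖ : F)‖ : ℂ) := absChar_half_sq
  have hcpow : (‖(ϖ : F)‖ : ℂ) ^ (1 / 2 : ℂ) = (absChar F (1 / 2) ϖ : ℂ) := rfl
  have b0 := b 0
  have b1 := b 1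
  have b2 := b 2
  -- `IsTotal` is symmetric in the three representations, so the seven cases use the three closed
  -- formulas with the factors permuted.
  rcases h0 : π 0 with ⟨μ₁, ν₁⟩ | σ₁ <;> rcases h1 : π 1 with ⟨μ₂, ν₂⟩ | σ₂ <;>
    rcases h2 : π 2 with ⟨μ₃, ν₃⟩ | σ₃
  · obtain ⟨i, hi⟩ := hSt
    fin_cases i <;> simp [h0, h1, h2, RepType.IsSteinberg] at hi
  · rw [h0, h1, h2] at h
    rw [h0] at b0
    rw [h1] at b1
    rw [h2] at b2
    have hT := IsTotal.steinberg_spherical_spherical hK hD hr hr1 hC0 hC (σ₃ ϖ).ne_zero b2 b0 b1 h.swap₂₃.swap₁₂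
    have hc := hasCoords_trd (ϖ := ϖ) (π := π) (χ := χ) (by rw [h0]; rfl) (by rw [h1]; rfl) (by rw [h2]; rfl)
    rw [hc.lFactorInv_eq, hc.epsFactor_eq, hcpow]
    simp only [tripleEig, h0, h1, h2, RepType.frobEig_steinberg, RepType.frobEig_principal]
    clear hc h h0 h1 h2 b0 b1 b2
    simp only [Fintype.prod_prod_type, Fin.prod_univ_two, RepType.series, sphSeries, steinSeries,
      ← hρ, Matrix.cons_val_zero, Matrix.cons_val_one] at hT ⊢
    -- With σ(ϖ) = τρ and ρ = |ϖ|^(1/2), the eigenvalues become τρ² and τ, so the identity is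
    -- polynomial in ρ.
    obtain ⟨τ₃, hτ₃⟩ := exists_eq_mul hρ0 (σ₃ ϖ : ℂ)
    simp only [hτ₃, mul_inv_cancel_right₀ hρ0] at hT ⊢
    generalize (absChar F (1 / 2) ϖ : ℂ) = ρ at *
    simp [rankinDet] at hT ⊢
    -- The coefficient is the ε-factor, the product over the four coordinates outside the kernel.
    linear_combination (χ ϖ : ℂ) ^ 4 * (τ₃) ^ 4 * ρ ^ 4 * ((μ₁ ϖ : ℂ) * ν₁ ϖ) ^ 2 * ((μ₂ ϖ : ℂ) * ν₂ ϖ) ^ 2 * hT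
  · rw [h0, h1, h2] at h
    rw [h0] at b0
    rw [h1] at b1
    rw [h2] at b2
    have hT := IsTotal.steinberg_spherical_spherical hK hD hr hr1 hC0 hC (σ₂ ϖ).ne_zero b1 b0 b2 h.swap₁₂
    have hc := hasCoords_snd (ϖ := ϖ) (π := π) (χ := χ) (by rw [h0]; rfl) (by rw [h1]; rfl) (by rw [h2]; rfl)
    rw [hc.lFactorInv_eq, hc.epsFactor_eq, hcpow]
    simp only [tripleEig, h0, h1, h2, RepType.frobEig_steinberg, RepType.frobEig_principal]
    clear hc h h0 h1 h2 b0 b1 b2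
    simp only [Fintype.prod_prod_type, Fin.prod_univ_two, RepType.series, sphSeries, steinSeries,
      ← hρ, Matrix.cons_val_zero, Matrix.cons_val_one] at hT ⊢
    obtain ⟨τ₂, hτ₂⟩ := exists_eq_mul hρ0 (σ₂ ϖ : ℂ)
    simp only [hτ₂, mul_inv_cancel_right₀ hρ0] at hT ⊢
    generalize (absChar F (1 / 2) ϖ : ℂ) = ρ at *
    simp [rankinDet] at hT ⊢
    linear_combination (χ ϖ : ℂ) ^ 4 * (τ₂) ^ 4 * ρ ^ 4 * ((μ₁ ϖ : ℂ) * ν₁ ϖ) ^ 2 * ((μ₃ ϖ : ℂ) * ν₃ ϖ) ^ 2 * hT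
  · rw [h0, h1, h2] at h
    rw [h0] at b0
    rw [h1] at b1
    rw [h2] at b2
    have hT := IsTotal.steinberg_steinberg_spherical hK hD hr hr1 hC0 hC (σ₂ ϖ).ne_zero (σ₃ ϖ).ne_zero b1 b2 b0 h.swap₁₂.swap₂₃
    have hc := hasCoords_snd_trd (ϖ := ϖ) (π := π) (χ := χ) (by rw [h0]; rfl) (by rw [h1]; rfl) (by rw [h2]; rfl)
      (by rw [h1, h2]; exact steinberg_frobEig_cross _ _ _)
    rw [hc.lFactorInv_eq, hc.epsFactor_eq, hcpow]
    simp only [tripleEig, h0, h1, h2, RepType.frobEig_steinberg, RepType.frobEig_principal]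
    clear hc h h0 h1 h2 b0 b1 b2
    simp only [Fintype.prod_prod_type, Fin.prod_univ_two, RepType.series, sphSeries, steinSeries,
      ← hρ, Matrix.cons_val_zero, Matrix.cons_val_one] at hT ⊢
    obtain ⟨τ₂, hτ₂⟩ := exists_eq_mul hρ0 (σ₂ ϖ : ℂ)
    obtain ⟨τ₃, hτ₃⟩ := exists_eq_mul hρ0 (σ₃ ϖ : ℂ)
    simp only [hτ₂, hτ₃, mul_inv_cancel_right₀ hρ0] at hT ⊢
    generalize (absChar F (1 / 2) ϖ : ℂ) = ρ at *
    simp [steinSteinDet] at hT ⊢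
    linear_combination (χ ϖ : ℂ) ^ 4 * (τ₂ * τ₃) ^ 4 * ρ ^ 8 * ((μ₁ ϖ : ℂ) * ν₁ ϖ) ^ 2 * hT
  · rw [h0, h1, h2] at h
    rw [h0] at b0
    rw [h1] at b1
    rw [h2] at b2
    have hT := IsTotal.steinberg_spherical_spherical hK hD hr hr1 hC0 hC (σ₁ ϖ).ne_zero b0 b1 b2 h
    have hc := hasCoords_fst (ϖ := ϖ) (π := π) (χ := χ) (by rw [h0]; rfl) (by rw [h1]; rfl) (by rw [h2]; rfl)
    rw [hc.lFactorInv_eq, hc.epsFactor_eq, hcpow]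
    simp only [tripleEig, h0, h1, h2, RepType.frobEig_steinberg, RepType.frobEig_principal]
    clear hc h h0 h1 h2 b0 b1 b2
    simp only [Fintype.prod_prod_type, Fin.prod_univ_two, RepType.series, sphSeries, steinSeries,
      ← hρ, Matrix.cons_val_zero, Matrix.cons_val_one] at hT ⊢
    obtain ⟨τ₁, hτ₁⟩ := exists_eq_mul hρ0 (σ₁ ϖ : ℂ)
    simp only [hτ₁, mul_inv_cancel_right₀ hρ0] at hT ⊢
    generalize (absChar F (1 / 2) ϖ : ℂ) = ρ at *
    simp [rankinDet] at hT ⊢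
    linear_combination (χ ϖ : ℂ) ^ 4 * (τ₁) ^ 4 * ρ ^ 4 * ((μ₂ ϖ : ℂ) * ν₂ ϖ) ^ 2 * ((μ₃ ϖ : ℂ) * ν₃ ϖ) ^ 2 * hT
  · rw [h0, h1, h2] at h
    rw [h0] at b0
    rw [h1] at b1
    rw [h2] at b2
    have hT := IsTotal.steinberg_steinberg_spherical hK hD hr hr1 hC0 hC (σ₁ ϖ).ne_zero (σ₃ ϖ).ne_zero b0 b2 b1 h.swap₂₃
    have hc := hasCoords_fst_trd (ϖ := ϖ) (π := π) (χ := χ) (by rw [h0]; rfl) (by rw [h1]; rfl) (by rw [h2]; rfl)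
      (by rw [h0, h2]; exact steinberg_frobEig_cross _ _ _)
    rw [hc.lFactorInv_eq, hc.epsFactor_eq, hcpow]
    simp only [tripleEig, h0, h1, h2, RepType.frobEig_steinberg, RepType.frobEig_principal]
    clear hc h h0 h1 h2 b0 b1 b2
    simp only [Fintype.prod_prod_type, Fin.prod_univ_two, RepType.series, sphSeries, steinSeries,
      ← hρ, Matrix.cons_val_zero, Matrix.cons_val_one] at hT ⊢
    obtain ⟨τ₁, hτ₁⟩ := exists_eq_mul hρ0 (σ₁ ϖ : ℂ)
    obtain ⟨τ₃, hτ₃⟩ := exists_eq_mul hρ0 (σ₃ ϖ : ℂ)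
    simp only [hτ₁, hτ₃, mul_inv_cancel_right₀ hρ0] at hT ⊢
    generalize (absChar F (1 / 2) ϖ : ℂ) = ρ at *
    simp [steinSteinDet] at hT ⊢
    linear_combination (χ ϖ : ℂ) ^ 4 * (τ₁ * τ₃) ^ 4 * ρ ^ 8 * ((μ₂ ϖ : ℂ) * ν₂ ϖ) ^ 2 * hT
  · rw [h0, h1, h2] at h
    rw [h0] at b0
    rw [h1] at b1
    rw [h2] at b2
    have hT := IsTotal.steinberg_steinberg_spherical hK hD hr hr1 hC0 hC (σ₁ ϖ).ne_zero (σ₂ ϖ).ne_zero b0 b1 b2 h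
    have hc := hasCoords_fst_snd (ϖ := ϖ) (π := π) (χ := χ) (by rw [h0]; rfl) (by rw [h1]; rfl) (by rw [h2]; rfl)
      (by rw [h0, h1]; exact steinberg_frobEig_cross _ _ _)
    rw [hc.lFactorInv_eq, hc.epsFactor_eq, hcpow]
    simp only [tripleEig, h0, h1, h2, RepType.frobEig_steinberg, RepType.frobEig_principal]
    clear hc h h0 h1 h2 b0 b1 b2
    simp only [Fintype.prod_prod_type, Fin.prod_univ_two, RepType.series, sphSeries, steinSeries,
      ← hρ, Matrix.cons_val_zero, Matrix.cons_val_one] at hT ⊢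
    obtain ⟨τ₁, hτ₁⟩ := exists_eq_mul hρ0 (σ₁ ϖ : ℂ)
    obtain ⟨τ₂, hτ₂⟩ := exists_eq_mul hρ0 (σ₂ ϖ : ℂ)
    simp only [hτ₁, hτ₂, mul_inv_cancel_right₀ hρ0] at hT ⊢
    generalize (absChar F (1 / 2) ϖ : ℂ) = ρ at *
    simp [steinSteinDet] at hT ⊢
    linear_combination (χ ϖ : ℂ) ^ 4 * (τ₁ * τ₂) ^ 4 * ρ ^ 8 * ((μ₃ ϖ : ℂ) * ν₃ ϖ) ^ 2 * hT
  · rw [h0, h1, h2] at h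
    rw [h0] at b0
    rw [h1] at b1
    rw [h2] at b2
    have hT := IsTotal.steinberg_steinberg_steinberg hD hr hr1 hC0 hC (σ₁ ϖ).ne_zero (σ₂ ϖ).ne_zero (σ₃ ϖ).ne_zero b0 b1 b2 h
    have hc := hasCoords_all (ϖ := ϖ) (π := π) (χ := χ) (by rw [h0]; rfl) (by rw [h1]; rfl) (by rw [h2]; rfl)
      (by rw [h1, h2]; exact steinberg_frobEig_cross _ _ _)
      (by rw [h0, h2]; exact steinberg_frobEig_cross _ _ _)
    rw [hc.lFactorInv_eq, hc.epsFactor_eq, hcpow]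
    simp only [tripleEig, h0, h1, h2, RepType.frobEig_steinberg]
    clear hc h h0 h1 h2 b0 b1 b2
    simp only [Fintype.prod_prod_type, Fin.prod_univ_two, RepType.series, steinSeries,
      ← hρ, Matrix.cons_val_zero, Matrix.cons_val_one] at hT ⊢
    obtain ⟨τ₁, hτ₁⟩ := exists_eq_mul hρ0 (σ₁ ϖ : ℂ)
    obtain ⟨τ₂, hτ₂⟩ := exists_eq_mul hρ0 (σ₂ ϖ : ℂ)
    obtain ⟨τ₃, hτ₃⟩ := exists_eq_mul hρ0 (σ₃ ϖ : ℂ)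
    simp only [hτ₁, hτ₂, hτ₃, mul_inv_cancel_right₀ hρ0] at hT ⊢
    generalize (absChar F (1 / 2) ϖ : ℂ) = ρ at *
    simp at hT ⊢
    -- Five coordinates lie outside the kernel: ε is minus this coefficient times the first factor
    -- of `hT`, the product of χ(ϖ), the three σᵢ(ϖ) and r.
    linear_combination ((χ ϖ : ℂ) * (τ₁ * τ₂ * τ₃)) ^ 4 * ρ ^ 10 * hT

end Comparison


/-! ### The zeta integral for small χ(ϖ) -/

theorem similitude_eta_mul_iota {F : Type*} [Field F] (h : H F) :
    similitude (eta F * iota h) = h.1.1.det := by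
  rw [similitude_mul, eta, iota, similitude_mk', similitude_mk', one_mul]

theorem norm_uniformizer_lt_one {F : Type*} [NontriviallyNormedField F] {ϖ : Fˣ}
    (hϖ : IsUniformizer ϖ) : ‖(ϖ : F)‖ < 1 := (hϖ _).2 le_rfl

section Integral

variable {F : Type*} [NontriviallyNormedField F] [IsUltrametricDist F] {ϖ : Fˣ}

/-- The zeta integral converges for `χ(ϖ)` small, and is the sum over the shells. -/
theorem zetaConverges_and_isTotal [LocallyCompactSpace F] [MeasurableSpace F] [BorelSpace F]
    (hϖ : IsUniformizer ϖ) (hnorm : ‖(ϖ : F)‖ = (residueCard F : ℝ)⁻¹)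
    {ψ : AddChar F Circle} (hψ : ∀ x : F, ‖x‖ ≤ 1 → ψ x = 1)
    (hψ' : ∃ x : F, ‖x‖ ≤ ‖(ϖ : F)‖⁻¹ ∧ ψ x ≠ 1)
    (dx : Measure F) [dx.IsAddHaarMeasure] (hdx : dx {x | ‖x‖ ≤ 1} = 1)
    (dt : Measure Fˣ) [dt.IsHaarMeasure] (hdt : dt {t | ‖(t : F)‖ = 1} = 1)
    {ω χ : Fˣ →* ℂˣ} (hω : IsUnramified ω) (hχ : IsUnramified χ)
    {W : Fin 3 → GL (Fin 2) F → ℂ} {d : Fin 3 → SeriesData}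
    (hW : ∀ i, IsLocalData ϖ ψ (W i) (d i).low (d i).big (d i).w)
    (hw : (ω ϖ : ℂ) = (d 0).w * (d 1).w * (d 2).w)
    {K D : ℝ} (hK : 0 ≤ K) (hD : 1 ≤ D) (b : ∀ i, (d i).Bounded K D)
    (hC : ‖(χ ϖ : ℂ)‖ * (D ^ 3 / ‖(ϖ : F)‖) ^ 4 < 1) :
    ZetaConverges dx dt W (hZero ω χ) ∧
      IsTotal ‖(ϖ : F)‖ (χ ϖ) (d 0) (d 1) (d 2)
        ((1 + (‖(ϖ : F)‖ : ℂ)) ^ 3 * localZeta dx dt W (hZero ω χ)) := by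
  have hr : 0 < ‖(ϖ : F)‖ := by simp
  have h1 : (1 + (‖(ϖ : F)‖ : ℂ)) ≠ 0 := by exact_mod_cast (by positivity : (1 + ‖(ϖ : F)‖) ≠ 0)
  obtain ⟨hs, ht⟩ := cellCoeff_isTotal hK hD hr (norm_uniformizer_lt_one hϖ) (χ ϖ).ne_zero hC
    (b 0) (b 1) (b 2)
  obtain ⟨hi, hv⟩ := integrable_of_cellShell_shear hϖ hnorm dx hdx dt hdt hψ hψ'
    (fun p => (cellWeight p : ℂ) * zetaIntegrand W (hZero ω χ) (cell p)) _ cellShear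
    measurable_cellShear (zetaIntegrand_cell hϖ hnorm hω hχ hW hw) (by
      simp only [norm_mul _ (cellCoeff _ _ _ _ _ _ _ _ _ _ _ _), mul_assoc]
      exact hs.mul_left _)
  refine ⟨hi, ?_⟩
  rw [localZeta, hv]
  simp only [mul_assoc _ (cellCoeff _ _ _ _ _ _ _ _ _ _ _ _)]
  rw [tsum_mul_left, mul_inv_cancel_left₀ (pow_ne_zero 3 h1)]
  exact ht

end Integral

/-! ### The twisted integral and analyticity in s -/

section Continuation

variable {F : Type*} [NontriviallyNormedField F] {ϖ : Fˣ} {π : Fin 3 → RepType F}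

/-- Twisting the Whittaker functions by `ωᵢ⁻¹` amounts to changing the section. -/
theorem zetaIntegrand_twist (W : Fin 3 → GL (Fin 2) F → ℂ) (η : Fin 3 → (Fˣ →* ℂˣ))
    (χ : Fˣ →* ℂˣ) (h : H F) :
    zetaIntegrand (fun i => twistFun (W i) (η i)⁻¹) (hZero (∏ i, η i)⁻¹ (χ * ∏ i, η i)) h =
      zetaIntegrand W (hZero (∏ i, η i) χ) h := by
  have e1 : h.1.2.1.det = h.1.1.det := h.2.1.symm
  have e2 : h.1.2.2.det = h.1.1.det := h.2.2.symm
  -- With ν the similitude and δ the determinant of the lower left block, ω⁻¹(ν/δ) ω(ν³/δ²) = ω(ν)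
  -- ω(ν/δ). The factor ω(ν) cancels the twists of the Whittaker functions, because ν is the common
  -- determinant.
  have key : ∀ ω : Fˣ →* ℂˣ, hZero ω⁻¹ (χ * ω) (eta F * iota h) =
      (ω h.1.1.det : ℂ) * hZero ω χ (eta F * iota h) := fun ω => by
    rw [hZero, hZero, siegelSection, siegelSection, similitude_eta_mul_iota]
    split_ifs with hu
    · have := (ω hu.unit).ne_zero
      have := (ω h.1.1.det).ne_zero
      simp only [MonoidHom.inv_apply, MonoidHom.mul_apply, map_div, map_pow, Units.val_mul,
        Units.val_inv_eq_inv_val, Units.val_div_eq_div_val, Units.val_pow_eq_pow_val]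
      field_simp
    · rw [mul_zero]
  simp only [zetaIntegrand, twistFun, e1, e2, key, Fin.prod_univ_three, MonoidHom.inv_apply,
    MonoidHom.mul_apply, Units.val_mul, Units.val_inv_eq_inv_val]
  have n0 := (η 0 h.1.1.det).ne_zero
  have n1 := (η 1 h.1.1.det).ne_zero
  have n2 := (η 2 h.1.1.det).ne_zero
  field_simp

theorem analyticAt_absChar (a : Fˣ) (s : ℂ) :
    AnalyticAt ℂ (fun s => (absChar F s a : ℂ)) s := by
  have h : ‖(a : F)‖ ≠ 0 := by simp
  change AnalyticAt ℂ (fun s => (‖(a : F)‖ : ℂ) ^ s) s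
  refine AnalyticAt.cpow analyticAt_const analyticAt_id ?_
  exact Complex.ofReal_mem_slitPlane.2 (by simp)

theorem analyticAt_tripleEig (χ : Fˣ →* ℂˣ) (i : (Fin 2 × Fin 2) × Fin 2) (s : ℂ) :
    AnalyticAt ℂ (fun s => tripleEig ϖ π (χ * absChar F s) i) s := by
  have := analyticAt_absChar (F := F) ϖ s
  simp only [tripleEig, MonoidHom.mul_apply, Units.val_mul]
  fun_prop

theorem tripleEig_ne_zero (χ : Fˣ →* ℂˣ) (i : (Fin 2 × Fin 2) × Fin 2) :
    tripleEig ϖ π χ i ≠ 0 :=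
  mul_ne_zero (Units.ne_zero _) (mul_ne_zero (mul_ne_zero (RepType.frobEig_ne_zero _ _ _)
    (RepType.frobEig_ne_zero _ _ _)) (RepType.frobEig_ne_zero _ _ _))

/-- The coordinates of `exists_hasCoords` serve all s at once, so this is a finite product of entire
functions of s. -/
theorem analyticAt_lFactorInv (hSt : ∃ i, (π i).IsSteinberg) (χ : Fˣ →* ℂˣ) (s₀ s : ℂ) :
    AnalyticAt ℂ (fun s => (tripleWD ϖ π (χ * absChar F s)).lFactorInv s₀) s := by
  classical
  obtain ⟨e, p, h⟩ := exists_hasCoords ϖ hSt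
  simp only [(h _).lFactorInv_eq]
  refine Finset.analyticAt_fun_prod _ fun i _ => ?_
  split_ifs
  · exact analyticAt_const.sub (analyticAt_const.mul (analyticAt_tripleEig χ i s))
  · exact analyticAt_const

theorem analyticAt_epsFactor (hSt : ∃ i, (π i).IsSteinberg) (χ : Fˣ →* ℂˣ) (s₀ s : ℂ) :
    AnalyticAt ℂ (fun s => (tripleWD ϖ π (χ * absChar F s)).epsFactor s₀) s := by
  classical
  obtain ⟨e, p, h⟩ := exists_hasCoords ϖ hSt
  simp only [(h _).epsFactor_eq]
  refine Finset.analyticAt_fun_prod _ fun i _ => ?_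
  split_ifs
  · exact analyticAt_const
  · exact (analyticAt_const.mul (analyticAt_tripleEig χ i s)).neg

theorem epsFactor_ne_zero (hSt : ∃ i, (π i).IsSteinberg) (χ : Fˣ →* ℂˣ) (s : ℂ) :
    (tripleWD ϖ π χ).epsFactor s ≠ 0 := by
  classical
  obtain ⟨e, p, h⟩ := exists_hasCoords ϖ hSt
  rw [(h _).epsFactor_eq]
  refine Finset.prod_ne_zero_iff.2 fun i _ => ?_
  split_ifs
  · exact one_ne_zero
  · exact neg_ne_zero.2 (mul_ne_zero (by simp [Complex.cpow_eq_zero_iff]) (tripleEig_ne_zero χ i))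

end Continuation


/-! ### Common bounds and the half-plane of convergence -/

section Bounds

variable {F : Type*} [NontriviallyNormedField F] {ϖ : Fˣ}

theorem exists_series_bounded (ϖ : Fˣ) (π : Fin 3 → RepType F) :
    ∃ K D : ℝ, 0 ≤ K ∧ 1 ≤ D ∧ ∀ i, ((π i).series ϖ).Bounded K D := by
  choose K D hK hD h using fun i => (π i).series_bounded (ϖ := ϖ)
  have hD0 : ∀ i, 0 ≤ D i := fun i => zero_le_one.trans (hD i)
  have hle : ∀ i, D i ≤ ∑ i, D i := fun i =>
    Finset.single_le_sum (fun i _ => hD0 i) (Finset.mem_univ i)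
  exact ⟨∑ i, K i, ∑ i, D i, Finset.sum_nonneg fun i _ => hK i, (hD 0).trans (hle 0), fun i =>
    (h i).mono (hK i) (hD0 i) (Finset.single_le_sum (fun i _ => hK i) (Finset.mem_univ i)) (hle i)⟩

/-- The modulus of |ϖ|^s is |ϖ|^(Re s), which tends to 0. The half-plane Re s > R is thus where C is
small enough. -/
theorem exists_forall_norm_absChar_mul_lt_one (hϖ : IsUniformizer ϖ) (χ : Fˣ →* ℂˣ) (M : ℝ) :
    ∃ R : ℝ, ∀ s : ℂ, R < s.re → ‖((χ * absChar F s) ϖ : ℂ)‖ * M < 1 := by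
  have hr : 0 < ‖(ϖ : F)‖ := by simp
  have h := (tendsto_rpow_atTop_of_base_lt_one ‖(ϖ : F)‖ (by linarith)
    (norm_uniformizer_lt_one hϖ)).const_mul (‖(χ ϖ : ℂ)‖ * M)
  rw [mul_zero] at h
  obtain ⟨R, hR⟩ := Filter.eventually_atTop.1 (h.eventually_lt_const zero_lt_one)
  refine ⟨R, fun s hs => lt_of_eq_of_lt ?_ (hR s.re hs.le)⟩
  have e : ‖(absChar F s ϖ : ℂ)‖ = ‖(ϖ : F)‖ ^ s.re :=
    Complex.norm_cpow_eq_rpow_re_of_pos hr s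
  rw [MonoidHom.mul_apply, Units.val_mul, norm_mul, e]
  ring

theorem RepType.IsAdmissible.isUnramified_centralChar {π : RepType F} (h : π.IsAdmissible) :
    IsUnramified π.centralChar := by
  cases π with
  | principal μ ν => exact h.1.mul h.2.1
  | steinberg σ => exact IsUnramified.pow h 2

end Bounds

end TripleZeta

end

theorem mainTheorem8 {F : Type*} [NontriviallyNormedField F] [IsUltrametricDist F]
    [LocallyCompactSpace F] [CharZero F] [MeasurableSpace F] [BorelSpace F]
    -- a prime element, and the normalisation `|ϖ| = q⁻¹` of the absolute value
    (ϖ : Fˣ) (hϖ : TripleZeta.IsUniformizer ϖ)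
    (hnorm : ‖(ϖ : F)‖ = (TripleZeta.residueCard F : ℝ)⁻¹)
    -- an additive character trivial on `𝔬` but not on `𝔭⁻¹`
    (ψ : AddChar F Circle) (hψ : ∀ x : F, ‖x‖ ≤ 1 → ψ x = 1)
    (hψ' : ∃ x : F, ‖x‖ ≤ ‖(ϖ : F)‖⁻¹ ∧ ψ x ≠ 1)
    -- the Haar measures on `F` and `Fˣ` giving `𝔬` and `𝔬ˣ` volume one
    (dx : Measure F) [dx.IsAddHaarMeasure] (hdx : dx {x | ‖x‖ ≤ 1} = 1)
    (dt : Measure Fˣ) [dt.IsHaarMeasure] (hdt : dt {t | ‖(t : F)‖ = 1} = 1)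
    -- the representations `π₁, π₂, π₃`, not all of them principal series
    (π : Fin 3 → TripleZeta.RepType F) (hπ : ∀ i, (π i).IsAdmissible)
    (hSt : ∃ i, (π i).IsSteinberg)
    (W : Fin 3 → GL (Fin 2) F → ℂ) (hW : ∀ i, (π i).IsDistinguished ψ (W i))
    (χ : Fˣ →* ℂˣ) (hχ : TripleZeta.IsUnramified χ) :
    let q : ℂ := (TripleZeta.residueCard F : ℂ)
    let ω : Fˣ →* ℂˣ := ∏ i, (π i).centralChar
    let Wtw : Fin 3 → GL (Fin 2) F → ℂ :=
      fun i => TripleZeta.twistFun (W i) ((π i).centralChar)⁻¹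
    let χs : ℂ → (Fˣ →* ℂˣ) := fun s => χ * TripleZeta.absChar F s
    -- `Z` is the meromorphic continuation to `s ∈ ℂ` of both zeta integrals
    -- `Z(W₁, W₂, W₃, h⁰(χ|·|^s))` and `Z(W₁ ⊗ ω₁⁻¹, W₂ ⊗ ω₂⁻¹, W₃ ⊗ ω₃⁻¹, h⁰(χω|·|^s))`
    ∃ Z : ℂ → ℂ, (∀ s, MeromorphicAt Z s) ∧
      (∃ R : ℝ, ∀ s : ℂ, R < s.re →
        TripleZeta.ZetaConverges dx dt W (TripleZeta.hZero ω (χs s)) ∧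
        TripleZeta.localZeta dx dt W (TripleZeta.hZero ω (χs s)) = Z s ∧
        TripleZeta.ZetaConverges dx dt Wtw (TripleZeta.hZero ω⁻¹ (χs s * ω)) ∧
        TripleZeta.localZeta dx dt Wtw (TripleZeta.hZero ω⁻¹ (χs s * ω)) = Z s) ∧
      -- the value at `χ|·|^s` (at `χ` itself for `s = 0`), away from the poles of the `L`-factor
      ∀ s : ℂ, (TripleZeta.tripleWD ϖ π (χs s)).lFactorInv (1 / 2) ≠ 0 →
        AnalyticAt ℂ Z s ∧
        Z s = -(((ω ^ 2 * χs s ^ 4) ϖ : ℂˣ) : ℂ) * q * ((1 + q) ^ 3)⁻¹ *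
          ((TripleZeta.tripleWD ϖ π (χs s)).lFactor (1 / 2) /
            (TripleZeta.tripleWD ϖ π (χs s)).epsFactor (1 / 2)) := by
  intro q ω Wtw χs
  have hr : 0 < ‖(ϖ : F)‖ := by simp
  have hr1 := TripleZeta.norm_uniformizer_lt_one hϖ
  have hq : q = (‖(ϖ : F)‖ : ℂ)⁻¹ := by rw [hnorm]; simp [q]
  have hω : TripleZeta.IsUnramified ω := by
    have h := fun i => (hπ i).isUnramified_centralChar
    simpa only [ω, Fin.prod_univ_three] using ((h 0).mul (h 1)).mul (h 2)
  have hw : (ω ϖ : ℂ) = ((π 0).series ϖ).w * ((π 1).series ϖ).w * ((π 2).series ϖ).w := by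
    simp only [ω, Fin.prod_univ_three, MonoidHom.mul_apply, Units.val_mul,
      TripleZeta.RepType.series_w]
  have htw : ∀ s p, TripleZeta.zetaIntegrand Wtw (TripleZeta.hZero ω⁻¹ (χs s * ω)) p =
      TripleZeta.zetaIntegrand W (TripleZeta.hZero ω (χs s)) p := fun s p =>
    TripleZeta.zetaIntegrand_twist W (fun i => (π i).centralChar) (χs s) p
  have hA : ∀ s, AnalyticAt ℂ
      (fun s => -(((ω ^ 2 * χs s ^ 4) ϖ : ℂˣ) : ℂ) * q * ((1 + q) ^ 3)⁻¹) s := fun s => by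
    have := TripleZeta.analyticAt_absChar (F := F) ϖ s
    simp only [χs, MonoidHom.mul_apply, MonoidHom.pow_apply, Units.val_mul,
      Units.val_pow_eq_pow_val]
    fun_prop
  have hL := TripleZeta.analyticAt_lFactorInv (ϖ := ϖ) hSt χ (1 / 2)
  have hE := TripleZeta.analyticAt_epsFactor (ϖ := ϖ) hSt χ (1 / 2)
  have hE0 := fun s => TripleZeta.epsFactor_ne_zero (ϖ := ϖ) hSt (χs s) (1 / 2)
  -- Z is defined by the closed formula, so its value is known by definition; the content is that
  -- the integrals agree with it in a half-plane.
  refine ⟨fun s => -(((ω ^ 2 * χs s ^ 4) ϖ : ℂˣ) : ℂ) * q * ((1 + q) ^ 3)⁻¹ *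
    ((TripleZeta.tripleWD ϖ π (χs s)).lFactor (1 / 2) /
      (TripleZeta.tripleWD ϖ π (χs s)).epsFactor (1 / 2)), fun s => ?_, ?_, fun s hs => ⟨?_, rfl⟩⟩
  · exact (hA s).meromorphicAt.mul ((hL s).meromorphicAt.inv.div (hE s).meromorphicAt)
  · obtain ⟨K, D, hK, hD, hb⟩ := TripleZeta.exists_series_bounded ϖ π
    obtain ⟨R, hR⟩ := TripleZeta.exists_forall_norm_absChar_mul_lt_one hϖ χ
      ((D ^ 3 / ‖(ϖ : F)‖) ^ 4)
    refine ⟨R, fun s hs => ?_⟩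
    have hC : ‖(χs s ϖ : ℂ)‖ * (D ^ 3 / ‖(ϖ : F)‖) ^ 4 < 1 := hR s hs
    have hC' : ‖(χs s ϖ : ℂ)‖ * D ^ 3 / ‖(ϖ : F)‖ < 1 := by
      refine lt_of_le_of_lt ?_ hC
      rw [mul_div_assoc]
      have h1 : 1 ≤ D ^ 3 / ‖(ϖ : F)‖ :=
        (one_le_div hr).2 (hr1.le.trans (one_le_pow₀ hD))
      exact mul_le_mul_of_nonneg_left (le_self_pow₀ h1 four_ne_zero) (norm_nonneg _)
    obtain ⟨hi, ht⟩ := TripleZeta.zetaConverges_and_isTotal hϖ hnorm hψ hψ' dx hdx dt hdt hω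
      (hχ.mul (TripleZeta.isUnramified_absChar s))
      (fun i => (π i).series_isLocalData hϖ hnorm dx hdx hψ hψ' (hπ i) (hW i)) hw hK hD hb hC
    have hT := ht.mul_lFactorInv_mul_epsFactor hK hD hr1 hC' hb hSt
    rw [← hw] at hT
    have hv : TripleZeta.localZeta dx dt W (TripleZeta.hZero ω (χs s)) =
        -(((ω ^ 2 * χs s ^ 4) ϖ : ℂˣ) : ℂ) * q * ((1 + q) ^ 3)⁻¹ *
          ((TripleZeta.tripleWD ϖ π (χs s)).lFactor (1 / 2) /
            (TripleZeta.tripleWD ϖ π (χs s)).epsFactor (1 / 2)) := by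
      have hr0 : (‖(ϖ : F)‖ : ℂ) ≠ 0 := by simp
      have hr2 : (‖(ϖ : F)‖ : ℂ) + 1 ≠ 0 := by
        exact_mod_cast (by positivity : ‖(ϖ : F)‖ + 1 ≠ 0)
      -- The L-factor has no pole in this half-plane, because the product in `hT` is a non-zero
      -- monomial.
      have hL0 : (TripleZeta.tripleWD ϖ π (χs s)).lFactorInv (1 / 2) ≠ 0 := by
        intro h0
        rw [h0, mul_zero, zero_mul, eq_comm, neg_eq_zero] at hT
        exact mul_ne_zero (mul_ne_zero (pow_ne_zero _ (Units.ne_zero _))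
          (pow_ne_zero _ (Units.ne_zero _))) (pow_ne_zero _ hr0) hT
      have hE0 := hE0 s
      -- The constants agree since q(1 + q)⁻³ = r²(1 + r)⁻³ for r = q⁻¹.
      rw [hq, TripleZeta.WDRep.lFactor]
      simp only [MonoidHom.mul_apply, MonoidHom.pow_apply, Units.val_mul, Units.val_pow_eq_pow_val]
      field_simp
      linear_combination hT
    exact ⟨hi, hv, by simpa only [TripleZeta.ZetaConverges, htw] using hi,
      by simpa only [TripleZeta.localZeta, htw] using hv⟩
  · exact (hA s).mul (((hL s).inv hs).div (hE s) (hE0 s))
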